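/- **Setting.** For $g,s,n\ge 0$ let $F=F_{g,n+1}^s$ be a connected oriented surface of genus $g$ with $s$ punctures and boundary circles $\partial_0,\dots,\partial_n$, each with a closed arc (window) $W_i\subset\partial_i$. Let $PMC(F)$ be the group of isotopy classes of orientation-preserving homeomorphisms that fix every $\partial_i\setminus W_i$ pointwise and every $W_i$ setwise. An arc family is the isotopy class of a non-empty collection of disjointly embedded, pairwise non-parallel arcs with end points in the windows, none of them isotopic rel end points into $\partial F$; it is exhaustive if every window contains an end point of an arc. $Arc_g^s(n)$ is the space of $PMC(F)$-orbits of exhaustive arc families with positive weights on the arcs, modulo common rescaling, with the topology of the arc complex (an arc whose weight tends to $0$ disappears). Put $\mathcal{ARC}_{cp}(n)=Arc_0^0(n)$ and $\mathcal{ARC}(n)=\coprod_{g,s}Arc_g^s(n)$. The symmetric group $\mathbb S_n$ permutes the labels $1,\dots,n$. The composition $\alpha\circ_i\beta$ is defined as follows: thicken arcs to foliated bands whose width is the weight, so that every boundary circle becomes a circle with a base point (the complement of the window) and a transverse measure; rescale so that $\partial_i$ of $\alpha$ and $\partial_0$ of $\beta$ have equal measure; glue these two circles by the measure- and base-point-preserving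 identification that makes the glued surface oriented; discard the leaves which do not run from boundary to boundary; unite parallel bands; and read off the resulting projectively weighted arc family. The unit is the single arc joining the two boundary circles of the annulus. Let $k$ be a commutative ring and let $\mathcal O$ be $\mathcal{ARC}_{cp}$ or $\mathcal{ARC}$. Let $C_*(n)$ be the complex of normalized cubical singular chains of $\mathcal O(n)$ with coefficients in $k$, with the compositions $\circ_i$ induced by products of cubes. Let $\delta\in C_1(1)$ be the loop $s\mapsto\delta_s$, $s\in[0,1]$, which runs once around the circle $\mathcal{ARC}_{cp}(1)$ (the annulus with two arcs of weights $s$ and $1-s$ joining its boundary circles), let $\Delta=-\delta$, and let $\mu\in C_0(2)$ be the pair of pants with one arc from $\partial_0$ to $\partial_1$ and one from $\partial_0$ to $\partial_2$, of equal weights. Write $\mu_3=\mu\circ_1\mu$. **Proposition.** 1. $\Delta$ is a cycle of degree $1$, and there are chains $h_2\in C_3(1)$ and $h_3\in C_2(3)$ with $$\partial h_2=\Delta\circ_1\Delta ,$$ $$\partial h_3=\Delta\circ_1\mu_3-\mu\circ_1(\Delta\circ_1\mu)-\mu\circ_2(\Delta\circ_1\mu)-(1\,2)\cdot\bigl(\mu\circ_2(\Delta\circ_1\mu)\bigr)+\mu_3\circ_1\Delta+\mu_3\circ_2\Delta+\mu_3\circ_3\Delta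 ,$$ where all the families of arc families that occur are singular cubes of $\mathcal O$. 2. Consequently, every differential graded algebra $A$ ($\mathbb Z/2$-graded, over $k$) over the operad $C_*$ is a BV algebra up to chain homotopy. Precisely, let $\Delta(a)$, $ab$, $H_2(a)$ and $H_3(a,b,c)$ be the operations given by $\Delta$, $\mu$, $h_2$ and $h_3$, and $abc=(ab)c$. Then $\Delta^2(a)=dH_2(a)+H_2(da)$ for all $a$, and for all homogeneous $a,b,c$ $$\begin{aligned}\Delta(abc)&-\Bigl(\Delta(ab)c+(-1)^{|a|}a\Delta(bc)+(-1)^{(|a|+1)|b|}b\Delta(ac)-\Delta(a)bc-(-1)^{|a|}a\Delta(b)c-(-1)^{|a|+|b|}ab\Delta(c)\Bigr)\\&=dH_3(a,b,c)-H_3(da,b,c)-(-1)^{|a|}H_3(a,db,c)-(-1)^{|a|+|b|}H_3(a,b,dc).\end{aligned}$$ 3. Every $\mathbb Z/2$-graded algebra over the homology operad $H_*(\mathcal O;k)$ (that is, every Arc$_{cp}$ algebra and every Arc algebra) is a BV algebra, with the product given by $[\mu]$ and the operator given by $[\Delta]$: the product is associative and graded commutative, $\Delta$ is odd, $\Delta^2=0$,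 and for homogeneous $a,b,c$ $$\Delta(abc)=\Delta(ab)c+(-1)^{|a|}a\Delta(bc)+(-1)^{(|a|+1)|b|}b\Delta(ac)-\Delta(a)bc-(-1)^{|a|}a\Delta(b)c-(-1)^{|a|+|b|}ab\Delta(c).$$ -/

import Mathlib

open Set Filter Topology

noncomputable section

namespace ArcOperad

/-! ## Weighted arc families modulo the pure mapping class group -/

/-- The standard circle of total measure `1`.  The `i`-th end of a weighted arc family is
identified with it by normalizing the transverse measure; the point `0` is the class of the
end points of the window.  Every circle carries the orientation of the boundary. -/
abbrev Circ : Type := AddCircle (1 : ℝ)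

/-- Rotation of a point of a disjoint union of circles. -/
def shift {ι : Type} (t : ℝ) (p : ι × Circ) : ι × Circ := (p.1, p.2 + (t : Circ))

/-- Additive Euler characteristic (closed arcs count `1`, open arcs `-1`, half-open arcs and whole
circles `0`) of a finite union of points and arcs in a disjoint union of circles, computed as the
sum over all points of `1_A(x) - 1_A(x+)`. -/
def eul {ι : Type} (A : Set (ι × Circ)) : ℤ :=
  ({p | p ∈ A ∧ ∀ᶠ t in 𝓝[>] (0 : ℝ), shift t p ∉ A}.ncard : ℤ) -
    ({p | p ∉ A ∧ ∀ᶠ t in 𝓝[>] (0 : ℝ), shift t p ∈ A}.ncard : ℤ)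

/-- The data of the homeomorphism class of a surface with boundary circles indexed by `ι`, together
with a weighted arc family in it, thickened to a family of measured bands.

* `len i` is the total transverse measure of the `i`-th boundary;
* `leaf p q` means that `p` and `q` are the two end points of a leaf inside (the interior of) a band;
* the points of a circle which are not end points of such leaves are the *cut points*: each of them
  stands for one interval of the boundary between two neighbouring bands (the one which contains the
  complement of the window stands at `0`).  The complementary regions of the arc family partition
  the cut points: `regions` is the set of parts;
* `chi R` is the Euler characteristic and `pun R` the number of punctures of the region `R`, where
  punctures count as removed points. -/
@[ext]
structure ArcData (ι : Type) where
  len : ι → ℝ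
  leaf : ι × Circ → ι × Circ → Prop
  regions : Set (Set (ι × Circ))
  chi : Set (ι × Circ) → ℤ
  pun : Set (ι × Circ) → ℕ

namespace ArcData

variable {ι : Type}

/-- The cut points. -/
def cuts (α : ArcData ι) : Set (ι × Circ) := ⋃₀ α.regions

/-- The points in the interior of the bands. -/
def leafPts (α : ArcData ι) : Set (ι × Circ) := {p | ∃ q, α.leaf p q}

/-- `q` follows `p` on the boundary of a complementary region: the side of the band which starts
right after `p` ends right before `q`. -/
def next (α : ArcData ι) (p q : ι × Circ) : Prop :=
  ∀ᶠ t in 𝓝[>] (0 : ℝ), α.leaf (shift (t / α.len p.1) p) (shift (-(t / α.len q.1)) q)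

/-- The boundary cycles of the region `R`, each given by the set of the cut points on it. -/
def boundaryCycles (α : ArcData ι) (R : Set (ι × Circ)) : Set (Set (ι × Circ)) :=
  {B | ∃ p ∈ R, B = {q | Relation.EqvGen α.next p q}}

/-- The data come from an exhaustive arc family, with positive weights, in a connected oriented
surface.  The projective class of the weights is represented by the weights for which the total
measure of all the ends is `1`. -/
structure IsArcFamily [Fintype ι] (α : ArcData ι) : Prop where
  len_pos : ∀ i, 0 < α.len i
  len_sum : ∑ i, α.len i = 1
  cuts_finite : α.cuts.Finite
  regions_nonempty : ∀ R ∈ α.regions, R.Nonempty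
  regions_disjoint : ∀ R ∈ α.regions, ∀ R' ∈ α.regions, ∀ p, p ∈ R → p ∈ R' → R = R'
  base_mem : ∀ i, ((i, 0) : ι × Circ) ∈ α.cuts
  leafPts_eq : ∀ p, p ∈ α.leafPts ↔ p ∉ α.cuts
  leaf_symm : ∀ p q, α.leaf p q → α.leaf q p
  leaf_unique : ∀ p q q', α.leaf p q → α.leaf p q' → q = q'
  leaf_ne : ∀ p, ¬ α.leaf p p
  /-- The leaves of a band match its two ends by an isometry which reverses the orientation
  of the boundary. -/
  leaf_local : ∀ p q, α.leaf p q →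
    ∀ᶠ t in 𝓝 (0 : ℝ), α.leaf (shift (t / α.len p.1) p) (shift (-(t / α.len q.1)) q)
  next_mem : ∀ R ∈ α.regions, ∀ p ∈ R, ∀ q, α.next p q → q ∈ R
  /-- Every region is an orientable surface of some genus `g`. -/
  chi_eq : ∀ R ∈ α.regions, ∃ g : ℕ,
    α.chi R = 2 - 2 * (g : ℤ) - ((α.boundaryCycles R).ncard : ℤ) - (α.pun R : ℤ)
  connected : ∀ i j, Relation.ReflTransGen
    (fun i j => ∃ R ∈ α.regions, ∃ p ∈ R, ∃ q ∈ R, p.1 = i ∧ q.1 = j) i j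
  /-- No arc is isotopic into the boundary: no region is a disc with one side on the arcs. -/
  essential : ∀ R ∈ α.regions, α.chi R = 1 → 2 ≤ R.ncard
  /-- No two arcs are parallel: no region is a disc with two sides on the arcs which meets the
  boundary only in the windows. -/
  not_parallel : ∀ R ∈ α.regions, α.chi R = 1 → (∀ p ∈ R, p.2 ≠ 0) → 3 ≤ R.ncard
  chi_support : ∀ R, R ∉ α.regions → α.chi R = 0
  pun_support : ∀ R, R ∉ α.regions → α.pun R = 0

/-! ### The topology of the arc complex -/

/-- The map of a disjoint union of circles induced by maps of the unit interval. -/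
def circMap (F : ι → ℝ → ℝ) (p : ι × Circ) : ι × Circ :=
  (p.1, ((F p.1 (AddCircle.equivIco (1 : ℝ) 0 p.2 : ℝ) : ℝ) : Circ))

/-- Two cut points of `β` lie in regions which are united when `f` collapses some of the bands. -/
def merges (β : ArcData ι) (f : ι × Circ → ι × Circ) (p q : ι × Circ) : Prop :=
  p ∈ β.cuts ∧ q ∈ β.cuts ∧ ((∃ R ∈ β.regions, p ∈ R ∧ q ∈ R) ∨ f p = f q)

/-- `α` arises from `β` by deleting the arcs whose bands are collapsed by `f`. -/
structure CollapsesTo (β α : ArcData ι) (f : ι × Circ → ι × Circ) : Prop where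
  leaf_map : ∀ p q, β.leaf p q → f p ∉ α.cuts → α.leaf (f p) (f q)
  leaf_lift : ∀ p q, α.leaf p q → ∃ p' q', β.leaf p' q' ∧ f p' = p ∧ f q' = q
  regions_eq : α.regions =
    {R | ∃ p ∈ β.cuts, R = f '' {q | Relation.EqvGen (β.merges f) p q}}
  chi_eq : ∀ R ∈ α.regions, 2 * α.chi R =
    2 * (∑ᶠ R' ∈ {R' ∈ β.regions | f '' R' ⊆ R}, β.chi R') + eul (f ⁻¹' R ∩ β.leafPts)
  pun_eq : ∀ R ∈ α.regions, α.pun R = ∑ᶠ R' ∈ {R' ∈ β.regions | f '' R' ⊆ R}, β.pun R'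

/-- `β` lies in the `ε`-neighbourhood of `α` in the arc complex: `α` arises from `β` by deleting
arcs of small weight and changing the other weights by a small amount. -/
def Near (ε : ℝ) (β α : ArcData ι) : Prop :=
  ∃ F : ι → ℝ → ℝ,
    (∀ i, Monotone (F i) ∧ Continuous (F i) ∧ F i 0 = 0 ∧ F i 1 = 1) ∧
    (∀ i, ∀ x ∈ Icc (0 : ℝ) 1, |F i x - x| < ε) ∧
    (∀ i, |β.len i - α.len i| < ε) ∧
    CollapsesTo β α (circMap F)

theorem Near.mono {ε ε' : ℝ} (h : ε ≤ ε') {β α : ArcData ι} (hn : Near ε β α) :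
    Near ε' β α := by
  obtain ⟨F, h1, h2, h3, h4⟩ := hn
  exact ⟨F, h1, fun i x hx => (h2 i x hx).trans_le h, fun i => (h3 i).trans_le h, h4⟩

end ArcData

/-- Data on a surface with the boundary circles `0, 1, …, n`. -/
abbrev Fam (n : ℕ) : Type := ArcData (Fin (n + 1))

/-- The spaces `Arc_g^s(n)` of projectively weighted exhaustive arc families, modulo the pure mapping
class group, in the surface of genus `g` with `s` punctures and `n + 1` boundary circles.  The
Euler characteristic of the surface is the sum of those of the regions minus the number of arcs, and
there are twice as many cut points as arcs. -/
def Arc (g s n : ℕ) : Set (Fam n) :=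
  {α | α.IsArcFamily ∧ (∑ᶠ R ∈ α.regions, α.pun R) = s ∧
    2 * (∑ᶠ R ∈ α.regions, α.chi R) - (α.cuts.ncard : ℤ) =
      2 * (2 - 2 * (g : ℤ) - ((n : ℤ) + 1) - (s : ℤ))}

/-- The compact planar arc operad: genus `0` and no punctures. -/
def ARCcp (n : ℕ) : Set (Fam n) := Arc 0 0 n

/-- The arc operad: all genera and all numbers of punctures. -/
def ARC (n : ℕ) : Set (Fam n) := ⋃ (g : ℕ) (s : ℕ), Arc g s n

/-- The topological space of the members of `S n`. -/
def Space (S : ∀ n, Set (Fam n)) (n : ℕ) : Type := {α : Fam n // α ∈ S n}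

/-- The topology of the arc complex. -/
instance (S : ∀ n, Set (Fam n)) (n : ℕ) : TopologicalSpace (Space S n) where
  IsOpen U := ∀ α ∈ U, ∃ ε > 0, ∀ β : Space S n, ArcData.Near ε β.1 α.1 → β ∈ U
  isOpen_univ := fun _ _ => ⟨1, one_pos, fun _ _ => mem_univ _⟩
  isOpen_inter := fun U V hU hV α hα => by
    obtain ⟨ε, hε, h⟩ := hU α hα.1
    obtain ⟨ε', hε', h'⟩ := hV α hα.2
    exact ⟨min ε ε', lt_min hε hε', fun β hβ =>
      ⟨h β (hβ.mono (min_le_left _ _)), h' β (hβ.mono (min_le_right _ _))⟩⟩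
  isOpen_sUnion := fun 𝒰 h𝒰 α hα => by
    obtain ⟨U, hU, hαU⟩ := hα
    obtain ⟨ε, hε, h⟩ := h𝒰 U hU α hαU
    exact ⟨ε, hε, fun β hβ => ⟨U, hU, h β hβ⟩⟩

/-! ### Gluing -/

namespace ArcData

section Glue

variable {ι κ ο : Type} (α : ArcData ι) (β : ArcData κ) (a : ι) (b : κ) (out : ο → ι ⊕ κ)

/-- Points of the first surface as points of the disjoint union. -/
def inL (p : ι × Circ) : (ι ⊕ κ) × Circ := (Sum.inl p.1, p.2)

/-- Points of the second surface as points of the disjoint union. -/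
def inR (p : κ × Circ) : (ι ⊕ κ) × Circ := (Sum.inr p.1, p.2)

/-- Points on the boundary of the glued surface as points of the disjoint union. -/
def inO (p : ο × Circ) : (ι ⊕ κ) × Circ := (out p.1, p.2)

/-- The leaves of the disjoint union. -/
def leafU (p q : (ι ⊕ κ) × Circ) : Prop :=
  (∃ x y, α.leaf x y ∧ p = inL x ∧ q = inL y) ∨ (∃ x y, β.leaf x y ∧ p = inR x ∧ q = inR y)

/-- The identification of the circle `a` of the first surface with the circle `b` of the second one.
It preserves base points and normalized measures, and it reverses the boundary orientations, so that
the glued surface is oriented. -/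
def pass (p q : (ι ⊕ κ) × Circ) : Prop :=
  ∃ x : Circ, (p = (Sum.inl a, x) ∧ q = (Sum.inr b, -x)) ∨ (p = (Sum.inr b, -x) ∧ q = (Sum.inl a, x))

/-- The leaf of the glued foliation which enters a surface at `p` leaves the glued surface at the
boundary point `u`. -/
def runsTo (p : (ι ⊕ κ) × Circ) (u : ο × Circ) : Prop :=
  ∃ q, leafU α β p q ∧
    Relation.ReflTransGen (fun q r => ∃ q', pass a b q q' ∧ leafU α β q' r) q (inO out u)

/-- The points which are not on a leaf running from boundary to boundary in the interiors of bands: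
cut points, points on leaves that run into cut points, and points on the leaves to be discarded. -/
def trapped : Set ((ι ⊕ κ) × Circ) :=
  {p | ¬ ((∃ u, runsTo α β a b out p u) ∧ ∀ q, pass a b p q → ∃ u, runsTo α β a b out q u)}

/-- Two trapped points are joined in one step in the complement of the surviving bands. -/
def joined (p q : (ι ⊕ κ) × Circ) : Prop :=
  p ∈ trapped α β a b out ∧ q ∈ trapped α β a b out ∧
    ((∃ R ∈ α.regions, ∃ x ∈ R, ∃ y ∈ R, p = inL x ∧ q = inL y) ∨
      (∃ R ∈ β.regions, ∃ x ∈ R, ∃ y ∈ R, p = inR x ∧ q = inR y) ∨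
      leafU α β p q ∨ pass a b p q ∨
      ∃ s : ℝ, 0 ≤ s ∧ q = shift s p ∧ ∀ t ∈ Icc 0 s, shift t p ∈ trapped α β a b out)

/-- The trapped points in the complementary regions of the surviving bands that meet `S`. -/
def hull (S : Set (ο × Circ)) : Set ((ι ⊕ κ) × Circ) :=
  {q | ∃ u ∈ S, inO out u ∈ trapped α β a b out ∧
    Relation.EqvGen (joined α β a b out) (inO out u) q}

/-- The Euler characteristic of the complementary region with the trapped points `K`, by additivity:
the old regions in it, the strips of bands in it (which show up at both of their ends), and the
parts of the glued circle in it along which these pieces are glued. -/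
def hullChi (K : Set ((ι ⊕ κ) × Circ)) : ℤ :=
  (∑ᶠ R ∈ {R ∈ α.regions | inL '' R ⊆ K}, α.chi R) +
    (∑ᶠ R ∈ {R ∈ β.regions | inR '' R ⊆ K}, β.chi R) +
    eul (K ∩ {p | ∃ q, leafU α β p q}) / 2 - eul (K ∩ {p | p.1 = Sum.inl a})

/-- The number of punctures in the complementary region with the trapped points `K`. -/
def hullPun (K : Set ((ι ⊕ κ) × Circ)) : ℕ :=
  (∑ᶠ R ∈ {R ∈ α.regions | inL '' R ⊆ K}, α.pun R) +
    (∑ᶠ R ∈ {R ∈ β.regions | inR '' R ⊆ K}, β.pun R)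

/-- The complementary regions of the surviving bands. -/
def preRegions : Set (Set (ο × Circ)) :=
  {S | ∃ u, inO out u ∈ trapped α β a b out ∧ S = inO out ⁻¹' hull α β a b out {u}}

/-- A region which only separates two parallel bands. -/
def IsBigon (S : Set (ο × Circ)) : Prop :=
  hullChi α β a (hull α β a b out S) = 1 ∧ S.ncard = 2 ∧ ∀ u ∈ S, u.2 ≠ 0

/-- The regions that remain after parallel bands have been united. -/
def glueRegions : Set (Set (ο × Circ)) :=
  {S | S ∈ preRegions α β a b out ∧ ¬ IsBigon α β a b out S}

open Classical in
/-- Gluing of projectively weighted arc families along the circles `a` and `b`.  The weights are first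
scaled so that the two circles get the same measure; then the bands are glued, leaves which do not
run from boundary to boundary are discarded, and parallel bands are united. -/
def glue [Fintype ο] : ArcData ο where
  len u := Sum.elim (fun i => β.len b * α.len i) (fun j => α.len a * β.len j) (out u) /
    ∑ v, Sum.elim (fun i => β.len b * α.len i) (fun j => α.len a * β.len j) (out v)
  leaf u v := (runsTo α β a b out (inO out u) v) ∨
    ∃ S ∈ preRegions α β a b out, IsBigon α β a b out S ∧ u ∈ S ∧ v ∈ S ∧ u ≠ v
  regions := glueRegions α β a b out
  chi S := if S ∈ glueRegions α β a b out then hullChi α β a (hull α β a b out S) else 0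
  pun S := if S ∈ glueRegions α β a b out then hullPun α β (hull α β a b out S) else 0

end Glue

end ArcData

/-- The boundary circles `∂₀, …, ∂ᵢ₋₁, ∂'₁, …, ∂'ₙ, ∂ᵢ₊₁, …` of a surface glued along `∂ᵢ` and `∂'₀`,
where `∂ᵢ` is the `i`-th of the circles `1, …, m + 1`, counted from `0`. -/
def outer {m n : ℕ} (i : Fin (m + 1)) (k : Fin (m + n + 1)) : Fin (m + 1 + 1) ⊕ Fin (n + 1) :=
  if h : k.1 ≤ i.1 then Sum.inl ⟨k.1, by omega⟩
  else if h' : k.1 ≤ i.1 + n then Sum.inr ⟨k.1 - i.1, by omega⟩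
  else Sum.inl ⟨k.1 - n + 1, by omega⟩

/-- The operad composition `α ∘ᵢ β`. -/
def compFam {m n : ℕ} (α : Fam (m + 1)) (i : Fin (m + 1)) (β : Fam n) : Fam (m + n) :=
  ArcData.glue α β i.succ 0 (outer i)

/-- The circle of the old family which gets the label `k` under the permutation `σ` of `1, …, n`. -/
def oldLabel {n : ℕ} (σ : Equiv.Perm (Fin n)) (k : Fin (n + 1)) : Fin (n + 1) :=
  Fin.cases 0 (fun l => (σ.symm l).succ) k

/-- The action of the symmetric group on the labels `1, …, n`: the circle `k` becomes `σ k`. -/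
def permFam {n : ℕ} (σ : Equiv.Perm (Fin n)) (α : Fam n) : Fam n where
  len k := α.len (oldLabel σ k)
  leaf p q := α.leaf (oldLabel σ p.1, p.2) (oldLabel σ q.1, q.2)
  regions := {R | (fun p : Fin (n + 1) × Circ => (oldLabel σ p.1, p.2)) '' R ∈ α.regions}
  chi R := α.chi ((fun p : Fin (n + 1) × Circ => (oldLabel σ p.1, p.2)) '' R)
  pun R := α.pun ((fun p : Fin (n + 1) × Circ => (oldLabel σ p.1, p.2)) '' R)

/-! ### The basic families -/

/-- The circle of arc families in the annulus: the bands between the two boundary circles fill the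
annulus and are twisted by `s`.  For `s = 0` this is one arc, otherwise there are two arcs, with
weights proportional to `s` and `1 - s`. -/
def deltaFam (s : Circ) : Fam 1 where
  len _ := 1 / 2
  leaf p q := p.1 ≠ q.1 ∧ p.2 + q.2 = s ∧ p.2 ≠ 0 ∧ q.2 ≠ 0
  regions := {{(0, 0), (1, s)}, {(1, 0), (0, s)}}
  chi := Set.indicator {{(0, 0), (1, s)}, {(1, 0), (0, s)}} 1
  pun _ := 0

/-- The pair of pants with one arc from the circle `0` to each of the circles `1` and `2`, both of
the same weight.  On the circle `0` the arc to `1` comes first. -/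
def muFam : Fam 2 where
  len := ![1 / 2, 1 / 4, 1 / 4]
  leaf p q := ∃ x : ℝ, ∃ j : Fin 3,
    ((j = 1 ∧ 0 < x ∧ x < 1 / 2) ∨ (j = 2 ∧ 1 / 2 < x ∧ x < 1)) ∧
    ((p = (0, (x : Circ)) ∧ q = (j, ((-2 * x : ℝ) : Circ))) ∨
      (q = (0, (x : Circ)) ∧ p = (j, ((-2 * x : ℝ) : Circ))))
  regions := {{(0, 0), (0, ((1 / 2 : ℝ) : Circ)), (1, 0), (2, 0)}}
  chi := Set.indicator {{(0, 0), (0, ((1 / 2 : ℝ) : Circ)), (1, 0), (2, 0)}} 1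
  pun _ := 0

/-! ## Singular chains

Normalized cubical singular chains: the free module on the nondegenerate singular cubes. -/

/-- A family over a cube is degenerate if it does not depend on one of the coordinates. -/
def Degenerate {X : Type} {p : ℕ} (f : (Fin p → unitInterval) → X) : Prop :=
  ∃ j, ∀ x y, (∀ l, l ≠ j → x l = y l) → f x = f y

/-- The nondegenerate singular `p`-cubes. -/
def Cub (S : ∀ n, Set (Fam n)) (n p : ℕ) : Type :=
  {f : (Fin p → unitInterval) → Space S n // Continuous f ∧ ¬ Degenerate f}

/-- A family of arc families over a cube is a singular cube of the space. -/
def IsCube (S : ∀ n, Set (Fam n)) {n p : ℕ} (f : (Fin p → unitInterval) → Fam n) : Prop :=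
  ∃ g : (Fin p → unitInterval) → Space S n, Continuous g ∧ ∀ t, (g t).1 = f t

section Chains

variable (k : Type*) [CommRing k] (S : ∀ n, Set (Fam n))

/-- The singular chains `C_p(n)`. -/
abbrev Chain (n p : ℕ) : Type _ := Cub S n p →₀ k

open Classical in
/-- The chain given by a family over a cube; it is zero if the family is degenerate. -/
def fam {n p : ℕ} (f : (Fin p → unitInterval) → Fam n) : Chain k S n p :=
  if h : ∃ ρ : Cub S n p, ∀ t, (ρ.1 t).1 = f t then Finsupp.single h.choose 1 else 0

/-- The boundary of cubical chains in positive degree. -/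
def bd (n p : ℕ) : Chain k S n (p + 1) →ₗ[k] Chain k S n p :=
  Finsupp.linearCombination k fun ρ => ∑ j : Fin (p + 1), (-1 : k) ^ j.1 •
    (fam k S (fun t => (ρ.1 (j.insertNth (α := fun _ => unitInterval) 1 t)).1) -
      fam k S (fun t => (ρ.1 (j.insertNth (α := fun _ => unitInterval) 0 t)).1))

/-- The boundary in all degrees. -/
def diff (n : ℕ) : ∀ p, Chain k S n p →ₗ[k] Chain k S n (p - 1)
  | 0 => 0
  | p + 1 => bd k S n p

/-- The family `(s, t) ↦ σ(s) ∘ᵢ τ(t)`. -/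
def prodFam {m n p q : ℕ} (i : Fin (m + 1)) (σ : Cub S (m + 1) p) (τ : Cub S n q)
    (t : Fin (p + q) → unitInterval) : Fam (m + n) :=
  compFam (σ.1 fun l => t (l.castAdd q)).1 i (τ.1 fun l => t (l.natAdd p)).1

/-- The composition `x ∘ᵢ y` of chains: the cross product followed by the composition of spaces. -/
def comp {m n p q : ℕ} (i : Fin (m + 1)) :
    Chain k S (m + 1) p →ₗ[k] Chain k S n q →ₗ[k] Chain k S (m + n) (p + q) :=
  Finsupp.linearCombination k fun σ =>
    Finsupp.linearCombination k fun τ => fam k S (prodFam S i σ τ)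

variable {k S} in
/-- All the families in the composition `x ∘ᵢ y` are singular cubes. -/
def Composable {m n p q : ℕ} (x : Chain k S (m + 1) p) (i : Fin (m + 1)) (y : Chain k S n q) : Prop :=
  ∀ σ ∈ x.support, ∀ τ ∈ y.support, IsCube S (prodFam S i σ τ)

/-- The action of the symmetric group on chains. -/
def perm {n p : ℕ} (σ : Equiv.Perm (Fin n)) : Chain k S n p →ₗ[k] Chain k S n p :=
  Finsupp.linearCombination k fun ρ => fam k S fun t => permFam σ (ρ.1 t).1

/-- The unit of the operad. -/
def unit : Chain k S 1 0 := fam k S fun _ => deltaFam 0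

/-- The 1-cycle `δ`. -/
def delta : Chain k S 1 1 := fam k S fun t => deltaFam (((t 0 : unitInterval) : ℝ) : Circ)

/-- The operator `Δ = -δ`. -/
def Delta : Chain k S 1 1 := -delta k S

/-- The product. -/
def mu : Chain k S 2 0 := fam k S fun _ => muFam

/-- The operation `abc = (ab)c`. -/
def mu₃ : Chain k S 3 0 := comp k S (m := 1) (n := 2) 0 (mu k S) (mu k S)

/-- The operation `Δ(ab)`. -/
def DeltaMu : Chain k S 2 1 := comp k S (m := 0) (n := 2) 0 (Delta k S) (mu k S)

/-- The operation `aΔ(bc)`. -/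
def muDeltaMu : Chain k S 3 1 := comp k S (m := 1) (n := 2) 1 (mu k S) (DeltaMu k S)

/-- The operation whose vanishing is the seven-term relation:
`Δ(abc) - Δ(ab)c - aΔ(bc) - bΔ(ac) + Δ(a)bc + aΔ(b)c + abΔ(c)`, with the signs that arise when the
operations are applied to elements. -/
def bvDefect : Chain k S 3 1 :=
  (comp k S (m := 0) (n := 3) 0 (Delta k S) (mu₃ k S) : Chain k S 3 1)
    - (comp k S (m := 1) (n := 2) 0 (mu k S) (DeltaMu k S) : Chain k S 3 1)
    - muDeltaMu k S
    - perm k S (Equiv.swap 0 1) (muDeltaMu k S)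
    + (comp k S (m := 2) (n := 1) 0 (mu₃ k S) (Delta k S) : Chain k S 3 1)
    + (comp k S (m := 2) (n := 1) 1 (mu₃ k S) (Delta k S) : Chain k S 3 1)
    + (comp k S (m := 2) (n := 1) 2 (mu₃ k S) (Delta k S) : Chain k S 3 1)

/-- The cycles. -/
def cycles (n p : ℕ) : Submodule k (Chain k S n p) := LinearMap.ker (diff k S n p)

/-- The singular homology `H_p(n)`: the image of the cycles in the chains modulo boundaries. -/
def Homology (n p : ℕ) : Type _ :=
  (cycles k S n p).map (LinearMap.range (bd k S n p)).mkQ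

instance (n p : ℕ) : AddCommGroup (Homology k S n p) :=
  inferInstanceAs (AddCommGroup ((cycles k S n p).map (LinearMap.range (bd k S n p)).mkQ))

instance (n p : ℕ) : Module k (Homology k S n p) :=
  inferInstanceAs (Module k ((cycles k S n p).map (LinearMap.range (bd k S n p)).mkQ))

variable {k S} in
/-- The homology class `X` is represented by the cycle `x`. -/
def Represents {n p : ℕ} (x : Chain k S n p) (X : Homology k S n p) : Prop :=
  x ∈ cycles k S n p ∧ (LinearMap.range (bd k S n p)).mkQ x = X.1

end Chains

/-! ## Operad algebras and BV algebras -/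

/-- The sign `(-1) ^ e`. -/
def sgn (e : ZMod 2) : ℤ := if e = 0 then 1 else -1

/-- The Koszul sign of the rearrangement `(a 0, …, a (n-1)) ↦ (a (σ 0), …, a (σ (n-1)))`, where
`d i` is the parity of `a i`. -/
def koszul {n : ℕ} (σ : Equiv.Perm (Fin n)) (d : Fin n → ZMod 2) : ℤ :=
  ∏ i, ∏ j, if i < j ∧ σ j < σ i then sgn (d (σ i) * d (σ j)) else 1

/-- The arguments `(a 0, …, a (i-1), b, a (i+n), …)`. -/
def insertArg {A : Type*} {m n : ℕ} (i : Fin (m + 1)) (a : Fin (m + n) → A) (b : A)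
    (j : Fin (m + 1)) : A :=
  if _h : j.1 < i.1 then a ⟨j.1, by omega⟩
  else if _h' : j.1 = i.1 then b
  else a ⟨j.1 - 1 + n, by omega⟩

/-- The arguments `(a i, …, a (i+n-1))`. -/
def blockArg {A : Type*} {m n : ℕ} (i : Fin (m + 1)) (a : Fin (m + n) → A) (l : Fin n) : A :=
  a ⟨i.1 + l.1, by omega⟩

/-- An algebra, on a `ℤ/2`-graded module `A = 𝒜 0 ⊕ 𝒜 1`, over an operad of graded modules `P n p`
(arity `n`, degree `p`) with unit represented by `isUnit`, compositions `z = x ∘ᵢ y` given by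
`isComp x i y z`, and symmetric group actions `y = σ x` given by `isPerm σ x y`. -/
structure OperadAlgebra (k : Type*) [CommRing k] (P : ℕ → ℕ → Type*)
    [∀ n p, AddCommGroup (P n p)] [∀ n p, Module k (P n p)]
    (isUnit : P 1 0 → Prop)
    (isComp : ∀ m n p q, P (m + 1) p → Fin (m + 1) → P n q → P (m + n) (p + q) → Prop)
    (isPerm : ∀ n p, Equiv.Perm (Fin n) → P n p → P n p → Prop)
    (A : Type*) [AddCommGroup A] [Module k A] (𝒜 : ZMod 2 → Submodule k A) where
  act : ∀ n p, P n p →ₗ[k] MultilinearMap k (fun _ : Fin n => A) A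
  isInternal : DirectSum.IsInternal 𝒜
  act_mem : ∀ n p (x : P n p) (a : Fin n → A) (d : Fin n → ZMod 2), (∀ j, a j ∈ 𝒜 (d j)) →
    act n p x a ∈ 𝒜 ((p : ZMod 2) + ∑ j, d j)
  act_unit : ∀ x, isUnit x → ∀ a, act 1 0 x a = a 0
  act_comp : ∀ m n p q (x : P (m + 1) p) (i : Fin (m + 1)) (y : P n q) (z : P (m + n) (p + q)),
    isComp m n p q x i y z → ∀ (a : Fin (m + n) → A) (d : Fin (m + n) → ZMod 2),
    (∀ j, a j ∈ 𝒜 (d j)) →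
    act (m + n) (p + q) z a =
      sgn ((q : ZMod 2) * ∑ j, if j.1 < i.1 then d j else 0) •
        act (m + 1) p x (insertArg i a (act n q y (blockArg i a)))
  act_perm : ∀ n p (σ : Equiv.Perm (Fin n)) (x y : P n p), isPerm n p σ x y →
    ∀ (a : Fin n → A) (d : Fin n → ZMod 2), (∀ j, a j ∈ 𝒜 (d j)) →
    act n p y a = koszul σ d • act n p x (a ∘ σ)

section Algebras

variable (k : Type*) [CommRing k] (S : ∀ n, Set (Fam n))
  (A : Type*) [AddCommGroup A] [Module k A] (𝒜 : ZMod 2 → Submodule k A)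

/-- An algebra over the homology operad. -/
abbrev HomologyAlgebra : Type _ :=
  OperadAlgebra k (Homology k S) (fun X => Represents (unit k S) X)
    (fun m n p q X i Y Z => ∃ (x : Chain k S (m + 1) p) (y : Chain k S n q),
      Represents x X ∧ Represents y Y ∧ Composable x i y ∧ Represents (comp k S i x y) Z)
    (fun _ _ σ X Y => ∃ x, Represents x X ∧ Represents (perm k S σ x) Y)
    A 𝒜

/-- A differential graded algebra over the operad of singular chains. -/
structure ChainAlgebra extends
    OperadAlgebra k (Chain k S) (fun x => x = unit k S)
      (fun _ _ _ _ x i y z => Composable x i y ∧ z = comp k S i x y)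
      (fun _ _ σ x y => y = perm k S σ x) A 𝒜 where
  d : A →ₗ[k] A
  d_mem : ∀ e, ∀ a ∈ 𝒜 e, d a ∈ 𝒜 (e + 1)
  d_d : ∀ a, d (d a) = 0
  d_act : ∀ n p (x : Chain k S n p) (a : Fin n → A) (e : Fin n → ZMod 2),
    (∀ j, a j ∈ 𝒜 (e j)) →
    d (act n p x a) = act n (p - 1) (diff k S n p x) a +
      ∑ j, sgn ((p : ZMod 2) + ∑ l, if l < j then e l else 0) •
        act n p x (Function.update a j (d (a j)))

/-- Batalin-Vilkovisky algebras: associative supercommutative algebras with an odd operator `D`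
of square zero that satisfies the seven-term relation. -/
structure IsBVAlgebra {k : Type*} [CommRing k] {A : Type*} [AddCommGroup A] [Module k A]
    (𝒜 : ZMod 2 → Submodule k A) (mul : A →ₗ[k] A →ₗ[k] A) (D : A →ₗ[k] A) : Prop where
  isInternal : DirectSum.IsInternal 𝒜
  mul_mem : ∀ e f, ∀ a ∈ 𝒜 e, ∀ b ∈ 𝒜 f, mul a b ∈ 𝒜 (e + f)
  mul_assoc : ∀ a b c, mul (mul a b) c = mul a (mul b c)
  mul_comm : ∀ e f, ∀ a ∈ 𝒜 e, ∀ b ∈ 𝒜 f, mul a b = sgn (e * f) • mul b a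
  D_mem : ∀ e, ∀ a ∈ 𝒜 e, D a ∈ 𝒜 (e + 1)
  D_D : ∀ a, D (D a) = 0
  bv : ∀ e f g, ∀ a ∈ 𝒜 e, ∀ b ∈ 𝒜 f, ∀ c ∈ 𝒜 g,
    D (mul (mul a b) c) =
      mul (D (mul a b)) c + sgn e • mul a (D (mul b c)) + sgn ((e + 1) * f) • mul b (D (mul a c))
        - mul (mul (D a) b) c - sgn e • mul (mul a (D b)) c - sgn (e + f) • mul (mul a b) (D c)

end Algebras

end ArcOperad

end

/-! All arc families that occur are read off from planar tree-like configurations of circles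
(`Cactus`). A loop of length 1 runs around the configuration; its coordinates in the circles are
monotone degree-one maps `map i` of the line, and at any time only one of them moves. Together they
send `∂₀` to a torus, while each inner boundary circle goes to a coordinate circle of that torus
(`Cactus.pos`). Boundary points with the same image face each other: the two-point fibres without
base points are the leaves, and all other fibres are the complementary regions, which are discs
(`ofPos`). The topology of the surface is thus encoded in the fibres of one map.

Three facts make this model work. By `Cactus.fam_mem` the family of a cactus is an exhaustive arc
family of genus 0 without punctures; this is a count of the points in the fibres, where every
position other than the starting one is entered through exactly one circle (`existsUnique_entry`).
By `Cactus.compFam_fam` gluing surfaces means replacing a circle of one cactus by another cactus;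
underneath lies `Glues.glue_eq`, where discs remain discs because the pieces of a glued region and
the points along which they are glued form a tree (`ncard_nodes`). By `continuous_fam` a family of
cacti with continuous lengths and coordinates is continuous in the topology of the arc complex: a
nearby cactus maps to the given one by collapsing short arcs between cut points (`exists_collapse`).

The rest is homotopy theory of explicit families. `Δ ∘₁ Δ` is the loop of rotations pulled back
along the addition of two parameters. Scaling the sum down to 0 gives a cube whose side faces cancel
in pairs because addition is symmetric; this is `h₂`, and no division by 2 is needed.

For the seven-term relation, all seven composites are loops in three families `famA`, `famB`, `famC`
of cacti with three circles, corresponding to the bracketings `(12)3`, `1(23)` and `2(13)`. Their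
parameter spaces are vector spaces, so within one family a path modulo boundaries depends only on
its end points (`seg_trans`), and a loop along a period does not depend on its starting point
(`seg_loop`). If all three circles have the same length, half a turn of an inner pair carries the
point of attachment of the remaining circle once around one circle of the pair, and such a chain of
three circles can be bracketed in another way, as a member of another family. Cutting the loops of
`famB` and `famC` into half turns and transporting the pieces turns the relation into an identity in
an abelian group (`loop_relation`), whence `h₃`.

Commutativity and associativity up to boundaries come from rotating two equal circles by half a turn
and from changing the weights until the circles are equal. Evaluation on an algebra then only
requires the Koszul signs (`act_seven_terms`). -/

noncomputable section

namespace ArcOperad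

namespace ArcData

/-! ## Families given by the fibres of a position map -/

section Fibres

variable {ι Q : Type}

/-- The points with the same position as `p`. -/
def fibre (pos : ι × Circ → Q) (p : ι × Circ) : Set (ι × Circ) := {q | pos q = pos p}

/-- The fibre of `p` consists of the two points `p` and `q`, which are not base points. -/
def fibreLeaf (pos : ι × Circ → Q) (p q : ι × Circ) : Prop :=
  p ≠ q ∧ fibre pos p = {p, q} ∧ p.2 ≠ 0 ∧ q.2 ≠ 0

/-- The fibre of `p` is a pair of points which are not base points. -/
def OnLeaf (pos : ι × Circ → Q) (p : ι × Circ) : Prop := ∃ q, fibreLeaf pos p q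

/-- The data whose leaves are the two-point fibres without base points, and whose regions are discs
given by the other fibres. -/
def ofPos (len : ι → ℝ) (pos : ι × Circ → Q) : ArcData ι where
  len := len
  leaf := fibreLeaf pos
  regions := {R | ∃ p, R = fibre pos p ∧ ¬ OnLeaf pos p}
  chi := Set.indicator {R | ∃ p, R = fibre pos p ∧ ¬ OnLeaf pos p} 1
  pun _ := 0

variable {pos : ι × Circ → Q} {p q r : ι × Circ}

theorem mem_fibre : q ∈ fibre pos p ↔ pos q = pos p := Iff.rfl

theorem self_mem_fibre : p ∈ fibre pos p := rfl

theorem fibre_congr (h : pos p = pos q) : fibre pos p = fibre pos q := by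
  ext r; simp [mem_fibre, h]

theorem fibreLeaf.pos_eq (h : fibreLeaf pos p q) : pos q = pos p := by
  have : q ∈ fibre pos p := by rw [h.2.1]; simp
  exact this

theorem fibreLeaf.symm (h : fibreLeaf pos p q) : fibreLeaf pos q p :=
  ⟨h.1.symm, by rw [fibre_congr h.pos_eq, h.2.1, Set.pair_comm], h.2.2.2, h.2.2.1⟩

theorem fibreLeaf.eq_or (h : fibreLeaf pos p q) (hr : pos r = pos p) : r = p ∨ r = q := by
  have : r ∈ fibre pos p := hr
  rw [h.2.1] at this; simpa using this

theorem OnLeaf.congr (h : OnLeaf pos p) (hr : pos r = pos p) : OnLeaf pos r := by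
  obtain ⟨q, hq⟩ := h
  rcases hq.eq_or hr with rfl | rfl
  · exact ⟨q, hq⟩
  · exact ⟨p, hq.symm⟩

theorem onLeaf_congr (hr : pos r = pos p) : OnLeaf pos r ↔ OnLeaf pos p :=
  ⟨fun h => h.congr hr.symm, fun h => h.congr hr⟩

theorem mem_cuts_ofPos {len : ι → ℝ} : p ∈ (ofPos len pos).cuts ↔ ¬ OnLeaf pos p := by
  constructor
  · rintro ⟨R, ⟨p', rfl, hp'⟩, hp⟩ h
    exact hp' (h.congr (mem_fibre.1 hp).symm)
  · intro h
    exact ⟨fibre pos p, ⟨p, rfl, h⟩, self_mem_fibre⟩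

theorem mem_region_ofPos {len : ι → ℝ} {R : Set (ι × Circ)} (hR : R ∈ (ofPos len pos).regions)
    (hp : p ∈ R) : R = fibre pos p ∧ ¬ OnLeaf pos p := by
  obtain ⟨p', rfl, hp'⟩ := hR
  exact ⟨(fibre_congr hp).symm, fun h => hp' (h.congr (mem_fibre.1 hp).symm)⟩

end Fibres

theorem shift_zero {ι : Type} (p : ι × Circ) : shift 0 p = p := by
  simp [shift]

theorem shift_injOn {ι : Type} (p : ι × Circ) : Set.InjOn (fun t : ℝ => shift t p) (Ico 0 1) := by
  intro s hs t ht h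
  have h1 : ((s : ℝ) : Circ) = t := by
    have := congrArg Prod.snd h
    simpa [shift] using this
  rw [AddCircle.coe_eq_coe_iff_of_mem_Ico (p := (1:ℝ)) (a := 0)] at h1
  · exact h1
  · simpa using hs
  · simpa using ht

/-- Within one period `shift t p` is injective in `t`, so a finite set is met for finitely many `t`
only, and none of the positive ones accumulate at 0. -/
theorem eventually_shift_notMem {ι : Type} {A : Set (ι × Circ)} (hA : A.Finite) (p : ι × Circ) :
    ∀ᶠ t in 𝓝[>] (0 : ℝ), shift t p ∉ A := by
  have hfin : {t ∈ Ioo (0:ℝ) 1 | shift t p ∈ A}.Finite := by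
    refine Set.Finite.of_finite_image (f := fun t => shift t p) (hA.subset ?_) ?_
    · rintro _ ⟨t, ht, rfl⟩; exact ht.2
    · refine (shift_injOn p).mono ?_
      rintro t ⟨ht, -⟩
      exact ⟨ht.1.le, ht.2⟩
  have h1 : ∀ᶠ t in 𝓝[>] (0 : ℝ), t ∉ {t ∈ Ioo (0:ℝ) 1 | shift t p ∈ A} := by
    have : (0:ℝ) ∉ {t ∈ Ioo (0:ℝ) 1 | shift t p ∈ A} := by simp
    exact mem_nhdsWithin_of_mem_nhds (hfin.isClosed.isOpen_compl.mem_nhds this)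
  filter_upwards [h1, Ioo_mem_nhdsGT (zero_lt_one' ℝ)] with t ht ht' hA'
  exact ht ⟨ht', hA'⟩

theorem eul_of_finite {ι : Type} {A : Set (ι × Circ)} (hA : A.Finite) : eul A = A.ncard := by
  have h1 : {p | p ∈ A ∧ ∀ᶠ t in 𝓝[>] (0 : ℝ), shift t p ∉ A} = A := by
    ext p; simp only [mem_ofPred_eq, and_iff_left_iff_imp]
    exact fun _ => eventually_shift_notMem hA p
  have h2 : {p | p ∉ A ∧ ∀ᶠ t in 𝓝[>] (0 : ℝ), shift t p ∈ A} = ∅ := by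
    ext p; simp only [mem_ofPred_eq, mem_empty_iff_false, iff_false, not_and]
    intro _ h
    obtain ⟨t, h1, h2⟩ := (h.and (eventually_shift_notMem hA p)).exists
    exact h2 h1
  rw [eul, h1, h2]; simp

/-! ## Gluing of families given by position maps -/

section GluePos

variable {ι κ ο A B V : Type}

/-- The map `posU` exhibits the classes of points of the disjoint union which are generated by the
fibres of `posα` and `posβ` and by the identification of the circles `a` and `b`. -/
structure Glues (posα : ι × Circ → A) (posβ : κ × Circ → B) (a : ι) (b : κ) (out : ο → ι ⊕ κ)
    (posU : (ι ⊕ κ) × Circ → V) : Prop where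
  out_inj : Function.Injective out
  out_range : ∀ s, s ∈ range out ↔ s ≠ Sum.inl a ∧ s ≠ Sum.inr b
  congrL : ∀ p p', posα p = posα p' → posU (inL p) = posU (inL p')
  congrR : ∀ q q', posβ q = posβ q' → posU (inR q) = posU (inR q')
  glued : ∀ x, posU (Sum.inl a, x) = posU (Sum.inr b, -x)
  sepL : ∀ p p', posU (inL p) = posU (inL p') → posα p = posα p' ∨
    ∃ x x', posα p = posα (a, x) ∧ posα p' = posα (a, x')
  -- The two sides are not symmetric. By `inj` a fibre of `posα` meets the circle `a` at most once,
  -- so a detour through the first surface cannot connect different fibres of `posβ`.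
  sepR : ∀ q q', posU (inR q) = posU (inR q') → posβ q = posβ q'
  sepLR : ∀ p q, posU (inL p) = posU (inR q) → ∃ x, posα p = posα (a, x) ∧ posβ q = posβ (b, -x)
  inj : ∀ x x', posα (a, x) = posα (a, x') → x = x'
  leaf_b : ∀ p q, fibreLeaf posβ p q → p.1 = b → q.1 ≠ b
  finα : ∀ p, (fibre posα p).Finite
  finβ : ∀ p, (fibre posβ p).Finite
  cutα : {p | ¬ OnLeaf posα p}.Finite
  cutβ : {p | ¬ OnLeaf posβ p}.Finite

variable {posα : ι × Circ → A} {posβ : κ × Circ → B} {a : ι} {b : κ} {out : ο → ι ⊕ κ}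
  {posU : (ι ⊕ κ) × Circ → V}

/-- The class of `p` contains no cut points. -/
def Good (posα : ι × Circ → A) (posβ : κ × Circ → B) (posU : (ι ⊕ κ) × Circ → V)
    (p : (ι ⊕ κ) × Circ) : Prop :=
  (∀ x, posU (inL x) = posU p → OnLeaf posα x) ∧ (∀ y, posU (inR y) = posU p → OnLeaf posβ y)

theorem Good.congr {p q : (ι ⊕ κ) × Circ} (h : Good posα posβ posU p) (hq : posU q = posU p) :
    Good posα posβ posU q :=
  ⟨fun x hx => h.1 x (hx.trans hq), fun x hx => h.2 x (hx.trans hq)⟩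

theorem leafU_inL {lenα : ι → ℝ} {lenβ : κ → ℝ} {x : ι × Circ} {q : (ι ⊕ κ) × Circ}
    (h : leafU (ofPos lenα posα) (ofPos lenβ posβ) (inL x) q) : ∃ y, fibreLeaf posα x y ∧ q = inL y := by
  obtain ⟨x', y, h, h1, rfl⟩ | ⟨x', y, h, h1, rfl⟩ := h
  · simp only [inL, Prod.mk.injEq, Sum.inl.injEq] at h1
    obtain rfl : x = x' := by ext <;> simp [h1]
    exact ⟨y, h, rfl⟩
  · simp [inL, inR] at h1

theorem leafU_inR {lenα : ι → ℝ} {lenβ : κ → ℝ} {x : κ × Circ} {q : (ι ⊕ κ) × Circ}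
    (h : leafU (ofPos lenα posα) (ofPos lenβ posβ) (inR x) q) : ∃ y, fibreLeaf posβ x y ∧ q = inR y := by
  obtain ⟨x', y, h, h1, rfl⟩ | ⟨x', y, h, h1, rfl⟩ := h
  · simp [inL, inR] at h1
  · simp only [inR, Prod.mk.injEq, Sum.inr.injEq] at h1
    obtain rfl : x = x' := by ext <;> simp [h1]
    exact ⟨y, h, rfl⟩

namespace Glues

variable (G : Glues posα posβ a b out posU) (lenα : ι → ℝ) (lenβ : κ → ℝ)
include G

/-- A substitute for `inj` on the circle `b`: a region of the second surface may touch `b` several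
times, but a leaf with one end on `b` has its other end elsewhere. -/
theorem inj_b {x x' : Circ} (h : OnLeaf posβ (b, x)) (hx : posβ (b, x') = posβ (b, x)) : x' = x := by
  obtain ⟨y, hy⟩ := h
  rcases hy.eq_or hx with h | h
  · simpa using h
  · exact absurd (congrArg Prod.fst h.symm) (G.leaf_b _ _ hy rfl)

theorem posU_pass {p q : (ι ⊕ κ) × Circ} (h : pass a b p q) : posU p = posU q := by
  obtain ⟨x, ⟨rfl, rfl⟩ | ⟨rfl, rfl⟩⟩ := h
  · exact G.glued x
  · exact (G.glued x).symm

theorem posU_leafU {p q : (ι ⊕ κ) × Circ} (h : leafU (ofPos lenα posα) (ofPos lenβ posβ) p q) :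
    posU p = posU q := by
  obtain ⟨x, y, h, rfl, rfl⟩ | ⟨x, y, h, rfl, rfl⟩ := h
  · exact G.congrL _ _ (fibreLeaf.pos_eq h).symm
  · exact G.congrR _ _ (fibreLeaf.pos_eq h).symm

theorem exists_out {s : ι ⊕ κ} (h1 : s ≠ Sum.inl a) (h2 : s ≠ Sum.inr b) (x : Circ) :
    ∃ u : ο × Circ, inO out u = (s, x) := by
  obtain ⟨o, rfl⟩ := (G.out_range s).2 ⟨h1, h2⟩
  exact ⟨(o, x), rfl⟩

theorem fst_ne_of_leaf_a {x : Circ} {y : ι × Circ} (h : fibreLeaf posα (a, x) y) : y.1 ≠ a := by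
  intro hy
  obtain ⟨y1, y2⟩ := y
  obtain rfl : y1 = a := hy
  have := G.inj _ _ h.pos_eq
  exact h.1 (by rw [this])

/-- A leaf crosses the glued circle at most once: a leaf of the second surface that starts on `b`
ends elsewhere by `leaf_b`, and a leaf of the first surface that starts on `a` ends elsewhere by
`inj`. -/
theorem exists_runsTo {p : (ι ⊕ κ) × Circ} (h : Good posα posβ posU p) :
    ∃ u, runsTo (ofPos lenα posα) (ofPos lenβ posβ) a b out p u ∧ inO out u ≠ p := by
  obtain ⟨s, t⟩ := p
  rcases s with s | s
  · obtain ⟨y, hy⟩ := h.1 (s, t) rfl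
    have hl : leafU (ofPos lenα posα) (ofPos lenβ posβ) (Sum.inl s, t) (inL y) :=
      Or.inl ⟨_, _, hy, rfl, rfl⟩
    by_cases hya : y.1 = a
    · obtain ⟨y1, y2⟩ := y
      obtain rfl : y1 = a := hya
      have h2 : posU (inR (b, -y2)) = posU (Sum.inl s, t) := by
        rw [show (inR (b, -y2) : (ι ⊕ κ) × Circ) = (Sum.inr b, -y2) from rfl, ← G.glued]
        exact G.congrL _ _ hy.pos_eq
      obtain ⟨y', hy'⟩ := h.2 _ h2
      obtain ⟨u, hu⟩ := G.exists_out (s := Sum.inr y'.1) (by simp)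
        (by simpa using G.leaf_b _ _ hy' rfl) y'.2
      refine ⟨u, ⟨_, hl, ?_⟩, ?_⟩
      · refine Relation.ReflTransGen.single ⟨(Sum.inr b, -y2), ⟨y2, Or.inl ⟨rfl, rfl⟩⟩, ?_⟩
        exact Or.inr ⟨_, _, hy', rfl, hu⟩
      · rw [hu]; simp
    · obtain ⟨u, hu⟩ := G.exists_out (s := Sum.inl y.1) (by simpa using hya) (by simp) y.2
      refine ⟨u, ⟨_, hl, ?_⟩, ?_⟩
      · rw [hu]; exact Relation.ReflTransGen.refl
      · rw [hu]; rintro h; apply hy.1; simp only [Prod.mk.injEq, Sum.inl.injEq] at h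
        ext <;> simp [h]
  · obtain ⟨y, hy⟩ := h.2 (s, t) rfl
    have hl : leafU (ofPos lenα posα) (ofPos lenβ posβ) (Sum.inr s, t) (inR y) :=
      Or.inr ⟨_, _, hy, rfl, rfl⟩
    by_cases hya : y.1 = b
    · obtain ⟨y1, y2⟩ := y
      obtain rfl : y1 = b := hya
      have h2 : posU (inL (a, -y2)) = posU (Sum.inr s, t) := by
        rw [show (inL (a, -y2) : (ι ⊕ κ) × Circ) = (Sum.inl a, -y2) from rfl, G.glued, neg_neg]
        exact G.congrR _ _ hy.pos_eq
      obtain ⟨y', hy'⟩ := h.1 _ h2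
      obtain ⟨u, hu⟩ := G.exists_out (s := Sum.inl y'.1) 
        (by simpa using G.fst_ne_of_leaf_a hy') (by simp) y'.2
      refine ⟨u, ⟨_, hl, ?_⟩, ?_⟩
      · refine Relation.ReflTransGen.single ⟨(Sum.inl a, -y2), ⟨-y2, Or.inr ⟨by simp [inR], rfl⟩⟩, ?_⟩
        exact Or.inl ⟨_, _, hy', rfl, hu⟩
      · rw [hu]; simp
    · obtain ⟨u, hu⟩ := G.exists_out (s := Sum.inr y.1) (by simp) (by simpa using hya) y.2
      refine ⟨u, ⟨_, hl, ?_⟩, ?_⟩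
      · rw [hu]; exact Relation.ReflTransGen.refl
      · rw [hu]; rintro h; apply hy.1; simp only [Prod.mk.injEq, Sum.inr.injEq] at h
        ext <;> simp [h]

/-- If the fibre of `x` touches the circle `a` at `t`, then the leaf at `(b, -t)` has no other point
on `b`, so the crossing brings no further fibre of the first surface into the class. -/
theorem good_of_left {x : ι × Circ} (h1 : OnLeaf posα x)
    (h2 : ∀ t, posα x = posα (a, t) → OnLeaf posβ (b, -t)) : Good posα posβ posU (inL x) := by
  refine ⟨fun x' hx' => ?_, fun y hy => ?_⟩
  · rcases G.sepL _ _ hx' with h | ⟨t', t, h3, h4⟩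
    · exact h1.congr h
    · have h5 : posU (inR (b, -t')) = posU (inR (b, -t)) := by
        change posU (Sum.inr b, -t') = posU (Sum.inr b, -t)
        rw [← G.glued, ← G.glued]
        exact (G.congrL _ _ h3).symm.trans (hx'.trans (G.congrL _ _ h4))
      have := G.inj_b (h2 t h4) (G.sepR _ _ h5)
      rw [neg_inj] at this
      subst this
      exact h1.congr (h3.trans h4.symm)
  · obtain ⟨t, h3, h4⟩ := G.sepLR _ _ hy.symm
    exact (h2 t h3).congr h4

theorem good_of_right {x : κ × Circ} (h1 : OnLeaf posβ x)
    (h2 : ∀ t, posβ x = posβ (b, -t) → OnLeaf posα (a, t)) : Good posα posβ posU (inR x) := by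
  refine ⟨fun x' hx' => ?_, fun y hy => h1.congr (G.sepR _ _ hy)⟩
  obtain ⟨t, h3, h4⟩ := G.sepLR _ _ hx'
  exact (h2 t h4).congr h3

/-- On the glued circle a point has a surface on either side, and the second clause of `trapped`
asks that one can escape on both sides. Together the two clauses visit the whole class. -/
theorem mem_trapped {p : (ι ⊕ κ) × Circ} :
    p ∈ trapped (ofPos lenα posα) (ofPos lenβ posβ) a b out ↔ ¬ Good posα posβ posU p := by
  rw [trapped, mem_ofPred_eq, not_iff_not]
  constructor
  · rintro ⟨⟨u, q, hq, hqu⟩, h2⟩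
    -- A run that ends on an outer circle cannot stop on `a`; its next step passes to `b` and
    -- continues on a leaf there.
    have key : ∀ {q' u' }, q' = (Sum.inl a, u') →
        Relation.ReflTransGen (fun q r => ∃ q', pass a b q q' ∧
          leafU (ofPos lenα posα) (ofPos lenβ posβ) q' r) q' (inO out u) → OnLeaf posβ (b, -u') := by
      rintro q' t rfl h
      rcases Relation.ReflTransGen.cases_head h with h | ⟨r, ⟨q', ⟨x, ⟨h3, rfl⟩ | ⟨h3, h4⟩⟩, h5⟩, _⟩
      · exact absurd (congrArg Prod.fst h.symm) ((G.out_range _).1 ⟨u.1, rfl⟩).1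
      · obtain ⟨y, hy, -⟩ := leafU_inR (x := (b, -x)) h5
        obtain rfl : t = x := by simpa using h3
        exact ⟨y, hy⟩
      · simp at h3
    have key' : ∀ {q' u' }, q' = (Sum.inr b, -u') →
        Relation.ReflTransGen (fun q r => ∃ q', pass a b q q' ∧
          leafU (ofPos lenα posα) (ofPos lenβ posβ) q' r) q' (inO out u) → OnLeaf posα (a, u') := by
      rintro q' t rfl h
      rcases Relation.ReflTransGen.cases_head h with h | ⟨r, ⟨q', ⟨x, ⟨h3, h4⟩ | ⟨h3, rfl⟩⟩, h5⟩, _⟩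
      · exact absurd (congrArg Prod.fst h.symm) ((G.out_range _).1 ⟨u.1, rfl⟩).2
      · simp at h3
      · obtain ⟨y, hy, -⟩ := leafU_inL (x := (a, x)) h5
        obtain rfl : t = x := by simpa using h3
        exact ⟨y, hy⟩
    obtain ⟨s, t⟩ := p
    rcases s with s | s
    · obtain ⟨y, hy, rfl⟩ := leafU_inL (x := (s, t)) hq
      refine G.good_of_left ⟨y, hy⟩ fun t' ht' => ?_
      rcases hy.eq_or ht'.symm with h | rfl
      · obtain ⟨u', q', h3, -⟩ := h2 (Sum.inr b, -t') ⟨t', Or.inl ⟨by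
          simp only [Prod.mk.injEq] at h; simp [h], rfl⟩⟩
        obtain ⟨y', hy', -⟩ := leafU_inR (x := (b, -t')) h3
        exact ⟨y', hy'⟩
      · exact key rfl hqu
    · obtain ⟨y, hy, rfl⟩ := leafU_inR (x := (s, t)) hq
      refine G.good_of_right ⟨y, hy⟩ fun t' ht' => ?_
      rcases hy.eq_or ht'.symm with h | rfl
      · obtain ⟨u', q', h3, -⟩ := h2 (Sum.inl a, t') ⟨t', Or.inr ⟨by
          simp only [Prod.mk.injEq] at h; simp [h], rfl⟩⟩
        obtain ⟨y', hy', -⟩ := leafU_inL (x := (a, t')) h3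
        exact ⟨y', hy'⟩
      · exact key' rfl hqu
  · intro h
    refine ⟨?_, fun q hq => ?_⟩
    · obtain ⟨u, hu, -⟩ := G.exists_runsTo lenα lenβ h
      exact ⟨u, hu⟩
    · obtain ⟨u, hu, -⟩ := G.exists_runsTo lenα lenβ (h.congr (G.posU_pass hq).symm)
      exact ⟨u, hu⟩

theorem finite_right (v : V) : {y | posU (inR y) = v}.Finite := by
  by_cases h : ∃ y, posU (inR y) = v
  · obtain ⟨y, rfl⟩ := h
    exact (G.finβ y).subset fun z hz => G.sepR _ _ hz
  · push Not at h
    simp [h]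

/-- A class may contain many fibres of the first surface, but each additional one is attached at a
point `(b, -t)` of the class, and by `finite_right` there are finitely many of these. -/
theorem finite_left (v : V) : {x | posU (inL x) = v}.Finite := by
  by_cases h : ∃ x, posU (inL x) = v
  · obtain ⟨x, rfl⟩ := h
    refine ((G.finα x).union ((G.finite_right (posU (inL x))).biUnion
      fun y _ => G.finα (a, -y.2))).subset ?_
    intro z hz
    rcases G.sepL _ _ hz with h | ⟨t, t', h1, h2⟩
    · exact Or.inl h
    · refine Or.inr (mem_biUnion (x := (b, -t)) ?_ ?_)
      · change posU (Sum.inr b, -t) = _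
        rw [← G.glued, ← hz]
        exact (G.congrL _ _ h1).symm
      · simpa [mem_fibre] using h1
  · push Not at h
    simp [h]

theorem finite_class (v : V) : {r | posU r = v}.Finite := by
  refine (((G.finite_left v).image inL).union ((G.finite_right v).image inR)).subset ?_
  rintro ⟨s | s, t⟩ h
  · exact Or.inl ⟨(s, t), h, rfl⟩
  · exact Or.inr ⟨(s, t), h, rfl⟩

theorem finite_trapped : (trapped (ofPos lenα posα) (ofPos lenβ posβ) a b out).Finite := by
  refine ((G.cutα.biUnion fun x _ => G.finite_class (posU (inL x))).union
    (G.cutβ.biUnion fun x _ => G.finite_class (posU (inR x)))).subset ?_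
  intro p hp
  rw [G.mem_trapped, Good, not_and_or] at hp
  push Not at hp
  rcases hp with ⟨x, h1, h2⟩ | ⟨x, h1, h2⟩
  · exact Or.inl (mem_biUnion h2 h1.symm)
  · exact Or.inr (mem_biUnion h2 h1.symm)

theorem posU_joined {p q : (ι ⊕ κ) × Circ}
    (h : joined (ofPos lenα posα) (ofPos lenβ posβ) a b out p q) : posU p = posU q := by
  obtain ⟨-, -, ⟨R, ⟨r, rfl, -⟩, x, hx, y, hy, rfl, rfl⟩ | ⟨R, ⟨r, rfl, -⟩, x, hx, y, hy, rfl, rfl⟩ |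
    h | h | ⟨s, hs, rfl, h⟩⟩ := h
  · exact G.congrL _ _ (hx.trans hy.symm)
  · exact G.congrR _ _ (hx.trans hy.symm)
  · exact G.posU_leafU _ _ h
  · exact G.posU_pass h
  -- The trapped set is finite, so an arc of trapped points consists of one point.
  · rcases hs.eq_or_lt with rfl | hs
    · rw [shift_zero]
    · exfalso
      obtain ⟨t, ht, ht'⟩ := ((eventually_shift_notMem (G.finite_trapped lenα lenβ) p).and
        (Ioo_mem_nhdsGT hs)).exists
      exact ht (h t ⟨ht'.1.le, ht'.2.le⟩)

/-- A fibre is connected in itself, as a leaf or as a region, and `sepL` and `sepLR` say that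
different fibres of a class meet across the glued circle. Being trapped is a property of the class,
so no step leaves the trapped set. -/
theorem eqvGen_joined {p q : (ι ⊕ κ) × Circ}
    (hp : p ∈ trapped (ofPos lenα posα) (ofPos lenβ posβ) a b out) (h : posU p = posU q) :
    Relation.EqvGen (joined (ofPos lenα posα) (ofPos lenβ posβ) a b out) p q := by
  set J := joined (ofPos lenα posα) (ofPos lenβ posβ) a b out
  have hT : ∀ r, posU p = posU r → r ∈ trapped (ofPos lenα posα) (ofPos lenβ posβ) a b out := by
    intro r hr
    rw [G.mem_trapped] at hp ⊢
    exact fun h => hp (h.congr hr)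
  have stepL : ∀ x y, posU p = posU (inL x) → posα x = posα y → Relation.EqvGen J (inL x) (inL y) := by
    intro x y hx hxy
    have h1 := hT _ hx
    have h2 := hT _ (hx.trans (G.congrL _ _ hxy))
    by_cases hl : OnLeaf posα x
    · obtain ⟨z, hz⟩ := hl
      rcases hz.eq_or hxy.symm with rfl | rfl
      · exact Relation.EqvGen.refl _
      · exact Relation.EqvGen.rel _ _ ⟨h1, h2, Or.inr (Or.inr (Or.inl (Or.inl ⟨_, _, hz, rfl, rfl⟩)))⟩
    · exact Relation.EqvGen.rel _ _ ⟨h1, h2, Or.inl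
        ⟨fibre posα x, ⟨x, rfl, hl⟩, x, self_mem_fibre, y, hxy.symm, rfl, rfl⟩⟩
  have stepR : ∀ x y, posU p = posU (inR x) → posβ x = posβ y → Relation.EqvGen J (inR x) (inR y) := by
    intro x y hx hxy
    have h1 := hT _ hx
    have h2 := hT _ (hx.trans (G.congrR _ _ hxy))
    by_cases hl : OnLeaf posβ x
    · obtain ⟨z, hz⟩ := hl
      rcases hz.eq_or hxy.symm with rfl | rfl
      · exact Relation.EqvGen.refl _
      · exact Relation.EqvGen.rel _ _ ⟨h1, h2, Or.inr (Or.inr (Or.inl (Or.inr ⟨_, _, hz, rfl, rfl⟩)))⟩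
    · exact Relation.EqvGen.rel _ _ ⟨h1, h2, Or.inr (Or.inl
        ⟨fibre posβ x, ⟨x, rfl, hl⟩, x, self_mem_fibre, y, hxy.symm, rfl, rfl⟩)⟩
  have stepP : ∀ t, posU p = posU (inL (a, t)) → Relation.EqvGen J (inL (a, t)) (inR (b, -t)) := by
    intro t ht
    refine Relation.EqvGen.rel _ _ ⟨hT _ ht, hT _ (ht.trans (G.glued t)), ?_⟩
    exact Or.inr (Or.inr (Or.inr (Or.inl ⟨t, Or.inl ⟨rfl, rfl⟩⟩)))
  have cross : ∀ x y, posU p = posU (inL x) → posU p = posU (inR y) →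
      Relation.EqvGen J (inL x) (inR y) := by
    intro x y hx hy
    obtain ⟨t, h1, h2⟩ := G.sepLR _ _ (hx.symm.trans hy)
    have h3 := hx.trans (G.congrL _ _ h1)
    exact ((stepL x _ hx h1).trans _ _ _ (stepP t h3)).trans _ _ _
      (stepR _ _ (h3.trans (G.glued t)) h2.symm)
  obtain ⟨s | s, x⟩ := p <;> obtain ⟨s' | s', x'⟩ := q
  · rcases G.sepL (s, x) (s', x') h with h | ⟨t, t', h1, h2⟩
    · exact stepL (s, x) (s', x') rfl h
    · have h3 : posU (Sum.inl s, x) = posU (inL (a, t')) := h.trans (G.congrL _ _ h2)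
      exact (cross (s, x) (b, -t') rfl (h3.trans (G.glued t'))).trans _ _ _
        ((stepP t' h3).symm _ _ |>.trans _ _ _ (stepL _ (s', x') h3 h2.symm))
  · exact cross (s, x) (s', x') rfl h
  · exact (cross (s', x') (s, x) h rfl).symm _ _
  · exact stepR (s, x) (s', x') rfl (G.sepR _ _ h)

theorem hull_fibre {u : ο × Circ} (hu : ¬ Good posα posβ posU (inO out u)) {S : Set (ο × Circ)}
    (hS : S ⊆ fibre (posU ∘ inO out) u) (huS : u ∈ S) :
    hull (ofPos lenα posα) (ofPos lenβ posβ) a b out S = {r | posU r = posU (inO out u)} := by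
  rw [← G.mem_trapped lenα lenβ] at hu
  ext r
  constructor
  · rintro ⟨u', hu', -, h⟩
    have : ∀ {p q}, Relation.EqvGen (joined (ofPos lenα posα) (ofPos lenβ posβ) a b out) p q →
        posU p = posU q := by
      intro p q h
      induction h with
      | rel _ _ h => exact G.posU_joined _ _ h
      | refl => rfl
      | symm _ _ _ h => exact h.symm
      | trans _ _ _ _ _ h1 h2 => exact h1.trans h2
    exact (this h).symm.trans (hS hu')
  · intro hr
    exact ⟨u, huS, hu, G.eqvGen_joined _ _ hu hr.symm⟩

end Glues

end GluePos

end ArcData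

/-! ### Euler characteristics and leaves of the glued family -/

namespace ArcData

section Fibres

variable {ι Q : Type} {pos : ι × Circ → Q}

theorem finsum_chi_ofPos {len : ι → ℝ} {𝓡 : Set (Set (ι × Circ))} (h𝓡 : 𝓡 ⊆ (ofPos len pos).regions) :
    ∑ᶠ R ∈ 𝓡, (ofPos len pos).chi R = 𝓡.ncard := by
  have h1 : ∑ᶠ R ∈ 𝓡, (ofPos len pos).chi R = ∑ᶠ R ∈ 𝓡, ((1 : ℕ) : ℤ) := by
    refine finsum_mem_congr rfl fun R hR => ?_
    exact Set.indicator_of_mem (h𝓡 hR) 1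
  rw [h1]
  by_cases hf : 𝓡.Finite
  · rw [finsum_mem_eq_finite_toFinset_sum _ hf, Set.ncard_eq_toFinset_card _ hf]; simp
  -- For infinitely many regions both sides are 0 by convention.
  · rw [Set.Infinite.ncard hf, finsum_mem_eq_zero_of_infinite]
    · rfl
    · simpa [Function.support_const] using hf

/-- The number of fibres which are regions in a finite union of fibres. -/
theorem ncard_regions_subset {len : ι → ℝ} {X : Set (ι × Circ)} 
    (hX : ∀ x ∈ X, fibre pos x ⊆ X) :
    {R ∈ (ofPos len pos).regions | R ⊆ X}.ncard = (pos '' {x ∈ X | ¬ OnLeaf pos x}).ncard := by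
  symm
  refine Set.ncard_congr (fun v _ => {q | pos q = v}) ?_ ?_ ?_
  · rintro _ ⟨x, ⟨hx, hl⟩, rfl⟩
    exact ⟨⟨x, rfl, hl⟩, hX x hx⟩
  · rintro _ _ ⟨x, ⟨hx, hl⟩, rfl⟩ ⟨y, ⟨hy, hl'⟩, rfl⟩ h
    have : x ∈ {q | pos q = pos x} := rfl
    rw [h] at this
    exact this
  · rintro _ ⟨⟨p, rfl, hp⟩, h⟩
    exact ⟨pos p, ⟨p, ⟨h self_mem_fibre, hp⟩, rfl⟩, rfl⟩

theorem ncard_onLeaf {X : Set (ι × Circ)} (hfin : X.Finite) (hX : ∀ x ∈ X, fibre pos x ⊆ X) :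
    {x ∈ X | OnLeaf pos x}.ncard = 2 * (pos '' {x ∈ X | OnLeaf pos x}).ncard := by
  classical
  have hf : {x ∈ X | OnLeaf pos x}.Finite := hfin.subset fun x hx => hx.1
  rw [Set.ncard_eq_toFinset_card _ hf, Set.ncard_eq_toFinset_card _ (hf.image _),
    Set.Finite.toFinset_image, Finset.card_eq_sum_card_image pos, Finset.sum_const_nat (m := 2), mul_comm]
  intro v hv
  simp only [Finset.mem_image, Set.Finite.mem_toFinset, mem_ofPred_eq] at hv
  obtain ⟨x, ⟨hx, y, hy⟩, rfl⟩ := hv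
  have : (Finset.filter (fun z => pos z = pos x) hf.toFinset) = {x, y} := by
    ext z
    simp only [Finset.mem_filter, Set.Finite.mem_toFinset, mem_ofPred_eq, Finset.mem_insert,
      Finset.mem_singleton]
    constructor
    · rintro ⟨-, h⟩; exact hy.eq_or h
    · intro h
      have : pos z = pos x := by
        rcases h with rfl | rfl
        exacts [rfl, hy.pos_eq]
      exact ⟨⟨hX x hx this, OnLeaf.congr ⟨y, hy⟩ this⟩, this⟩
  rw [this, Finset.card_pair hy.1]

theorem ncard_image_split {X : Set (ι × Circ)} (hfin : X.Finite) :
    (pos '' X).ncard = (pos '' {x ∈ X | ¬ OnLeaf pos x}).ncard + (pos '' {x ∈ X | OnLeaf pos x}).ncard := by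
  rw [← Set.ncard_union_eq _ ((hfin.subset fun x hx => hx.1).image _)
    ((hfin.subset fun x hx => hx.1).image _), ← image_union]
  · congr 2
    ext x; simp only [mem_union, mem_ofPred_eq]; tauto
  · rw [Set.disjoint_left]
    rintro _ ⟨x, ⟨-, hx⟩, rfl⟩ ⟨y, ⟨-, hy⟩, h⟩
    exact hx (hy.congr h.symm)

end Fibres

section GluePos

variable {ι κ ο A B V : Type}
variable {posα : ι × Circ → A} {posβ : κ × Circ → B} {a : ι} {b : κ} {out : ο → ι ⊕ κ}
  {posU : (ι ⊕ κ) × Circ → V}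

theorem inL_injective : Function.Injective (inL : ι × Circ → (ι ⊕ κ) × Circ) := by
  rintro ⟨_, _⟩ ⟨_, _⟩ h; simpa [inL] using h

theorem inR_injective : Function.Injective (inR : κ × Circ → (ι ⊕ κ) × Circ) := by
  rintro ⟨_, _⟩ ⟨_, _⟩ h; simpa [inR] using h

theorem hullPun_ofPos (lenα : ι → ℝ) (lenβ : κ → ℝ) (K : Set ((ι ⊕ κ) × Circ)) :
    hullPun (ofPos lenα posα) (ofPos lenβ posβ) K = 0 := by
  simp [hullPun, ofPos]

namespace Glues

variable (G : Glues posα posβ a b out posU) (lenα : ι → ℝ) (lenβ : κ → ℝ)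
include G

theorem inO_injective : Function.Injective (inO out : ο × Circ → (ι ⊕ κ) × Circ) := by
  rintro ⟨_, _⟩ ⟨_, _⟩ h
  simp only [inO, Prod.mk.injEq] at h
  simp [G.out_inj h.1, h.2]

/-- With the fibres of the class as vertices and the glued points as edges one obtains a star. If
the class reaches the second surface, it contains exactly one fibre of `posβ`, and each fibre of
`posα` in it meets the circle `a` exactly once. Otherwise it is one fibre of `posα` without glued
points. -/
theorem ncard_nodes {v : V} (hv : ∃ r, posU r = v) :
    (posα '' {x | posU (inL x) = v}).ncard + (posβ '' {y | posU (inR y) = v}).ncard =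
      {t | posU (Sum.inl a, t) = v}.ncard + 1 := by
  by_cases hY : ∃ y, posU (inR y) = v
  · obtain ⟨y, hy⟩ := hY
    have h1 : posβ '' {y | posU (inR y) = v} = {posβ y} := by
      ext w; simp only [mem_image, mem_ofPred_eq, mem_singleton_iff]
      constructor
      · rintro ⟨z, hz, rfl⟩; exact G.sepR _ _ (hz.trans hy.symm)
      · rintro rfl; exact ⟨y, hy, rfl⟩
    have h2 : posα '' {x | posU (inL x) = v} =
        (fun t => posα (a, t)) '' {t | posU (Sum.inl a, t) = v} := by
      ext w; simp only [mem_image, mem_ofPred_eq]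
      constructor
      · rintro ⟨x, hx, rfl⟩
        obtain ⟨t, h1, h2⟩ := G.sepLR _ _ (hx.trans hy.symm)
        exact ⟨t, (G.congrL _ _ h1).symm.trans hx, h1.symm⟩
      · rintro ⟨t, ht, rfl⟩; exact ⟨(a, t), ht, rfl⟩
    rw [h1, h2, Set.ncard_singleton, Set.ncard_image_of_injective _ (fun t t' h => G.inj _ _ h)]
  · push Not at hY
    have hT : ∀ t, posU (Sum.inl a, t) ≠ v := fun t h => hY (b, -t) ((G.glued t).symm.trans h)
    obtain ⟨⟨s | s, t⟩, hr⟩ := hv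
    · have h1 : posα '' {x | posU (inL x) = v} = {posα (s, t)} := by
        ext w; simp only [mem_image, mem_ofPred_eq, mem_singleton_iff]
        constructor
        · rintro ⟨z, hz, rfl⟩
          rcases G.sepL z (s, t) (hz.trans hr.symm) with h | ⟨t1, t2, h1, h2⟩
          · exact h
          · exact absurd ((G.congrL _ _ h1).symm.trans hz) (hT t1)
        · rintro rfl; exact ⟨(s, t), hr, rfl⟩
      rw [h1]; simp [hY, hT]
    · exact absurd hr (hY (s, t))

/-- In `hullChi` a region counts 1, a leaf counts 1 (half of its two end points), and a glued point
counts -1. The total is the Euler characteristic of the tree of `ncard_nodes`. -/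
theorem hullChi_class {v : V} (hv : ∃ r, posU r = v) :
    hullChi (ofPos lenα posα) (ofPos lenβ posβ) a {r | posU r = v} = 1 := by
  set X := {x | posU (inL x) = v} with hXdef
  set Y := {y | posU (inR y) = v} with hYdef
  have hX : X.Finite := G.finite_left v
  have hY : Y.Finite := G.finite_right v
  have hXs : ∀ x ∈ X, fibre posα x ⊆ X := fun x hx z hz => (G.congrL _ _ hz).trans hx
  have hYs : ∀ x ∈ Y, fibre posβ x ⊆ Y := fun x hx z hz => (G.congrR _ _ hz).trans hx
  have e1 : ∀ R, inL '' R ⊆ {r | posU r = v} ↔ R ⊆ X := fun R => by rw [image_subset_iff]; rfl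
  have e2 : ∀ R, inR '' R ⊆ {r | posU r = v} ↔ R ⊆ Y := fun R => by rw [image_subset_iff]; rfl
  have e3 : {r | posU r = v} ∩ {p | ∃ q, leafU (ofPos lenα posα) (ofPos lenβ posβ) p q} =
      inL '' {x ∈ X | OnLeaf posα x} ∪ inR '' {x ∈ Y | OnLeaf posβ x} := by
    ext r
    constructor
    · rintro ⟨h1, q, ⟨x, y, h, rfl, rfl⟩ | ⟨x, y, h, rfl, rfl⟩⟩
      · exact Or.inl ⟨x, ⟨h1, y, h⟩, rfl⟩
      · exact Or.inr ⟨x, ⟨h1, y, h⟩, rfl⟩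
    · rintro (⟨x, ⟨h1, y, h⟩, rfl⟩ | ⟨x, ⟨h1, y, h⟩, rfl⟩)
      · exact ⟨h1, inL y, Or.inl ⟨_, _, h, rfl, rfl⟩⟩
      · exact ⟨h1, inR y, Or.inr ⟨_, _, h, rfl, rfl⟩⟩
  have e4 : ({r | posU r = v} ∩ {p | p.1 = Sum.inl a}) =
      (fun t => (Sum.inl a, t)) '' {t | posU (Sum.inl a, t) = v} := by
    ext ⟨s, t⟩
    constructor
    · rintro ⟨h1, h2⟩
      obtain rfl : s = Sum.inl a := h2
      exact ⟨t, h1, rfl⟩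
    · rintro ⟨t, h1, h2⟩
      simp only [Prod.mk.injEq] at h2
      obtain ⟨rfl, rfl⟩ := h2
      exact ⟨h1, rfl⟩
  have hfin := G.finite_class v
  have d1 : Disjoint (inL '' {x ∈ X | OnLeaf posα x}) (inR '' {x ∈ Y | OnLeaf posβ x}) := by
    rw [Set.disjoint_left]
    rintro _ ⟨x, -, rfl⟩ ⟨y, -, h⟩
    simp [inL, inR] at h
  have hXl : {x ∈ X | OnLeaf posα x}.Finite := hX.subset fun x hx => hx.1
  have hYl : {x ∈ Y | OnLeaf posβ x}.Finite := hY.subset fun x hx => hx.1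
  have hinj : Function.Injective (fun t : Circ => ((Sum.inl a, t) : (ι ⊕ κ) × Circ)) :=
    fun t t' h => by simpa using h
  have h1 := G.ncard_nodes hv
  rw [← hXdef, ← hYdef, ncard_image_split hX, ncard_image_split hY] at h1
  unfold hullChi
  simp only [e1, e2]
  rw [finsum_chi_ofPos (fun R hR => hR.1), finsum_chi_ofPos (fun R hR => hR.1),
    ncard_regions_subset hXs, ncard_regions_subset hYs, eul_of_finite (hfin.subset inter_subset_left),
    eul_of_finite (hfin.subset inter_subset_left), e3, e4,
    Set.ncard_union_eq d1 (hXl.image _) (hYl.image _), Set.ncard_image_of_injective _ inL_injective,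
    Set.ncard_image_of_injective _ inR_injective, ncard_onLeaf hX hXs, ncard_onLeaf hY hYs,
    Set.ncard_image_of_injective _ hinj]
  push_cast
  omega

theorem out_ne_a (u : ο × Circ) (t : Circ) : inO out u ≠ (Sum.inl a, t) := fun h =>
  ((G.out_range _).1 ⟨u.1, rfl⟩).1 (congrArg Prod.fst h)

theorem out_ne_b (u : ο × Circ) (t : Circ) : inO out u ≠ (Sum.inr b, t) := fun h =>
  ((G.out_range _).1 ⟨u.1, rfl⟩).2 (congrArg Prod.fst h)

theorem fibreLeaf_of_fibre {u v : ο × Circ} (h1 : inO out u ≠ inO out v) (hu : u.2 ≠ 0) (hv : v.2 ≠ 0)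
    (huv : posU (inO out v) = posU (inO out u))
    (h : ∀ w, posU (inO out w) = posU (inO out u) → inO out w = inO out u ∨ inO out w = inO out v) :
    fibreLeaf (posU ∘ inO out) u v := by
  refine ⟨fun h => h1 (by rw [h]), ?_, hu, hv⟩
  ext w
  constructor
  · intro hw
    rcases h w hw with h | h
    · exact Or.inl (G.inO_injective h)
    · exact Or.inr (G.inO_injective h)
  · rintro (rfl | rfl)
    · rfl
    · exact huv

theorem fibreLeaf_short_left {u v : ο × Circ} {x y : ι × Circ} (hu : inO out u = inL x)
    (hv : inO out v = inL y) (h : fibreLeaf posα x y) : fibreLeaf (posU ∘ inO out) u v := by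
  have hu2 : u.2 = x.2 := by simpa [inO, inL] using congrArg Prod.snd hu
  have hv2 : v.2 = y.2 := by simpa [inO, inL] using congrArg Prod.snd hv
  have hne : ∀ t, posα x ≠ posα (a, t) := by
    intro t ht
    rcases h.eq_or ht.symm with rfl | rfl
    · exact G.out_ne_a _ _ hu
    · exact G.out_ne_a _ _ hv
  refine G.fibreLeaf_of_fibre ?_ (hu2 ▸ h.2.2.1) (hv2 ▸ h.2.2.2) ?_ ?_
  · rw [hu, hv]; exact fun e => h.1 (inL_injective e)
  · rw [hu, hv]; exact G.congrL _ _ h.pos_eq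
  · intro w hw
    rw [hu, hv]
    rw [hu] at hw
    generalize inO out w = r at hw
    obtain ⟨s | s, t⟩ := r
    · rcases G.sepL (s, t) x hw with h2 | ⟨t1, t2, h1, h2⟩
      · exact (h.eq_or h2).imp (congrArg inL) (congrArg inL)
      · exact absurd h2 (hne t2)
    · obtain ⟨t1, h1, -⟩ := G.sepLR x (s, t) hw.symm
      exact absurd h1 (hne _)

theorem fibreLeaf_short_right {u v : ο × Circ} {x y : κ × Circ} (hu : inO out u = inR x)
    (hv : inO out v = inR y) (h : fibreLeaf posβ x y) : fibreLeaf (posU ∘ inO out) u v := by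
  have hu2 : u.2 = x.2 := by simpa [inO, inR] using congrArg Prod.snd hu
  have hv2 : v.2 = y.2 := by simpa [inO, inR] using congrArg Prod.snd hv
  have hne : ∀ t, posβ x ≠ posβ (b, t) := by
    intro t ht
    rcases h.eq_or ht.symm with rfl | rfl
    · exact G.out_ne_b _ _ hu
    · exact G.out_ne_b _ _ hv
  refine G.fibreLeaf_of_fibre ?_ (hu2 ▸ h.2.2.1) (hv2 ▸ h.2.2.2) ?_ ?_
  · rw [hu, hv]; exact fun e => h.1 (inR_injective e)
  · rw [hu, hv]; exact G.congrR _ _ h.pos_eq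
  · intro w hw
    rw [hu, hv]
    rw [hu] at hw
    generalize inO out w = r at hw
    obtain ⟨s | s, t⟩ := r
    · obtain ⟨t1, -, h1⟩ := G.sepLR (s, t) x hw
      exact absurd h1 (hne _)
    · exact (h.eq_or (G.sepR (s, t) x hw)).imp (congrArg inR) (congrArg inR)

/-- The crossing point `t` is unique on the first side by `inj` and on the second by `inj_b`. Hence
the class consists of the two leaves alone, and its only points on outer circles are the two far
ends. -/
theorem fibreLeaf_long {u v : ο × Circ} {x : ι × Circ} {y : κ × Circ} {t : Circ}
    (hu : inO out u = inL x) (hv : inO out v = inR y) (hx : fibreLeaf posα x (a, t))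
    (hy : fibreLeaf posβ (b, -t) y) : fibreLeaf (posU ∘ inO out) u v := by
  have hu2 : u.2 = x.2 := by simpa [inO, inL] using congrArg Prod.snd hu
  have hv2 : v.2 = y.2 := by simpa [inO, inR] using congrArg Prod.snd hv
  have ht : ∀ t', posα x = posα (a, t') → t' = t := by
    intro t' ht'
    exact G.inj _ _ (ht'.symm.trans hx.pos_eq.symm)
  refine G.fibreLeaf_of_fibre ?_ (hu2 ▸ hx.2.2.1) (hv2 ▸ hy.2.2.2) ?_ ?_
  · rw [hu, hv]; simp [inL, inR]
  · rw [hu, hv, G.congrR _ _ hy.pos_eq, G.congrL _ _ hx.pos_eq.symm]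
    exact (G.glued t).symm
  · intro w hw
    rw [hu, hv]
    rw [hu] at hw
    have hwa := G.out_ne_a w
    have hwb := G.out_ne_b w
    generalize inO out w = r at hw hwa hwb
    obtain ⟨s | s, z⟩ := r
    · have h4 : posα (s, z) = posα x := by
        rcases G.sepL (s, z) x hw with h2 | ⟨t1, t2, h1, h2⟩
        · exact h2
        · have h5 : posU (inR (b, -t1)) = posU (inR (b, -t)) := by
            change posU (Sum.inr b, -t1) = posU (Sum.inr b, -t)
            rw [← G.glued, ← G.glued]
            exact (G.congrL _ _ h1).symm.trans (hw.trans (G.congrL _ _ hx.pos_eq.symm))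
          have := G.inj_b ⟨y, hy⟩ (G.sepR _ _ h5)
          rw [neg_inj] at this
          rw [h1, this, hx.pos_eq]
      rcases hx.eq_or h4 with h5 | h5
      · exact Or.inl (by rw [← h5]; rfl)
      · exact absurd (congrArg inL h5) (hwa t)
    · obtain ⟨t1, h1, h2⟩ := G.sepLR x (s, z) hw.symm
      rw [ht _ h1] at h2
      rcases hy.eq_or h2 with h5 | h5
      · exact absurd (congrArg inR h5) (hwb (-t))
      · exact Or.inr (by rw [← h5]; rfl)

theorem fibreLeaf_of_runsTo {u v : ο × Circ}
    (h : runsTo (ofPos lenα posα) (ofPos lenβ posβ) a b out (inO out u) v) :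
    fibreLeaf (posU ∘ inO out) u v := by
  obtain ⟨q, hq, hqv⟩ := h
  -- Away from the glued circle a run cannot be continued.
  have halt : ∀ {r w}, (∀ t, r ≠ (Sum.inl a, t)) → (∀ t, r ≠ (Sum.inr b, t)) →
      Relation.ReflTransGen (fun q r => ∃ q', pass a b q q' ∧
          leafU (ofPos lenα posα) (ofPos lenβ posβ) q' r) r w → w = r := by
    intro r w h1 h2 h
    rcases Relation.ReflTransGen.cases_head h with h | ⟨r', ⟨q', ⟨x, ⟨h3, -⟩ | ⟨h3, -⟩⟩, -⟩, -⟩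
    · exact h.symm
    · exact absurd h3 (h1 _)
    · exact absurd h3 (h2 _)
  rcases hp : inO out u with ⟨s | s, t⟩
  · rw [hp] at hq
    obtain ⟨y, hy, rfl⟩ := leafU_inL (x := (s, t)) hq
    rcases Relation.ReflTransGen.cases_head hqv with h | ⟨r, ⟨q', ⟨x, ⟨h3, rfl⟩ | ⟨h3, -⟩⟩, h5⟩, h6⟩
    · exact G.fibreLeaf_short_left (x := (s, t)) hp h.symm hy
    · obtain ⟨y', hy', rfl⟩ := leafU_inR (x := (b, -x)) h5
      obtain rfl : y = (a, x) := inL_injective h3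
      have hb := G.leaf_b _ _ hy' rfl
      refine G.fibreLeaf_long (x := (s, t)) hp ?_ hy hy'
      exact halt (by simp [inR]) (fun t h => hb (by simpa [inR] using congrArg Prod.fst h)) h6
    · simp [inL] at h3
  · rw [hp] at hq
    obtain ⟨y, hy, rfl⟩ := leafU_inR (x := (s, t)) hq
    rcases Relation.ReflTransGen.cases_head hqv with h | ⟨r, ⟨q', ⟨x, ⟨h3, -⟩ | ⟨h3, rfl⟩⟩, h5⟩, h6⟩
    · exact G.fibreLeaf_short_right (x := (s, t)) hp h.symm hy
    · simp [inR] at h3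
    · obtain ⟨y', hy', rfl⟩ := leafU_inL (x := (a, x)) h5
      obtain rfl : y = (b, -x) := inR_injective h3
      have ha := G.fst_ne_of_leaf_a hy'
      refine (G.fibreLeaf_long ?_ hp hy'.symm hy.symm).symm
      exact halt (fun t h => ha (by simpa [inL] using congrArg Prod.fst h)) (by simp [inL]) h6

theorem good_iff_runsTo {u v : ο × Circ} :
    runsTo (ofPos lenα posα) (ofPos lenβ posβ) a b out (inO out u) v ↔
      Good posα posβ posU (inO out u) ∧ fibreLeaf (posU ∘ inO out) u v := by
  constructor
  · intro h
    refine ⟨?_, G.fibreLeaf_of_runsTo _ _ h⟩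
    by_contra h2
    rw [← G.mem_trapped lenα lenβ] at h2
    refine h2 ⟨⟨v, h⟩, ?_⟩
    rintro q ⟨x, ⟨h3, -⟩ | ⟨h3, -⟩⟩
    · exact absurd h3 (G.out_ne_a _ _)
    · exact absurd h3 (G.out_ne_b _ _)
  · rintro ⟨h1, h2⟩
    obtain ⟨v', h3, -⟩ := G.exists_runsTo lenα lenβ h1
    have h4 := G.fibreLeaf_of_runsTo _ _ h3
    have : v' = v := by
      rcases h2.eq_or h4.pos_eq with h | h
      · exact absurd h.symm h4.1
      · exact h
    exact this ▸ h3

theorem mem_preRegions {S : Set (ο × Circ)} :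
    S ∈ preRegions (ofPos lenα posα) (ofPos lenβ posβ) a b out ↔
      ∃ u, ¬ Good posα posβ posU (inO out u) ∧ S = fibre (posU ∘ inO out) u := by
  constructor
  · rintro ⟨u, h, rfl⟩
    rw [G.mem_trapped] at h
    refine ⟨u, h, ?_⟩
    rw [G.hull_fibre lenα lenβ h (S := {u}) (by simp [fibre]) rfl]; rfl
  · rintro ⟨u, h, rfl⟩
    refine ⟨u, (G.mem_trapped _ _).2 h, ?_⟩
    rw [G.hull_fibre lenα lenβ h (S := {u}) (by simp [fibre]) rfl]; rfl

/-- The Euler characteristic of the class is always 1, so what remains of the bigon condition is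
that it has two outer points and that they are not base points. -/
theorem isBigon_iff {u : ο × Circ} (hu : ¬ Good posα posβ posU (inO out u)) :
    IsBigon (ofPos lenα posα) (ofPos lenβ posβ) a b out (fibre (posU ∘ inO out) u) ↔
      OnLeaf (posU ∘ inO out) u := by
  rw [IsBigon, G.hull_fibre lenα lenβ hu subset_rfl self_mem_fibre, G.hullChi_class _ _ ⟨_, rfl⟩]
  constructor
  · rintro ⟨-, h1, h2⟩
    obtain ⟨x, y, hxy, h3⟩ := Set.ncard_eq_two.1 h1
    have hu : u ∈ fibre (posU ∘ inO out) u := self_mem_fibre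
    rw [h3] at hu h2
    rcases hu with rfl | rfl
    · exact ⟨y, hxy, h3, h2 _ (by simp), h2 _ (by simp)⟩
    · exact ⟨x, Ne.symm hxy, by rw [h3, Set.pair_comm], h2 _ (by simp), h2 _ (by simp)⟩
  · rintro ⟨v, h1, h2, h3, h4⟩
    refine ⟨rfl, by rw [h2, Set.ncard_pair h1], ?_⟩
    rw [h2]
    rintro w (rfl | rfl) <;> assumption

theorem mem_glueRegions {S : Set (ο × Circ)} :
    S ∈ glueRegions (ofPos lenα posα) (ofPos lenβ posβ) a b out ↔
      ∃ u, S = fibre (posU ∘ inO out) u ∧ ¬ OnLeaf (posU ∘ inO out) u := by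
  rw [glueRegions, mem_ofPred_eq, G.mem_preRegions]
  constructor
  · rintro ⟨⟨u, hu, rfl⟩, h⟩
    rw [G.isBigon_iff _ _ hu] at h
    exact ⟨u, rfl, h⟩
  · rintro ⟨u, rfl, h⟩
    have hu : ¬ Good posα posβ posU (inO out u) := by
      intro hu
      obtain ⟨v, hv, -⟩ := G.exists_runsTo lenα lenβ hu
      exact h ⟨v, G.fibreLeaf_of_runsTo _ _ hv⟩
    refine ⟨⟨u, hu, rfl⟩, ?_⟩
    rwa [G.isBigon_iff _ _ hu]

/-- The glued leaves are of two kinds: runs through classes without cut points, and classes with cut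
points that have become bigons, where parallel bands are united. Together they are all the two-point
fibres without base points, so both operations of the gluing are absorbed in the position map. -/
theorem glue_eq [Fintype ο] :
    glue (ofPos lenα posα) (ofPos lenβ posβ) a b out =
      ofPos (fun u => Sum.elim (fun i => lenβ b * lenα i) (fun j => lenα a * lenβ j) (out u) /
        ∑ v, Sum.elim (fun i => lenβ b * lenα i) (fun j => lenα a * lenβ j) (out v))
        (posU ∘ inO out) := by
  have hreg : glueRegions (ofPos lenα posα) (ofPos lenβ posβ) a b out =
      {R | ∃ p, R = fibre (posU ∘ inO out) p ∧ ¬ OnLeaf (posU ∘ inO out) p} := by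
    ext S; exact G.mem_glueRegions _ _
  classical
  refine ArcData.ext rfl ?_ hreg ?_ ?_
  · ext u v
    change (runsTo _ _ a b out (inO out u) v ∨ _) ↔ fibreLeaf (posU ∘ inO out) u v
    rw [G.good_iff_runsTo]
    constructor
    · rintro (h | ⟨S, hS, h1, h2, h3, h4⟩)
      · exact h.2
      · obtain ⟨w, hw, rfl⟩ := (G.mem_preRegions _ _).1 hS
        rw [G.isBigon_iff _ _ hw] at h1
        obtain ⟨w', hw'⟩ := h1.congr h2
        have : v = w' := by
          rcases hw'.eq_or ((mem_fibre.1 h3).trans (mem_fibre.1 h2).symm) with h | h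
          · exact absurd h.symm h4
          · exact h
        exact this ▸ hw'
    · intro h
      by_cases hg : Good posα posβ posU (inO out u)
      · exact Or.inl ⟨hg, h⟩
      · refine Or.inr ⟨_, (G.mem_preRegions _ _).2 ⟨u, hg, rfl⟩, ?_, self_mem_fibre, h.pos_eq, h.1⟩
        rw [G.isBigon_iff _ _ hg]
        exact ⟨v, h⟩
  · ext S
    change _ = Set.indicator _ _ S
    rw [← hreg]
    unfold glue
    dsimp only
    by_cases hS : S ∈ glueRegions (ofPos lenα posα) (ofPos lenβ posβ) a b out
    · rw [if_pos hS, Set.indicator_of_mem hS]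
      obtain ⟨⟨u, hu, rfl⟩, -⟩ := (⟨(G.mem_preRegions _ _).1 hS.1, hS.2⟩ : _ ∧ _)
      rw [G.hull_fibre lenα lenβ hu subset_rfl self_mem_fibre, G.hullChi_class _ _ ⟨_, rfl⟩]
      rfl
    · rw [if_neg hS, Set.indicator_of_notMem hS]
  · ext S
    unfold glue
    dsimp only
    rw [hullPun_ofPos, ite_self]
    rfl

end Glues

end GluePos

end ArcData

/-! ### Cacti: coordinates of the loop and its moves -/

theorem circ_eq_iff {x y : ℝ} : (x : Circ) = (y : Circ) ↔ ∃ m : ℤ, x = y + m := by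
  rw [← sub_eq_zero, ← AddCircle.coe_sub, AddCircle.coe_eq_zero_iff]
  constructor
  · rintro ⟨m, hm⟩; exact ⟨m, by simp at hm; linarith⟩
  · rintro ⟨m, hm⟩; exact ⟨m, by simp [hm]⟩

theorem circ_eq_of_lt {x y : ℝ} (h : (x : Circ) = (y : Circ)) (h1 : x - y < 1) (h2 : -1 < x - y) :
    x = y := by
  obtain ⟨m, hm⟩ := circ_eq_iff.1 h
  have h3 : (m : ℝ) < 1 := by linarith
  have h4 : (-1 : ℝ) < m := by linarith
  have h5 : m < 1 := by exact_mod_cast h3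
  have h6 : -1 < m := by exact_mod_cast h4
  obtain rfl : m = 0 := by omega
  simpa using hm

theorem exists_coe_circ (w : Circ) : ∃ x : ℝ, (x : Circ) = w := QuotientAddGroup.mk_surjective w

theorem exists_coe_circ_Ico (w : Circ) (a : ℝ) : ∃ x ∈ Ico a (a + 1), (x : Circ) = w := by
  refine ⟨AddCircle.equivIco 1 a w, (AddCircle.equivIco 1 a w).2, ?_⟩
  exact AddCircle.coe_equivIco

theorem coe_circ_add_one (x : ℝ) : ((x + 1 : ℝ) : Circ) = x := circ_eq_iff.2 ⟨1, by simp⟩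

/-- A planar tree-like configuration of circles of the lengths `len i`, each with a base point,
traversed by a loop with coordinates `map i`: in the `i`-th circle, with its orientation reversed, the
loop is at `map i z` at the time `z`, and at any time it moves in one of the circles only. -/
@[ext]
structure Cactus (n : ℕ) where
  len : Fin n → ℝ
  map : Fin n → ℝ → ℝ
  len_pos : ∀ i, 0 < len i
  len_sum : ∑ i, len i = 1
  mono : ∀ i, Monotone (map i)
  map_add_one : ∀ i z, map i (z + 1) = map i z + 1
  sum_map : ∀ z, ∑ i, len i * (map i z - map i 0) = z
  /-- Any two of the circles form a wedge. -/
  wedge : ∃ c : Fin n → Fin n → Circ, ∀ i j, i ≠ j → ∀ z,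
    (map i z : Circ) = c i j ∨ (map j z : Circ) = c j i

namespace Cactus

variable {n : ℕ} (C : Cactus n)

/-- The point of the `i`-th circle from which the `j`-th circle branches off. -/
def att : Fin n → Fin n → Circ := C.wedge.choose

theorem att_spec {i j : Fin n} (h : i ≠ j) (z : ℝ) :
    (C.map i z : Circ) = C.att i j ∨ (C.map j z : Circ) = C.att j i :=
  C.wedge.choose_spec i j h z

theorem sum_sub (z z' : ℝ) : ∑ i, C.len i * (C.map i z' - C.map i z) = z' - z := by
  have h1 := C.sum_map z
  have h2 := C.sum_map z'
  rw [← h1, ← h2, ← Finset.sum_sub_distrib]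
  exact (Finset.sum_congr rfl fun i _ => by rw [C.sum_map, C.sum_map]; ring)

theorem len_mul_sub_le (i : Fin n) {z z' : ℝ} (h : z ≤ z') :
    C.len i * (C.map i z' - C.map i z) ≤ z' - z := by
  rw [← C.sum_sub z z']
  exact Finset.single_le_sum (f := fun i => C.len i * (C.map i z' - C.map i z))
    (fun j _ => mul_nonneg (C.len_pos j).le (sub_nonneg.2 (C.mono j h))) (Finset.mem_univ i)

/-- All coordinates increase, and their increments, weighted with the lengths, add up to the elapsed
time. So `map i` is Lipschitz with the constant `(len i)⁻¹`. -/
theorem continuous_map (i : Fin n) : Continuous (C.map i) := by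
  have hl := C.len_pos i
  have h0 : ∀ z z', z ≤ z' → |C.map i z' - C.map i z| ≤ (C.len i)⁻¹ * |z' - z| := by
    intro z z' h
    rw [abs_of_nonneg (sub_nonneg.2 (C.mono i h)), abs_of_nonneg (sub_nonneg.2 h),
      ← div_eq_inv_mul, le_div_iff₀ hl, mul_comm]
    exact C.len_mul_sub_le i h
  refine (LipschitzWith.of_dist_le_mul (K := ⟨(C.len i)⁻¹, (inv_pos.2 hl).le⟩) ?_).continuous
  intro z z'
  rw [Real.dist_eq, Real.dist_eq]
  rcases le_total z z' with h | h
  · rw [abs_sub_comm, abs_sub_comm z]; exact h0 _ _ h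
  · exact h0 _ _ h

/-- The coordinate `map i` as a map of the circle of degree one. -/
def lift (i : Fin n) : CircleDeg1Lift := ⟨⟨C.map i, C.mono i⟩, C.map_add_one i⟩

theorem map_add_int (i : Fin n) (z : ℝ) (m : ℤ) : C.map i (z + m) = C.map i z + m :=
  (C.lift i).map_add_int z m

theorem periodic (i : Fin n) : Function.Periodic (fun z => (C.map i z : Circ)) 1 := fun z => by
  simp only [C.map_add_one, coe_circ_add_one]

/-- The coordinate `map i` as a map of circles. -/
def circ (i : Fin n) : Circ → Circ := (C.periodic i).lift

@[simp] theorem circ_coe (i : Fin n) (z : ℝ) : C.circ i (z : Circ) = (C.map i z : Circ) :=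
  (C.periodic i).lift_coe z

theorem exists_map_eq (i : Fin n) (y : ℝ) : ∃ z, C.map i z = y := by
  have h := mem_range_of_exists_le_of_exists_ge (C.continuous_map i) (c := y)
    ⟨((⌊y - C.map i 0⌋ : ℤ) : ℝ), ?_⟩ ⟨((⌈y - C.map i 0⌉ : ℤ) : ℝ), ?_⟩
  · exact h
  · have := C.map_add_int i 0 ⌊y - C.map i 0⌋
    rw [zero_add] at this; rw [this]
    linarith [Int.floor_le (y - C.map i 0)]
  · have := C.map_add_int i 0 ⌈y - C.map i 0⌉
    rw [zero_add] at this; rw [this]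
    linarith [Int.le_ceil (y - C.map i 0)]

/-! ### The lobes next to a point -/

/-- The two coordinates stay in a wedge of two circles. A coordinate which is off the wedge point
remains so for a short time, which pins the other one at the wedge point; at the wedge point, one of
the two is there at any nearby time, and by closeness not only modulo 1. -/
theorem eventually_pair {i j : Fin n} (hij : i ≠ j) (z : ℝ) :
    ∀ᶠ t in 𝓝 (0 : ℝ), C.map i (z + t) = C.map i z ∨ C.map j (z + t) = C.map j z := by
  have hc : ∀ k, Tendsto (fun t => C.map k (z + t)) (𝓝 0) (𝓝 (C.map k z)) := by
    intro k
    have : Continuous fun t => C.map k (z + t) := (C.continuous_map k).comp (by fun_prop)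
    simpa using this.tendsto 0
  have hs : ∀ k, ∀ᶠ t in 𝓝 (0 : ℝ), |C.map k (z + t) - C.map k z| < 1 := by
    intro k
    have := (hc k).eventually (Metric.ball_mem_nhds _ one_pos)
    simpa [Real.dist_eq] using this
  have hne : ∀ k (w : Circ), (C.map k z : Circ) ≠ w → ∀ᶠ t in 𝓝 (0 : ℝ), (C.map k (z + t) : Circ) ≠ w := by
    intro k w hw
    have := (AddCircle.continuous_mk' 1).continuousAt.tendsto.comp (hc k)
    exact this.eventually_ne hw
  have hfin : ∀ k t, |C.map k (z + t) - C.map k z| < 1 → (C.map k (z + t) : Circ) = C.map k z →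
      C.map k (z + t) = C.map k z := fun k t h1 h2 =>
    circ_eq_of_lt h2 (abs_lt.1 h1).2 (abs_lt.1 h1).1
  by_cases hi : (C.map i z : Circ) = C.att i j
  · by_cases hj : (C.map j z : Circ) = C.att j i
    · filter_upwards [hs i, hs j] with t h1 h2
      rcases C.att_spec hij (z + t) with h | h
      · exact Or.inl (hfin i t h1 (h.trans hi.symm))
      · exact Or.inr (hfin j t h2 (h.trans hj.symm))
    · filter_upwards [hs i, hne j _ hj] with t h1 h2
      have := (C.att_spec hij (z + t)).resolve_right h2
      exact Or.inl (hfin i t h1 (this.trans hi.symm))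
  · have hj := (C.att_spec hij z).resolve_left hi
    filter_upwards [hs j, hne i _ hi] with t h1 h2
    have := (C.att_spec hij (z + t)).resolve_left h2
    exact Or.inr (hfin j t h1 (this.trans hj.symm))

/-- Right after the time `z` the loop moves in the `j`-th circle. -/
def RightLobe (z : ℝ) (j : Fin n) : Prop :=
  ∀ᶠ t in 𝓝[>] (0 : ℝ), C.map j (z + t) = C.map j z + t / C.len j ∧
    ∀ i, i ≠ j → C.map i (z + t) = C.map i z

/-- Right before the time `z` the loop moves in the `j`-th circle. -/
def LeftLobe (z : ℝ) (j : Fin n) : Prop :=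
  ∀ᶠ t in 𝓝[>] (0 : ℝ), C.map j (z - t) = C.map j z - t / C.len j ∧
    ∀ i, i ≠ j → C.map i (z - t) = C.map i z

/-- If two coordinates had changed, the pair would contradict `eventually_pair`; if none had, the
weighted sum would give `e = 0`. The index may still depend on `e` here. -/
theorem exists_moving (z : ℝ) : ∃ ε > 0, ∀ e, |e| < ε → e ≠ 0 →
    ∃ j, ∀ i, i ≠ j → C.map i (z + e) = C.map i z := by
  have h : ∀ᶠ t in 𝓝 (0 : ℝ), ∀ i j, i ≠ j →
      C.map i (z + t) = C.map i z ∨ C.map j (z + t) = C.map j z := by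
    rw [eventually_all]; intro i
    rw [eventually_all]; intro j
    by_cases hij : i = j
    · simp [hij]
    · filter_upwards [C.eventually_pair hij z] with t ht _ using ht
  obtain ⟨ε, hε, h⟩ := Metric.eventually_nhds_iff.1 h
  refine ⟨ε, hε, fun e he he0 => ?_⟩
  have h' := h (y := e) (by simpa [Real.dist_eq] using he)
  by_contra hcon
  push Not at hcon
  have hall : ∃ i, C.map i (z + e) ≠ C.map i z := by
    by_contra hc
    push Not at hc
    have := C.sum_sub z (z + e)
    simp [hc] at this
    exact he0 this.symm
  obtain ⟨j, hj⟩ := hall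
  obtain ⟨i, hij, hi⟩ := hcon j
  exact (h' i j hij).elim hi hj

theorem map_of_others {z t : ℝ} {j : Fin n} (h : ∀ i, i ≠ j → C.map i (z + t) = C.map i z) :
    C.map j (z + t) = C.map j z + t / C.len j := by
  have h1 := C.sum_sub z (z + t)
  rw [Finset.sum_eq_single j (fun i _ hi => by rw [h i hi]; simp) (by simp)] at h1
  have := C.len_pos j
  field_simp
  linarith

theorem exists_rightLobe (z : ℝ) : ∃ j, C.RightLobe z j := by
  obtain ⟨ε, hε, h⟩ := C.exists_moving z
  obtain ⟨j, hj⟩ := h (ε / 2) (by rw [abs_of_pos (by positivity)]; linarith) (by positivity)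
  refine ⟨j, ?_⟩
  filter_upwards [Ioo_mem_nhdsGT (half_pos hε)] with t ht
  -- A monotone coordinate with the same value at `z` and at `z + ε / 2` is constant in between, so
  -- the index found for `ε / 2` serves all shorter times.
  have h2 : ∀ i, i ≠ j → C.map i (z + t) = C.map i z := fun i hi =>
    le_antisymm ((C.mono i (by linarith [ht.2])).trans (hj i hi).le) (C.mono i (by linarith [ht.1]))
  exact ⟨C.map_of_others h2, h2⟩

theorem exists_leftLobe (z : ℝ) : ∃ j, C.LeftLobe z j := by
  obtain ⟨ε, hε, h⟩ := C.exists_moving z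
  obtain ⟨j, hj⟩ := h (-(ε / 2)) (by rw [abs_neg, abs_of_pos (by positivity)]; linarith)
    (by simpa using hε.ne')
  refine ⟨j, ?_⟩
  filter_upwards [Ioo_mem_nhdsGT (half_pos hε)] with t ht
  have h2 : ∀ i, i ≠ j → C.map i (z + -t) = C.map i z := fun i hi =>
    le_antisymm (C.mono i (by linarith [ht.1])) ((hj i hi).symm.le.trans (C.mono i (by linarith [ht.2])))
  have h3 := C.map_of_others h2
  rw [sub_eq_add_neg, h3]
  exact ⟨by ring, h2⟩

variable {C}

theorem RightLobe.lt {z z' : ℝ} {j : Fin n} (h : C.RightLobe z j) (hz : z < z') :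
    C.map j z < C.map j z' := by
  obtain ⟨t, ht, h1⟩ := (h.and (Ioo_mem_nhdsGT (sub_pos.2 hz))).exists
  calc C.map j z < C.map j z + t / C.len j := by
        have := div_pos h1.1 (C.len_pos j); linarith
    _ = C.map j (z + t) := ht.1.symm
    _ ≤ C.map j z' := C.mono j (by linarith [h1.2])

theorem LeftLobe.lt {z z' : ℝ} {j : Fin n} (h : C.LeftLobe z j) (hz : z' < z) :
    C.map j z' < C.map j z := by
  obtain ⟨t, ht, h1⟩ := (h.and (Ioo_mem_nhdsGT (sub_pos.2 hz))).exists
  calc C.map j z' ≤ C.map j (z - t) := C.mono j (by linarith [h1.2])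
    _ = C.map j z - t / C.len j := ht.1
    _ < C.map j z := by
        have := div_pos h1.1 (C.len_pos j); linarith

theorem RightLobe.unique {z : ℝ} {i j : Fin n} (hi : C.RightLobe z i) (hj : C.RightLobe z j) : i = j := by
  by_contra h
  obtain ⟨t, ⟨h1, h2⟩, h3, h4⟩ := (hi.and (hj.and self_mem_nhdsWithin)).exists
  have := hi.lt (z' := z + t) (by linarith [show (0:ℝ) < t from h4])
  rw [h3.2 i h] at this
  exact lt_irrefl _ this

/-- At the times `ε / 3` and `2 * ε / 3` after `z` the `j`-th coordinate has different values on the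
circle, as less than one turn has passed. At one of them it is not at `c j i`, so the resting
coordinate is at `c i j`. The choice `c` is arbitrary, which also yields the uniqueness of the
points of attachment. -/
theorem RightLobe.map_eq {z : ℝ} {j : Fin n} (h : C.RightLobe z j) {c : Fin n → Fin n → Circ}
    (hc : ∀ i j, i ≠ j → ∀ z, (C.map i z : Circ) = c i j ∨ (C.map j z : Circ) = c j i)
    {i : Fin n} (hi : i ≠ j) : (C.map i z : Circ) = c i j := by
  have hl := C.len_pos j
  obtain ⟨ε, hε, h⟩ := mem_nhdsGT_iff_exists_Ioo_subset.1 (h.and (Ioo_mem_nhdsGT hl))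
  have hε' : (0:ℝ) < ε := hε
  have e1 := h (show ε / 3 ∈ Ioo 0 ε from ⟨by linarith, by linarith⟩)
  have e2 := h (show 2 * ε / 3 ∈ Ioo 0 ε from ⟨by linarith, by linarith⟩)
  rcases hc i j hi (z + ε / 3) with h1 | h1
  · rw [← h1, e1.1.2 i hi]
  · rcases hc i j hi (z + 2 * ε / 3) with h2 | h2
    · rw [← h2, e2.1.2 i hi]
    · exfalso
      have hlt : ε / 3 / C.len j < 1 := by
        rw [div_lt_one hl]; linarith [e2.2.2]
      have hpos : 0 < ε / 3 / C.len j := by positivity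
      have h3 := circ_eq_of_lt (h2.trans h1.symm)
      rw [e1.1.1, e2.1.1] at h3
      have h4 : C.map j z + 2 * ε / 3 / C.len j - (C.map j z + ε / 3 / C.len j) = ε / 3 / C.len j := by ring
      rw [h4] at h3
      linarith [h3 hlt (by linarith), h4]

variable (C)

/-- Take the last time at which the coordinate equals `y`: moving in another circle would keep it at
`y` for longer. -/
theorem exists_rightLobe_eq (j : Fin n) (y : ℝ) : ∃ z, C.map j z = y ∧ C.RightLobe z j := by
  obtain ⟨z0, hz0⟩ := C.exists_map_eq j y
  have hcl : IsClosed {z | C.map j z = y} := isClosed_singleton.preimage (C.continuous_map j)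
  have hbd : BddAbove {z | C.map j z = y} := by
    refine ⟨z0 + 1, fun z hz => ?_⟩
    by_contra hlt
    have := C.mono j (not_le.1 hlt).le
    rw [C.map_add_one, hz0, show C.map j z = y from hz] at this
    linarith
  have hmem := hcl.csSup_mem ⟨z0, hz0⟩ hbd
  refine ⟨_, hmem, ?_⟩
  obtain ⟨i, hi⟩ := C.exists_rightLobe (sSup {z | C.map j z = y})
  by_cases hij : j = i
  · exact hij ▸ hi
  · exfalso
    obtain ⟨t, ht, ht'⟩ := (hi.and self_mem_nhdsWithin).exists
    have := le_csSup hbd (show sSup {z | C.map j z = y} + t ∈ {z | C.map j z = y} from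
      (ht.2 j hij).trans hmem)
    linarith [show (0:ℝ) < t from ht']

variable {C}

theorem RightLobe.map_eq_att {z : ℝ} {j i : Fin n} (h : C.RightLobe z j) (hi : i ≠ j) :
    (C.map i z : Circ) = C.att i j :=
  h.map_eq (fun _ _ h z => C.att_spec h z) hi

theorem att_unique {c : Fin n → Fin n → Circ}
    (hc : ∀ i j, i ≠ j → ∀ z, (C.map i z : Circ) = c i j ∨ (C.map j z : Circ) = c j i)
    {i j : Fin n} (hij : i ≠ j) : C.att i j = c i j := by
  obtain ⟨z, -, hz⟩ := C.exists_rightLobe_eq j 0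
  rw [← hz.map_eq_att hij, hz.map_eq hc hij]

/-- Just before `z` the `j`-th coordinate increases, so the loop is moving on in the `j`-th circle
at some time there, for instance when it leaves the midpoint value; the other coordinates rest
between that time and `z`. -/
theorem LeftLobe.map_eq_att {z : ℝ} {j i : Fin n} (h : C.LeftLobe z j) (hi : i ≠ j) :
    (C.map i z : Circ) = C.att i j := by
  obtain ⟨t, ht, ht'⟩ := (h.and self_mem_nhdsWithin).exists
  by_cases hr : ∃ s, z - t < s ∧ s < z ∧ C.RightLobe s j
  · obtain ⟨s, hs1, hs2, hs⟩ := hr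
    rw [← hs.map_eq_att hi]
    have h1 := C.mono i hs1.le
    have h2 := C.mono i hs2.le
    rw [ht.2 i hi] at h1
    rw [le_antisymm h2 h1]
  · exfalso
    obtain ⟨s, hs1, hs⟩ := C.exists_rightLobe_eq j ((C.map j (z - t) + C.map j z) / 2)
    have hlt : C.map j (z - t) < C.map j z := h.lt (by linarith [show (0:ℝ) < t from ht'])
    refine hr ⟨s, ?_, ?_, hs⟩
    · by_contra hh
      have := C.mono j (not_lt.1 hh)
      linarith
    · by_contra hh
      have := C.mono j (not_lt.1 hh)
      linarith

end Cactus

/-! ### The position map of a cactus and the sizes of its fibres -/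

namespace Cactus
open ArcData

variable {n : ℕ} (C : Cactus n)

/-- The position of a boundary point of the surface in the product of the circles. -/
def pos (p : Fin (n + 1) × Circ) : Fin n → Circ :=
  Fin.cases (fun i => C.circ i p.2) (fun j i => if i = j then -p.2 else C.att i j) p.1

theorem pos_zero (z : ℝ) : C.pos (0, (z : Circ)) = fun i => (C.map i z : Circ) := by
  funext i; simp [pos]

theorem pos_zero' (w : Circ) : C.pos (0, w) = fun i => C.circ i w := rfl

theorem pos_succ (j : Fin n) (w : Circ) :
    C.pos (j.succ, w) = fun i => if i = j then -w else C.att i j := by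
  funext i; simp [pos]

theorem pos_succ_self (j : Fin n) (w : Circ) : C.pos (j.succ, w) j = -w := by simp [pos_succ]

theorem pos_succ_ne {i j : Fin n} (h : i ≠ j) (w : Circ) : C.pos (j.succ, w) i = C.att i j := by
  simp [pos_succ, h]

theorem pos_succ_inj {j : Fin n} {w w' : Circ} (h : C.pos (j.succ, w) = C.pos (j.succ, w')) : w = w' := by
  have := congrFun h j
  simpa [pos_succ_self] using this

/-- The arc family of the cactus. -/
def fam : Fam n := ofPos (Fin.cons (1 / 2) fun i => C.len i / 2) C.pos

variable {C}

theorem pos_succ_eq {p : Fin (n + 1) × Circ} {j : Fin n} (h : ∀ i, i ≠ j → C.pos p i = C.att i j) :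
    C.pos (j.succ, -C.pos p j) = C.pos p := by
  funext i
  by_cases hi : i = j
  · subst hi; simp [pos_succ_self]
  · rw [C.pos_succ_ne hi, h i hi]

theorem pos_succ_of {z : ℝ} {j : Fin n} (h : ∀ i, i ≠ j → (C.map i z : Circ) = C.att i j) :
    C.pos (j.succ, -(C.map j z : Circ)) = C.pos (0, (z : Circ)) := by
  have := pos_succ_eq (C := C) (p := (0, (z : Circ))) (j := j) (by simpa [pos_zero] using h)
  simpa [pos_zero] using this

theorem RightLobe.pos_eq {z : ℝ} {j : Fin n} (h : C.RightLobe z j) :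
    C.pos (j.succ, -(C.map j z : Circ)) = C.pos (0, (z : Circ)) :=
  pos_succ_of fun _ hi => h.map_eq_att hi

theorem LeftLobe.pos_eq {z : ℝ} {j : Fin n} (h : C.LeftLobe z j) :
    C.pos (j.succ, -(C.map j z : Circ)) = C.pos (0, (z : Circ)) :=
  pos_succ_of fun _ hi => h.map_eq_att hi

variable (C)

theorem pos_wedge (p : Fin (n + 1) × Circ) {i j : Fin n} (h : i ≠ j) :
    C.pos p i = C.att i j ∨ C.pos p j = C.att j i := by
  obtain ⟨s, w⟩ := p
  induction s using Fin.cases with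
  | zero =>
    obtain ⟨z, rfl⟩ := exists_coe_circ w
    simpa [pos_zero] using C.att_spec h z
  | succ k =>
    by_cases hi : i = k
    · subst hi; exact Or.inr (C.pos_succ_ne h.symm w)
    · by_cases hj : j = k
      · subst hj; exact Or.inl (C.pos_succ_ne h w)
      · rw [C.pos_succ_ne hi, C.pos_succ_ne hj]
        -- Both coordinates are those of the loop at a time at which it moves in the `k`-th circle.
        obtain ⟨z, -, hz⟩ := C.exists_rightLobe_eq k 0
        rw [← hz.map_eq_att hi, ← hz.map_eq_att hj]
        exact C.att_spec h z

/-- For every position on the `j`-th circle there is a time at which the loop is there and moves on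
in that circle. -/
theorem exists_rightLobe_pos {p : Fin (n + 1) × Circ} {j : Fin n}
    (h : ∀ i, i ≠ j → C.pos p i = C.att i j) {y : ℝ} (hy : (y : Circ) = C.pos p j) :
    ∃ z, C.map j z = y ∧ C.RightLobe z j ∧ C.pos (0, (z : Circ)) = C.pos p := by
  obtain ⟨z, h1, h2⟩ := C.exists_rightLobe_eq j y
  refine ⟨z, h1, h2, ?_⟩
  rw [← h2.pos_eq, ← pos_succ_eq h, h1, hy]

theorem exists_zero_pos (p : Fin (n + 1) × Circ) : ∃ z : ℝ, C.pos (0, (z : Circ)) = C.pos p := by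
  obtain ⟨s, w⟩ := p
  induction s using Fin.cases with
  | zero => obtain ⟨z, rfl⟩ := exists_coe_circ w; exact ⟨z, rfl⟩
  | succ k =>
    obtain ⟨y, hy⟩ := exists_coe_circ (C.pos (k.succ, w) k)
    obtain ⟨z, -, -, h⟩ := C.exists_rightLobe_pos (p := (k.succ, w)) (j := k)
      (fun i hi => C.pos_succ_ne hi w) hy
    exact ⟨z, h⟩

/-! ### Finiteness -/

/-- The position `v` is, in each coordinate, a point from which some other circle branches off. -/
def Sing (v : Fin n → Circ) : Prop := ∀ i, ∃ j, j ≠ i ∧ v i = C.att i j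

theorem rightLobe_of_not_att {z : ℝ} {i : Fin n} (h : ∀ j, j ≠ i → (C.map i z : Circ) ≠ C.att i j) :
    C.RightLobe z i := by
  obtain ⟨j, hj⟩ := C.exists_rightLobe z
  by_cases hij : i = j
  · exact hij ▸ hj
  · exact absurd (hj.map_eq_att hij) (h j (Ne.symm hij))

theorem leftLobe_of_not_att {z : ℝ} {i : Fin n} (h : ∀ j, j ≠ i → (C.map i z : Circ) ≠ C.att i j) :
    C.LeftLobe z i := by
  obtain ⟨j, hj⟩ := C.exists_leftLobe z
  by_cases hij : i = j
  · exact hij ▸ hj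
  · exact absurd (hj.map_eq_att hij) (h j (Ne.symm hij))

/-- The loop moves in the `i`-th circle both before and after `z`. So during the rest of the period
this coordinate lies strictly between its values at `z` and `z + 1`, and no other point of `∂₀` has
the same position. The points on a circle `k ≠ i` have `i`-th coordinate `att i k`, which is
excluded. -/
theorem fibre_of_not_sing {z : ℝ} {i : Fin n} (h : ∀ j, j ≠ i → (C.map i z : Circ) ≠ C.att i j) :
    fibre C.pos (0, (z : Circ)) = {(0, (z : Circ)), (i.succ, -(C.map i z : Circ))} := by
  have hr := C.rightLobe_of_not_att h
  have hl := C.leftLobe_of_not_att h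
  ext ⟨s, w⟩
  simp only [mem_fibre, mem_insert_iff, mem_singleton_iff]
  constructor
  · intro hw
    induction s using Fin.cases with
    | zero =>
      left
      obtain ⟨z', hz', rfl⟩ := exists_coe_circ_Ico w z
      rcases hz'.1.eq_or_lt with rfl | hlt
      · rfl
      · exfalso
        have h1 := hr.lt hlt
        have h2 : C.LeftLobe (z + 1) i := C.leftLobe_of_not_att fun j hj => by
          rw [C.map_add_one, coe_circ_add_one]; exact h j hj
        have h3 := h2.lt hz'.2
        rw [C.map_add_one] at h3
        have h4 := congrFun hw i
        simp only [pos_zero] at h4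
        have := circ_eq_of_lt h4 (by linarith) (by linarith)
        linarith
    | succ k =>
      right
      by_cases hk : i = k
      · subst hk
        have h4 := congrFun hw i
        rw [pos_succ_self, pos_zero] at h4
        simp only at h4
        rw [← h4, neg_neg]
      · have h4 := congrFun hw i
        rw [C.pos_succ_ne hk, pos_zero] at h4
        exact absurd h4.symm (h k (Ne.symm hk))
  · rintro (h | h)
    · rw [h]
    · rw [h, hr.pos_eq]

theorem finite_coe_mem {F : Set Circ} (hF : F.Finite) (a : ℝ) :
    {y ∈ Icc a (a + 1) | (y : Circ) ∈ F}.Finite := by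
  have h1 : {y ∈ Ico a (a + 1) | (y : Circ) ∈ F}.Finite := by
    refine Set.Finite.of_finite_image (f := fun y : ℝ => (y : Circ)) (hF.subset ?_) ?_
    · rintro _ ⟨y, hy, rfl⟩; exact hy.2
    · intro x hx y hy hxy
      exact circ_eq_of_lt hxy (by linarith [hx.1.2, hy.1.1]) (by linarith [hy.1.2, hx.1.1])
  refine (h1.union (finite_singleton (a + 1))).subset ?_
  rintro y ⟨hy, hyF⟩
  rcases hy.2.eq_or_lt with h | h
  · exact Or.inr h
  · exact Or.inl ⟨⟨hy.1, h⟩, hyF⟩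

/-- At a singular time each coordinate lies in a finite set over one period, and by `sum_map` the
coordinates determine the time. -/
theorem finite_sing : {w : Circ | C.Sing (C.pos (0, w))}.Finite := by
  have h1 : {z ∈ Ico (0:ℝ) 1 | C.Sing (C.pos (0, (z : Circ)))}.Finite := by
    have hpi : (Set.pi univ fun i => {y ∈ Icc (C.map i 0) (C.map i 0 + 1) |
        (y : Circ) ∈ range (C.att i)}).Finite :=
      Set.Finite.pi fun i => finite_coe_mem (finite_range _) _
    refine Set.Finite.of_finite_image (f := fun z i => C.map i z) (hpi.subset ?_) ?_
    · rintro _ ⟨z, ⟨hz, hs⟩, rfl⟩ i -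
      refine ⟨⟨C.mono i hz.1, ?_⟩, ?_⟩
      · rw [← C.map_add_one, zero_add]; exact C.mono i hz.2.le
      · obtain ⟨j, -, hj⟩ := hs i
        rw [pos_zero] at hj
        exact ⟨j, hj.symm⟩
    · intro z _ z' _ h
      rw [← C.sum_map z, ← C.sum_map z']
      exact Finset.sum_congr rfl fun i _ => by rw [show C.map i z = C.map i z' from congrFun h i]
  refine (h1.image fun z : ℝ => (z : Circ)).subset ?_
  intro w hw
  obtain ⟨z, hz, rfl⟩ := exists_coe_circ_Ico w 0
  exact ⟨z, ⟨by simpa using hz, hw⟩, rfl⟩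

theorem finite_fibre (p : Fin (n + 1) × Circ) : (fibre C.pos p).Finite := by
  have h0 : {w : Circ | C.pos (0, w) = C.pos p}.Finite := by
    by_cases hs : C.Sing (C.pos p)
    · exact C.finite_sing.subset fun w hw => by simpa [mem_ofPred_eq, show C.pos (0, w) = _ from hw] using hs
    · obtain ⟨z, hz⟩ := C.exists_zero_pos p
      rw [← hz] at hs ⊢
      simp only [Sing, not_forall, not_exists, not_and] at hs
      obtain ⟨i, hi⟩ := hs
      have := C.fibre_of_not_sing (z := z) (i := i) (by simpa [pos_zero] using hi)
      have hfin : (fibre C.pos (0, (z : Circ))).Finite := by rw [this]; simp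
      exact hfin.preimage (f := fun w => ((0 : Fin (n + 1)), w)) (fun _ _ _ _ h => by simpa using h)
  refine ((h0.image fun w => ((0 : Fin (n + 1)), w)).union
    (finite_range fun j : Fin n => (j.succ, -C.pos p j))).subset ?_
  rintro ⟨s, w⟩ hw
  induction s using Fin.cases with
  | zero => exact Or.inl ⟨w, hw, rfl⟩
  | succ k =>
    refine Or.inr ⟨k, ?_⟩
    simp only [← mem_fibre.1 hw, pos_succ_self, neg_neg]

/-- A non-singular fibre has two points and is a leaf unless one of them is a base point. So the cut
points lie in the fibres of the base points and of the finitely many singular positions. -/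
theorem finite_cut : {p | ¬ OnLeaf C.pos p}.Finite := by
  refine (((finite_range fun i : Fin (n + 1) => (i, (0 : Circ))).biUnion fun p _ => C.finite_fibre p).union
    (C.finite_sing.biUnion fun w _ => C.finite_fibre (0, w))).subset ?_
  intro p hp
  obtain ⟨z, hz⟩ := C.exists_zero_pos p
  by_cases hs : C.Sing (C.pos (0, (z : Circ)))
  · exact Or.inr (mem_biUnion (show (z : Circ) ∈ _ from hs) hz.symm)
  · left
    have hp' : ¬ OnLeaf C.pos (0, (z : Circ)) := fun h => hp (h.congr hz.symm)
    simp only [Sing, not_forall, not_exists, not_and] at hs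
    obtain ⟨i, hi⟩ := hs
    have hf := C.fibre_of_not_sing (z := z) (i := i) (by simpa [pos_zero] using hi)
    have : ∃ k, C.pos (k, 0) = C.pos (0, (z : Circ)) := by
      by_contra hc
      push Not at hc
      refine hp' ⟨_, ?_, hf, ?_, ?_⟩
      · simp [Fin.ext_iff]
      · intro h; exact hc 0 (by rw [show ((z : ℝ) : Circ) = 0 from h])
      · intro h
        have h2 : ((i.succ, -(C.map i z : Circ)) : Fin (n + 1) × Circ) ∈ fibre C.pos (0, (z : Circ)) := by
          rw [hf]; simp
        rw [show -(C.map i z : Circ) = 0 from h] at h2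
        exact hc _ h2
    obtain ⟨k, hk⟩ := this
    exact mem_biUnion ⟨k, rfl⟩ (hz.symm.trans hk.symm)

/-! ### Counting the points of a fibre -/

/-- A visit of the loop corresponds to the circle in which it moves on. Two visits within one period
cannot continue in the same circle, since its coordinate would increase strictly and by less than a
full turn between them; and every circle through the position is used by `exists_rightLobe_pos`. -/
theorem ncard_fibre_zero (p : Fin (n + 1) × Circ) :
    {w : Circ | C.pos (0, w) = C.pos p}.ncard = {j : Fin n | C.pos (j.succ, -C.pos p j) = C.pos p}.ncard := by
  choose r hr using C.exists_rightLobe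
  have hinj : ∀ z z' : ℝ, z < z' → z' < z + 1 → C.pos (0, (z : Circ)) = C.pos (0, (z' : Circ)) → r z ≠ r z' := by
    intro z z' h1 h2 h3 h4
    have h5 := congrFun h3 (r z)
    simp only [pos_zero] at h5
    have h6 := (hr z).lt h1
    have h7 := (h4 ▸ hr z').lt h2
    rw [C.map_add_one] at h7
    have := circ_eq_of_lt h5 (by linarith) (by linarith)
    linarith
  choose q hq hq' using fun w => exists_coe_circ_Ico w 0
  refine Set.ncard_congr (fun w _ => r (q w)) ?_ ?_ ?_
  · intro w hw
    have h1 := (hr (q w)).pos_eq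
    rw [hq', show C.pos (0, w) = _ from hw] at h1
    have h2 := congrFun h1 (r (q w))
    rw [pos_succ_self, neg_neg] at h2
    rw [h2] at h1
    exact h1
  · intro w w' hw hw' h
    have h3 : C.pos (0, (q w : Circ)) = C.pos (0, (q w' : Circ)) := by
      rw [hq', hq']; exact Eq.trans hw hw'.symm
    rw [← hq' w, ← hq' w']
    rcases lt_trichotomy (q w) (q w') with h1 | h1 | h1
    · exact absurd h (hinj _ _ h1 (by linarith [(hq w).1, (hq w').2]) h3)
    · rw [h1]
    · exact absurd h.symm (hinj _ _ h1 (by linarith [(hq w').1, (hq w).2]) h3.symm)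
  · intro j hj
    obtain ⟨y, hy⟩ := exists_coe_circ (C.pos p j)
    obtain ⟨z, h1, h2, h3⟩ := C.exists_rightLobe_pos (p := p) (j := j) (y := y)
      (fun i hi => by rw [← show C.pos (j.succ, -C.pos p j) = C.pos p from hj, C.pos_succ_ne hi]) hy
    refine ⟨(z : Circ), h3, ?_⟩
    obtain ⟨m, hm⟩ := circ_eq_iff.1 (hq' (z : Circ))
    refine (hr _).unique ?_
    rw [hm]
    unfold RightLobe at h2 ⊢
    filter_upwards [h2] with t ht
    refine ⟨?_, fun i hi => ?_⟩
    · rw [add_right_comm, C.map_add_int, C.map_add_int, ht.1]; ring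
    · rw [add_right_comm, C.map_add_int, C.map_add_int, ht.2 i hi]

/-- The point of the `j`-th circle at which the loop enters it. -/
def root (j : Fin n) : Fin (n + 1) × Circ := (j.succ, -(C.map j 0 : Circ))

theorem pos_root_iff {p : Fin (n + 1) × Circ} {j : Fin n} : C.pos (C.root j) = C.pos p ↔
    C.pos (j.succ, -C.pos p j) = C.pos p ∧ C.pos p j = C.map j 0 := by
  constructor
  · intro h
    have h1 := congrFun h j
    rw [root, pos_succ_self, neg_neg] at h1
    exact ⟨by rw [← h1]; exact h, h1.symm⟩
  · rintro ⟨h1, h2⟩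
    rw [root, ← h2, h1]

/-- Seen from the start of the loop the circles form a rooted tree. The circle singled out is the
one through which the loop arrives at its first visit; the other circles through the position are
entered there, so that their coordinate is still the one of the time 0. -/
theorem existsUnique_entry {p : Fin (n + 1) × Circ} (hp : C.pos (0, 0) ≠ C.pos p) :
    ∃! j : Fin n, C.pos (j.succ, -C.pos p j) = C.pos p ∧ C.pos p j ≠ C.map j 0 := by
  have hf : {z ∈ Ico (0:ℝ) 1 | C.pos (0, (z : Circ)) = C.pos p}.Finite := by
    refine Set.Finite.of_finite_image (f := fun z : ℝ => ((0 : Fin (n + 1)), (z : Circ)))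
      ((C.finite_fibre p).subset ?_) ?_
    · rintro _ ⟨z, hz, rfl⟩; exact hz.2
    · intro x hx y hy hxy
      exact circ_eq_of_lt (by simpa using hxy) (by linarith [hx.1.2, hy.1.1]) (by linarith [hy.1.2, hx.1.1])
  obtain ⟨z0, hz0⟩ := C.exists_zero_pos p
  obtain ⟨z1, hz1, hz1'⟩ := exists_coe_circ_Ico (z0 : Circ) 0
  have hne : {z ∈ Ico (0:ℝ) 1 | C.pos (0, (z : Circ)) = C.pos p}.Nonempty :=
    ⟨z1, by simpa using hz1, by rw [hz1', hz0]⟩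
  obtain ⟨z, ⟨hz, hzp⟩, hmin⟩ := Set.exists_min_image _ id hf hne
  obtain ⟨j, hj⟩ := C.exists_leftLobe z
  have hzpos : 0 < z := by
    rcases hz.1.eq_or_lt with rfl | h
    · exact absurd (by simpa using hzp) hp
    · exact h
  have hjp : C.pos (j.succ, -C.pos p j) = C.pos p := by
    rw [← hzp, ← hj.pos_eq, C.pos_succ_self]; simp
  have hzj : (C.map j z : Circ) = C.pos p j := by rw [← hzp, pos_zero]
  -- Otherwise the loop would just have completed a full turn of the `j`-th circle, and the start of
  -- that turn would be an earlier visit, contrary to the choice of `z`.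
  have hj0 : C.pos p j ≠ C.map j 0 := by
    intro heq
    have h1 := hj.lt hzpos
    have h2 : C.map j z ≤ C.map j 0 + 1 := by
      rw [← C.map_add_one, zero_add]; exact C.mono j hz.2.le
    obtain ⟨z2, h3, h4, h5⟩ := C.exists_rightLobe_pos (p := p) (j := j) (y := C.map j 0)
      (fun i hi => by rw [← hjp, C.pos_succ_ne hi]) heq.symm
    have h6 : C.map j z = C.map j 0 + 1 := by
      obtain ⟨m, hm⟩ := circ_eq_iff.1 (hzj.trans heq)
      have a1 : (0:ℝ) < m := by linarith
      have a2 : (m:ℝ) ≤ 1 := by linarith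
      have a3 : 0 < m := by exact_mod_cast a1
      have a4 : m ≤ 1 := by exact_mod_cast a2
      obtain rfl : m = 1 := by omega
      rw [hm]; simp
    have h7 : z2 < z := by
      by_contra h; have := C.mono j (not_lt.1 h); linarith
    have h8 : 0 ≤ z2 := by
      by_contra h; have := h4.lt (not_le.1 h); linarith
    have := hmin z2 ⟨⟨h8, h7.trans hz.2⟩, h5⟩
    simp only [id] at this
    linarith
  refine ⟨j, ⟨hjp, hj0⟩, ?_⟩
  · rintro k ⟨hk1, hk2⟩
    by_contra hkj
    -- At the time 0 one of any two circles is at its branch point towards the other, so two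
    -- candidates cannot both differ from their roots.
    have h1 : C.pos p k = C.att k j := by rw [← hjp, C.pos_succ_ne hkj]
    have h2 : C.pos p j = C.att j k := by rw [← hk1, C.pos_succ_ne (Ne.symm hkj)]
    rcases C.att_spec hkj 0 with h | h
    · exact hk2 (h1.trans h.symm)
    · exact hj0 (h2.trans h.symm)

-- The circles through a position are those that the loop enters there, counted by roots, and the
-- one of `existsUnique_entry`, which is missing at the start of the loop.
open Classical in
theorem ncard_fibre_zero_eq (p : Fin (n + 1) × Circ) :
    {w : Circ | C.pos (0, w) = C.pos p}.ncard =
      {j : Fin n | C.pos (C.root j) = C.pos p}.ncard + if C.pos (0, 0) = C.pos p then 0 else 1 := by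
  rw [ncard_fibre_zero]
  have h1 : {j : Fin n | C.pos (j.succ, -C.pos p j) = C.pos p} =
      {j | C.pos (C.root j) = C.pos p} ∪
        {j | C.pos (j.succ, -C.pos p j) = C.pos p ∧ C.pos p j ≠ C.map j 0} := by
    ext j; simp only [mem_union, mem_ofPred_eq, pos_root_iff]; tauto
  rw [h1, Set.ncard_union_eq ?_ (toFinite _) (toFinite _)]
  · congr 1
    split_ifs with h
    · rw [Set.ncard_eq_zero (toFinite _)]
      ext j; simp only [mem_ofPred_eq, mem_empty_iff_false, iff_false, not_and, not_not]
      intro _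
      rw [← h]
      exact congrFun (C.pos_zero 0) j
    · obtain ⟨j, hj, hj'⟩ := C.existsUnique_entry h
      rw [Set.ncard_eq_one]
      exact ⟨j, by ext k; exact ⟨fun hk => hj' k hk, fun hk => by rw [show k = j from hk]; exact hj⟩⟩
  · rw [Set.disjoint_left]
    intro j hj hj'
    exact hj'.2 (C.pos_root_iff.1 hj).2

/-- Each circle through the position contributes one inner point, and by `ncard_fibre_zero` there
are as many such circles as points on `∂₀`. -/
theorem ncard_fibre (p : Fin (n + 1) × Circ) :
    (fibre C.pos p).ncard = 2 * {w : Circ | C.pos (0, w) = C.pos p}.ncard := by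
  have h1 : fibre C.pos p = (fun w => ((0 : Fin (n + 1)), w)) '' {w : Circ | C.pos (0, w) = C.pos p} ∪
      (fun j : Fin n => (j.succ, -C.pos p j)) '' {j : Fin n | C.pos (j.succ, -C.pos p j) = C.pos p} := by
    ext ⟨s, w⟩
    constructor
    · intro h
      induction s using Fin.cases with
      | zero => exact Or.inl ⟨w, h, rfl⟩
      | succ k =>
        have h2 := congrFun (mem_fibre.1 h) k
        rw [pos_succ_self] at h2
        refine Or.inr ⟨k, ?_, ?_⟩
        · rw [mem_ofPred_eq, ← h2, neg_neg]; exact h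
        · simp only [← h2, neg_neg]
    · rintro (⟨w', hw, h⟩ | ⟨k, hw, h⟩)
      · rw [← h]; exact hw
      · rw [← h]; exact hw
  have hf := C.finite_fibre p
  rw [h1] at hf ⊢
  rw [Set.ncard_union_eq ?_ (hf.subset subset_union_left) (hf.subset subset_union_right),
    Set.ncard_image_of_injective _ (fun _ _ h => by simpa using h), Set.ncard_image_of_injective,
    ← C.ncard_fibre_zero, two_mul]
  · intro j k h
    simp only [Prod.mk.injEq, Fin.succ_inj] at h
    exact h.1
  · rw [Set.disjoint_left]
    rintro _ ⟨w, -, rfl⟩ ⟨k, -, h⟩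
    simp [Fin.ext_iff] at h

end Cactus

/-! ### The fibres of a cactus form a planar arc family -/

theorem ArcData.fibreLeaf_of {ι Q : Type} {pos : ι × Circ → Q} {p q : ι × Circ} (h : ArcData.OnLeaf pos p)
    (hq : pos q = pos p) (hne : q ≠ p) : ArcData.fibreLeaf pos p q := by
  obtain ⟨r, hr⟩ := h
  rcases hr.eq_or hq with h | rfl
  · exact absurd h hne
  · exact hr

theorem ArcData.onLeaf_of_ncard {ι Q : Type} {pos : ι × Circ → Q} {p : ι × Circ}
    (h1 : (ArcData.fibre pos p).ncard = 2) (h2 : ∀ q ∈ ArcData.fibre pos p, q.2 ≠ 0) :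
    ArcData.OnLeaf pos p := by
  obtain ⟨x, y, hxy, h3⟩ := Set.ncard_eq_two.1 h1
  have hu : p ∈ ArcData.fibre pos p := ArcData.self_mem_fibre
  rw [h3] at hu h2
  rcases hu with rfl | rfl
  · exact ⟨y, hxy, h3, h2 _ (by simp), h2 _ (by simp)⟩
  · exact ⟨x, Ne.symm hxy, by rw [h3, Set.pair_comm], h2 _ (by simp), h2 _ (by simp)⟩

theorem continuous_shift {ι : Type} [TopologicalSpace ι] (p : ι × Circ) : Continuous fun t : ℝ => shift t p := by
  unfold shift
  exact Continuous.prodMk continuous_const (continuous_const.add (AddCircle.continuous_mk' 1))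

namespace Cactus
open ArcData

variable {n : ℕ} {C : Cactus n}

@[simp] theorem fam_len_zero : C.fam.len 0 = 1 / 2 := rfl

@[simp] theorem fam_len_succ (j : Fin n) : C.fam.len j.succ = C.len j / 2 := rfl

theorem mem_cuts {p : Fin (n + 1) × Circ} : p ∈ C.fam.cuts ↔ ¬ OnLeaf C.pos p := mem_cuts_ofPos

theorem shift_zero_coe (t z : ℝ) :
    shift t ((0 : Fin (n + 1)), (z : Circ)) = (0, ((z + t : ℝ) : Circ)) := by
  simp [shift]

theorem zero_ne_succ {j : Fin n} {w w' : Circ} : ((0 : Fin (n + 1)), w) ≠ (j.succ, w') := by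
  simp [Fin.ext_iff]

theorem continuous_pos_shift (p : Fin (n + 1) × Circ) : Continuous fun t : ℝ => C.pos (shift t p) := by
  obtain ⟨s, w⟩ := p
  refine continuous_pi fun i => ?_
  induction s using Fin.cases with
  | zero =>
    obtain ⟨z, rfl⟩ := exists_coe_circ w
    simp only [shift_zero_coe, pos_zero]
    exact (AddCircle.continuous_mk' 1).comp ((C.continuous_map i).comp (by fun_prop))
  | succ k =>
    simp only [shift, pos_succ]
    by_cases h : i = k
    · simp only [h, if_true]
      exact (continuous_const.add (AddCircle.continuous_mk' 1)).neg
    · simp only [h, if_false]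
      exact continuous_const

theorem tendsto_div_nhdsGT {a : ℝ} (ha : 0 < a) : Tendsto (fun t : ℝ => t / a) (𝓝[>] 0) (𝓝[>] 0) := by
  refine tendsto_nhdsWithin_iff.2 ⟨?_, ?_⟩
  · have : Tendsto (fun t : ℝ => t / a) (𝓝 0) (𝓝 (0 / a)) := (continuous_id.div_const a).tendsto 0
    rw [zero_div] at this
    exact this.mono_left nhdsWithin_le_nhds
  · filter_upwards [self_mem_nhdsWithin] with t ht
    exact div_pos ht ha

/-- Positions agree along the leaves that define `next`, and the position map is continuous along
the circles, so they agree in the limit. -/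
theorem next_pos {p q : Fin (n + 1) × Circ} (h : C.fam.next p q) : C.pos q = C.pos p := by
  have h1 : Tendsto (fun t : ℝ => C.pos (shift (t / C.fam.len p.1) p)) (𝓝[>] 0) (𝓝 (C.pos p)) := by
    have : Continuous fun t : ℝ => C.pos (shift (t / C.fam.len p.1) p) :=
      (continuous_pos_shift p).comp (by fun_prop)
    have := this.tendsto 0
    simp only [zero_div, shift_zero] at this
    exact this.mono_left nhdsWithin_le_nhds
  have h2 : Tendsto (fun t : ℝ => C.pos (shift (-(t / C.fam.len q.1)) q)) (𝓝[>] 0) (𝓝 (C.pos q)) := by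
    have : Continuous fun t : ℝ => C.pos (shift (-(t / C.fam.len q.1)) q) :=
      (continuous_pos_shift q).comp (by fun_prop)
    have := this.tendsto 0
    simp only [zero_div, neg_zero, shift_zero] at this
    exact this.mono_left nhdsWithin_le_nhds
  refine tendsto_nhds_unique_of_eventuallyEq h2 h1 ?_
  filter_upwards [h] with t ht
  exact fibreLeaf.pos_eq ht

theorem eventually_onLeaf (p : Fin (n + 1) × Circ) : ∀ᶠ t in 𝓝[>] (0:ℝ), OnLeaf C.pos (shift t p) := by
  filter_upwards [eventually_shift_notMem C.finite_cut p] with t ht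
  simpa using ht

theorem RightLobe.next {z : ℝ} {j : Fin n} (h : C.RightLobe z j) :
    C.fam.next (0, (z : Circ)) (j.succ, -(C.map j z : Circ)) := by
  have hl := C.len_pos j
  have h1 : ∀ᶠ s in 𝓝[>] (0:ℝ), fibreLeaf C.pos (shift s (0, (z : Circ)))
      (shift (-(s / C.len j)) (j.succ, -(C.map j z : Circ))) := by
    filter_upwards [h, eventually_onLeaf (C := C) (0, (z : Circ))] with s hs hs'
    refine fibreLeaf_of hs' ?_ ?_
    · have h2 := pos_succ_of (C := C) (z := z + s) (j := j)
        (fun i hi => by rw [hs.2 i hi]; exact h.map_eq_att hi)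
      rw [shift_zero_coe, ← h2, hs.1]
      simp [shift]; congr 2; abel
    · rw [shift_zero_coe]; exact zero_ne_succ.symm
  -- The circles have measures `1 / 2` and `len j / 2` in the family, so the transverse measure `t`
  -- is the time `t / (1 / 2)` of the loop.
  have h2 := (tendsto_div_nhdsGT (a := 1 / 2) (by norm_num)).eventually h1
  unfold ArcData.next
  filter_upwards [h2] with t ht
  simp only [fam_len_zero, fam_len_succ]
  have e : t / (C.len j / 2) = t / (1 / 2) / C.len j := by field_simp
  rw [e]
  exact ht

theorem LeftLobe.next {z : ℝ} {j : Fin n} (h : C.LeftLobe z j) :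
    C.fam.next (j.succ, -(C.map j z : Circ)) (0, (z : Circ)) := by
  have hl := C.len_pos j
  have h0 := (tendsto_div_nhdsGT hl).eventually (eventually_onLeaf (C := C) (j.succ, -(C.map j z : Circ)))
  have h1 : ∀ᶠ s in 𝓝[>] (0:ℝ), fibreLeaf C.pos (shift (s / C.len j) (j.succ, -(C.map j z : Circ)))
      (shift (-s) (0, (z : Circ))) := by
    filter_upwards [h, h0] with s hs hs'
    refine fibreLeaf_of hs' ?_ ?_
    · have h2 := pos_succ_of (C := C) (z := z - s) (j := j)
        (fun i hi => by rw [hs.2 i hi]; exact h.map_eq_att hi)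
      rw [shift_zero_coe, ← sub_eq_add_neg, ← h2, hs.1]
      simp [shift]; congr 2; abel
    · rw [shift_zero_coe]; exact zero_ne_succ
  have h2 := (tendsto_div_nhdsGT (a := 1 / 2) (by norm_num)).eventually h1
  unfold ArcData.next
  filter_upwards [h2] with t ht
  simp only [fam_len_zero, fam_len_succ]
  have e : t / (C.len j / 2) = t / (1 / 2) / C.len j := by field_simp
  rw [e]
  exact ht

theorem finite_fibre_Ico (p : Fin (n + 1) × Circ) (a : ℝ) :
    {z ∈ Ico a (a + 1) | C.pos (0, (z : Circ)) = C.pos p}.Finite := by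
  refine Set.Finite.of_finite_image (f := fun z : ℝ => ((0 : Fin (n + 1)), (z : Circ)))
    ((C.finite_fibre p).subset ?_) ?_
  · rintro _ ⟨z, hz, rfl⟩; exact hz.2
  · intro x hx y hy hxy
    exact circ_eq_of_lt (by simpa using hxy) (by linarith [hx.1.2, hy.1.1]) (by linarith [hy.1.2, hx.1.1])

/-- Consider the first time `x` that is not reached, and the circle `j` through which the loop
arrives at `x`. One turn of this circle earlier the loop was at the same position and moved into
`j`, so the two times are linked through the point of the `j`-th circle. The earlier time is not
before `z`, because then the coordinates at `z` and `x` would be congruent modulo 1 and differ by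
strictly between 0 and 1. -/
theorem eqvGen_zero_of_lobes {ρ : Fin (n + 1) × Circ → Fin (n + 1) × Circ → Prop} {z : ℝ}
    (hR : ∀ (x : ℝ) j, C.pos (0, (x : Circ)) = C.pos (0, (z : Circ)) → C.RightLobe x j →
      ρ (0, (x : Circ)) (j.succ, -(C.map j x : Circ)))
    (hL : ∀ (x : ℝ) j, C.pos (0, (x : Circ)) = C.pos (0, (z : Circ)) → C.LeftLobe x j →
      ρ (j.succ, -(C.map j x : Circ)) (0, (x : Circ)))
    {z' : ℝ} (h1 : z' ∈ Ico z (z + 1)) (h : C.pos (0, (z' : Circ)) = C.pos (0, (z : Circ))) :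
    Relation.EqvGen ρ (0, (z : Circ)) (0, (z' : Circ)) := by
  by_contra hbad
  set B := {x ∈ Ico z (z + 1) | C.pos (0, (x : Circ)) = C.pos (0, (z : Circ)) ∧
    ¬ Relation.EqvGen ρ (0, (z : Circ)) (0, (x : Circ))} with hB
  have hBf : B.Finite := (finite_fibre_Ico (0, (z : Circ)) z).subset fun x hx => ⟨hx.1, hx.2.1⟩
  obtain ⟨x, ⟨hx1, hx2, hx3⟩, hmin⟩ := Set.exists_min_image B id hBf ⟨z', h1, h, hbad⟩
  obtain ⟨j, hj⟩ := C.exists_leftLobe x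
  have hjx : ∀ i, i ≠ j → C.pos (0, (x : Circ)) i = C.att i j := fun i hi => by
    rw [pos_zero]; exact hj.map_eq_att hi
  have hcoe : ((C.map j x - 1 : ℝ) : Circ) = (C.map j x : Circ) :=
    circ_eq_iff.2 ⟨-1, by push_cast; ring⟩
  obtain ⟨y, hy1, hy2, hy3⟩ := C.exists_rightLobe_pos (p := (0, (x : Circ))) (j := j)
    (y := C.map j x - 1) hjx (by rw [pos_zero, hcoe])
  have hyx : Relation.EqvGen ρ (0, (y : Circ)) (0, (x : Circ)) := by
    refine (Relation.EqvGen.rel _ _ (hR y j (hy3.trans hx2) hy2)).trans _ _ _ (Relation.EqvGen.rel _ _ ?_)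
    rw [hy1, hcoe]
    exact hL x j hx2 hj
  have hylt : y < x := by
    by_contra hh; have := C.mono j (not_lt.1 hh); linarith
  by_cases hyz : z ≤ y
  · refine hx3 (Relation.EqvGen.trans _ (0, (y : Circ)) _ ?_ hyx)
    by_contra hc
    have := hmin y ⟨⟨hyz, hylt.trans hx1.2⟩, hy3.trans hx2, hc⟩
    simp only [id] at this
    linarith
  · push Not at hyz
    have hzx : z < x := by
      rcases hx1.1.eq_or_lt with h | h
      · exact absurd (by rw [h]; exact Relation.EqvGen.refl _) hx3
      · exact h
    have a1 := hy2.lt hyz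
    have a2 := hj.lt hzx
    have a3 := congrFun hx2 j
    simp only [pos_zero] at a3
    have := circ_eq_of_lt a3 (by linarith) (by linarith)
    linarith

/-- The points of a fibre are connected by the moves of the loop. -/
theorem eqvGen_of_lobes {ρ : Fin (n + 1) × Circ → Fin (n + 1) × Circ → Prop} {p q : Fin (n + 1) × Circ}
    (hR : ∀ (x : ℝ) j, C.pos (0, (x : Circ)) = C.pos p → C.RightLobe x j →
      ρ (0, (x : Circ)) (j.succ, -(C.map j x : Circ)))
    (hL : ∀ (x : ℝ) j, C.pos (0, (x : Circ)) = C.pos p → C.LeftLobe x j →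
      ρ (j.succ, -(C.map j x : Circ)) (0, (x : Circ)))
    (h : C.pos q = C.pos p) : Relation.EqvGen ρ p q := by
  have key : ∀ p' : Fin (n + 1) × Circ, C.pos p' = C.pos p → ∃ z : ℝ, C.pos (0, (z : Circ)) = C.pos p ∧
      Relation.EqvGen ρ (0, (z : Circ)) p' := by
    rintro ⟨s, w⟩ hp
    induction s using Fin.cases with
    | zero => obtain ⟨z, rfl⟩ := exists_coe_circ w; exact ⟨z, hp, Relation.EqvGen.refl _⟩
    | succ j =>
      obtain ⟨y, hy⟩ := exists_coe_circ (-w)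
      obtain ⟨z, h1, h2, h3⟩ := C.exists_rightLobe_pos (p := (j.succ, w)) (j := j) (y := y)
        (fun i hi => C.pos_succ_ne hi w) (by rw [hy, pos_succ_self])
      refine ⟨z, h3.trans hp, Relation.EqvGen.rel _ _ ?_⟩
      have := hR z j (h3.trans hp) h2
      rwa [h1, hy, neg_neg] at this
  obtain ⟨z, hz, hz'⟩ := key p rfl
  obtain ⟨y, hy, hy'⟩ := key q h
  obtain ⟨y', h1, h2⟩ := exists_coe_circ_Ico (y : Circ) z
  refine (hz'.symm _ _).trans _ _ _ (Relation.EqvGen.trans _ _ _ ?_ hy')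
  rw [← h2]
  exact eqvGen_zero_of_lobes (fun x j hx => hR x j (hx.trans hz)) (fun x j hx => hL x j (hx.trans hz)) h1
    (by rw [h2, hy, hz])

theorem eqvGen_next {p q : Fin (n + 1) × Circ} (h : C.pos q = C.pos p) : Relation.EqvGen C.fam.next p q :=
  eqvGen_of_lobes (fun _ _ _ h => h.next) (fun _ _ _ h => h.next) h

theorem eqvGen_next_iff {p q : Fin (n + 1) × Circ} :
    Relation.EqvGen C.fam.next p q ↔ C.pos q = C.pos p := by
  refine ⟨fun h => ?_, eqvGen_next⟩
  induction h with
  | rel _ _ h => exact next_pos h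
  | refl => rfl
  | symm _ _ _ h => exact h.symm
  | trans _ _ _ _ _ h1 h2 => exact h2.trans h1

/-- The circles before and after `z` both contribute an inner point to the fibre; as there is only
one, they coincide. -/
theorem fibreLeaf_zero_succ {z : ℝ} {q : Fin (n + 1) × Circ} (h : fibreLeaf C.pos (0, (z : Circ)) q) :
    ∃ j, C.RightLobe z j ∧ C.LeftLobe z j ∧ q = (j.succ, -(C.map j z : Circ)) := by
  obtain ⟨j, hj⟩ := C.exists_rightLobe z
  obtain ⟨k, hk⟩ := C.exists_leftLobe z
  have h1 := (h.eq_or hj.pos_eq).resolve_left zero_ne_succ.symm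
  have h2 := (h.eq_or hk.pos_eq).resolve_left zero_ne_succ.symm
  obtain rfl : k = j := by
    have := h2.trans h1.symm
    simp only [Prod.mk.injEq, Fin.succ_inj] at this
    exact this.1
  exact ⟨k, hj, hk, h1.symm⟩

theorem fibreLeaf_fst {p q : Fin (n + 1) × Circ} (h : fibreLeaf C.pos p q) (hp : p.1 = 0) : q.1 ≠ 0 := by
  obtain ⟨s, w⟩ := p
  obtain rfl : s = 0 := hp
  obtain ⟨z, rfl⟩ := exists_coe_circ w
  obtain ⟨j, -, -, rfl⟩ := fibreLeaf_zero_succ h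
  simp

theorem fibreLeaf_fst' {p q : Fin (n + 1) × Circ} (h : fibreLeaf C.pos p q) (hp : p.1 ≠ 0) : q.1 = 0 := by
  obtain ⟨z, hz⟩ := C.exists_zero_pos p
  rcases h.eq_or hz with rfl | rfl
  · simp at hp
  · rfl

theorem leaf_local_zero {z : ℝ} {q : Fin (n + 1) × Circ} (h : fibreLeaf C.pos (0, (z : Circ)) q) :
    ∀ᶠ t in 𝓝 (0 : ℝ), fibreLeaf C.pos (shift (t / C.fam.len 0) (0, (z : Circ)))
      (shift (-(t / C.fam.len q.1)) q) := by
  obtain ⟨j, hr, hl, rfl⟩ := fibreLeaf_zero_succ h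
  have hlen := C.len_pos j
  have h1 : ∀ᶠ t in 𝓝 (0 : ℝ), C.map j (z + t) = C.map j z + t / C.len j ∧
      ∀ i, i ≠ j → C.map i (z + t) = C.map i z := by
    obtain ⟨ε, hε, he⟩ := mem_nhdsGT_iff_exists_Ioo_subset.1 hr
    obtain ⟨ε', hε', he'⟩ := mem_nhdsGT_iff_exists_Ioo_subset.1 hl
    filter_upwards [Ioo_mem_nhds (show -ε' < (0:ℝ) by simpa using hε') (show (0:ℝ) < ε from hε)] with t ht
    rcases lt_trichotomy t 0 with h0 | rfl | h0
    · have := he' (show -t ∈ Ioo 0 ε' from ⟨by linarith, by linarith [ht.1]⟩)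
      simp only [mem_ofPred_eq, sub_neg_eq_add] at this
      exact ⟨by rw [this.1]; ring, this.2⟩
    · simp
    · exact he ⟨h0, ht.2⟩
  have h2 : ∀ᶠ t in 𝓝 (0 : ℝ), OnLeaf C.pos (shift t (0, (z : Circ))) := by
    have hc : IsOpen {p | ¬ OnLeaf C.pos p}ᶜ := C.finite_cut.isClosed.isOpen_compl
    have := (continuous_shift ((0 : Fin (n + 1)), (z : Circ))).tendsto 0
    rw [shift_zero] at this
    have h3 := this.eventually (hc.mem_nhds (by simpa using ⟨_, h⟩))
    filter_upwards [h3] with t ht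
    simpa using ht
  have h3 : ∀ᶠ s in 𝓝 (0:ℝ), fibreLeaf C.pos (shift s (0, (z : Circ)))
      (shift (-(s / C.len j)) (j.succ, -(C.map j z : Circ))) := by
    filter_upwards [h1, h2] with s hs hs'
    refine fibreLeaf_of hs' ?_ ?_
    · have h2 := pos_succ_of (C := C) (z := z + s) (j := j)
        (fun i hi => by rw [hs.2 i hi]; exact hr.map_eq_att hi)
      rw [shift_zero_coe, ← h2, hs.1]
      simp [shift]; congr 2; abel
    · rw [shift_zero_coe]; exact zero_ne_succ.symm
  have h4 : Tendsto (fun t : ℝ => t / (1 / 2)) (𝓝 0) (𝓝 0) := by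
    have : Tendsto (fun t : ℝ => t / (1 / 2)) (𝓝 0) (𝓝 (0 / (1 / 2))) := (continuous_id.div_const _).tendsto 0
    rwa [zero_div] at this
  filter_upwards [h4.eventually h3] with t ht
  simp only [fam_len_zero, fam_len_succ]
  have e : t / (C.len j / 2) = t / (1 / 2) / C.len j := by field_simp
  rw [e]
  exact ht

variable (C)

theorem finite_fibre_circle (p : Fin (n + 1) × Circ) : {w : Circ | C.pos (0, w) = C.pos p}.Finite :=
  (C.finite_fibre p).preimage (f := fun w => ((0 : Fin (n + 1)), w)) (fun _ _ _ _ h => by simpa using h)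

theorem isArcFamily : C.fam.IsArcFamily where
  len_pos i := by
    induction i using Fin.cases with
    | zero => simp
    | succ j => have := C.len_pos j; simp [this]
  len_sum := by
    rw [Fin.sum_univ_succ]
    simp only [fam_len_zero, fam_len_succ]
    rw [← Finset.sum_div, C.len_sum]; norm_num
  cuts_finite := by
    have : C.fam.cuts = {p | ¬ OnLeaf C.pos p} := by ext p; exact mem_cuts
    rw [this]; exact C.finite_cut
  regions_nonempty := by
    rintro _ ⟨p, rfl, -⟩; exact ⟨p, self_mem_fibre⟩
  regions_disjoint := by
    intro R hR R' hR' p hp hp'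
    rw [(mem_region_ofPos hR hp).1, (mem_region_ofPos hR' hp').1]
  base_mem i := mem_cuts.2 fun ⟨q, hq⟩ => hq.2.2.1 rfl
  leafPts_eq p := by rw [mem_cuts, not_not]; rfl
  leaf_symm p q h := fibreLeaf.symm h
  leaf_unique p q q' h h' := by
    rcases fibreLeaf.eq_or h (fibreLeaf.pos_eq h') with e | e
    · exact absurd e.symm (fibreLeaf.symm h').1.symm
    · exact e.symm
  leaf_ne p h := h.1 rfl
  leaf_local := by
    intro p q h
    by_cases hp : p.1 = 0
    · obtain ⟨s, w⟩ := p
      obtain rfl : s = 0 := hp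
      obtain ⟨z, rfl⟩ := exists_coe_circ w
      exact leaf_local_zero h
    · have hq := fibreLeaf_fst' h hp
      obtain ⟨s, w⟩ := q
      obtain rfl : s = 0 := hq
      obtain ⟨z, rfl⟩ := exists_coe_circ w
      have h1 := leaf_local_zero (fibreLeaf.symm h)
      have h2 : Tendsto (fun t : ℝ => -t) (𝓝 0) (𝓝 0) := by
        simpa using (continuous_neg (G := ℝ)).tendsto 0
      filter_upwards [h2.eventually h1] with t ht
      have := ht.symm
      simp only [neg_div, neg_neg] at this
      exact this
  next_mem := by
    intro R hR p hp q hq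
    rw [(mem_region_ofPos hR hp).1]
    exact next_pos hq
  chi_eq := by
    intro R hR
    -- The moves of the loop link all points of a fibre, so each region has one boundary cycle and
    -- is a disc.
    have hB : C.fam.boundaryCycles R = {R} := by
      ext B
      constructor
      · rintro ⟨p, hp, rfl⟩
        rw [mem_singleton_iff, (mem_region_ofPos hR hp).1]
        ext q; exact eqvGen_next_iff
      · intro hB
        obtain ⟨p, rfl, hp⟩ := id hR
        refine ⟨p, self_mem_fibre, ?_⟩
        rw [show B = fibre C.pos p from hB]
        ext q; exact eqvGen_next_iff.symm
    refine ⟨0, ?_⟩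
    rw [hB, Set.ncard_singleton, show C.fam.chi R = 1 from Set.indicator_of_mem hR 1]
    simp [fam, ofPos]
  connected := by
    have key : ∀ i : Fin (n + 1), ∃ R ∈ C.fam.regions, ∃ p ∈ R, ∃ q ∈ R, p.1 = i ∧ q.1 = 0 := by
      intro i
      obtain ⟨z, hz⟩ := C.exists_zero_pos (i, 0)
      exact ⟨fibre C.pos (i, 0), ⟨_, rfl, fun ⟨q, hq⟩ => hq.2.2.1 rfl⟩, (i, 0), self_mem_fibre,
        (0, (z : Circ)), hz, rfl, rfl⟩
    intro i j
    refine (Relation.ReflTransGen.single (b := 0) (key i)).tail ?_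
    obtain ⟨R, hR, p, hp, q, hq, h1, h2⟩ := key j
    exact ⟨R, hR, q, hq, p, hp, h2, h1⟩
  essential := by
    rintro _ ⟨p, rfl, -⟩ -
    rw [C.ncard_fibre]
    have : 0 < {w : Circ | C.pos (0, w) = C.pos p}.ncard := by
      rw [Set.ncard_pos (C.finite_fibre_circle p)]
      obtain ⟨z, hz⟩ := C.exists_zero_pos p
      exact ⟨_, hz⟩
    omega
  not_parallel := by
    rintro _ ⟨p, rfl, hp⟩ - hb
    have h1 : 0 < (fibre C.pos p).ncard := by
      rw [Set.ncard_pos (C.finite_fibre p)]; exact ⟨p, self_mem_fibre⟩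
    -- The number of points of a fibre is even. Fewer than three therefore means two, and two points
    -- without base points form a leaf.
    by_contra h2
    refine hp (onLeaf_of_ncard ?_ hb)
    have := C.ncard_fibre p
    omega
  chi_support R hR := Set.indicator_of_notMem hR 1
  pun_support R hR := rfl

/-- The fibre of a leaf has one point on `∂₀`. It does not contain the start of the loop, which is a
base point, so the count in `ncard_fibre_zero_eq` leaves no room for a root. -/
theorem not_onLeaf_root (j : Fin n) : ¬ OnLeaf C.pos (C.root j) := by
  classical
  rintro ⟨q, hq⟩
  have h2 := C.ncard_fibre_zero_eq (C.root j)
  have h3 := C.ncard_fibre (C.root j)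
  rw [hq.2.1, Set.ncard_pair hq.1] at h3
  have h4 : C.pos (0, 0) ≠ C.pos (C.root j) := by
    intro h
    rcases hq.eq_or h with e | e
    · exact hq.2.2.1 (by rw [← e])
    · exact hq.2.2.2 (by rw [← e])
  rw [if_neg h4] at h2
  have h5 : 0 < {k : Fin n | C.pos (C.root k) = C.pos (C.root j)}.ncard := by
    rw [Set.ncard_pos (toFinite _)]; exact ⟨j, rfl⟩
  omega

open Classical in
/-- The number of cut points in a union of fibres. -/
theorem ncard_cuts_inter {Y : Set (Fin (n + 1) × Circ)} (hY : ∀ p q, C.pos p = C.pos q → (p ∈ Y ↔ q ∈ Y)) :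
    ((C.fam.cuts ∩ Y).ncard : ℤ) = 2 * ({j | C.root j ∈ Y}.ncard + {R ∈ C.fam.regions | R ⊆ Y}.ncard
      - if (0, 0) ∈ Y then 1 else 0) := by
  have hf : (C.fam.cuts ∩ Y).Finite := C.isArcFamily.cuts_finite.subset inter_subset_left
  have hreg : {R ∈ C.fam.regions | R ⊆ Y} = fibre C.pos '' (C.fam.cuts ∩ Y) := by
    ext R; constructor
    · rintro ⟨⟨p, rfl, hp⟩, h⟩; exact ⟨p, ⟨mem_cuts.2 hp, h self_mem_fibre⟩, rfl⟩
    · rintro ⟨p, hp, rfl⟩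
      exact ⟨⟨p, rfl, mem_cuts.1 hp.1⟩, fun q hq => (hY q p hq).2 hp.2⟩
  set s := hf.toFinset with hs
  have hmem : ∀ p, p ∈ s ↔ ¬ OnLeaf C.pos p ∧ p ∈ Y := fun p => by
    rw [hs, Set.Finite.mem_toFinset, mem_inter_iff, mem_cuts]
  set t := s.image (fibre C.pos) with ht
  have hrt : {R ∈ C.fam.regions | R ⊆ Y}.ncard = t.card := by
    rw [hreg, ht, ← Set.ncard_coe_finset, Finset.coe_image, hs, Set.Finite.coe_toFinset]
  have hct : (C.fam.cuts ∩ Y).ncard = s.card := by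
    rw [hs, ← Set.ncard_coe_finset, Set.Finite.coe_toFinset]
  -- Size of a single region: twice the number of its roots, plus 2 unless it contains the start of
  -- the loop. The formula follows by summation, as each root and the start lie in exactly one
  -- region.
  have hone : ∀ R ∈ t, R.ncard = 2 * ((Finset.univ.filter fun j => fibre C.pos (C.root j) = R).card +
      if ((0 : Fin (n + 1)), (0 : Circ)) ∈ R then 0 else 1) := by
    intro R hR
    obtain ⟨p, hp, rfl⟩ := Finset.mem_image.1 hR
    rw [C.ncard_fibre, C.ncard_fibre_zero_eq]
    congr 2
    · rw [← Set.ncard_coe_finset]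
      congr 1
      ext j
      simp only [mem_ofPred_eq, Finset.coe_filter, Finset.mem_univ, true_and]
      exact ⟨fun h => fibre_congr h, fun h => by rw [← mem_fibre, ← h]; exact self_mem_fibre⟩
    · exact if_congr Iff.rfl rfl rfl
  have h1 : s.card = ∑ R ∈ t, R.ncard := by
    rw [Finset.card_eq_sum_card_image (fibre C.pos) s]
    refine Finset.sum_congr rfl fun R hR => ?_
    obtain ⟨p, hp, rfl⟩ := Finset.mem_image.1 hR
    rw [← Set.ncard_coe_finset]
    congr 1
    ext q
    simp only [Finset.coe_filter, mem_ofPred_eq, hmem]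
    constructor
    · rintro ⟨-, h⟩; rw [← h]; exact self_mem_fibre
    · intro h
      exact ⟨⟨fun hl => ((hmem p).1 hp).1 (hl.congr (mem_fibre.1 h).symm), (hY _ _ h).2 ((hmem p).1 hp).2⟩,
        fibre_congr h⟩
  have h2 : {j | C.root j ∈ Y}.ncard = ∑ R ∈ t, (Finset.univ.filter fun j => fibre C.pos (C.root j) = R).card := by
    have e : {j | C.root j ∈ Y}.ncard = (Finset.univ.filter fun j => C.root j ∈ Y).card := by
      rw [← Set.ncard_coe_finset]; congr 1; ext j; simp
    rw [e, Finset.card_eq_sum_card_fiberwise (f := fun j => fibre C.pos (C.root j)) (t := t)]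
    · refine Finset.sum_congr rfl fun R hR => ?_
      congr 1
      ext j
      simp only [Finset.mem_filter, Finset.mem_univ, true_and, and_iff_right_iff_imp]
      rintro rfl
      obtain ⟨p, hp, h⟩ := Finset.mem_image.1 hR
      exact (hY p _ (mem_fibre.1 (h ▸ self_mem_fibre))).1 ((hmem p).1 hp).2
    · intro j hj
      simp only [Finset.coe_filter, Finset.mem_univ, true_and, mem_ofPred_eq] at hj
      exact Finset.mem_image_of_mem _ ((hmem _).2 ⟨C.not_onLeaf_root j, hj⟩)
  have h3 : ∑ R ∈ t, (if ((0 : Fin (n + 1)), (0 : Circ)) ∈ R then 0 else 1) +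
      (if ((0 : Fin (n + 1)), (0 : Circ)) ∈ Y then 1 else 0) = t.card := by
    have : ∑ R ∈ t, (if ((0 : Fin (n + 1)), (0 : Circ)) ∈ R then 1 else 0) =
        if ((0 : Fin (n + 1)), (0 : Circ)) ∈ Y then 1 else 0 := by
      split_ifs with h0
      · rw [Finset.sum_eq_single (fibre C.pos (0, 0))]
        · rw [if_pos self_mem_fibre]
        · intro R hR hne
          obtain ⟨p, hp, rfl⟩ := Finset.mem_image.1 hR
          exact if_neg fun h => hne (fibre_congr h).symm
        · intro h
          exact absurd (Finset.mem_image_of_mem _ ((hmem _).2 ⟨fun ⟨q, hq⟩ => hq.2.2.1 rfl, h0⟩)) h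
      · refine Finset.sum_eq_zero fun R hR => ?_
        obtain ⟨p, hp, rfl⟩ := Finset.mem_image.1 hR
        exact if_neg fun h => h0 ((hY _ _ h).2 ((hmem p).1 hp).2)
    have h4 : t.card = ∑ R ∈ t, ((if ((0 : Fin (n + 1)), (0 : Circ)) ∈ R then 0 else 1) +
        if ((0 : Fin (n + 1)), (0 : Circ)) ∈ R then 1 else 0) := by
      rw [Finset.card_eq_sum_ones]
      refine Finset.sum_congr rfl fun R _ => ?_
      split_ifs <;> rfl
    rw [h4, Finset.sum_add_distrib, this]
  rw [Finset.sum_congr rfl hone, ← Finset.mul_sum, Finset.sum_add_distrib, ← h2] at h1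
  rw [hct, hrt]
  split_ifs at h3 ⊢ <;> omega

theorem ncard_cuts : (C.fam.cuts.ncard : ℤ) = 2 * (n + C.fam.regions.ncard - 1) := by
  classical
  have h := C.ncard_cuts_inter (Y := univ) (fun _ _ _ => by simp)
  simpa [Set.ncard_univ] using h

/-- Twice the number of discs minus the number of cut points is `2 * (1 - n)`, twice the Euler
characteristic of a sphere with `n + 1` holes. -/
theorem fam_mem : C.fam ∈ ARCcp n := by
  refine ⟨C.isArcFamily, ?_, ?_⟩
  · simp [fam, ofPos]
  · have h := C.ncard_cuts
    rw [show C.fam = ofPos _ _ from rfl] at h ⊢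
    rw [finsum_chi_ofPos subset_rfl, h]
    push_cast
    ring

end Cactus

/-! ## Relabelling and gluing of cacti -/

namespace ArcData

section Reindex

variable {ι ι' Q Q' : Type} {pos : ι × Circ → Q} {pos' : ι' × Circ → Q'}
  {e : ι × Circ → ι' × Circ} (he : Function.Bijective e) (h2 : ∀ p, (e p).2 = p.2)
  (hpos : ∀ p q, pos p = pos q ↔ pos' (e p) = pos' (e q))
include he hpos

theorem image_fibre (p : ι × Circ) : e '' fibre pos p = fibre pos' (e p) := by
  ext q
  obtain ⟨q, rfl⟩ := he.2 q
  rw [he.1.mem_set_image, mem_fibre, mem_fibre, hpos]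

include h2

theorem fibreLeaf_map {p q : ι × Circ} : fibreLeaf pos' (e p) (e q) ↔ fibreLeaf pos p q := by
  unfold fibreLeaf
  rw [he.1.ne_iff, h2, h2, ← image_fibre he hpos, ← image_pair, he.1.image_injective.eq_iff]

theorem onLeaf_map {p : ι × Circ} : OnLeaf pos' (e p) ↔ OnLeaf pos p := by
  constructor
  · rintro ⟨q, hq⟩
    obtain ⟨q, rfl⟩ := he.2 q
    exact ⟨q, (fibreLeaf_map he h2 hpos).1 hq⟩
  · rintro ⟨q, hq⟩
    exact ⟨e q, (fibreLeaf_map he h2 hpos).2 hq⟩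

theorem image_mem_regions {R : Set (ι × Circ)} :
    (∃ p, e '' R = fibre pos' p ∧ ¬ OnLeaf pos' p) ↔ ∃ p, R = fibre pos p ∧ ¬ OnLeaf pos p := by
  constructor
  · rintro ⟨q, h3, h4⟩
    obtain ⟨p, rfl⟩ := he.2 q
    rw [← image_fibre he hpos, he.1.image_injective.eq_iff] at h3
    exact ⟨p, h3, fun h => h4 ((onLeaf_map he h2 hpos).2 h)⟩
  · rintro ⟨p, rfl, h4⟩
    exact ⟨e p, image_fibre he hpos p, fun h => h4 ((onLeaf_map he h2 hpos).1 h)⟩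

end Reindex

end ArcData

namespace Cactus
open ArcData

variable {n m : ℕ}

theorem att_congr {C D : Cactus n} (h : ∀ i z, (C.map i z : Circ) = D.map i z) {i j : Fin n} (hij : i ≠ j) :
    C.att i j = D.att i j := by
  refine att_unique (fun i j hij z => ?_) hij
  rw [h, h]
  exact D.att_spec hij z

theorem pos_congr {C D : Cactus n} (h : ∀ i z, (C.map i z : Circ) = D.map i z) : C.pos = D.pos := by
  funext ⟨s, w⟩ i
  induction s using Fin.cases with
  | zero =>
    obtain ⟨z, rfl⟩ := exists_coe_circ w
    simp [pos_zero, h]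
  | succ k =>
    by_cases hi : i = k
    · simp [pos_succ, hi]
    · simp [pos_succ, hi, att_congr h hi]

/-- Only the classes of the coordinates modulo 1 matter. The points of attachment were chosen, but
by `att_unique` they are determined by these classes. -/
theorem fam_congr {C D : Cactus n} (hl : ∀ i, C.len i = D.len i)
    (h : ∀ i z, (C.map i z : Circ) = D.map i z) : C.fam = D.fam := by
  unfold fam
  rw [pos_congr h, funext hl]

/-- Rotation of the base points of the loop and of the circles. -/
def rotate (C : Cactus n) (x : ℝ) (y : Fin n → ℝ) : Cactus n where
  len := C.len
  map i z := C.map i (z + x) + y i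
  len_pos := C.len_pos
  len_sum := C.len_sum
  mono i z z' h := by
    have := C.mono i (show z + x ≤ z' + x by linarith)
    linarith
  map_add_one i z := by rw [add_right_comm z 1 x, C.map_add_one]; ring
  sum_map z := by
    have := C.sum_sub (0 + x) (z + x)
    rw [show z + x - (0 + x) = z by ring] at this
    refine (Finset.sum_congr rfl fun i _ => ?_).trans this
    ring
  wedge := ⟨fun i j => C.att i j + (y i : Circ), fun i j hij z => by
    rw [AddCircle.coe_add, AddCircle.coe_add, add_left_inj, add_left_inj]
    exact C.att_spec hij _⟩

/-- Permutation of the labels. -/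
def perm (σ : Equiv.Perm (Fin n)) (C : Cactus n) : Cactus n where
  len i := C.len (σ.symm i)
  map i := C.map (σ.symm i)
  len_pos i := C.len_pos _
  len_sum := by rw [Equiv.sum_comp σ.symm C.len, C.len_sum]
  mono i := C.mono _
  map_add_one i := C.map_add_one _
  sum_map z := by
    rw [Equiv.sum_comp σ.symm fun i => C.len i * (C.map i z - C.map i 0), C.sum_map]
  wedge := ⟨fun i j => C.att (σ.symm i) (σ.symm j), fun i j hij z =>
    C.att_spec (fun h => hij (σ.symm.injective h)) z⟩

/-- Relabelling acts simultaneously on the boundary circles and on the coordinates of the torus;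
hence it is a bijection of the boundary points which respects fibres and base points. -/
theorem permFam_fam (σ : Equiv.Perm (Fin n)) (C : Cactus n) : permFam σ C.fam = (C.perm σ).fam := by
  set e : Fin (n + 1) × Circ → Fin (n + 1) × Circ := fun p => (oldLabel σ p.1, p.2) with he
  have hpos : ∀ p, (C.perm σ).pos p = C.pos (e p) ∘ σ.symm := by
    rintro ⟨s, w⟩
    funext i
    induction s using Fin.cases with
    | zero =>
      obtain ⟨z, rfl⟩ := exists_coe_circ w
      simp [he, oldLabel, pos_zero, perm]
    | succ k =>
      by_cases hi : i = k
      · simp [he, oldLabel, pos_succ, hi]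
      · have h1 : (C.perm σ).att i k = C.att (σ.symm i) (σ.symm k) :=
          att_unique (c := fun i j => C.att (σ.symm i) (σ.symm j))
            (fun i j hij z => C.att_spec (fun h => hij (σ.symm.injective h)) z) hi
        simp [he, oldLabel, pos_succ, hi, h1]
  have hbij : Function.Bijective e := by
    have hb : Function.Bijective (oldLabel σ) := by
      rw [Finite.injective_iff_bijective.symm]
      intro a b h
      induction a using Fin.cases with
      | zero =>
        induction b using Fin.cases with
        | zero => rfl
        | succ b => exact absurd h.symm (Fin.succ_ne_zero _)
      | succ a =>
        induction b using Fin.cases with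
        | zero => exact absurd h (Fin.succ_ne_zero _)
        | succ b => exact congrArg Fin.succ (σ.symm.injective (Fin.succ_injective _ h))
    exact Function.Bijective.prodMap hb Function.bijective_id
  have hiff : ∀ p q, (C.perm σ).pos p = (C.perm σ).pos q ↔ C.pos (e p) = C.pos (e q) := by
    intro p q
    rw [hpos, hpos]
    exact ⟨fun h => σ.symm.surjective.injective_comp_right h, fun h => by rw [h]⟩
  have hreg : (permFam σ C.fam).regions = (C.perm σ).fam.regions := by
    ext R
    exact image_mem_regions hbij (fun _ => rfl) hiff
  refine ArcData.ext ?_ ?_ hreg ?_ rfl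
  · funext k
    induction k using Fin.cases with
    | zero => rfl
    | succ k => rfl
  · funext p q
    exact propext (fibreLeaf_map hbij (fun _ => rfl) hiff)
  · funext R
    have h1 : e '' R ∈ C.fam.regions ↔ R ∈ (C.perm σ).fam.regions := image_mem_regions hbij (fun _ => rfl) hiff
    by_cases hR : R ∈ (C.perm σ).fam.regions
    · exact (Set.indicator_of_mem (h1.2 hR) 1).trans (Set.indicator_of_mem hR 1).symm
    · exact (Set.indicator_of_notMem (fun h => hR (h1.1 h)) 1).trans (Set.indicator_of_notMem hR 1).symm

/-- The label of the first or of the second surface which becomes the label `k` of the surface glued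
along the circle `i` of the first one. -/
def oldIndex (i : Fin (m + 1)) (k : Fin (m + n)) : Fin (m + 1) ⊕ Fin n :=
  if h : k.1 < i.1 then Sum.inl ⟨k.1, by omega⟩
  else if h' : k.1 < i.1 + n then Sum.inr ⟨k.1 - i.1, by omega⟩
  else Sum.inl ⟨k.1 - n + 1, by omega⟩

theorem outer_succ (i : Fin (m + 1)) (k : Fin (m + n)) :
    outer i k.succ = Sum.map Fin.succ Fin.succ (oldIndex i k) := by
  unfold outer oldIndex
  simp only [Fin.val_succ]
  by_cases h : k.1 < i.1
  · rw [dif_pos h, dif_pos (by omega)]; rfl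
  · rw [dif_neg h, dif_neg (by omega)]
    by_cases h' : k.1 < i.1 + n
    · rw [dif_pos h', dif_pos (by omega)]
      simp only [Sum.map_inr, Sum.inr.injEq, Fin.ext_iff, Fin.val_succ]
      omega
    · rw [dif_neg h', dif_neg (by omega)]
      simp only [Sum.map_inl, Sum.inl.injEq, Fin.ext_iff, Fin.val_succ]
      omega

theorem outer_zero (i : Fin (m + 1)) : outer (n := n) i 0 = Sum.inl 0 := by
  unfold outer
  rw [dif_pos (by simp)]; rfl

theorem oldIndex_injective (i : Fin (m + 1)) : Function.Injective (oldIndex (n := n) i) := by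
  intro k k' h
  unfold oldIndex at h
  split_ifs at h <;> simp [Fin.ext_iff] at h ⊢ <;> omega

theorem oldIndex_ne (i : Fin (m + 1)) (k : Fin (m + n)) : oldIndex i k ≠ Sum.inl i := by
  unfold oldIndex
  split_ifs <;> simp [Fin.ext_iff] <;> omega

theorem exists_oldIndex (i : Fin (m + 1)) {s : Fin (m + 1) ⊕ Fin n} (hs : s ≠ Sum.inl i) :
    ∃ k, oldIndex i k = s := by
  rcases s with a | j
  · have ha : a.1 ≠ i.1 := fun h => hs (by rw [Fin.ext h])
    rcases lt_or_gt_of_ne ha with h | h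
    · refine ⟨⟨a.1, by omega⟩, ?_⟩
      unfold oldIndex; rw [dif_pos h]
    · refine ⟨⟨a.1 + n - 1, by omega⟩, ?_⟩
      unfold oldIndex
      rw [dif_neg (by simp only; omega), dif_neg (by simp only; omega)]
      simp only [Sum.inl.injEq, Fin.ext_iff]; omega
  · refine ⟨⟨i.1 + j.1, by omega⟩, ?_⟩
    unfold oldIndex
    rw [dif_neg (by simp), dif_pos (by simp)]
    simp

theorem sum_oldIndex (i : Fin (m + 1)) (f : Fin (m + 1) ⊕ Fin n → ℝ) :
    ∑ k, f (oldIndex i k) = ∑ a, f (Sum.inl a) - f (Sum.inl i) + ∑ j, f (Sum.inr j) := by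
  classical
  have h1 : (Finset.univ : Finset (Fin (m + 1) ⊕ Fin n)) =
      insert (Sum.inl i) (Finset.univ.image (oldIndex i)) := by
    ext s
    simp only [Finset.mem_univ, Finset.mem_insert, Finset.mem_image, true_and, true_iff]
    by_cases hs : s = Sum.inl i
    · exact Or.inl hs
    · exact Or.inr (exists_oldIndex i hs)
  have h2 : ∑ s, f s = f (Sum.inl i) + ∑ k, f (oldIndex i k) := by
    rw [h1, Finset.sum_insert, Finset.sum_image (fun _ _ _ _ h => oldIndex_injective i h)]
    simp only [Finset.mem_image, Finset.mem_univ, true_and, not_exists]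
    exact oldIndex_ne i
  rw [Fintype.sum_sum_type] at h2
  linarith

/-- The circle from which another one branches off, after gluing. -/
def compAtt (C : Cactus (m + 1)) (i : Fin (m + 1)) (D : Cactus n) (s s' : Fin (m + 1) ⊕ Fin n) : Circ :=
  Sum.elim (fun a => Sum.elim (fun b => C.att a b) (fun _ => C.att a i) s')
    (fun j => Sum.elim (fun b => D.circ j (C.att i b)) (fun j' => D.att j j') s') s

/-- The mixed case is the new one: either the circle `a` of `C` is at its branch point towards `i`,
or the coordinate in the circle `i` rests at `att i a`, and then the circles of `D` rest at the
coordinates of that point. -/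
theorem compAtt_spec (C : Cactus (m + 1)) {i : Fin (m + 1)} (D : Cactus n) {s s' : Fin (m + 1) ⊕ Fin n}
    (hne : s ≠ s') (h1 : s ≠ Sum.inl i) (h2 : s' ≠ Sum.inl i) (z : ℝ) :
    ((Sum.elim (fun a => C.map a z) (fun j => D.map j (C.map i z)) s : ℝ) : Circ) = compAtt C i D s s' ∨
      ((Sum.elim (fun a => C.map a z) (fun j => D.map j (C.map i z)) s' : ℝ) : Circ) = compAtt C i D s' s := by
  unfold compAtt
  rcases s with a | j <;> rcases s' with a' | j'
  · exact C.att_spec (fun h => hne (by rw [h])) z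
  · rcases C.att_spec (show a ≠ i from fun h => h1 (by rw [h])) z with h | h
    · exact Or.inl h
    · refine Or.inr ?_
      simp only [Sum.elim_inr, Sum.elim_inl]
      rw [← h, circ_coe]
  · rcases C.att_spec (show a' ≠ i from fun h => h2 (by rw [h])) z with h | h
    · exact Or.inr h
    · refine Or.inl ?_
      simp only [Sum.elim_inr, Sum.elim_inl]
      rw [← h, circ_coe]
  · exact D.att_spec (fun h => hne (by rw [h])) _

/-- The cactus in which the circle `i` of `C` has been replaced by `D`. -/
def comp (C : Cactus (m + 1)) (i : Fin (m + 1)) (D : Cactus n) : Cactus (m + n) where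
  len k := Sum.elim C.len (fun j => C.len i * D.len j) (oldIndex i k)
  map k z := Sum.elim (fun a => C.map a z) (fun j => D.map j (C.map i z)) (oldIndex i k)
  len_pos k := by
    rcases oldIndex i k with a | j
    · exact C.len_pos a
    · exact mul_pos (C.len_pos i) (D.len_pos j)
  len_sum := by
    rw [sum_oldIndex i (Sum.elim C.len fun j => C.len i * D.len j)]
    simp only [Sum.elim_inl, Sum.elim_inr]
    rw [← Finset.mul_sum, C.len_sum, D.len_sum]; ring
  mono k z z' h := by
    rcases oldIndex i k with a | j
    · exact C.mono a h
    · exact D.mono j (C.mono i h)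
  map_add_one k z := by
    rcases oldIndex i k with a | j
    · exact C.map_add_one a z
    · simp only [Sum.elim_inr, C.map_add_one, D.map_add_one]
  sum_map z := by
    rw [sum_oldIndex i fun s => Sum.elim C.len (fun j => C.len i * D.len j) s *
      (Sum.elim (fun a => C.map a z) (fun j => D.map j (C.map i z)) s -
        Sum.elim (fun a => C.map a 0) (fun j => D.map j (C.map i 0)) s)]
    simp only [Sum.elim_inl, Sum.elim_inr, mul_assoc]
    rw [← Finset.mul_sum, C.sum_map, D.sum_sub]; ring
  wedge := ⟨fun k k' => compAtt C i D (oldIndex i k) (oldIndex i k'), fun k k' hk =>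
    compAtt_spec C D (fun h => hk (oldIndex_injective i h)) (oldIndex_ne i k) (oldIndex_ne i k')⟩

theorem comp_att (C : Cactus (m + 1)) (i : Fin (m + 1)) (D : Cactus n) {k k' : Fin (m + n)} (hk : k ≠ k') :
    (C.comp i D).att k k' = compAtt C i D (oldIndex i k) (oldIndex i k') :=
  att_unique (c := fun k k' => compAtt C i D (oldIndex i k) (oldIndex i k')) (fun k k' hk =>
    compAtt_spec C D (fun h => hk (oldIndex_injective i h)) (oldIndex_ne i k) (oldIndex_ne i k')) hk

/-- The position of a point of the disjoint union in the glued surface. -/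
def posGlue (C : Cactus (m + 1)) (i : Fin (m + 1)) (D : Cactus n)
    (p : (Fin (m + 1 + 1) ⊕ Fin (n + 1)) × Circ) (k : Fin (m + n)) : Circ :=
  Sum.elim
    (fun s => Sum.elim (fun a => C.pos (s, p.2) a) (fun j => D.circ j (C.pos (s, p.2) i)) (oldIndex i k))
    (fun s => Sum.elim (fun a => C.att a i) (fun j => D.pos (s, p.2) j) (oldIndex i k)) p.1

theorem comp_pos (C : Cactus (m + 1)) (i : Fin (m + 1)) (D : Cactus n) :
    (C.comp i D).pos = posGlue C i D ∘ inO (outer i) := by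
  funext ⟨s, w⟩ k
  induction s using Fin.cases with
  | zero =>
    obtain ⟨z, rfl⟩ := exists_coe_circ w
    simp only [pos_zero, Function.comp_apply, inO, outer_zero, posGlue, Sum.elim_inl, comp]
    rcases oldIndex i k with a | j <;> simp
  | succ l =>
    simp only [pos_succ, Function.comp_apply, inO, outer_succ, posGlue]
    have hl := oldIndex_ne i l
    by_cases hkl : k = l
    · subst hkl
      rw [if_pos rfl]
      generalize oldIndex i k = s
      rcases s with a | j <;> simp [pos_succ]
    · rw [if_neg hkl, C.comp_att i D hkl, compAtt]
      have hne : oldIndex i k ≠ oldIndex i l := fun h => hkl (oldIndex_injective i h)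
      generalize oldIndex i l = s' at hl hne ⊢
      generalize oldIndex i k = s at hne ⊢
      rcases s' with b | j' <;> rcases s with a | j
      · have : a ≠ b := fun h => hne (by rw [h])
        simp [pos_succ, this]
      · have : i ≠ b := fun h => hl (by rw [h])
        simp [pos_succ, this]
      · simp
      · have : j ≠ j' := fun h => hne (by rw [h])
        simp [pos_succ, this]

theorem glues (C : Cactus (m + 1)) (i : Fin (m + 1)) (D : Cactus n) :
    Glues C.pos D.pos i.succ 0 (outer i) (posGlue C i D) where
  out_inj := by
    intro k k' h
    induction k using Fin.cases with
    | zero =>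
      induction k' using Fin.cases with
      | zero => rfl
      | succ k' =>
        rw [outer_zero, outer_succ] at h
        generalize oldIndex i k' = s at h
        rcases s with a | j
        · exact absurd (Sum.inl_injective h).symm (Fin.succ_ne_zero a)
        · simp at h
    | succ k =>
      induction k' using Fin.cases with
      | zero =>
        rw [outer_zero, outer_succ] at h
        generalize oldIndex i k = s at h
        rcases s with a | j
        · exact absurd (Sum.inl_injective h) (Fin.succ_ne_zero a)
        · simp at h
      | succ k' =>
        rw [outer_succ, outer_succ] at h
        rw [oldIndex_injective i ((Sum.map_injective.2 ⟨Fin.succ_injective _, Fin.succ_injective _⟩) h)]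
  out_range s := by
    constructor
    · rintro ⟨k, rfl⟩
      induction k using Fin.cases with
      | zero => rw [outer_zero]; exact ⟨fun h => absurd (Sum.inl_injective h).symm (Fin.succ_ne_zero i), by simp⟩
      | succ k =>
        rw [outer_succ]
        have := oldIndex_ne i k
        generalize oldIndex i k = s at this ⊢
        rcases s with a | j
        · simpa using this
        · simp [Fin.succ_ne_zero]
    · rintro ⟨h1, h2⟩
      rcases s with a | j
      · induction a using Fin.cases with
        | zero => exact ⟨0, outer_zero i⟩
        | succ a =>
          obtain ⟨k, hk⟩ := exists_oldIndex (n := n) i (s := Sum.inl a) (by simpa using h1)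
          exact ⟨k.succ, by rw [outer_succ, hk]; rfl⟩
      · induction j using Fin.cases with
        | zero => simp at h2
        | succ j =>
          obtain ⟨k, hk⟩ := exists_oldIndex (n := n) i (s := Sum.inr j) (by simp)
          exact ⟨k.succ, by rw [outer_succ, hk]; rfl⟩
  congrL p p' h := by
    funext k
    simp only [posGlue, inL, Sum.elim_inl, Prod.mk.eta, h]
  congrR p p' h := by
    funext k
    simp only [posGlue, inR, Sum.elim_inr, Prod.mk.eta, h]
  glued x := by
    funext k
    have hk := oldIndex_ne i k
    simp only [posGlue, Sum.elim_inl, Sum.elim_inr]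
    generalize oldIndex i k = s at hk ⊢
    rcases s with a | j
    · have : a ≠ i := fun h => hk (by rw [h])
      simp [pos_succ, this]
    · simp [pos_succ, pos_zero']
  sepL p p' h := by
    have h1 : ∀ a, a ≠ i → C.pos p a = C.pos p' a := fun a ha => by
      obtain ⟨k, hk⟩ := exists_oldIndex (n := n) i (s := Sum.inl a) (by simpa using ha)
      have := congrFun h k
      simpa [posGlue, inL, hk] using this
    by_cases hi : C.pos p i = C.pos p' i
    · left
      funext a
      by_cases ha : a = i
      · rw [ha, hi]
      · exact h1 a ha
    · right
      -- The two positions differ in the `i`-th coordinate only. If another coordinate were off its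
      -- branch point towards `i`, the wedge condition would fix the `i`-th coordinate of both. So
      -- both positions lie on the circle `i`.
      have h2 : ∀ a, a ≠ i → C.pos p a = C.att a i := by
        intro a ha
        by_contra hc
        have e1 := (C.pos_wedge p ha).resolve_left hc
        have e2 := (C.pos_wedge p' ha).resolve_left (h1 a ha ▸ hc)
        exact hi (e1.trans e2.symm)
      exact ⟨_, _, (pos_succ_eq h2).symm, (pos_succ_eq fun a ha => h1 a ha ▸ h2 a ha).symm⟩
  sepR q q' h := by
    funext j
    obtain ⟨k, hk⟩ := exists_oldIndex (n := n) i (s := Sum.inr j) (by simp)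
    have := congrFun h k
    simpa [posGlue, inR, hk] using this
  sepLR p q h := by
    have h2 : ∀ a, a ≠ i → C.pos p a = C.att a i := fun a ha => by
      obtain ⟨k, hk⟩ := exists_oldIndex (n := n) i (s := Sum.inl a) (by simpa using ha)
      have := congrFun h k
      simpa [posGlue, inL, inR, hk] using this
    refine ⟨_, (pos_succ_eq h2).symm, ?_⟩
    funext j
    obtain ⟨k, hk⟩ := exists_oldIndex (n := n) i (s := Sum.inr j) (by simp)
    have := congrFun h k
    simpa [posGlue, inL, inR, hk, pos_zero'] using this.symm
  inj x x' h := C.pos_succ_inj h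
  leaf_b p q h hp := fibreLeaf_fst h hp
  finα := C.finite_fibre
  finβ := D.finite_fibre
  cutα := C.finite_cut
  cutβ := D.finite_cut

/-- Substitution of `D` for the circle `i` has exactly the glued classes as fibres (`glues`), so
`glue_eq` applies; only the lengths remain to be compared. -/
theorem compFam_fam (C : Cactus (m + 1)) (i : Fin (m + 1)) (D : Cactus n) :
    compFam C.fam i D.fam = (C.comp i D).fam := by
  unfold compFam
  rw [show C.fam = ofPos _ C.pos from rfl, show D.fam = ofPos _ D.pos from rfl, (C.glues i D).glue_eq]
  unfold fam
  rw [comp_pos]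
  congr 1
  -- The outer circle of `D` has measure `1 / 2`, so before normalization all measures are half of
  -- the final ones.
  have key : ∀ u : Fin (m + n + 1), Sum.elim
      (fun s => (Fin.cons (1 / 2) (fun i => D.len i / 2) : Fin (n + 1) → ℝ) 0 *
        (Fin.cons (1 / 2) (fun i => C.len i / 2) : Fin (m + 1 + 1) → ℝ) s)
      (fun s => (Fin.cons (1 / 2) (fun i => C.len i / 2) : Fin (m + 1 + 1) → ℝ) i.succ *
        (Fin.cons (1 / 2) (fun i => D.len i / 2) : Fin (n + 1) → ℝ) s) (outer i u) =
      (Fin.cons (1 / 2) (fun k => (C.comp i D).len k / 2) : Fin (m + n + 1) → ℝ) u / 2 := by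
    intro u
    induction u using Fin.cases with
    | zero => rw [outer_zero]; simp; norm_num
    | succ k =>
      rw [outer_succ]
      simp only [Fin.cons_succ, comp]
      generalize oldIndex i k = s
      rcases s with a | j
      · simp; ring
      · simp; ring
  funext u
  simp only [key]
  have hsum : ∑ v, (Fin.cons (1 / 2) (fun k => (C.comp i D).len k / 2) : Fin (m + n + 1) → ℝ) v / 2 = 1 / 2 := by
    rw [← Finset.sum_div, Fin.sum_univ_succ]
    simp only [Fin.cons_zero, Fin.cons_succ]
    rw [← Finset.sum_div, (C.comp i D).len_sum]; norm_num
  rw [hsum]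
  ring

end Cactus

/-! ## Monotone interpolation -/

/-- Monotone interpolation between points `a' l ↦ a l` of the plane, by a function which is constant
only between points `a' l` with the same value `a l`. -/
theorem exists_interpolation {Λ : Type} [Finite Λ] [Nonempty Λ] {κ : ℝ} (h0 : 0 < κ) (h1 : κ ≤ 1 / 4)
    {a a' : Λ → ℝ} (h : ∀ k l, a k < a l →
      a l - a k ≤ (1 + κ) * (a' l - a' k) ∧ a' l - a' k ≤ 3 / 2 * (a l - a k)) :
    ∃ f : ℝ → ℝ, Monotone f ∧ Continuous f ∧ (∀ l, f (a' l) = a l) ∧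
      (∀ k x, a' k ≤ x → f x ≤ a k + (1 + κ) * (x - a' k)) ∧
      (∀ k x, x ≤ a' k → a k - (1 + κ) * (a' k - x) ≤ f x) ∧
      ∀ x y, x < y → f x = f y → ∃ k l, a' k ≤ x ∧ y ≤ a' l ∧ a k = f x ∧ a l = f x := by
  have := Fintype.ofFinite Λ
  set L := 1 + κ with hL
  have hLp : 0 < L := by positivity
  -- The functions `lo` and `up` are the least and the greatest monotone functions through the given
  -- points with Lipschitz constant `L`. Their mean can be constant on an interval only if both are.
  set lo : ℝ → ℝ := fun x => Finset.univ.sup' Finset.univ_nonempty fun l => a l - L * max (a' l - x) 0 with hlo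
  set up : ℝ → ℝ := fun x => Finset.univ.inf' Finset.univ_nonempty fun l => a l + L * max (x - a' l) 0 with hup
  have le_lo : ∀ x l, a l - L * max (a' l - x) 0 ≤ lo x := fun x l =>
    Finset.le_sup' (fun l => a l - L * max (a' l - x) 0) (Finset.mem_univ l)
  have up_le : ∀ x l, up x ≤ a l + L * max (x - a' l) 0 := fun x l =>
    Finset.inf'_le (fun l => a l + L * max (x - a' l) 0) (Finset.mem_univ l)
  have lo_eq : ∀ x, ∃ l, lo x = a l - L * max (a' l - x) 0 := fun x => by
    obtain ⟨l, -, hl⟩ := Finset.exists_mem_eq_sup' Finset.univ_nonempty fun l => a l - L * max (a' l - x) 0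
    exact ⟨l, hl⟩
  have up_eq : ∀ x, ∃ l, up x = a l + L * max (x - a' l) 0 := fun x => by
    obtain ⟨l, -, hl⟩ := Finset.exists_mem_eq_inf' Finset.univ_nonempty fun l => a l + L * max (x - a' l) 0
    exact ⟨l, hl⟩
  have lo_mono : Monotone lo := by
    intro x y hxy
    obtain ⟨l, hl⟩ := lo_eq x
    rw [hl]
    refine le_trans ?_ (le_lo y l)
    have := max_le_max_right 0 (show a' l - y ≤ a' l - x by linarith)
    nlinarith
  have up_mono : Monotone up := by
    intro x y hxy
    obtain ⟨l, hl⟩ := up_eq y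
    rw [hl]
    refine (up_le x l).trans ?_
    have := max_le_max_right 0 (show x - a' l ≤ y - a' l by linarith)
    nlinarith
  have lo_cont : Continuous lo :=
    Continuous.finset_sup'_apply _ fun l _ => by fun_prop
  have up_cont : Continuous up :=
    Continuous.finset_inf'_apply _ fun l _ => by fun_prop
  have key : ∀ x k l, a l - L * max (a' l - x) 0 ≤ a k + L * max (x - a' k) 0 := by
    intro x k l
    rcases le_or_gt (a l) (a k) with h2 | h2
    · have e1 : 0 ≤ L * max (a' l - x) 0 := by positivity
      have e2 : 0 ≤ L * max (x - a' k) 0 := by positivity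
      linarith
    · have := (h k l h2).1
      have e1 := mul_le_mul_of_nonneg_left (le_max_left (a' l - x) 0) hLp.le
      have e2 := mul_le_mul_of_nonneg_left (le_max_left (x - a' k) 0) hLp.le
      nlinarith
  have lo_le_up : ∀ x, lo x ≤ up x := fun x => by
    obtain ⟨l, hl⟩ := lo_eq x
    obtain ⟨k, hk⟩ := up_eq x
    rw [hl, hk]; exact key x k l
  have lo_pt : ∀ l, lo (a' l) = a l := fun l => by
    apply le_antisymm
    · refine (lo_le_up _).trans ((up_le _ l).trans ?_)
      simp
    · simpa using le_lo (a' l) l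
  have up_pt : ∀ l, up (a' l) = a l := fun l => by
    apply le_antisymm
    · simpa using up_le (a' l) l
    · rw [← lo_pt l]; exact lo_le_up _
  refine ⟨fun x => (lo x + up x) / 2, ?_, by fun_prop, ?_, ?_, ?_, ?_⟩
  · intro x y hxy
    have := lo_mono hxy
    have := up_mono hxy
    simp only; linarith
  · intro l
    simp only [lo_pt, up_pt]; ring
  · intro k x hx
    have e1 := up_le x k
    rw [max_eq_left (by linarith)] at e1
    have := lo_le_up x
    simp only; linarith
  · intro k x hx
    have e1 := le_lo x k
    rw [max_eq_left (by linarith)] at e1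
    have := lo_le_up x
    simp only; linarith
  · intro x y hxy hf
    simp only at hf ⊢
    have m1 := lo_mono hxy.le
    have m2 := up_mono hxy.le
    have e1 : lo x = lo y := by linarith
    have e2 : up x = up y := by linarith
    obtain ⟨l, hl⟩ := up_eq y
    obtain ⟨k, hk⟩ := lo_eq x
    have hly : y ≤ a' l := by
      by_contra hc
      push Not at hc
      have h3 := up_le x l
      rw [e2, hl, max_eq_left (by linarith)] at h3
      have : max (x - a' l) 0 < y - a' l := max_lt (by linarith) (by linarith)
      nlinarith
    have hkx : a' k ≤ x := by
      by_contra hc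
      push Not at hc
      have h3 := le_lo y k
      rw [← e1, hk, max_eq_left (show 0 ≤ a' k - x by linarith)] at h3
      have : max (a' k - y) 0 < a' k - x := max_lt (by linarith) (by linarith)
      nlinarith
    rw [max_eq_right (by linarith)] at hl hk
    simp only [mul_zero, add_zero, sub_zero] at hl hk
    -- If both bounds are constant with different values, adding the two estimates gives `2 * (a l -
    -- a k) ≤ L * (a' l - a' k)`. But `L ≤ 5 / 4` and the bound `3 / 2` on the expansion make the
    -- right side at most `15 / 8` times `a l - a k`.
    have hkl : a k = a l := by
      by_contra hne
      have hlt : a k < a l := lt_of_le_of_ne (by rw [← hk, ← hl, ← e2]; exact lo_le_up x) hne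
      have h3 := le_lo y l
      rw [← e1, hk, max_eq_left (by linarith)] at h3
      have h4 := up_le x k
      rw [e2, hl, max_eq_left (by linarith)] at h4
      have h5 := (h k l hlt).2
      nlinarith
    refine ⟨k, l, hkx, hly, ?_, ?_⟩ <;> rw [hk, e2, hl] <;> linarith

/-- The extension of a function on the unit interval to a function of degree one. -/
def degOne (f : ℝ → ℝ) (x : ℝ) : ℝ := ⌊x⌋ + f (Int.fract x)

theorem degOne_add_one (f : ℝ → ℝ) (x : ℝ) : degOne f (x + 1) = degOne f x + 1 := by
  simp [degOne]; ring

theorem degOne_add_int (f : ℝ → ℝ) (x : ℝ) (m : ℤ) : degOne f (x + m) = degOne f x + m := by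
  simp [degOne]; ring

theorem degOne_eq {f : ℝ → ℝ} (h0 : f 0 = 0) (h1 : f 1 = 1) {x : ℝ} {m : ℤ} (hx : x ∈ Icc (m : ℝ) (m + 1)) :
    degOne f x = m + f (x - m) := by
  rcases hx.2.eq_or_lt with rfl | h
  · simp [degOne, h0, h1]
  · have : ⌊x⌋ = m := Int.floor_eq_iff.2 ⟨hx.1, h⟩
    rw [degOne, Int.fract, this]

theorem degOne_monotone {f : ℝ → ℝ} (hf : MonotoneOn f (Icc 0 1)) (h0 : f 0 = 0) (h1 : f 1 = 1) :
    Monotone (degOne f) := by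
  have hI : ∀ x : ℝ, Int.fract x ∈ Icc (0:ℝ) 1 := fun x => ⟨Int.fract_nonneg x, (Int.fract_lt_one x).le⟩
  intro x y hxy
  rcases (Int.floor_mono hxy).eq_or_lt with h | h
  · unfold degOne
    rw [h]
    have : Int.fract x ≤ Int.fract y := by unfold Int.fract; rw [h]; linarith
    linarith [hf (hI x) (hI y) this]
  · have e1 := hf (hI x) (by simp : (1:ℝ) ∈ Icc (0:ℝ) 1) (hI x).2
    have e2 := hf (by simp : (0:ℝ) ∈ Icc (0:ℝ) 1) (hI y) (hI y).1
    have e3 : (⌊x⌋ : ℝ) + 1 ≤ ⌊y⌋ := by exact_mod_cast h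
    unfold degOne
    linarith

theorem continuous_degOne {X : Type*} [TopologicalSpace X] {f : X → ℝ → ℝ} (hf : Continuous (Function.uncurry f))
    (h0 : ∀ x, f x 0 = 0) (h1 : ∀ x, f x 1 = 1) : Continuous fun p : X × ℝ => degOne (f p.1) p.2 := by
  have e : (fun p : X × ℝ => degOne (f p.1) p.2) =
      fun p => p.2 + (f p.1 (Int.fract p.2) - Int.fract p.2) := by
    funext p
    unfold degOne
    have := Int.floor_add_fract p.2
    linarith
  rw [e]
  refine continuous_snd.add ?_
  refine ContinuousOn.comp_fract' (f := fun x t => f x t - t) ?_ fun s => by simp [h0, h1]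
  have := hf.sub continuous_snd
  exact this.continuousOn

/-- Interpolation on the circle. -/
theorem exists_circle_interpolation {Λ : Type} [Finite Λ] (s : Λ → ℝ) {κ : ℝ} (hκ : 0 < κ) :
    ∃ η > 0, ∀ s' : Λ → ℝ, (∀ l, |s' l - s l| < η) → ∃ f : ℝ → ℝ, Monotone f ∧ Continuous f ∧
      (∀ x, f (x + 1) = f x + 1) ∧ f 0 = 0 ∧ (∀ l, f (s' l) = s l) ∧ (∀ x, |f x - x| ≤ κ) ∧
      ∀ x y, x < y → f x = f y → ∃ a ≤ x, ∃ b, y ≤ b ∧ f a = f x ∧ f b = f x ∧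
        ((a : Circ) = 0 ∨ ∃ l, (a : Circ) = s' l) ∧ ((b : Circ) = 0 ∨ ∃ l, (b : Circ) = s' l) := by
  have := Fintype.ofFinite Λ
  wlog hk1 : κ ≤ 1 / 4 generalizing κ
  · obtain ⟨η, h1, h2⟩ := this (κ := 1 / 4) (by norm_num) le_rfl
    refine ⟨η, h1, fun s' hs' => ?_⟩
    obtain ⟨f, a1, a2, a3, a4, a5, a6, a7⟩ := h2 s' hs'
    exact ⟨f, a1, a2, a3, a4, a5, fun x => (a6 x).trans (by linarith), a7⟩
  -- The points are lifted to two consecutive periods: `none` stands for the base point 0, and the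
  -- flag adds 1.
  set a : Option Λ × Bool → ℝ := fun l => l.1.elim 0 (fun l => Int.fract (s l)) + bif l.2 then 1 else 0 with ha
  obtain ⟨g, hg, hgap⟩ : ∃ g > 0, ∀ k l, a k < a l → g ≤ a l - a k := by
    have hfin : (range fun p : (Option Λ × Bool) × (Option Λ × Bool) =>
        if a p.1 < a p.2 then a p.2 - a p.1 else 1).Finite := finite_range _
    obtain ⟨y, ⟨p, rfl⟩, hy⟩ := Set.exists_min_image _ id hfin (range_nonempty _)
    refine ⟨if a p.1 < a p.2 then a p.2 - a p.1 else 1, ?_, fun k l hkl => ?_⟩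
    · split_ifs with h
      · linarith
      · norm_num
    · have := hy _ ⟨(k, l), rfl⟩
      simpa [hkl] using this
  -- All gaps are at least `g`, so moving two points by less than `g * κ / 4` each changes a gap by
  -- at most the fraction `κ / 2` of itself, which is within the bounds for interpolation.
  refine ⟨min (g * κ / 4) (1 / 4), by positivity, fun s' hs' => ?_⟩
  set a' : Option Λ × Bool → ℝ := fun l => l.1.elim 0 (fun l => s' l - ⌊s l⌋) + bif l.2 then 1 else 0 with ha'
  have hclose : ∀ l, |a' l - a l| < min (g * κ / 4) (1 / 4) := by
    rintro ⟨_ | l, b⟩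
    · simp only [ha, ha', Option.elim]; rw [sub_self, abs_zero]; positivity
    · simp only [ha, ha', Option.elim, Int.fract]
      convert hs' l using 2; ring
  obtain ⟨f, f1, f2, f3, f4, f5, f6⟩ := exists_interpolation hκ hk1 (a := a) (a' := a') (by
    intro k l hkl
    have e1 := hgap k l hkl
    have e2 := abs_lt.1 ((hclose k).trans_le (min_le_left _ _))
    have e3 := abs_lt.1 ((hclose l).trans_le (min_le_left _ _))
    have e4 : g * κ ≤ (a l - a k) * κ := mul_le_mul_of_nonneg_right e1 hκ.le
    constructor <;> nlinarith)
  have h0 : f 0 = 0 := by simpa [ha, ha'] using f3 (none, false)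
  have h1 : f 1 = 1 := by simpa [ha, ha'] using f3 (none, true)
  have hcont : Continuous (degOne f) := by
    have := continuous_degOne (X := Unit) (f := fun _ => f) (by unfold Function.uncurry; fun_prop)
      (fun _ => h0) (fun _ => h1)
    exact this.comp (Continuous.prodMk (f := fun _ => ()) continuous_const continuous_id)
  have hspec : ∀ l : Option Λ × Bool, (a' l : Circ) = 0 ∨ ∃ m, (a' l : Circ) = s' m := by
    rintro ⟨_ | l, b⟩
    · left
      cases b <;> simp [ha', AddCircle.coe_period]
    · right
      refine ⟨l, ?_⟩
      cases b
      · exact circ_eq_iff.2 ⟨-⌊s l⌋, by simp [ha']; ring⟩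
      · exact circ_eq_iff.2 ⟨1 - ⌊s l⌋, by simp [ha']; ring⟩
  have hpt : ∀ l : Option Λ, degOne f (a' (l, false)) = a (l, false) := by
    intro l
    have e2 := abs_lt.1 ((hclose (l, false)).trans_le (min_le_right _ _))
    have e3 : 0 ≤ a (l, false) ∧ a (l, false) < 1 := by
      rcases l with _ | l
      · simp [ha]
      · simp [ha, Int.fract_lt_one]
    have e4 : a' (l, true) = a' (l, false) + 1 := by simp [ha']
    have e5 : a (l, true) = a (l, false) + 1 := by simp [ha]
    -- A perturbed point may slip below 0. Its value is then read off from the copy in the next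
    -- period.
    rcases lt_or_ge (a' (l, false)) 0 with h | h
    · rw [degOne_eq h0 h1 (m := -1) (by constructor <;> push_cast <;> linarith)]
      have := f3 (l, true)
      rw [e4, e5] at this
      push_cast
      rw [sub_neg_eq_add, this]; ring
    · have e6 : a' (l, false) < 1 := by
        have hlt : a (l, false) < a (none, true) := by simpa [ha] using e3.2
        have g1 := hgap _ _ hlt
        have g2 := abs_lt.1 ((hclose (l, false)).trans_le (min_le_left _ _))
        have g3 : a' (none, true) = 1 := by simp [ha']
        have g4 : a (none, true) = 1 := by simp [ha]
        nlinarith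
      rw [degOne_eq h0 h1 (m := 0) (by constructor <;> push_cast <;> linarith)]
      simp [f3]
  have hflat : ∀ (m : ℤ) x y, x < y → x ∈ Icc (m : ℝ) (m + 1) → y ∈ Icc (m : ℝ) (m + 1) → degOne f x = degOne f y →
      ∃ a ≤ x, ∃ b, y ≤ b ∧ degOne f a = degOne f x ∧ degOne f b = degOne f x ∧
        ((a : Circ) = 0 ∨ ∃ l, (a : Circ) = s' l) ∧ ((b : Circ) = 0 ∨ ∃ l, (b : Circ) = s' l) := by
    intro m x y hxy hx hy hf
    have e1 := degOne_eq h0 h1 hx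
    have e2 := degOne_eq h0 h1 hy
    obtain ⟨k, l, hk, hl, hk', hl'⟩ := f6 (x - m) (y - m) (by linarith) (by linarith)
    have hcoe : ∀ l, ((a' l + m : ℝ) : Circ) = a' l := fun l => circ_eq_iff.2 ⟨m, rfl⟩
    have hdeg : ∀ l, degOne f (a' l + m) = a l + m := by
      intro l
      rw [degOne_add_int]
      obtain ⟨l, _ | _⟩ := l
      · rw [hpt]
      · have e4 : a' (l, true) = a' (l, false) + 1 := by simp [ha']
        have e5 : a (l, true) = a (l, false) + 1 := by simp [ha]
        rw [e4, e5, degOne_add_one, hpt]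
    refine ⟨a' k + m, by linarith, a' l + m, by linarith, ?_, ?_, ?_, ?_⟩
    · rw [hdeg, hk', e1]; ring
    · rw [hdeg, hl', e1]; ring
    · rw [hcoe]; exact hspec k
    · rw [hcoe]; exact hspec l
  refine ⟨degOne f, degOne_monotone (f1.monotoneOn _) h0 h1, hcont, degOne_add_one f, ?_, ?_, ?_, ?_⟩
  · simp [degOne, h0]
  · intro l
    have e1 := hpt (some l)
    simp only [ha, ha', Option.elim, cond_false, add_zero] at e1
    have e2 := degOne_add_int f (s' l - ⌊s l⌋) ⌊s l⌋
    rw [sub_add_cancel, e1] at e2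
    rw [e2]; exact Int.fract_add_floor _
  · intro x
    have e1 := f4 (none, false) (Int.fract x)
    have e2 := f5 (none, true) (Int.fract x)
    simp only [ha, ha', Option.elim, cond_false, cond_true, add_zero, zero_add, sub_zero] at e1 e2
    have e3 := e1 (Int.fract_nonneg x)
    have e4 := e2 (Int.fract_lt_one x).le
    have e5 := Int.fract_nonneg x
    have e6 := Int.fract_lt_one x
    have e7 : degOne f x - x = f (Int.fract x) - Int.fract x := by
      unfold degOne; have := Int.floor_add_fract x; linarith
    rw [e7, abs_le]
    constructor <;> nlinarith
  · intro x y hxy hf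
    set m := ⌊x⌋ with hm
    have hx : x ∈ Icc (m : ℝ) (m + 1) := ⟨Int.floor_le x, (Int.lt_floor_add_one x).le⟩
    have hmono := degOne_monotone (f1.monotoneOn _) h0 h1
    rcases le_or_gt y (m + 1) with hy | hy
    · exact hflat m x y hxy hx ⟨hx.1.trans hxy.le, hy⟩ hf
    -- A flat interval that crosses an integer is shorter than one period; it is cut there, and the
    -- two halves supply one end point each.
    · have hx1 : x < m + 1 := Int.lt_floor_add_one x
      have hc : degOne f x = degOne f (m + 1) := le_antisymm (hmono hx.2) (hf ▸ hmono hy.le)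
      obtain ⟨p, hp, -, -, hp', -, hp'', -⟩ := hflat m x (m + 1) hx1 hx ⟨by linarith, le_rfl⟩ hc
      have hy1 : y < m + 1 + 1 := by
        by_contra hcon
        have := hmono (not_lt.1 hcon)
        rw [degOne_add_one, ← hc, ← hf] at this
        linarith
      obtain ⟨-, -, q, hq, -, hq', -, hq''⟩ := hflat (m + 1) (m + 1) y hy
        (by push_cast; constructor <;> linarith) (by push_cast; constructor <;> linarith) (by rw [← hc, hf])
      exact ⟨p, hp, q, hq, hp', hq'.trans hc.symm, hp'', hq''⟩

/-! ## Collapsing short arcs of the circles of a cactus -/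

theorem exists_isGreatest_preimage {f : ℝ → ℝ} (hf : Continuous f) (hm : Monotone f) (h1 : ∀ x, f (x + 1) = f x + 1)
    (y : ℝ) : ∃ x, IsGreatest {x | f x = y} x := by
  let F : CircleDeg1Lift := ⟨⟨f, hm⟩, h1⟩
  have hi : ∀ (x : ℝ) (m : ℤ), f (x + m) = f x + m := F.map_add_int
  obtain ⟨m, hm'⟩ := exists_int_gt (|f 0 - y|)
  have e1 := abs_lt.1 hm'
  have l1 : f (0 + (-m : ℤ)) ≤ y := by rw [hi]; push_cast; linarith
  have l2 : y < f (0 + (m : ℤ)) := by rw [hi]; linarith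
  have hne : {x | f x = y}.Nonempty :=
    mem_range_of_exists_le_of_exists_ge hf ⟨_, l1⟩ ⟨_, l2.le⟩
  have hb : BddAbove {x | f x = y} := ⟨0 + (m : ℤ), fun x hx => by
    by_contra hc
    have := hm (not_le.1 hc).le
    rw [show f x = y from hx] at this
    linarith⟩
  have hcl : IsClosed {x | f x = y} := isClosed_eq hf continuous_const
  exact ⟨_, hcl.isGreatest_csSup hne hb⟩

namespace ArcData

variable {ι : Type} {F : ι → ℝ → ℝ}

theorem circMap_coe (h1 : ∀ i x, F i (x + 1) = F i x + 1) (i : ι) (x : ℝ) :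
    circMap F (i, (x : Circ)) = (i, (F i x : Circ)) := by
  have hp : Function.Periodic (fun x => (F i x : Circ)) 1 := fun x => by
    simp only [h1, coe_circ_add_one]
  obtain ⟨m, hm⟩ := circ_eq_iff.1 (AddCircle.coe_equivIco (p := (1 : ℝ)) (a := 0) (y := (x : Circ)))
  unfold circMap
  simp only [Prod.mk.injEq, true_and]
  rw [hm]
  have := hp.int_mul m x
  simpa using this

variable (h1 : ∀ i x, F i (x + 1) = F i x + 1) (hm : ∀ i, Monotone (F i)) (hc : ∀ i, Continuous (F i))
include h1

theorem circMap_shift (i : ι) (x t : ℝ) : circMap F (shift t (i, (x : Circ))) = (i, (F i (x + t) : Circ)) := by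
  rw [← circMap_coe h1]; simp [shift]

include hm hc

/-- To the right of a point a monotone map of the circles is constant, or it leaves any finite set. -/
theorem circMap_right {R : Set (ι × Circ)} (hR : R.Finite) (p : ι × Circ) :
    (∀ᶠ t in 𝓝[>] (0 : ℝ), circMap F (shift t p) = circMap F p) ∨
      ∀ᶠ t in 𝓝[>] (0 : ℝ), circMap F (shift t p) ∉ R := by
  obtain ⟨i, w⟩ := p
  obtain ⟨x, rfl⟩ := exists_coe_circ w
  simp only [circMap_shift h1, circMap_coe h1]
  by_cases h : ∃ t > 0, F i (x + t) = F i x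
  · left
    obtain ⟨t, ht, he⟩ := h
    filter_upwards [Ioo_mem_nhdsGT ht] with s hs
    rw [le_antisymm ((hm i (by linarith [hs.2] : x + s ≤ x + t)).trans he.le) (hm i (by linarith [hs.1]))]
  · right
    push Not at h
    have ht : Tendsto (fun t => F i (x + t) - F i x) (𝓝[>] 0) (𝓝[>] 0) := by
      refine tendsto_nhdsWithin_iff.2 ⟨?_, ?_⟩
      · have : Continuous fun t => F i (x + t) - F i x := by have := hc i; fun_prop
        have := this.tendsto 0
        simp only [add_zero, sub_self] at this
        exact this.mono_left nhdsWithin_le_nhds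
      · filter_upwards [self_mem_nhdsWithin] with t ht
        exact sub_pos.2 (lt_of_le_of_ne (hm i (by linarith [show (0:ℝ) < t from ht])) (h t ht).symm)
    filter_upwards [ht.eventually (eventually_shift_notMem hR (i, (F i x : Circ)))] with t ht
    simpa [shift] using ht

theorem mem_of_eventually_circMap {R : Set (ι × Circ)} (hR : R.Finite) {p : ι × Circ}
    (h : ∀ᶠ t in 𝓝[>] (0 : ℝ), circMap F (shift t p) ∈ R) : circMap F p ∈ R := by
  rcases circMap_right h1 hm hc hR p with h2 | h2
  · obtain ⟨t, ht, ht'⟩ := (h.and h2).exists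
    rwa [← ht']
  · obtain ⟨t, ht, ht'⟩ := (h.and h2).exists
    exact absurd ht ht'

/-- Every point has a last preimage. -/
theorem ncard_right_ends {R : Set (ι × Circ)} (hR : R.Finite) :
    {p | circMap F p ∈ R ∧ ∀ᶠ t in 𝓝[>] (0 : ℝ), circMap F (shift t p) ∉ R}.ncard = R.ncard := by
  refine Set.ncard_congr (fun p _ => circMap F p) (fun p hp => hp.1) ?_ ?_
  · rintro ⟨i, w⟩ ⟨i', w'⟩ hp hp' h
    obtain ⟨x, rfl⟩ := exists_coe_circ w
    obtain ⟨x', rfl⟩ := exists_coe_circ w'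
    simp only [circMap_coe h1, Prod.mk.injEq] at h
    obtain ⟨rfl, h⟩ := h
    obtain ⟨m, hm'⟩ := circ_eq_iff.1 h
    have hi : ∀ (x : ℝ) (m : ℤ), F i (x + m) = F i x + m :=
      CircleDeg1Lift.map_add_int ⟨⟨F i, hm i⟩, h1 i⟩
    have hx' : ((x' + m : ℝ) : Circ) = x' := circ_eq_iff.2 ⟨m, rfl⟩
    rw [← hi] at hm'
    rw [← hx'] at hp' ⊢
    generalize x' + m = y at hm' hp'
    have stay : ∀ x y, x < y → F i x = F i y → circMap F (i, (x : Circ)) ∈ R →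
        ¬ ∀ᶠ t in 𝓝[>] (0 : ℝ), circMap F (shift t (i, (x : Circ))) ∉ R := by
      intro x y hxy he hx hev
      obtain ⟨t, ht, ht'⟩ := (hev.and (Ioo_mem_nhdsGT (sub_pos.2 hxy))).exists
      apply ht
      rw [circMap_shift h1, le_antisymm ((hm i (by linarith [ht'.2])).trans he.ge) (hm i (by linarith [ht'.1])),
        ← circMap_coe h1]
      exact hx
    rcases lt_trichotomy x y with h | h | h
    · exact absurd hp.2 (stay _ _ h hm' hp.1)
    · rw [h]
    · exact absurd hp'.2 (stay _ _ h hm'.symm hp'.1)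
  · rintro ⟨i, w⟩ hq
    obtain ⟨y, rfl⟩ := exists_coe_circ w
    obtain ⟨x, hx, hx'⟩ := exists_isGreatest_preimage (hc i) (hm i) (h1 i) y
    have hfx : circMap F (i, (x : Circ)) = (i, (y : Circ)) := by rw [circMap_coe h1, hx]
    refine ⟨(i, (x : Circ)), ⟨by rwa [hfx], ?_⟩, hfx⟩
    refine (circMap_right h1 hm hc hR _).resolve_left fun hev => ?_
    have hlt : ∀ᶠ t in 𝓝[>] (0 : ℝ), F i (x + t) < F i x + 1 := by
      have : Continuous fun t => F i (x + t) := by have := hc i; fun_prop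
      exact ((this.tendsto 0).mono_left nhdsWithin_le_nhds).eventually (gt_mem_nhds (by simp))
    obtain ⟨t, ⟨ht, hlt⟩, ht'⟩ := ((hev.and hlt).and self_mem_nhdsWithin).exists
    have ht' : 0 < t := ht'
    rw [circMap_shift h1, circMap_coe h1] at ht
    have e1 := circ_eq_of_lt (Prod.ext_iff.1 ht).2 (by linarith)
      (by have := hm i (by linarith : x ≤ x + t); linarith)
    have := hx' (show F i (x + t) = y by rw [e1]; exact hx)
    linarith

end ArcData

/-! ### Cut points in coordinates, and maps that collapse a cactus -/

namespace Cactus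
open ArcData

variable {n : ℕ} (C : Cactus n)

/-- The points of the `i`-th circle, with its orientation reversed, which are cut points. -/
def Spec (i : Fin n) : Set Circ := {x | x = 0 ∨ x = C.map i 0 ∨ ∃ j, j ≠ i ∧ x = C.att i j}

variable {C}

theorem pos_zero_apply (z : ℝ) (i : Fin n) : C.pos (0, (z : Circ)) i = (C.map i z : Circ) := by
  rw [pos_zero]

/-- If the loop moves in the circle `i` before and after being at the branch point of `k`, it is off
that branch point during the whole period in between. Then the coordinate in `k` would have to rest
at `att k i`, although it makes a full turn in that time. -/
theorem map_ne_att {z : ℝ} {i k : Fin n} (hr : C.RightLobe z i) (hl : C.LeftLobe z i)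
    (hik : k ≠ i) :
    (C.map i z : Circ) ≠ C.att i k := by
  intro h
  have hall : ∀ y ∈ Ioo z (z + 1), (C.map k y : Circ) = C.att k i := by
    intro y hy
    refine (C.att_spec hik y).resolve_right fun hc => ?_
    have h1 := hr.lt hy.1
    have h2 : C.map i y < C.map i (z + 1) := by
      have := hl.lt (show y - 1 < z by linarith [hy.2])
      have e := C.map_add_one i (y - 1)
      rw [sub_add_cancel] at e
      rw [C.map_add_one, e]; linarith
    rw [C.map_add_one] at h2
    have := circ_eq_of_lt (hc.trans h.symm) (by linarith) (by linarith)
    linarith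
  have hex : ∀ s ∈ Ioo (0:ℝ) 1, ((C.map k z + s : ℝ) : Circ) = C.att k i := by
    intro s hs
    obtain ⟨y, hy⟩ := C.exists_map_eq k (C.map k z + s)
    rw [← hy]
    refine hall y ⟨?_, ?_⟩
    · by_contra hc
      have := C.mono k (not_lt.1 hc); linarith [hs.1]
    · by_contra hc
      have := C.mono k (not_lt.1 hc); rw [C.map_add_one] at this; linarith [hs.2]
  have := circ_eq_of_lt ((hex (1 / 3) (by norm_num)).trans (hex (2 / 3) (by norm_num)).symm)
    (by linarith) (by linarith)
  linarith

/-- This criterion looks at single coordinates, and so lets maps of the individual circles be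
compared with the leaves and regions of the surface. -/
theorem onLeaf_iff {p : Fin (n + 1) × Circ} : OnLeaf C.pos p ↔ ∃ i, C.pos p i ∉ C.Spec i := by
  obtain ⟨z, hz⟩ := C.exists_zero_pos p
  rw [← onLeaf_congr hz, ← hz]
  constructor
  · rintro ⟨q, hq⟩
    obtain ⟨i, hr, hl, rfl⟩ := fibreLeaf_zero_succ hq
    refine ⟨i, ?_⟩
    rw [pos_zero_apply]
    have hatt : ∀ k, k ≠ i → (C.map i z : Circ) ≠ C.att i k :=
      fun k hk => map_ne_att hr hl hk
    rintro (h | h | ⟨j, hj, h⟩)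
    · exact hq.2.2.2 (by rw [h]; simp)
    -- If the moving coordinate equals its value at the time 0, all other coordinates do as well,
    -- and the base point of `∂₀` would lie in the fibre.
    · have : C.pos (0, ((0 : ℝ) : Circ)) = C.pos (0, (z : Circ)) := by
        rw [pos_zero, pos_zero]
        funext k
        by_cases hk : k = i
        · rw [hk, h]
        · rw [hr.map_eq_att hk]
          exact (C.att_spec hk 0).resolve_right fun hc => hatt k hk (h.trans hc)
      rcases hq.eq_or this with h | h
      · exact hq.2.2.1 (by rw [← h]; simp)
      · exact zero_ne_succ h
    · exact hatt j hj h
  · rintro ⟨i, hi⟩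
    rw [pos_zero_apply] at hi
    refine ⟨_, zero_ne_succ, C.fibre_of_not_sing (i := i) fun j hj h => hi (Or.inr (Or.inr ⟨j, hj, h⟩)), ?_, ?_⟩
    · intro h
      obtain ⟨m, hm⟩ := circ_eq_iff.1 (show (z : Circ) = ((0 : ℝ) : Circ) by simpa using h)
      refine hi (Or.inr (Or.inl ?_))
      rw [hm, C.map_add_int]
      exact circ_eq_iff.2 ⟨m, rfl⟩
    · intro h
      exact hi (Or.inl (by simpa using h))

/-- The maps `φ i` of the circles and the map `φ₀` of the loop exhibit `C` as the cactus which arises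
from `C'` by collapsing arcs between neighbouring cut points. -/
structure Collapse (C' C : Cactus n) (φ : Fin n → ℝ → ℝ) (φ₀ : ℝ → ℝ) : Prop where
  mono : ∀ i, Monotone (φ i)
  cont : ∀ i, Continuous (φ i)
  add_one : ∀ i x, φ i (x + 1) = φ i x + 1
  zero : ∀ i, φ i 0 = 0
  mono₀ : Monotone φ₀
  cont₀ : Continuous φ₀
  add_one₀ : ∀ x, φ₀ (x + 1) = φ₀ x + 1
  zero₀ : φ₀ 0 = 0
  map : ∀ i z, C.map i (φ₀ z) = φ i (C'.map i z)
  att : ∀ i j, i ≠ j → ∀ x : ℝ, (x : Circ) = C'.att i j → (φ i x : Circ) = C.att i j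
  flat : ∀ i x y, x < y → φ i x = φ i y → ∃ a ≤ x, ∃ b, y ≤ b ∧ φ i a = φ i x ∧ φ i b = φ i x ∧
    (a : Circ) ∈ C'.Spec i ∧ (b : Circ) ∈ C'.Spec i

/-- The maps of the boundary circles of the surface. -/
def collapseMap (φ : Fin n → ℝ → ℝ) (φ₀ : ℝ → ℝ) : Fin (n + 1) → ℝ → ℝ :=
  Fin.cons φ₀ fun i x => -φ i (-x)

namespace Collapse

variable {C' : Cactus n} {φ : Fin n → ℝ → ℝ} {φ₀ : ℝ → ℝ} (H : Collapse C' C φ φ₀)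
include H

theorem add_int (i : Fin n) (x : ℝ) (m : ℤ) : φ i (x + m) = φ i x + m :=
  CircleDeg1Lift.map_add_int ⟨⟨φ i, H.mono i⟩, H.add_one i⟩ x m

theorem coe_congr {i : Fin n} {x y : ℝ} (h : (x : Circ) = y) : (φ i x : Circ) = φ i y := by
  obtain ⟨m, rfl⟩ := circ_eq_iff.1 h
  rw [H.add_int]; exact circ_eq_iff.2 ⟨m, rfl⟩

theorem F_add_one (i : Fin (n + 1)) (x : ℝ) : collapseMap φ φ₀ i (x + 1) = collapseMap φ φ₀ i x + 1 := by
  induction i using Fin.cases with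
  | zero => exact H.add_one₀ x
  | succ i =>
    have := H.add_one i (-(x + 1))
    rw [show -(x + 1) + 1 = -x by ring] at this
    simp only [collapseMap, Fin.cons_succ, this]; ring

theorem F_mono (i : Fin (n + 1)) : Monotone (collapseMap φ φ₀ i) := by
  induction i using Fin.cases with
  | zero => exact H.mono₀
  | succ i => exact fun x y h => neg_le_neg (H.mono i (neg_le_neg h))

theorem F_cont (i : Fin (n + 1)) : Continuous (collapseMap φ φ₀ i) := by
  induction i using Fin.cases with
  | zero => exact H.cont₀
  | succ i => exact ((H.cont i).comp continuous_neg).neg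

theorem map_zero (z : ℝ) : circMap (collapseMap φ φ₀) (0, (z : Circ)) = (0, (φ₀ z : Circ)) :=
  circMap_coe H.F_add_one 0 z

theorem map_succ (i : Fin n) (x : ℝ) :
    circMap (collapseMap φ φ₀) (i.succ, -(x : Circ)) = (i.succ, -(φ i x : Circ)) := by
  have := circMap_coe H.F_add_one i.succ (-x)
  simpa [collapseMap] using this

/-- On `∂₀` this is the compatibility `map`, on the inner circles the compatibility `att`; so the
maps of the boundary circles are induced by one map of the torus. -/
theorem pos_map {p : Fin (n + 1) × Circ} {i : Fin n} {x : ℝ} (hx : (x : Circ) = C'.pos p i) :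
    C.pos (circMap (collapseMap φ φ₀) p) i = (φ i x : Circ) := by
  obtain ⟨s, w⟩ := p
  induction s using Fin.cases with
  | zero =>
    obtain ⟨z, rfl⟩ := exists_coe_circ w
    rw [pos_zero_apply] at hx
    rw [H.map_zero, pos_zero_apply, H.map, H.coe_congr hx]
  | succ j =>
    obtain ⟨y, hy⟩ := exists_coe_circ (-w)
    obtain rfl : w = -(y : Circ) := by rw [hy, neg_neg]
    rw [H.map_succ]
    by_cases hij : i = j
    · subst hij
      rw [pos_succ_self, neg_neg] at hx ⊢
      exact (H.coe_congr hx).symm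
    · rw [pos_succ_ne _ hij] at hx ⊢
      exact (H.att i j hij x hx).symm

theorem pos_map_congr {p q : Fin (n + 1) × Circ} (h : C'.pos p = C'.pos q) :
    C.pos (circMap (collapseMap φ φ₀) p) = C.pos (circMap (collapseMap φ φ₀) q) := by
  funext i
  obtain ⟨x, hx⟩ := exists_coe_circ (C'.pos p i)
  rw [H.pos_map hx, H.pos_map (hx.trans (congrFun h i))]

theorem spec_map {i : Fin n} {x : ℝ} (h : (x : Circ) ∈ C'.Spec i) : (φ i x : Circ) ∈ C.Spec i := by
  rcases h with h | h | ⟨j, hj, h⟩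
  · left
    have := H.coe_congr (i := i) (y := 0) (by simpa using h)
    simpa [H.zero] using this
  · right; left
    have := H.map i 0
    rw [H.coe_congr h, ← this, H.zero₀]
  · exact Or.inr (Or.inr ⟨j, hj, H.att i j hj.symm x h⟩)

theorem spec_lift {i : Fin n} {x : ℝ} (h : (φ i x : Circ) ∈ C.Spec i) :
    ∃ y : ℝ, (y : Circ) ∈ C'.Spec i ∧ φ i y = φ i x := by
  have key : ∀ y : ℝ, (y : Circ) ∈ C'.Spec i → (φ i x : Circ) = φ i y →
      ∃ y : ℝ, (y : Circ) ∈ C'.Spec i ∧ φ i y = φ i x := by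
    intro y hy he
    obtain ⟨m, hm⟩ := circ_eq_iff.1 he
    refine ⟨y + m, ?_, by rw [H.add_int, hm]⟩
    rwa [show ((y + m : ℝ) : Circ) = y from circ_eq_iff.2 ⟨m, rfl⟩]
  rcases h with h | h | ⟨j, hj, h⟩
  · exact key 0 (Or.inl (by simp)) (by rw [h, H.zero]; simp)
  · refine key (C'.map i 0) (Or.inr (Or.inl rfl)) ?_
    rw [h, ← H.map, H.zero₀]
  · obtain ⟨y, hy⟩ := exists_coe_circ (C'.att i j)
    exact key y (Or.inr (Or.inr ⟨j, hj, hy⟩)) (h.trans (H.att i j hj.symm y hy).symm)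

/-- By `flat` the interval on which `φ i` is constant extends to cut points at both ends. As `x` is
not a cut point itself, it lies strictly inside. -/
theorem interior {i : Fin n} {x : ℝ} (hx : (x : Circ) ∉ C'.Spec i) (h : (φ i x : Circ) ∈ C.Spec i) :
    ∃ a < x, ∃ b, x < b ∧ φ i a = φ i x ∧ φ i b = φ i x := by
  obtain ⟨y, hy, he⟩ := H.spec_lift h
  rcases lt_trichotomy x y with hxy | rfl | hxy
  · obtain ⟨a, ha, b, hb, ha', hb', ha'', hb''⟩ := H.flat i x y hxy he.symm
    exact ⟨a, lt_of_le_of_ne ha fun h => hx (h ▸ ha''), b, hxy.trans_le hb, ha', hb'⟩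
  · exact absurd hy hx
  · obtain ⟨a, ha, b, hb, ha', hb', ha'', hb''⟩ := H.flat i y x hxy he
    exact ⟨a, ha.trans_lt hxy, b, lt_of_le_of_ne hb fun h => hx (h ▸ hb''), ha'.trans he, hb'.trans he⟩

theorem onLeaf_of_map {p : Fin (n + 1) × Circ} (h : OnLeaf C.pos (circMap (collapseMap φ φ₀) p)) :
    OnLeaf C'.pos p := by
  rw [onLeaf_iff] at h ⊢
  obtain ⟨i, hi⟩ := h
  obtain ⟨x, hx⟩ := exists_coe_circ (C'.pos p i)
  rw [H.pos_map hx] at hi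
  exact ⟨i, fun hc => hi (H.spec_map (hx ▸ hc))⟩

theorem eq_of_map_eq {z z' : ℝ} (h : ∀ i, φ i (C'.map i z) = φ i (C'.map i z')) : φ₀ z = φ₀ z' := by
  have := C.sum_sub (φ₀ z') (φ₀ z)
  rw [Finset.sum_eq_zero fun i _ => by rw [H.map, H.map, h]; ring] at this
  linarith

/-- Around such a time the loop of `C'` moves in a single circle, within an arc that `φ i`
collapses. All coordinates of the image rest, and with them its time. -/
theorem eventually_stay_zero {z : ℝ} (h : OnLeaf C'.pos (0, (z : Circ))) (h' : ¬ OnLeaf C.pos (0, (φ₀ z : Circ))) :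
    ∀ᶠ t in 𝓝[>] (0 : ℝ), φ₀ (z + t) = φ₀ z ∧ φ₀ (z - t) = φ₀ z := by
  obtain ⟨i, hi⟩ := onLeaf_iff.1 h
  rw [onLeaf_iff] at h'
  push Not at h'
  have h2 := h' i
  rw [pos_zero_apply] at hi h2
  rw [H.map] at h2
  obtain ⟨a, ha, b, hb, ha', hb'⟩ := H.interior hi h2
  have hne : ∀ j, j ≠ i → (C'.map i z : Circ) ≠ C'.att i j := fun j hj h => hi (Or.inr (Or.inr ⟨j, hj, h⟩))
  have e1 : ∀ᶠ t in 𝓝[>] (0 : ℝ), C'.map i (z + t) < b := by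
    have : Continuous fun t => C'.map i (z + t) := by have := C'.continuous_map i; fun_prop
    exact ((this.tendsto 0).mono_left nhdsWithin_le_nhds).eventually (gt_mem_nhds (by simpa using hb))
  have e2 : ∀ᶠ t in 𝓝[>] (0 : ℝ), a < C'.map i (z - t) := by
    have : Continuous fun t => C'.map i (z - t) := by have := C'.continuous_map i; fun_prop
    exact ((this.tendsto 0).mono_left nhdsWithin_le_nhds).eventually (lt_mem_nhds (by simpa using ha))
  filter_upwards [e1, e2, C'.rightLobe_of_not_att hne, C'.leftLobe_of_not_att hne, self_mem_nhdsWithin]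
    with t h1 h2 h3 h4 ht
  have ht : 0 < t := ht
  constructor <;> refine H.eq_of_map_eq fun k => ?_ <;> by_cases hk : k = i
  · subst hk
    exact le_antisymm ((H.mono k h1.le).trans hb'.le) (H.mono k (C'.mono k (by linarith)))
  · rw [h3.2 k hk]
  · subst hk
    exact le_antisymm (H.mono k (C'.mono k (by linarith))) (ha'.ge.trans (H.mono k h2.le))
  · rw [h4.2 k hk]

theorem eventually_stay {p : Fin (n + 1) × Circ} (h : OnLeaf C'.pos p)
    (h' : ¬ OnLeaf C.pos (circMap (collapseMap φ φ₀) p)) :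
    ∀ᶠ t in 𝓝[>] (0 : ℝ), circMap (collapseMap φ φ₀) (shift t p) = circMap (collapseMap φ φ₀) p := by
  obtain ⟨s, w⟩ := p
  induction s using Fin.cases with
  | zero =>
    obtain ⟨z, rfl⟩ := exists_coe_circ w
    rw [H.map_zero] at h'
    filter_upwards [H.eventually_stay_zero h h'] with t ht
    rw [circMap_shift H.F_add_one, H.map_zero]
    exact congrArg (fun x : ℝ => ((0 : Fin (n + 1)), (x : Circ))) ht.1
  | succ j =>
    obtain ⟨y, hy⟩ := exists_coe_circ (-w)
    obtain rfl : w = -(y : Circ) := by rw [hy, neg_neg]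
    rw [onLeaf_iff] at h h'
    push Not at h'
    obtain ⟨i, hi⟩ := h
    -- On the `j`-th circle the other coordinates are branch points, so only the `j`-th can fail to
    -- be special.
    obtain rfl : i = j := by
      by_contra hij
      rw [pos_succ_ne _ hij] at hi
      exact hi (Or.inr (Or.inr ⟨j, Ne.symm hij, rfl⟩))
    have h2 := h' i
    rw [H.map_succ, pos_succ_self, neg_neg] at h2
    rw [pos_succ_self, neg_neg] at hi
    obtain ⟨a, ha, b, hb, ha', hb'⟩ := H.interior hi h2
    filter_upwards [Ioo_mem_nhdsGT (sub_pos.2 ha)] with t ht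
    have e : shift t (i.succ, -(y : Circ)) = (i.succ, -((y - t : ℝ) : Circ)) := by
      simp [shift]; abel
    rw [e, H.map_succ, H.map_succ,
      le_antisymm (H.mono i (by linarith [ht.1] : y - t ≤ y)) (ha'.ge.trans (H.mono i (by linarith [ht.2])))]

theorem fibreLeaf_map {p q : Fin (n + 1) × Circ} (h : fibreLeaf C'.pos p q)
    (h' : OnLeaf C.pos (circMap (collapseMap φ φ₀) p)) :
    fibreLeaf C.pos (circMap (collapseMap φ φ₀) p) (circMap (collapseMap φ φ₀) q) := by
  refine fibreLeaf_of h' (H.pos_map_congr h.pos_eq) fun he => ?_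
  have h1 : q.1 = p.1 := (Prod.ext_iff.1 he).1
  by_cases hp : p.1 = 0
  · exact fibreLeaf_fst h hp (h1.trans hp)
  · exact hp (h1.symm.trans (fibreLeaf_fst' h hp))

theorem surjective : Function.Surjective (circMap (collapseMap φ φ₀)) := by
  rintro ⟨i, w⟩
  obtain ⟨y, rfl⟩ := exists_coe_circ w
  obtain ⟨x, hx, -⟩ := exists_isGreatest_preimage (H.F_cont i) (H.F_mono i) (H.F_add_one i) y
  exact ⟨(i, (x : Circ)), by rw [circMap_coe H.F_add_one, hx]⟩

/-- The last preimage of a cut point is a cut point. -/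
theorem exists_cut_lift {q : Fin (n + 1) × Circ} (hq : ¬ OnLeaf C.pos q) :
    ∃ p, ¬ OnLeaf C'.pos p ∧ circMap (collapseMap φ φ₀) p = q := by
  have h1 := ncard_right_ends H.F_add_one H.F_mono H.F_cont (finite_singleton q)
  rw [ncard_singleton] at h1
  obtain ⟨p, hp, hp'⟩ := Set.nonempty_of_ncard_ne_zero (h1.trans_ne one_ne_zero)
  refine ⟨p, fun h => ?_, hp⟩
  obtain ⟨t, ht, ht'⟩ := (hp'.and (H.eventually_stay h (by rw [show _ = q from hp]; exact hq))).exists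
  exact ht (ht'.trans hp)

/-- At the last preimage of `z` the map `φ₀` starts to move, so the circle in which the loop of `C'`
continues must be the one in which the loop of `C` continues. Thus a link between two cut points of
`C` lifts to a link within one region of `C'`. -/
theorem merges_right {z : ℝ} {j : Fin n} (hz : ¬ OnLeaf C.pos (0, (z : Circ))) (hj : C.RightLobe z j) :
    ∃ p p', circMap (collapseMap φ φ₀) p = (0, (z : Circ)) ∧
      circMap (collapseMap φ φ₀) p' = (j.succ, -(C.map j z : Circ)) ∧ ¬ OnLeaf C'.pos p ∧ C'.pos p' = C'.pos p := by
  obtain ⟨x, hx, hx'⟩ := exists_isGreatest_preimage H.cont₀ H.mono₀ H.add_one₀ z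
  have hx : φ₀ x = z := hx
  obtain ⟨i, hi⟩ := C'.exists_rightLobe x
  have hlt : ∀ t > 0, z < φ₀ (x + t) := by
    intro t ht
    refine lt_of_le_of_ne (hx ▸ H.mono₀ (by linarith)) fun he => ?_
    have := hx' (show φ₀ (x + t) = z from he.symm)
    linarith
  obtain rfl : i = j := by
    by_contra hij
    obtain ⟨t, ht, ht'⟩ := (hi.and self_mem_nhdsWithin).exists
    have := hj.lt (hlt t ht')
    rw [H.map, ht.2 j (Ne.symm hij), ← H.map, hx] at this
    exact this.false
  refine ⟨(0, (x : Circ)), (i.succ, -(C'.map i x : Circ)), by rw [H.map_zero, hx], ?_, fun h => ?_, hi.pos_eq⟩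
  · rw [H.map_succ, ← H.map, hx]
  · obtain ⟨t, ht, ht'⟩ := ((H.eventually_stay_zero h (by rwa [hx])).and self_mem_nhdsWithin).exists
    have := hlt t ht'
    rw [ht.1, hx] at this
    exact this.false

/-- The mirror image of `merges_right`, with the first preimage, which is the greatest preimage of
the reflected map. -/
theorem merges_left {z : ℝ} {j : Fin n} (hz : ¬ OnLeaf C.pos (0, (z : Circ))) (hj : C.LeftLobe z j) :
    ∃ p p', circMap (collapseMap φ φ₀) p = (0, (z : Circ)) ∧
      circMap (collapseMap φ φ₀) p' = (j.succ, -(C.map j z : Circ)) ∧ ¬ OnLeaf C'.pos p ∧ C'.pos p' = C'.pos p := by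
  obtain ⟨y, hy, hy'⟩ := exists_isGreatest_preimage (f := fun x => -φ₀ (-x)) (H.cont₀.comp continuous_neg).neg
    (fun x y h => neg_le_neg (H.mono₀ (neg_le_neg h))) (fun x => by
      have := H.add_one₀ (-(x + 1))
      rw [show -(x + 1) + 1 = -x by ring] at this
      rw [this]; ring) (-z)
  set x := -y with hxy
  have hx : φ₀ x = z := neg_injective hy
  obtain ⟨i, hi⟩ := C'.exists_leftLobe x
  have hlt : ∀ t > 0, φ₀ (x - t) < z := by
    intro t ht
    refine lt_of_le_of_ne (hx ▸ H.mono₀ (by linarith)) fun he => ?_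
    have := hy' (show -φ₀ (-(y + t)) = -z by rw [← he, hxy]; ring_nf)
    linarith
  obtain rfl : i = j := by
    by_contra hij
    obtain ⟨t, ht, ht'⟩ := (hi.and self_mem_nhdsWithin).exists
    have := hj.lt (hlt t ht')
    rw [H.map, ht.2 j (Ne.symm hij), ← H.map, hx] at this
    exact this.false
  refine ⟨(0, (x : Circ)), (i.succ, -(C'.map i x : Circ)), by rw [H.map_zero, hx], ?_, fun h => ?_, hi.pos_eq⟩
  · rw [H.map_succ, ← H.map, hx]
  · obtain ⟨t, ht, ht'⟩ := ((H.eventually_stay_zero h (by rwa [hx])).and self_mem_nhdsWithin).exists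
    have := hlt t ht'
    rw [ht.2, hx] at this
    exact this.false

/-- Each point of the fibre has a cut point above it. The moves of the loop of `C` connect the
fibre, each of them lifts by `merges_right` or `merges_left`, and different cut points above the
same point are merged by definition. -/
theorem eqvGen_merges {p q : Fin (n + 1) × Circ} (hp : ¬ OnLeaf C'.pos p)
    (hq : C.pos q = C.pos (circMap (collapseMap φ φ₀) p)) :
    ∃ q', circMap (collapseMap φ φ₀) q' = q ∧
      Relation.EqvGen (C'.fam.merges (circMap (collapseMap φ φ₀))) p q' := by
  set f := circMap (collapseMap φ φ₀) with hf
  have hcut : ∀ r, C.pos r = C.pos (f p) → ¬ OnLeaf C.pos r := fun r hr h =>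
    hp (H.onLeaf_of_map (h.congr hr.symm))
  have hlift : ∀ r, ∃ p', C.pos r = C.pos (f p) → ¬ OnLeaf C'.pos p' ∧ f p' = r := by
    intro r
    by_cases hr : C.pos r = C.pos (f p)
    · obtain ⟨p', hp'⟩ := H.exists_cut_lift (hcut r hr)
      exact ⟨p', fun _ => hp'⟩
    · exact ⟨p, fun h => absurd h hr⟩
  choose s hs using hlift
  have hsame : ∀ {a b}, ¬ OnLeaf C'.pos a → ¬ OnLeaf C'.pos b → f a = f b →
      Relation.EqvGen (C'.fam.merges f) a b := fun ha hb h =>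
    Relation.EqvGen.rel _ _ ⟨mem_cuts.2 ha, mem_cuts.2 hb, Or.inr h⟩
  have hreg : ∀ {a b}, ¬ OnLeaf C'.pos a → C'.pos b = C'.pos a → Relation.EqvGen (C'.fam.merges f) a b :=
    fun {a b} ha h => Relation.EqvGen.rel _ _ ⟨mem_cuts.2 ha, mem_cuts.2 fun hb => ha (hb.congr h.symm),
      Or.inl ⟨fibre C'.pos a, ⟨a, rfl, ha⟩, rfl, h⟩⟩
  have hstep : ∀ (z : ℝ) j, C.pos (0, (z : Circ)) = C.pos (f p) → C.pos (j.succ, -(C.map j z : Circ)) = C.pos (0, (z : Circ)) →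
      (∃ a b, f a = (0, (z : Circ)) ∧ f b = (j.succ, -(C.map j z : Circ)) ∧ ¬ OnLeaf C'.pos a ∧ C'.pos b = C'.pos a) →
      Relation.EqvGen (C'.fam.merges f) (s (0, (z : Circ))) (s (j.succ, -(C.map j z : Circ))) := by
    rintro z j h1 h2 ⟨a, b, ha, hb, hac, hab⟩
    have s1 := hs _ h1
    have s2 := hs _ (h2.trans h1)
    exact (hsame s1.1 hac (s1.2.trans ha.symm)).trans _ _ _ ((hreg hac hab).trans _ _ _
      (hsame (fun h => hac (h.congr hab.symm)) s2.1 (hb.trans s2.2.symm)))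
  have main : Relation.EqvGen (fun a b => Relation.EqvGen (C'.fam.merges f) (s a) (s b)) (f p) q := by
    refine eqvGen_of_lobes (C := C) (fun x j hx hj => ?_) (fun x j hx hj => ?_) hq
    · exact hstep x j hx hj.pos_eq (H.merges_right (hcut _ hx) hj)
    · exact (hstep x j hx hj.pos_eq (H.merges_left (hcut _ hx) hj)).symm
  have main' : ∀ a b, Relation.EqvGen (fun a b => Relation.EqvGen (C'.fam.merges f) (s a) (s b)) a b →
      Relation.EqvGen (C'.fam.merges f) (s a) (s b) := by
    intro a b h
    induction h with
    | rel _ _ h => exact h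
    | refl => exact Relation.EqvGen.refl _
    | symm _ _ _ h => exact h.symm
    | trans _ _ _ _ _ h1 h2 => exact h1.trans _ _ _ h2
  refine ⟨s q, (hs q hq).2, (hsame hp (hs _ rfl).1 (hs _ rfl).2.symm).trans _ _ _ (main' _ _ main)⟩

theorem image_merges {p : Fin (n + 1) × Circ} (hp : ¬ OnLeaf C'.pos p) :
    circMap (collapseMap φ φ₀) '' {q | Relation.EqvGen (C'.fam.merges (circMap (collapseMap φ φ₀))) p q} =
      fibre C.pos (circMap (collapseMap φ φ₀) p) := by
  ext r
  constructor
  · rintro ⟨q, hq, rfl⟩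
    clear hp
    induction hq with
    | rel a b h =>
      rcases h.2.2 with ⟨R, hR, ha, hb⟩ | h
      · rw [(mem_region_ofPos hR ha).1] at hb
        exact H.pos_map_congr hb
      · exact congrArg _ h.symm
    | refl => rfl
    | symm _ _ _ h => exact h.symm
    | trans _ _ _ _ _ h1 h2 => exact h2.trans h1
  · intro h
    obtain ⟨q', h1, h2⟩ := H.eqvGen_merges hp h
    exact ⟨q', h2, h1⟩

/-- The collapsed band ends above `R` are open arcs, each counting -1. Such an arc begins after
every cut point above `R` except at the last preimages of the points of `R`, and there are as many
of those as points of `R`. -/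
theorem eul_preimage {R : Set (Fin (n + 1) × Circ)} (hR : R ∈ C.fam.regions) :
    eul (circMap (collapseMap φ φ₀) ⁻¹' R ∩ C'.fam.leafPts) =
      R.ncard - ((C'.fam.cuts ∩ circMap (collapseMap φ φ₀) ⁻¹' R).ncard : ℤ) := by
  set f := circMap (collapseMap φ φ₀) with hf
  have hfin : R.Finite := by
    obtain ⟨p, rfl, -⟩ := hR; exact C.finite_fibre p
  have hcut : ∀ p, f p ∈ R → ¬ OnLeaf C.pos (f p) := fun p hp => (mem_region_ofPos hR hp).2
  set E := {p | f p ∈ R ∧ ∀ᶠ t in 𝓝[>] (0 : ℝ), f (shift t p) ∉ R} with hE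
  have hEn : E.ncard = R.ncard := ncard_right_ends H.F_add_one H.F_mono H.F_cont hfin
  have hEc : E ⊆ C'.fam.cuts ∩ f ⁻¹' R := by
    rintro p ⟨h1, h2⟩
    refine ⟨mem_cuts.2 fun h => ?_, h1⟩
    obtain ⟨t, ht, ht'⟩ := (h2.and (H.eventually_stay h (hcut p h1))).exists
    exact ht (by rw [hf, ht']; exact h1)
  have s1 : {p | p ∈ f ⁻¹' R ∩ C'.fam.leafPts ∧ ∀ᶠ t in 𝓝[>] (0 : ℝ), shift t p ∉ f ⁻¹' R ∩ C'.fam.leafPts} = ∅ := by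
    ext p
    simp only [mem_ofPred_eq, mem_empty_iff_false, iff_false, not_and]
    rintro ⟨h1, h2⟩ h3
    obtain ⟨t, ⟨ht, ht'⟩, ht''⟩ := ((h3.and (H.eventually_stay h2 (hcut p h1))).and (eventually_onLeaf (C := C') p)).exists
    exact ht ⟨by rw [mem_preimage, hf, ht']; exact h1, ht''⟩
  have s2 : {p | p ∉ f ⁻¹' R ∩ C'.fam.leafPts ∧ ∀ᶠ t in 𝓝[>] (0 : ℝ), shift t p ∈ f ⁻¹' R ∩ C'.fam.leafPts} =
      (C'.fam.cuts ∩ f ⁻¹' R) \ E := by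
    ext p
    constructor
    · rintro ⟨h1, h2⟩
      have h3 : f p ∈ R := mem_of_eventually_circMap H.F_add_one H.F_mono H.F_cont hfin (h2.mono fun t ht => ht.1)
      refine ⟨⟨mem_cuts.2 fun h => h1 ⟨h3, h⟩, h3⟩, fun h => ?_⟩
      obtain ⟨t, ht, ht'⟩ := (h.2.and h2).exists
      exact ht ht'.1
    · rintro ⟨⟨h1, h2⟩, h3⟩
      refine ⟨fun h => mem_cuts.1 h1 h.2, ?_⟩
      have h4 := (circMap_right H.F_add_one H.F_mono H.F_cont hfin p).resolve_right fun h => h3 ⟨h2, h⟩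
      filter_upwards [h4, eventually_onLeaf (C := C') p] with t ht ht'
      exact ⟨by rw [mem_preimage, hf, ht]; exact h2, ht'⟩
  have hcf : (C'.fam.cuts ∩ f ⁻¹' R).Finite := C'.isArcFamily.cuts_finite.subset inter_subset_left
  rw [eul, s1, s2, ncard_empty]
  have := Set.ncard_sdiff_add_ncard_of_subset hEc hcf
  rw [hEn] at this
  omega

theorem collapsesTo : CollapsesTo C'.fam C.fam (circMap (collapseMap φ φ₀)) where
  leaf_map p q h h' := H.fibreLeaf_map h (by rwa [mem_cuts, not_not] at h')
  leaf_lift p q h := by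
    obtain ⟨p', rfl⟩ := H.surjective p
    obtain ⟨q', hq'⟩ := H.onLeaf_of_map ⟨q, h⟩
    refine ⟨p', q', hq', rfl, ?_⟩
    exact C.isArcFamily.leaf_unique _ _ _ (H.fibreLeaf_map hq' ⟨q, h⟩) h
  regions_eq := by
    ext R
    constructor
    · rintro ⟨q, rfl, hq⟩
      obtain ⟨p, hp, rfl⟩ := H.exists_cut_lift hq
      exact ⟨p, mem_cuts.2 hp, (H.image_merges hp).symm⟩
    · rintro ⟨p, hp, rfl⟩
      rw [mem_cuts] at hp
      rw [H.image_merges hp]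
      exact ⟨_, rfl, fun h => hp (H.onLeaf_of_map h)⟩
  chi_eq R hR := by
    classical
    set f := circMap (collapseMap φ φ₀) with hf
    have h0 : f (0, 0) = (0, 0) := by
      have := H.map_zero 0
      simpa [H.zero₀] using this
    have hroot : ∀ j, f (C'.root j) = C.root j := by
      intro j
      rw [root, root, hf, H.map_succ, ← H.map, H.zero₀]
    have hsat : ∀ p q, C.pos p = C.pos q → (p ∈ R ↔ q ∈ R) := by
      obtain ⟨r, rfl, -⟩ := hR
      intro p q h
      simp only [mem_fibre, h]
    -- The collapse carries roots to roots and the base point to the base point, so these terms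
    -- agree in the two counts; what is left is the formula for the Euler characteristic.
    have c1 := C.ncard_cuts_inter hsat
    have c2 := C'.ncard_cuts_inter (Y := f ⁻¹' R) fun p q h => hsat _ _ (H.pos_map_congr h)
    simp only [mem_preimage, h0, hroot] at c2
    have e1 : C.fam.cuts ∩ R = R := inter_eq_right.2 fun p hp => mem_cuts.2 (mem_region_ofPos hR hp).2
    have e2 : {R' ∈ C.fam.regions | R' ⊆ R} = {R} := by
      ext R'
      constructor
      · rintro ⟨h1, h2⟩
        obtain ⟨p, hp⟩ := C.isArcFamily.regions_nonempty R' h1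
        exact C.isArcFamily.regions_disjoint R' h1 R hR p hp (h2 hp)
      · rintro rfl; exact ⟨hR, subset_rfl⟩
    rw [e1, e2, ncard_singleton] at c1
    have e3 : {R' ∈ C'.fam.regions | f '' R' ⊆ R} = {R' ∈ C'.fam.regions | R' ⊆ f ⁻¹' R} := by
      simp only [image_subset_iff]
    rw [H.eul_preimage hR, show C.fam.chi R = 1 from Set.indicator_of_mem hR 1, e3,
      show C'.fam = ofPos _ _ from rfl, finsum_chi_ofPos fun R' h => h.1]
    rw [show C'.fam = ofPos _ _ from rfl] at c2
    rw [c1, c2]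
    push_cast
    ring
  pun_eq R hR := by simp [fam, ofPos]

theorem near {ε : ℝ} (h0 : ∀ x, |φ₀ x - x| < ε) (h : ∀ i x, |φ i x - x| < ε)
    (hl : ∀ i, |C'.len i - C.len i| < ε) : Near ε C'.fam C.fam := by
  have hε : 0 < ε := (abs_nonneg _).trans_lt (h0 0)
  refine ⟨collapseMap φ φ₀, fun i => ⟨H.F_mono i, H.F_cont i, ?_⟩, fun i x _ => ?_, fun i => ?_, H.collapsesTo⟩
  · have h1 : collapseMap φ φ₀ i 0 = 0 := by
      induction i using Fin.cases with
      | zero => exact H.zero₀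
      | succ i => simp [collapseMap, H.zero]
    refine ⟨h1, ?_⟩
    have := H.F_add_one i 0
    rwa [zero_add, h1, zero_add] at this
  · induction i using Fin.cases with
    | zero => exact h0 x
    | succ i =>
      have := h i (-x)
      rw [← abs_neg] at this
      convert this using 2
      simp [collapseMap]; ring
  · induction i using Fin.cases with
    | zero => simpa using hε
    | succ i =>
      rw [fam_len_succ, fam_len_succ, ← sub_div, abs_div, abs_two]
      have := hl i
      have := abs_nonneg (C'.len i - C.len i)
      linarith

end Collapse
end Cactus

/-! ## Continuity of families of cacti -/

theorem circ_ne_of_half {x : ℝ} {y : Circ} (h : (x : Circ) = y) : ((x + 1 / 2 : ℝ) : Circ) ≠ y := by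
  intro h'
  have := circ_eq_of_lt (h'.trans h.symm) (by linarith) (by linarith)
  linarith

namespace Cactus
open ArcData

variable {n : ℕ} {C C' : Cactus n}

/-- The points of attachment depend continuously on the cactus. -/
theorem exists_att_close {η : ℝ} (hη : η ≤ 1 / 6) (h : ∀ i z, |C'.map i z - C.map i z| < η) {i j : Fin n}
    (hij : i ≠ j) {c : ℝ} (hc : (c : Circ) = C.att i j) : ∃ c' : ℝ, (c' : Circ) = C'.att i j ∧ |c' - c| < η := by
  obtain ⟨d, hd⟩ := exists_coe_circ (C.att j i)
  -- Two times are compared, one third and two thirds of a turn after the branch point of the circle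
  -- `j`. The perturbed loop cannot be at its own branch point at both, so at one of them its `i`-th
  -- coordinate shows the perturbed point of attachment.
  have key : ∀ s, 0 < s → s < 1 → ∃ z, C.map j z = d + s ∧ (C.map i z : Circ) = C.att i j := by
    intro s h0 h1
    obtain ⟨z, hz⟩ := C.exists_map_eq j (d + s)
    refine ⟨z, hz, (C.att_spec hij z).resolve_right fun hc => ?_⟩
    have := circ_eq_of_lt ((hz ▸ hc).trans hd.symm) (by linarith) (by linarith)
    linarith
  have good : ∀ z, (C.map i z : Circ) = C.att i j → (C'.map i z : Circ) = C'.att i j →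
      ∃ c' : ℝ, (c' : Circ) = C'.att i j ∧ |c' - c| < η := by
    intro z h1 h2
    obtain ⟨m, hm⟩ := circ_eq_iff.1 (hc.trans h1.symm)
    refine ⟨C'.map i z + m, ?_, ?_⟩
    · rw [← h2]; exact circ_eq_iff.2 ⟨m, rfl⟩
    · rw [hm]; convert h i z using 2; ring
  obtain ⟨z1, h1, h1'⟩ := key (1 / 3) (by norm_num) (by norm_num)
  obtain ⟨z2, h2, h2'⟩ := key (2 / 3) (by norm_num) (by norm_num)
  rcases C'.att_spec hij z1 with h3 | h3
  · exact good z1 h1' h3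
  · rcases C'.att_spec hij z2 with h4 | h4
    · exact good z2 h2' h4
    · have e1 := abs_lt.1 (h j z1)
      have e2 := abs_lt.1 (h j z2)
      have := circ_eq_of_lt (h3.trans h4.symm) (by linarith) (by linarith)
      linarith

/-- Two monotone functions, one of which is at a lattice point at any time: the second one is constant
while the first one is between lattice points. -/
theorem const_between {u w : ℝ → ℝ} (hu : Monotone u) (hw : Monotone w) (hwc : Continuous w) {c d : Circ}
    (h : ∀ t, (u t : Circ) = c ∨ (w t : Circ) = d) {a s t : ℝ} (ha : (a : Circ) = c)
    (hs : u s ∈ Ioo a (a + 1)) (ht : u t ∈ Ioo a (a + 1)) : w s = w t := by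
  wlog hst : s ≤ t generalizing s t
  · exact (this ht hs (le_of_not_ge hst)).symm
  have hlat : ∀ r ∈ Icc s t, (w r : Circ) = d := by
    intro r hr
    refine (h r).resolve_left fun hc => ?_
    have h1 := hu hr.1
    have h2 := hu hr.2
    have := circ_eq_of_lt (hc.trans ha.symm) (by linarith [ht.2]) (by linarith [hs.1])
    linarith [hs.1]
  by_contra hne
  have hlt := lt_of_le_of_ne (hw hst) hne
  have h1 : w s + 1 ≤ w t := by
    obtain ⟨m, hm⟩ := circ_eq_iff.1 ((hlat t ⟨hst, le_rfl⟩).trans (hlat s ⟨le_rfl, hst⟩).symm)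
    have h2 : (0:ℝ) < m := by linarith
    have h3 : (1:ℤ) ≤ m := by exact_mod_cast h2
    have h4 : (1:ℝ) ≤ m := by exact_mod_cast h3
    linarith
  obtain ⟨r, hr, hr'⟩ := intermediate_value_Icc hst hwc.continuousOn
    (show w s + 1 / 2 ∈ Icc (w s) (w t) from ⟨by linarith, by linarith⟩)
  refine circ_ne_of_half (hlat s ⟨le_rfl, hst⟩) ?_
  rw [← hr']; exact hlat r hr

/-- Two close monotone curves in a wedge of two circles have the same image in the plane, which is a
staircase; so their points are comparable. -/
theorem not_crossing {u w u' w' : ℝ → ℝ} (hu : Monotone u) (hw : Monotone w) (hwc : Continuous w)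
    (hu' : Monotone u') (hw' : Monotone w') (hwc' : Continuous w')
    (hus : Function.Surjective u) (hus' : Function.Surjective u') {c d : Circ}
    (h : ∀ t, (u t : Circ) = c ∨ (w t : Circ) = d) (h' : ∀ t, (u' t : Circ) = c ∨ (w' t : Circ) = d)
    (hcu : ∀ t, |u' t - u t| < 1 / 2) (hcw : ∀ t, |w' t - w t| < 1 / 2) {z y : ℝ}
    (h1 : u' z < u y) (h2 : w y < w' z) : False := by
  obtain ⟨a₀, ha₀⟩ := exists_coe_circ c
  -- A level off the lattice which the first curve reaches by the time `y` and the second one only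
  -- after `z`; at this level the other coordinate of each curve rests.
  obtain ⟨e, he, hec⟩ : ∃ e ∈ Ioo (u' z) (u y), (e : Circ) ≠ c := by
    by_cases hm : ((min ((u' z + u y) / 2) (u' z + 1 / 2) : ℝ) : Circ) = c
    · refine ⟨(u' z + min ((u' z + u y) / 2) (u' z + 1 / 2)) / 2, ?_, fun h => ?_⟩
      · have := min_le_left ((u' z + u y) / 2) (u' z + 1 / 2)
        have : u' z < min ((u' z + u y) / 2) (u' z + 1 / 2) := lt_min (by linarith) (by linarith)
        constructor <;> linarith
      · have := min_le_right ((u' z + u y) / 2) (u' z + 1 / 2)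
        have : u' z < min ((u' z + u y) / 2) (u' z + 1 / 2) := lt_min (by linarith) (by linarith)
        have := circ_eq_of_lt (h.trans hm.symm) (by linarith) (by linarith)
        linarith
    · refine ⟨_, ⟨lt_min (by linarith) (by linarith), ?_⟩, hm⟩
      exact (min_le_left _ _).trans_lt (by linarith)
  obtain ⟨a, hae, ha⟩ : ∃ a : ℝ, e ∈ Ioo a (a + 1) ∧ (a : Circ) = c := by
    obtain ⟨x, hx, hx'⟩ := exists_coe_circ_Ico c (e - 1)
    refine ⟨x, ⟨?_, by linarith [hx.1, lt_of_le_of_ne hx.1 fun h => hec (by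
      rw [← hx', ← h]; exact circ_eq_iff.2 ⟨1, by simp⟩)]⟩, hx'⟩
    linarith [hx.2]
  obtain ⟨t, ht⟩ := hus e
  obtain ⟨s, hs⟩ := hus' e
  obtain ⟨t', ht'⟩ := hus (a + 1 / 2)
  obtain ⟨s', hs'⟩ := hus' (a + 1 / 2)
  have hty : t ≤ y := by
    by_contra hc; have := hu (not_le.1 hc).le; linarith [he.2]
  have hzs : z ≤ s := by
    by_contra hc; have := hu' (not_le.1 hc).le; linarith [he.1]
  have w1 := hw hty
  have w2 := hw' hzs
  -- In the strip between `a` and `a + 1` both `w` and `w'` are constant lattice values. Compared at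
  -- the middle of the strip they are closer than one turn, hence equal, against `w y < w' z`.
  have hI : a + 1 / 2 ∈ Ioo a (a + 1) := ⟨by linarith, by linarith⟩
  have k1 : w t = w t' := const_between hu hw hwc h ha (ht ▸ hae) (ht' ▸ hI)
  have k2 : w' s = w' s' := const_between hu' hw' hwc' h' ha (hs ▸ hae) (hs' ▸ hI)
  have e1 := abs_lt.1 (hcu s')
  have e2 := abs_lt.1 (hcw s')
  have hIs : u s' ∈ Ioo a (a + 1) := ⟨by linarith, by linarith⟩
  have k3 : w s' = w t' := const_between hu hw hwc h ha hIs (ht' ▸ hI)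
  have l1 : (w t' : Circ) = d := (h t').resolve_left fun hc => by
    have := circ_eq_of_lt (hc.trans ha.symm) (by linarith) (by linarith)
    linarith
  have l2 : (w' s' : Circ) = d := (h' s').resolve_left fun hc => by
    have := circ_eq_of_lt (hc.trans ha.symm) (by linarith) (by linarith)
    linarith
  have := circ_eq_of_lt (l2.trans l1.symm) (by linarith) (by linarith)
  linarith

/-- The circles are collapsed by interpolation, matching the roots and branch points of `C'` with
those of `C`. The loop of `C'`, pushed forward by the maps `φ i`, then runs through the same wedges
as the loop of `C` and stays close to it; so it is the same curve, up to a change of time. -/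
theorem exists_collapse (C : Cactus n) {ε : ℝ} (hε : 0 < ε) : ∃ η > 0, ∀ C' : Cactus n,
    (∀ i z, |C'.map i z - C.map i z| < η) → ∃ φ φ₀, Collapse C' C φ φ₀ ∧ (∀ x, |φ₀ x - x| < ε) ∧
      ∀ i x, |φ i x - x| < ε := by
  have hlift : ∀ i j, ∃ c : ℝ, (i ≠ j → (c : Circ) = C.att i j) ∧ (i = j → c = 0) := fun i j => by
    by_cases hij : i = j
    · exact ⟨0, fun h => absurd hij h, fun _ => rfl⟩
    · obtain ⟨c, hc⟩ := exists_coe_circ (C.att i j)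
      exact ⟨c, fun _ => hc, fun h => absurd h hij⟩
  choose c hc hc0 using hlift
  set κ := min (ε / 4) (1 / 8) with hκ
  have hκ0 : 0 < κ := by positivity
  choose η hη0 hη using fun i => exists_circle_interpolation
    (Λ := Option (Fin n)) (fun l => l.elim (C.map i 0) (c i)) hκ0
  obtain ⟨η', hη', hη'0⟩ : ∃ η' > 0, ∀ i, η' ≤ η i := by
    rcases isEmpty_or_nonempty (Fin n) with hn | hn
    · exact ⟨1, one_pos, fun i => hn.elim i⟩
    · obtain ⟨i, -, hi⟩ := Finset.exists_min_image Finset.univ η Finset.univ_nonempty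
      exact ⟨η i, hη0 i, fun j => hi j (Finset.mem_univ j)⟩
  refine ⟨min η' (min (ε / 4) (1 / 8)), by positivity, fun C' hC => ?_⟩
  have hC1 : ∀ i z, |C'.map i z - C.map i z| < η' := fun i z => (hC i z).trans_le (min_le_left _ _)
  have hC2 : ∀ i z, |C'.map i z - C.map i z| < κ := fun i z => (hC i z).trans_le (min_le_right _ _)
  have hatt : ∀ i j, ∃ c' : ℝ, |c' - c i j| < η' ∧ (i ≠ j → (c' : Circ) = C'.att i j) ∧ (i = j → c' = 0) := by
    intro i j
    by_cases hij : i = j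
    · exact ⟨c i j, by simpa using hη', fun h => absurd hij h, hc0 i j⟩
    · obtain ⟨c', h1, h2⟩ := exists_att_close (η := min η' κ)
        ((min_le_right _ _).trans ((min_le_right _ _).trans (by norm_num))) hC hij (hc i j hij)
      exact ⟨c', h2.trans_le (min_le_left _ _), fun _ => h1, fun h => absurd h hij⟩
  choose c' hc1 hc2 hc3 using hatt
  choose φ f1 f2 f3 f4 f5 f6 f7 using fun i => hη i (fun l => l.elim (C'.map i 0) (c' i)) (by
    rintro (_ | j)
    · exact (hC1 i 0).trans_le (hη'0 i)
    · exact (hc1 i j).trans_le (hη'0 i))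
  have f50 : ∀ i, φ i (C'.map i 0) = C.map i 0 := fun i => f5 i none
  have f5c : ∀ i j, φ i (c' i j) = c i j := fun i j => f5 i (some j)
  have fint : ∀ i (x : ℝ) (m : ℤ), φ i (x + m) = φ i x + m := fun i =>
    CircleDeg1Lift.map_add_int ⟨⟨φ i, f1 i⟩, f3 i⟩
  have fatt : ∀ i j, i ≠ j → ∀ x : ℝ, (x : Circ) = C'.att i j → (φ i x : Circ) = C.att i j := by
    intro i j hij x hx
    obtain ⟨m, rfl⟩ := circ_eq_iff.1 (hx.trans (hc2 i j hij).symm)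
    rw [fint, f5c, ← hc i j hij]
    exact circ_eq_iff.2 ⟨m, rfl⟩
  have hv : ∀ i z, |φ i (C'.map i z) - C.map i z| < 2 * κ := fun i z => by
    have e1 := f6 i (C'.map i z)
    have e2 := hC2 i z
    calc _ = |(φ i (C'.map i z) - C'.map i z) + (C'.map i z - C.map i z)| := by ring_nf
      _ ≤ _ := abs_add_le _ _
      _ < _ := by linarith
  have hκ8 : 2 * κ ≤ 1 / 4 := by have := min_le_right (ε / 4) (1 / 8); linarith
  have hκε : 2 * κ ≤ ε / 2 := by have := min_le_left (ε / 4) (1 / 8); linarith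
  -- By `sum_map` this is the only time at which the loop of `C` can have the required coordinates.
  set φ₀ : ℝ → ℝ := fun z => ∑ i, C.len i * (φ i (C'.map i z) - C.map i 0) with hφ₀
  have hmono : Monotone φ₀ := fun x y hxy => Finset.sum_le_sum fun i _ =>
    mul_le_mul_of_nonneg_left (sub_le_sub_right (f1 i (C'.mono i hxy)) _) (C.len_pos i).le
  have hsurj : ∀ i, Function.Surjective fun z => φ i (C'.map i z) := fun i y => by
    obtain ⟨x, hx, -⟩ := exists_isGreatest_preimage (f := fun z => φ i (C'.map i z))
      ((f2 i).comp (C'.continuous_map i)) ((f1 i).comp (C'.mono i))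
      (fun x => by simp only [C'.map_add_one, f3]) y
    exact ⟨x, hx⟩
  have hmap : ∀ i z, C.map i (φ₀ z) = φ i (C'.map i z) := by
    intro i z
    have hsum : ∑ i, C.len i * (φ i (C'.map i z) - C.map i (φ₀ z)) = 0 := by
      have h1 := C.sum_map (φ₀ z)
      have h2 : ∑ i, C.len i * (φ i (C'.map i z) - C.map i 0) = φ₀ z := rfl
      rw [← sub_eq_zero] at h1
      rw [← sub_eq_zero.2 (h2.trans (sub_eq_zero.1 h1).symm), ← Finset.sum_sub_distrib]
      exact Finset.sum_congr rfl fun i _ => by ring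
    -- No coordinate can be ahead while another one is behind. As the weighted differences add up to
    -- 0, they all vanish.
    have hcross : ∀ i j, φ i (C'.map i z) < C.map i (φ₀ z) → ¬ C.map j (φ₀ z) < φ j (C'.map j z) := by
      intro i j h1 h2
      have hij : i ≠ j := by rintro rfl; exact lt_asymm h1 h2
      refine not_crossing (u := C.map i) (w := C.map j) (u' := fun z => φ i (C'.map i z))
        (w' := fun z => φ j (C'.map j z)) (C.mono i) (C.mono j) (C.continuous_map j)
        ((f1 i).comp (C'.mono i)) ((f1 j).comp (C'.mono j)) ((f2 j).comp (C'.continuous_map j))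
        (C.exists_map_eq i) (hsurj i) (C.att_spec hij) (fun t => ?_) (fun t => (hv i t).trans_le (by linarith))
        (fun t => (hv j t).trans_le (by linarith)) h1 h2
      exact (C'.att_spec hij t).imp (fatt i j hij _) (fatt j i hij.symm _)
    by_cases hlt : ∃ j, φ j (C'.map j z) < C.map j (φ₀ z)
    · obtain ⟨j, hj⟩ := hlt
      have hle : ∀ k ∈ Finset.univ, C.len k * (φ k (C'.map k z) - C.map k (φ₀ z)) ≤ 0 := fun k _ =>
        mul_nonpos_of_nonneg_of_nonpos (C.len_pos k).le (sub_nonpos.2 (not_lt.1 (hcross j k hj)))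
      have := (Finset.sum_eq_zero_iff_of_nonpos hle).1 hsum i (Finset.mem_univ i)
      have := (mul_eq_zero.1 this).resolve_left (C.len_pos i).ne'
      linarith
    · push Not at hlt
      have hle : ∀ k ∈ Finset.univ, 0 ≤ C.len k * (φ k (C'.map k z) - C.map k (φ₀ z)) := fun k _ =>
        mul_nonneg (C.len_pos k).le (sub_nonneg.2 (hlt k))
      have := (Finset.sum_eq_zero_iff_of_nonneg hle).1 hsum i (Finset.mem_univ i)
      have := (mul_eq_zero.1 this).resolve_left (C.len_pos i).ne'
      linarith
  refine ⟨φ, φ₀, ?_, fun x => ?_, fun i x => ?_⟩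
  · refine ⟨f1, f2, f3, f4, hmono, ?_, fun x => ?_, ?_, hmap, fatt, fun i x y hxy he => ?_⟩
    · refine continuous_finsetSum _ fun i _ => ?_
      exact continuous_const.mul (((f2 i).comp (C'.continuous_map i)).sub continuous_const)
    · simp only [hφ₀, C'.map_add_one, f3]
      have h1 : ∀ i, C.len i * (φ i (C'.map i x) + 1 - C.map i 0) =
          C.len i * (φ i (C'.map i x) - C.map i 0) + C.len i := fun i => by ring
      rw [Finset.sum_congr rfl fun i _ => h1 i, Finset.sum_add_distrib, C.len_sum]
    · simp only [hφ₀, f50, sub_self, mul_zero, Finset.sum_const_zero]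
    · have hspec : ∀ a : ℝ, ((a : Circ) = 0 ∨ ∃ l : Option (Fin n), (a : Circ) = (l.elim (C'.map i 0) (c' i) : ℝ)) →
          (a : Circ) ∈ C'.Spec i := by
        rintro a (h | ⟨_ | j, h⟩)
        · exact Or.inl h
        · exact Or.inr (Or.inl h)
        · by_cases hij : i = j
          · exact Or.inl (by rw [h]; simp [hc3 i j hij])
          · exact Or.inr (Or.inr ⟨j, Ne.symm hij, h.trans (hc2 i j hij)⟩)
      obtain ⟨a, ha, b, hb, ha', hb', ha'', hb''⟩ := f7 i x y hxy he
      exact ⟨a, ha, b, hb, ha', hb', hspec a ha'', hspec b hb''⟩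
  · have h1 : φ₀ x - x = ∑ i, C.len i * (φ i (C'.map i x) - C.map i x) := by
      have := C.sum_map x
      simp only [hφ₀]
      nth_rewrite 2 [← this]
      rw [← Finset.sum_sub_distrib]
      exact Finset.sum_congr rfl fun i _ => by ring
    rw [h1]
    refine (Finset.abs_sum_le_sum_abs _ _).trans_lt (lt_of_le_of_lt ?_ (by linarith : ε / 2 < ε))
    calc ∑ i, |C.len i * (φ i (C'.map i x) - C.map i x)| ≤ ∑ i, C.len i * (ε / 2) := by
          refine Finset.sum_le_sum fun i _ => ?_
          rw [abs_mul, abs_of_pos (C.len_pos i)]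
          exact mul_le_mul_of_nonneg_left ((hv i x).le.trans hκε) (C.len_pos i).le
      _ = ε / 2 := by rw [← Finset.sum_mul, C.len_sum, one_mul]
  · exact (f6 i x).trans_lt (by have := min_le_left (ε / 4) (1 / 8); linarith)

theorem exists_near (C : Cactus n) {ε : ℝ} (hε : 0 < ε) : ∃ η > 0, ∀ C' : Cactus n,
    (∀ i z, |C'.map i z - C.map i z| < η) → (∀ i, |C'.len i - C.len i| < ε) → Near ε C'.fam C.fam := by
  obtain ⟨η, hη, h⟩ := C.exists_collapse hε
  refine ⟨η, hη, fun C' h1 h2 => ?_⟩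
  obtain ⟨φ, φ₀, H, h3, h4⟩ := h C' h1
  exact H.near h3 h4 h2

end Cactus

/-- A sufficient criterion for continuity in the topology of the arc complex. -/
theorem continuous_of_near {S : ∀ n, Set (Fam n)} {n : ℕ} {X : Type*} [TopologicalSpace X] {g : X → Space S n}
    (h : ∀ x, ∀ ε > 0, ∀ᶠ y in 𝓝 x, ArcData.Near ε (g y).1 (g x).1) : Continuous g := by
  refine continuous_def.2 fun U hU => isOpen_iff_mem_nhds.2 fun x hx => ?_
  obtain ⟨ε, hε, hε'⟩ := hU (g x) hx
  filter_upwards [h x ε hε] with y hy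
  exact hε' _ hy

/-- The arc family of a cactus as a point of the space of arc families. -/
def Cactus.toSpace {S : ∀ n, Set (Fam n)} (hS : ∀ n, ARCcp n ⊆ S n) {n : ℕ} (C : Cactus n) : Space S n :=
  ⟨C.fam, hS n C.fam_mem⟩

/-- Families of cacti with continuous lengths and coordinates are continuous. -/
theorem continuous_fam {S : ∀ n, Set (Fam n)} (hS : ∀ n, ARCcp n ⊆ S n) {n : ℕ} {X : Type*} [TopologicalSpace X]
    {C : X → Cactus n} (hl : ∀ i, Continuous fun x => (C x).len i)
    (hm : ∀ i, Continuous fun p : X × ℝ => (C p.1).map i p.2) :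
    Continuous fun x => (C x).toSpace hS := by
  refine continuous_of_near fun x ε hε => ?_
  obtain ⟨η, hη, h⟩ := (C x).exists_near hε
  have h1 : ∀ᶠ y in 𝓝 x, ∀ i, |(C y).len i - (C x).len i| < ε := by
    rw [eventually_all]; intro i
    have := ((hl i).tendsto x).eventually (Metric.ball_mem_nhds _ hε)
    filter_upwards [this] with y hy
    simpa [Real.dist_eq] using hy
  -- Compactness of one period makes the closeness uniform, and degree one extends it to the line.
  have h2 : ∀ᶠ y in 𝓝 x, ∀ i, ∀ z ∈ Icc (0:ℝ) 1, |(C y).map i z - (C x).map i z| < η := by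
    rw [eventually_all]; intro i
    refine isCompact_Icc.eventually_forall_of_forall_eventually fun z _ => ?_
    have hc : Continuous fun p : X × ℝ => (C p.1).map i p.2 - (C x).map i p.2 :=
      (hm i).sub (((C x).continuous_map i).comp continuous_snd)
    have := (hc.tendsto (x, z)).eventually (Metric.ball_mem_nhds _ hη)
    filter_upwards [this] with p hp
    simpa [Real.dist_eq] using hp
  filter_upwards [h1, h2] with y hy1 hy2
  refine h (C y) (fun i z => ?_) hy1
  have e := hy2 i (Int.fract z) ⟨Int.fract_nonneg z, (Int.fract_lt_one z).le⟩
  have e1 := (C y).map_add_int i (Int.fract z) ⌊z⌋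
  have e2 := (C x).map_add_int i (Int.fract z) ⌊z⌋
  rw [Int.fract_add_floor] at e1 e2
  rw [e1, e2]
  simpa using e

/-! ## The basic families as cacti -/

namespace Cactus
open ArcData

/-- One circle, rotated by `x`. -/
def circle (x : ℝ) : Cactus 1 where
  len _ := 1
  map _ z := z + x
  len_pos _ := one_pos
  len_sum := by simp
  mono _ z z' h := by simpa using h
  map_add_one _ z := by ring
  sum_map z := by simp
  wedge := ⟨0, fun i j h => absurd (Subsingleton.elim i j) h⟩

theorem circle_pos_zero (x : ℝ) (w : Circ) : (circle x).pos (0, w) = fun _ => w + (x : Circ) := by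
  obtain ⟨z, rfl⟩ := exists_coe_circ w
  rw [pos_zero]; funext i; simp [circle]

theorem circle_pos_one (x : ℝ) (w : Circ) : (circle x).pos (1, w) = fun _ => -w := by
  funext i
  obtain rfl : i = 0 := Subsingleton.elim _ _
  exact (circle x).pos_succ_self 0 w

theorem circle_fibre (x : ℝ) (p : Fin 2 × Circ) :
    fibre (circle x).pos p = {p, (1 - p.1, -(x : Circ) - p.2)} := by
  have key : ∀ a b : Circ, ((fun _ : Fin 1 => a) = fun _ => b) ↔ a = b :=
    fun a b => ⟨fun h => congrFun h 0, fun h => by rw [h]⟩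
  obtain ⟨i, v⟩ := p
  ext ⟨j, w⟩
  simp only [mem_fibre, mem_insert_iff, mem_singleton_iff, Prod.mk.injEq]
  fin_cases i <;> fin_cases j <;>
    simp only [Fin.zero_eta, Fin.mk_one, circle_pos_zero, circle_pos_one, key, true_and, false_and, or_false, false_or,
      sub_self, sub_zero, one_ne_zero, zero_ne_one, add_left_inj, neg_inj, eq_comm (a := w)]
  · exact ⟨fun h => by rw [← neg_neg w, h]; abel, fun h => by rw [← h]; abel⟩
  · exact ⟨fun h => by rw [← neg_neg v, ← h]; abel, fun h => by rw [← h]; abel⟩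

/-- On the inner circle the position is the negative of the coordinate, so facing points satisfy
`p.2 + q.2 = -x`. The loop `s ↦ δ_s` therefore rotates by `-s`. -/
theorem deltaFam_eq (x : ℝ) : deltaFam ((-x : ℝ) : Circ) = (circle x).fam := by
  have hne : ∀ p : Fin 2 × Circ, p ≠ (1 - p.1, -(x : Circ) - p.2) := by
    rintro ⟨i, w⟩ h
    have := (Prod.ext_iff.1 h).1
    fin_cases i <;> simp at this
  have hleaf : ∀ p q, fibreLeaf (circle x).pos p q ↔ p.1 ≠ q.1 ∧ p.2 + q.2 = ((-x : ℝ) : Circ) ∧ p.2 ≠ 0 ∧ q.2 ≠ 0 := by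
    intro p q
    constructor
    · rintro ⟨h1, h2, h3, h4⟩
      have hq : q ∈ fibre (circle x).pos p := by rw [h2]; simp
      rw [circle_fibre] at hq
      obtain rfl := hq.resolve_left (Ne.symm h1)
      refine ⟨?_, by simp, h3, h4⟩
      obtain ⟨i, w⟩ := p
      fin_cases i <;> simp
    · rintro ⟨h1, h2, h3, h4⟩
      obtain rfl : q = (1 - p.1, -(x : Circ) - p.2) := by
        refine Prod.ext ?_ ?_
        · obtain ⟨i, w⟩ := p
          obtain ⟨j, v⟩ := q
          fin_cases i <;> fin_cases j <;> simp at h1 ⊢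
        · rw [← AddCircle.coe_neg, ← h2]; simp
      exact ⟨hne p, circle_fibre x p, h3, h4⟩
  have hregions : (deltaFam ((-x : ℝ) : Circ)).regions = (circle x).fam.regions := by
    ext R
    have hR : R ∈ (circle x).fam.regions ↔ ∃ p, R = fibre (circle x).pos p ∧ ¬ OnLeaf (circle x).pos p := Iff.rfl
    rw [hR]
    have hbase : ∀ i : Fin 2, ¬ OnLeaf (circle x).pos (i, 0) := fun i ⟨q, hq⟩ => hq.2.2.1 rfl
    have f0 : fibre (circle x).pos (0, 0) = {(0, 0), (1, ((-x : ℝ) : Circ))} := by rw [circle_fibre]; simp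
    have f1 : fibre (circle x).pos (1, 0) = {(1, 0), (0, ((-x : ℝ) : Circ))} := by rw [circle_fibre]; simp
    constructor
    · rintro (h | h)
      · exact ⟨(0, 0), h.trans f0.symm, hbase 0⟩
      · exact ⟨(1, 0), h.trans f1.symm, hbase 1⟩
    · rintro ⟨p, rfl, hp⟩
      have : ∃ i : Fin 2, (circle x).pos (i, 0) = (circle x).pos p := by
        by_contra hc
        push Not at hc
        refine hp ⟨_, hne p, circle_fibre x p, fun h => hc p.1 (by rw [← h]), fun h => hc (1 - p.1) ?_⟩
        have : (1 - p.1, -(x : Circ) - p.2) ∈ fibre (circle x).pos p := by rw [circle_fibre]; simp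
        rw [← mem_fibre, ← show -(x : Circ) - p.2 = 0 from h]; exact this
      obtain ⟨i, hi⟩ := this
      rw [← fibre_congr hi]
      fin_cases i
      · exact Or.inl f0
      · exact Or.inr f1
  refine ArcData.ext ?_ ?_ hregions ?_ rfl
  · funext i
    fin_cases i
    · rfl
    · exact (show (1:ℝ) / 2 = 1 / 2 from rfl)
  · funext p q
    exact propext (hleaf p q).symm
  · exact congrArg (fun 𝓡 => Set.indicator 𝓡 1) hregions

/-- The coordinate of a loop that runs through the first circle in `[0, a]`. -/
def lobe₁ (a : ℝ) : ℝ → ℝ := degOne fun t => min (t / a) 1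

/-- The coordinate of a loop that runs through the second circle in `[a, 1]`. -/
def lobe₂ (a : ℝ) : ℝ → ℝ := degOne fun t => max ((t - a) / (1 - a)) 0

section Lobes

variable {a : ℝ} (h0 : 0 < a) (h1 : a < 1)
include h0 h1

theorem lobe₁_zero_one : (fun t : ℝ => min (t / a) 1) 0 = 0 ∧ (fun t : ℝ => min (t / a) 1) 1 = 1 := by
  refine ⟨by simp, min_eq_right ?_⟩
  rw [le_div_iff₀ h0]; linarith

theorem lobe₂_zero_one : (fun t : ℝ => max ((t - a) / (1 - a)) 0) 0 = 0 ∧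
    (fun t : ℝ => max ((t - a) / (1 - a)) 0) 1 = 1 := by
  have : 0 < 1 - a := by linarith
  refine ⟨max_eq_right ?_, ?_⟩
  · exact div_nonpos_of_nonpos_of_nonneg (by linarith) this.le
  · simp only [div_self this.ne']; simp

theorem lobe₁_mono : Monotone (lobe₁ a) := by
  refine degOne_monotone (fun x _ y _ h => ?_) (lobe₁_zero_one h0 h1).1 (lobe₁_zero_one h0 h1).2
  exact min_le_min_right 1 (by gcongr)

theorem lobe₂_mono : Monotone (lobe₂ a) := by
  have : 0 < 1 - a := by linarith
  refine degOne_monotone (fun x _ y _ h => ?_) (lobe₂_zero_one h0 h1).1 (lobe₂_zero_one h0 h1).2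
  exact max_le_max_right 0 (by gcongr)

theorem lobe₁_left (k : ℤ) {x : ℝ} (hk : k ≤ x) (hx : x ≤ k + a) : lobe₁ a x = k + (x - k) / a := by
  rw [lobe₁, degOne_eq (f := fun t => min (t / a) 1) (lobe₁_zero_one h0 h1).1 (lobe₁_zero_one h0 h1).2 (m := k) ⟨hk, by linarith⟩, min_eq_left]
  rw [div_le_iff₀ h0]; linarith

theorem lobe₁_right (k : ℤ) {x : ℝ} (hk : k + a ≤ x) (hx : x ≤ k + 1) : lobe₁ a x = k + 1 := by
  rw [lobe₁, degOne_eq (f := fun t => min (t / a) 1) (lobe₁_zero_one h0 h1).1 (lobe₁_zero_one h0 h1).2 (m := k) ⟨by linarith, hx⟩, min_eq_right]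
  rw [le_div_iff₀ h0]; linarith

theorem lobe₂_left (k : ℤ) {x : ℝ} (hk : k ≤ x) (hx : x ≤ k + a) : lobe₂ a x = k := by
  have : 0 < 1 - a := by linarith
  rw [lobe₂, degOne_eq (f := fun t => max ((t - a) / (1 - a)) 0) (lobe₂_zero_one h0 h1).1 (lobe₂_zero_one h0 h1).2 (m := k) ⟨hk, by linarith⟩, max_eq_right]
  · ring
  · exact div_nonpos_of_nonpos_of_nonneg (by linarith) this.le

theorem lobe₂_right (k : ℤ) {x : ℝ} (hk : k + a ≤ x) (hx : x ≤ k + 1) :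
    lobe₂ a x = k + (x - k - a) / (1 - a) := by
  have : 0 < 1 - a := by linarith
  rw [lobe₂, degOne_eq (f := fun t => max ((t - a) / (1 - a)) 0) (lobe₂_zero_one h0 h1).1 (lobe₂_zero_one h0 h1).2 (m := k) ⟨by linarith, hx⟩, max_eq_left]
  exact div_nonneg (by linarith) this.le

theorem lobes_spec (x : ℝ) : ∃ k : ℤ, (k ≤ x ∧ x ≤ k + a ∧ lobe₁ a x = k + (x - k) / a ∧ lobe₂ a x = k) ∨
    (k + a ≤ x ∧ x ≤ k + 1 ∧ lobe₁ a x = k + 1 ∧ lobe₂ a x = k + (x - k - a) / (1 - a)) := by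
  refine ⟨⌊x⌋, ?_⟩
  have e1 := Int.floor_le x
  have e2 := (Int.lt_floor_add_one x).le
  rcases le_total x (⌊x⌋ + a) with h | h
  · exact Or.inl ⟨e1, h, lobe₁_left h0 h1 _ e1 h, lobe₂_left h0 h1 _ e1 h⟩
  · exact Or.inr ⟨h, e2, lobe₁_right h0 h1 _ h e2, lobe₂_right h0 h1 _ h e2⟩

theorem lobes_wedge (z : ℝ) : (lobe₁ a z : Circ) = 0 ∨ (lobe₂ a z : Circ) = 0 := by
  have key : ∀ k : ℤ, ((k : ℝ) : Circ) = 0 := fun k => by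
    simp
  obtain ⟨k, ⟨-, -, f1, f2⟩ | ⟨-, -, f1, f2⟩⟩ := lobes_spec h0 h1 z
  · right; rw [f2, key]
  · left; rw [f1]; exact_mod_cast key (k + 1)

/-- Two circles with a common base point, which are traversed in `[0, a]` and in `[a, 1]`. -/
def pair : Cactus 2 where
  len := ![a, 1 - a]
  map := ![lobe₁ a, lobe₂ a]
  len_pos i := by fin_cases i <;> simp <;> linarith
  len_sum := by simp
  mono i := by
    fin_cases i
    · exact lobe₁_mono h0 h1
    · exact lobe₂_mono h0 h1
  map_add_one i z := by
    fin_cases i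
    · exact degOne_add_one (fun t => min (t / a) 1) z
    · exact degOne_add_one (fun t => max ((t - a) / (1 - a)) 0) z
  sum_map z := by
    have e1 : lobe₁ a 0 = 0 := by simpa using lobe₁_left h0 h1 0 (x := 0) (by simp) (by simp [h0.le])
    have e2 : lobe₂ a 0 = 0 := by simpa using lobe₂_left h0 h1 0 (x := 0) (by simp) (by simp [h0.le])
    have h2 : 1 - a ≠ 0 := by linarith
    have h3 := h0.ne'
    simp only [Fin.sum_univ_two, Matrix.cons_val_zero, Matrix.cons_val_one, e1, e2]
    obtain ⟨k, ⟨-, -, f1, f2⟩ | ⟨-, -, f1, f2⟩⟩ := lobes_spec h0 h1 z <;> rw [f1, f2] <;> field_simp <;> ring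
  wedge := ⟨0, by
    intro i j hij z
    fin_cases i <;> fin_cases j
    · exact absurd rfl hij
    · exact lobes_wedge h0 h1 z
    · exact (lobes_wedge h0 h1 z).symm
    · exact absurd rfl hij⟩

theorem pair_att {i j : Fin 2} (hij : i ≠ j) : (pair h0 h1).att i j = 0 := by
  refine att_unique (c := fun _ _ => 0) ?_ hij
  intro i j hij z
  fin_cases i <;> fin_cases j
  · exact absurd rfl hij
  · exact lobes_wedge h0 h1 z
  · exact (lobes_wedge h0 h1 z).symm
  · exact absurd rfl hij

theorem pair_map_zero (i : Fin 2) : (pair h0 h1).map i 0 = 0 := by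
  fin_cases i
  · show lobe₁ a 0 = 0
    simpa using lobe₁_left h0 h1 0 (x := 0) (by simp) (by simp [h0.le])
  · show lobe₂ a 0 = 0
    simpa using lobe₂_left h0 h1 0 (x := 0) (by simp) (by simp [h0.le])

theorem pair_spec (i : Fin 2) : (pair h0 h1).Spec i = {0} := by
  ext x
  constructor
  · rintro (h | h | ⟨j, hj, h⟩)
    · exact h
    · rw [h, pair_map_zero]; simp
    · rw [h, pair_att h0 h1 hj.symm]; simp
  · intro h; exact Or.inl h

end Lobes

theorem half_pos_lt : (0 : ℝ) < 1 / 2 ∧ (1 / 2 : ℝ) < 1 := by norm_num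

theorem muFam_eq : muFam = (pair half_pos_lt.1 half_pos_lt.2).fam := by
  set C := pair half_pos_lt.1 half_pos_lt.2 with hC
  have hz : ∀ k : ℤ, ((k : ℝ) : Circ) = 0 := fun k => by
    simp
  have hz1 : ((1 : ℝ) : Circ) = 0 := by exact_mod_cast hz 1
  have hl : ∀ x ∈ Icc (0:ℝ) (1 / 2), C.map 0 x = 2 * x ∧ C.map 1 x = 0 := fun x hx => by
    have e1 := lobe₁_left half_pos_lt.1 half_pos_lt.2 0 (x := x) (by simpa using hx.1) (by simpa using hx.2)
    have e2 := lobe₂_left half_pos_lt.1 half_pos_lt.2 0 (x := x) (by simpa using hx.1) (by simpa using hx.2)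
    exact ⟨by rw [show C.map 0 = lobe₁ (1 / 2) from rfl, e1]; simp; ring,
      by rw [show C.map 1 = lobe₂ (1 / 2) from rfl, e2]; simp⟩
  have hr : ∀ x ∈ Icc (1 / 2 : ℝ) 1, C.map 0 x = 1 ∧ C.map 1 x = 2 * x - 1 := fun x hx => by
    have e1 := lobe₁_right half_pos_lt.1 half_pos_lt.2 0 (x := x) (by simpa using hx.1) (by simpa using hx.2)
    have e2 := lobe₂_right half_pos_lt.1 half_pos_lt.2 0 (x := x) (by simpa using hx.1) (by simpa using hx.2)
    exact ⟨by rw [show C.map 0 = lobe₁ (1 / 2) from rfl, e1]; simp,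
      by rw [show C.map 1 = lobe₂ (1 / 2) from rfl, e2]; norm_num; ring⟩
  have hne : ∀ y ∈ Ioo (0:ℝ) 1, (y : Circ) ≠ 0 := fun y hy h => by
    have := circ_eq_of_lt (x := y) (y := 0) (by simpa using h) (by linarith [hy.2]) (by linarith [hy.1])
    linarith [hy.1]
  have hatt : ∀ {i j : Fin 2}, j ≠ i → C.att i j = 0 := fun h => pair_att _ _ h.symm
  have leaf₁ : ∀ x : ℝ, 0 < x → x < 1 / 2 → fibreLeaf C.pos (0, (x : Circ)) (1, ((-2 * x : ℝ) : Circ)) := by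
    intro x h0 h1
    have e := (hl x ⟨h0.le, h1.le⟩).1
    have hn := hne (2 * x) ⟨by linarith, by linarith⟩
    have f := C.fibre_of_not_sing (z := x) (i := 0) fun j hj => by rw [e, hatt hj]; exact hn
    rw [e, ← AddCircle.coe_neg, show -(2 * x) = -2 * x by ring] at f
    refine ⟨by simp, f, hne x ⟨h0, by linarith⟩, ?_⟩
    rw [show -2 * x = -(2 * x) by ring, AddCircle.coe_neg]
    simpa using hn
  have leaf₂ : ∀ x : ℝ, 1 / 2 < x → x < 1 → fibreLeaf C.pos (0, (x : Circ)) (2, ((-2 * x : ℝ) : Circ)) := by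
    intro x h0 h1
    have e := (hr x ⟨h0.le, h1.le⟩).2
    have hn := hne (2 * x - 1) ⟨by linarith, by linarith⟩
    have f := C.fibre_of_not_sing (z := x) (i := 1) fun j hj => by rw [e, hatt hj]; exact hn
    have e2 : -((2 * x - 1 : ℝ) : Circ) = ((-2 * x : ℝ) : Circ) := by
      rw [← AddCircle.coe_neg]; exact circ_eq_iff.2 ⟨1, by push_cast; ring⟩
    rw [e, e2] at f
    refine ⟨by simp, f, hne x ⟨by linarith, h1⟩, ?_⟩
    rw [← e2]
    simpa only [ne_eq, neg_eq_zero] using hn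
  -- The common base point is the only special point of either circle, so all cut points lie over it
  -- and form one region.
  have hcut : ∀ p, ¬ OnLeaf C.pos p ↔ ∀ i, C.pos p i = 0 := fun p => by
    rw [onLeaf_iff]; push Not
    simp only [hC, pair_spec, mem_singleton_iff]
  have hlist : ∀ p, (∀ i, C.pos p i = 0) ↔
      p ∈ ({(0, 0), (0, ((1 / 2 : ℝ) : Circ)), (1, 0), (2, 0)} : Set (Fin 3 × Circ)) := by
    rintro ⟨s, w⟩
    simp only [mem_insert_iff, mem_singleton_iff, Prod.mk.injEq]
    induction s using Fin.cases with
    | zero =>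
      obtain ⟨x, hx, rfl⟩ := exists_coe_circ_Ico w 0
      rw [zero_add] at hx
      simp only [pos_zero_apply, true_and, Fin.isValue, zero_ne_one, false_and, or_false, show (0 : Fin 3) ≠ 2 by decide]
      constructor
      · intro h
        rcases hx.1.eq_or_lt with rfl | h0
        · left; simp
        rcases lt_trichotomy x (1 / 2) with h1 | rfl | h1
        · have := h 0
          rw [(hl x ⟨h0.le, h1.le⟩).1] at this
          exact absurd this (hne _ ⟨by linarith, by linarith⟩)
        · right; rfl
        · have := h 1
          rw [(hr x ⟨h1.le, hx.2.le⟩).2] at this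
          exact absurd this (hne _ ⟨by linarith, by linarith [hx.2]⟩)
      · rintro (h | h) i
        · rw [← pos_zero_apply, h]
          have := pos_zero_apply (C := C) 0 i
          rw [pair_map_zero] at this
          simpa using this
        · rw [← pos_zero_apply, h, pos_zero_apply]
          fin_cases i
          · show ((C.map 0 (1 / 2) : ℝ) : Circ) = 0
            rw [(hr (1 / 2) (by norm_num)).1, hz1]
          · show ((C.map 1 (1 / 2) : ℝ) : Circ) = 0
            rw [(hl (1 / 2) (by norm_num)).2]; simp
    | succ j =>
      have e : (∀ i, C.pos (j.succ, w) i = 0) ↔ w = 0 := by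
        constructor
        · intro h; have := h j; rw [pos_succ_self] at this; simpa using this
        · rintro rfl i
          by_cases hij : i = j
          · rw [hij, pos_succ_self]; simp
          · rw [pos_succ_ne _ hij, hatt (Ne.symm hij)]
      rw [e]
      fin_cases j <;> simp
  have hregions : muFam.regions = C.fam.regions := by
    have hfib : ∀ p, (∀ i, C.pos p i = 0) → fibre C.pos p = {(0, 0), (0, ((1 / 2 : ℝ) : Circ)), (1, 0), (2, 0)} := by
      intro p hp
      ext q
      rw [← hlist, mem_fibre]
      exact ⟨fun h i => by rw [h, hp], fun h => funext fun i => by rw [h, hp]⟩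
    ext R
    constructor
    · intro h
      have h0 : ∀ i, C.pos (0, 0) i = 0 := (hlist (0, 0)).2 (by simp)
      exact ⟨(0, 0), (show R = _ from h).trans (hfib _ h0).symm, (hcut _).2 h0⟩
    · rintro ⟨p, rfl, hp⟩
      exact hfib p ((hcut p).1 hp)
  have hzero : ∀ {w : Circ} {q}, fibreLeaf C.pos (0, w) q → ∃ x : ℝ, ∃ j : Fin 3,
      ((j = 1 ∧ 0 < x ∧ x < 1 / 2) ∨ (j = 2 ∧ 1 / 2 < x ∧ x < 1)) ∧
        ((0 : Fin 3), w) = (0, (x : Circ)) ∧ q = (j, ((-2 * x : ℝ) : Circ)) := by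
    intro w q h
    obtain ⟨x, hx, rfl⟩ := exists_coe_circ_Ico w 0
    rw [zero_add] at hx
    have hnot : ¬ ∀ i, C.pos (0, (x : Circ)) i = 0 := fun hc => (hcut _).2 hc ⟨q, h⟩
    have h0 : 0 < x := by
      rcases hx.1.eq_or_lt with rfl | h0
      · exact absurd (show (((0 : ℝ) : Circ)) = 0 by simp) h.2.2.1
      · exact h0
    rcases lt_trichotomy x (1 / 2) with h1 | rfl | h1
    · exact ⟨x, 1, Or.inl ⟨rfl, h0, h1⟩, rfl, C.isArcFamily.leaf_unique _ _ _ h (leaf₁ x h0 h1)⟩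
    · exact absurd ((hlist _).2 (by simp)) hnot
    · exact ⟨x, 2, Or.inr ⟨rfl, h1, hx.2⟩, rfl, C.isArcFamily.leaf_unique _ _ _ h (leaf₂ x h1 hx.2)⟩
  refine ArcData.ext ?_ ?_ hregions ?_ rfl
  · funext i
    fin_cases i
    · rfl
    · exact (show (1:ℝ) / 4 = 1 / 2 / 2 by norm_num)
    · exact (show (1:ℝ) / 4 = (1 - 1 / 2) / 2 by norm_num)
  · funext p q
    refine propext ⟨?_, fun h => ?_⟩
    · rintro ⟨x, j, (⟨rfl, h1, h2⟩ | ⟨rfl, h1, h2⟩), (⟨rfl, rfl⟩ | ⟨rfl, rfl⟩)⟩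
      · exact leaf₁ x h1 h2
      · exact (leaf₁ x h1 h2).symm
      · exact leaf₂ x h1 h2
      · exact (leaf₂ x h1 h2).symm
    · have h : fibreLeaf C.pos p q := h
      by_cases hp : p.1 = 0
      · obtain ⟨s, w⟩ := p
        obtain rfl : s = 0 := hp
        obtain ⟨x, j, h1, h2, h3⟩ := hzero h
        exact ⟨x, j, h1, Or.inl ⟨h2, h3⟩⟩
      · have hq := fibreLeaf_fst' h hp
        obtain ⟨s, w⟩ := q
        obtain rfl : s = 0 := hq
        obtain ⟨x, j, h1, h2, h3⟩ := hzero h.symm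
        exact ⟨x, j, h1, Or.inr ⟨h2, h3⟩⟩
  · exact congrArg (fun 𝓡 => Set.indicator 𝓡 1) hregions

end Cactus

/-! ## Continuous families of cacti -/

namespace Cactus
open ArcData

/-- The lengths and the coordinates depend continuously on the parameter. -/
structure ContFam {X : Type*} [TopologicalSpace X] {n : ℕ} (C : X → Cactus n) : Prop where
  len : ∀ i, Continuous fun x => (C x).len i
  map : ∀ i, Continuous fun p : X × ℝ => (C p.1).map i p.2

namespace ContFam

variable {X Y : Type*} [TopologicalSpace X] [TopologicalSpace Y] {m n : ℕ}

theorem precomp {C : Y → Cactus n} (hC : ContFam C) {f : X → Y} (hf : Continuous f) :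
    ContFam fun x => C (f x) :=
  ⟨fun i => (hC.len i).comp hf, fun i => (hC.map i).comp
    ((hf.comp continuous_fst).prodMk continuous_snd : Continuous fun p : X × ℝ => (f p.1, p.2))⟩

theorem const (C : Cactus n) : ContFam fun _ : X => C :=
  ⟨fun _ => continuous_const, fun i => (C.continuous_map i).comp continuous_snd⟩

theorem rotate {C : X → Cactus n} (hC : ContFam C) {x : X → ℝ} (hx : Continuous x) {y : X → Fin n → ℝ}
    (hy : ∀ i, Continuous fun p => y p i) : ContFam fun p => (C p).rotate (x p) (y p) := by
  refine ⟨hC.len, fun i => ?_⟩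
  have h : Continuous fun p : X × ℝ => (p.1, p.2 + x p.1) := by fun_prop
  exact ((hC.map i).comp h).add ((hy i).comp continuous_fst)

theorem perm {C : X → Cactus n} (hC : ContFam C) (σ : Equiv.Perm (Fin n)) : ContFam fun p => (C p).perm σ :=
  ⟨fun i => hC.len (σ.symm i), fun i => hC.map (σ.symm i)⟩

theorem comp {C : X → Cactus (m + 1)} (hC : ContFam C) (i : Fin (m + 1)) {D : X → Cactus n}
    (hD : ContFam D) : ContFam fun p => (C p).comp i (D p) := by
  refine ⟨fun l => ?_, fun l => ?_⟩
  · rcases h : oldIndex i l with a | j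
    · simpa only [Cactus.comp, h, Sum.elim_inl] using hC.len a
    · simp only [Cactus.comp, h, Sum.elim_inr]
      exact (hC.len i).mul (hD.len j)
  · rcases h : oldIndex i l with a | j
    · simpa only [Cactus.comp, h, Sum.elim_inl] using hC.map a
    · simp only [Cactus.comp, h, Sum.elim_inr]
      exact (hD.map j).comp (continuous_fst.prodMk (hC.map i))

end ContFam

theorem contFam_circle : ContFam circle :=
  ⟨fun _ => continuous_const, fun _ => (continuous_snd.add continuous_fst : Continuous fun p : ℝ × ℝ => p.2 + p.1)⟩

/-- Retraction of the line onto the weights `[1/4, 3/4]`. -/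
def wt (a : ℝ) : ℝ := max (1 / 4) (min (3 / 4) a)

theorem wt_pos (a : ℝ) : 0 < wt a := lt_of_lt_of_le (by norm_num) (le_max_left _ _)

theorem wt_lt (a : ℝ) : wt a < 1 := max_lt (by norm_num) ((min_le_left _ _).trans_lt (by norm_num))

theorem wt_eq {a : ℝ} (h : a ∈ Icc (1 / 4 : ℝ) (3 / 4)) : wt a = a := by
  rw [wt, min_eq_right h.2, max_eq_right h.1]

theorem wt_half : wt (1 / 2) = 1 / 2 := wt_eq (by norm_num)

theorem wt_third : wt (1 / 3) = 1 / 3 := wt_eq (by norm_num)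

theorem wt_two_thirds : wt (2 / 3) = 2 / 3 := wt_eq (by norm_num)

/-- Two circles of lengths proportional to `a` and `1 - a` with a common base point. -/
def pairAt (a : ℝ) : Cactus 2 := pair (wt_pos a) (wt_lt a)

theorem contFam_pairAt : ContFam pairAt := by
  have hw : Continuous wt := by unfold wt; fun_prop
  refine ⟨fun i => ?_, fun i => ?_⟩
  · fin_cases i
    · exact hw
    · exact continuous_const.sub hw
  · fin_cases i
    · refine continuous_degOne (f := fun a t => min (t / wt a) 1) ?_ (fun a => (lobe₁_zero_one (wt_pos a) (wt_lt a)).1)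
        fun a => (lobe₁_zero_one (wt_pos a) (wt_lt a)).2
      exact (continuous_snd.div (hw.comp continuous_fst) fun p => (wt_pos p.1).ne').min continuous_const
    · refine continuous_degOne (f := fun a t => max ((t - wt a) / (1 - wt a)) 0) ?_ (fun a => (lobe₂_zero_one (wt_pos a) (wt_lt a)).1)
        fun a => (lobe₂_zero_one (wt_pos a) (wt_lt a)).2
      exact ((continuous_snd.sub (hw.comp continuous_fst)).div (continuous_const.sub (hw.comp continuous_fst))
        fun p => (sub_pos.2 (wt_lt p.1)).ne').max continuous_const

theorem muFam_eq_pairAt : muFam = (pairAt (1 / 2)).fam := by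
  rw [muFam_eq]
  refine fam_congr (fun i => ?_) fun i z => ?_
  · show ![1 / 2, 1 - 1 / 2] i = ![wt (1 / 2), 1 - wt (1 / 2)] i
    rw [wt_half]
  · show ((![lobe₁ (1 / 2), lobe₂ (1 / 2)] i z : ℝ) : Circ) = (![lobe₁ (wt (1 / 2)), lobe₂ (wt (1 / 2))] i z : ℝ)
    rw [wt_half]

/-- It suffices to compare coordinates on one period, and up to integers. -/
theorem fam_congr_Icc {n : ℕ} {C D : Cactus n} (x : ℝ) (e : Fin n → ℤ) (hl : ∀ i, C.len i = D.len i)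
    (h : ∀ z, z + x ∈ Icc (0 : ℝ) 1 → ∀ i, C.map i z = D.map i z + e i) : C.fam = D.fam := by
  refine fam_congr hl fun i z => circ_eq_iff.2 ⟨e i, ?_⟩
  have e0 := h (Int.fract (z + x) - x)
    (by rw [sub_add_cancel]; exact ⟨Int.fract_nonneg _, (Int.fract_lt_one _).le⟩) i
  have e1 := C.map_add_int i (Int.fract (z + x) - x) ⌊z + x⌋
  have e2 := D.map_add_int i (Int.fract (z + x) - x) ⌊z + x⌋
  have e3 : Int.fract (z + x) - x + ⌊z + x⌋ = z := by linarith [Int.fract_add_floor (z + x)]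
  rw [e3] at e1 e2
  rw [e1, e2, e0]; ring

/-- The parameters: the weight of the first circle of the outer pair, the rotations of the outer and
of the inner pair, and the base points of the three circles. -/
abbrev Par : Type := ℝ × ℝ × ℝ × ℝ × ℝ × ℝ

/-- The unrotated base points of a pair into which another pair has been inserted. -/
def graft (i : Fin 2) (v : Par) : Cactus 3 :=
  Cactus.comp (m := 1) (n := 2) ((pairAt v.1).rotate v.2.1 0) i ((pairAt (1 / 2)).rotate v.2.2.1 0)

/-- The base points of the three circles. -/
def Par.base (v : Par) : Fin 3 → ℝ := ![v.2.2.2.1, v.2.2.2.2.1, v.2.2.2.2.2]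

/-- The second pair is inserted into the first circle. -/
def famA (v : Par) : Cactus 3 := (graft 0 v).rotate 0 v.base

/-- The second pair is inserted into the second circle. -/
def famB (v : Par) : Cactus 3 := (graft 1 v).rotate 0 v.base

/-- As `famB`, with the first two labels interchanged. -/
def famC (v : Par) : Cactus 3 := ((graft 1 v).perm (Equiv.swap 0 1)).rotate 0 v.base

theorem contFam_graft (i : Fin 2) : ContFam (graft i) := by
  refine ContFam.comp (m := 1) (n := 2) ?_ i ?_
  · exact (contFam_pairAt.precomp continuous_fst).rotate (by fun_prop) fun _ => continuous_const
  · exact (ContFam.const _).rotate (by fun_prop) fun _ => continuous_const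

theorem continuous_base (i : Fin 3) : Continuous fun v : Par => v.base i := by
  fin_cases i <;> simp [Par.base] <;> fun_prop

theorem contFam_famA : ContFam famA := (contFam_graft 0).rotate continuous_const continuous_base
theorem contFam_famB : ContFam famB := (contFam_graft 1).rotate continuous_const continuous_base
theorem contFam_famC : ContFam famC := ((contFam_graft 1).perm _).rotate continuous_const continuous_base

theorem famA_len (v : Par) : (famA v).len = ![wt v.1 / 2, wt v.1 / 2, 1 - wt v.1] := by
  funext i
  fin_cases i
  · show wt v.1 * wt (1 / 2) = wt v.1 / 2
    rw [wt_half]; ring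
  · show wt v.1 * (1 - wt (1 / 2)) = wt v.1 / 2
    rw [wt_half]; ring
  · rfl

theorem famB_len (v : Par) : (famB v).len = ![wt v.1, (1 - wt v.1) / 2, (1 - wt v.1) / 2] := by
  funext i
  fin_cases i
  · rfl
  · show (1 - wt v.1) * wt (1 / 2) = (1 - wt v.1) / 2
    rw [wt_half]; ring
  · show (1 - wt v.1) * (1 - wt (1 / 2)) = (1 - wt v.1) / 2
    rw [wt_half]; ring

theorem famC_len (v : Par) : (famC v).len = ![(1 - wt v.1) / 2, wt v.1, (1 - wt v.1) / 2] := by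
  have h := famB_len v
  funext i
  fin_cases i
  · exact congrFun h 1
  · exact congrFun h 0
  · exact congrFun h 2

theorem famA_map (v : Par) (z : ℝ) (i : Fin 3) : (famA v).map i z =
    ![lobe₁ (1 / 2) (lobe₁ (wt v.1) (z + v.2.1) + v.2.2.1) + v.2.2.2.1,
      lobe₂ (1 / 2) (lobe₁ (wt v.1) (z + v.2.1) + v.2.2.1) + v.2.2.2.2.1,
      lobe₂ (wt v.1) (z + v.2.1) + v.2.2.2.2.2] i := by
  fin_cases i
  · show lobe₁ (wt (1 / 2)) (lobe₁ (wt v.1) (z + 0 + v.2.1) + 0 + v.2.2.1) + 0 + v.2.2.2.1 = _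
    rw [wt_half, add_zero, add_zero, add_zero]; rfl
  · show lobe₂ (wt (1 / 2)) (lobe₁ (wt v.1) (z + 0 + v.2.1) + 0 + v.2.2.1) + 0 + v.2.2.2.2.1 = _
    rw [wt_half, add_zero, add_zero, add_zero]; rfl
  · show lobe₂ (wt v.1) (z + 0 + v.2.1) + 0 + v.2.2.2.2.2 = _
    rw [add_zero, add_zero]; rfl

theorem famB_map (v : Par) (z : ℝ) (i : Fin 3) : (famB v).map i z =
    ![lobe₁ (wt v.1) (z + v.2.1) + v.2.2.2.1,
      lobe₁ (1 / 2) (lobe₂ (wt v.1) (z + v.2.1) + v.2.2.1) + v.2.2.2.2.1,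
      lobe₂ (1 / 2) (lobe₂ (wt v.1) (z + v.2.1) + v.2.2.1) + v.2.2.2.2.2] i := by
  fin_cases i
  · show lobe₁ (wt v.1) (z + 0 + v.2.1) + 0 + v.2.2.2.1 = _
    rw [add_zero, add_zero]; rfl
  · show lobe₁ (wt (1 / 2)) (lobe₂ (wt v.1) (z + 0 + v.2.1) + 0 + v.2.2.1) + 0 + v.2.2.2.2.1 = _
    rw [wt_half, add_zero, add_zero, add_zero]; rfl
  · show lobe₂ (wt (1 / 2)) (lobe₂ (wt v.1) (z + 0 + v.2.1) + 0 + v.2.2.1) + 0 + v.2.2.2.2.2 = _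
    rw [wt_half, add_zero, add_zero, add_zero]; rfl

theorem famC_map (v : Par) (z : ℝ) (i : Fin 3) : (famC v).map i z =
    ![lobe₁ (1 / 2) (lobe₂ (wt v.1) (z + v.2.1) + v.2.2.1) + v.2.2.2.1,
      lobe₁ (wt v.1) (z + v.2.1) + v.2.2.2.2.1,
      lobe₂ (1 / 2) (lobe₂ (wt v.1) (z + v.2.1) + v.2.2.1) + v.2.2.2.2.2] i := by
  fin_cases i
  · show lobe₁ (wt (1 / 2)) (lobe₂ (wt v.1) (z + 0 + v.2.1) + 0 + v.2.2.1) + 0 + v.2.2.2.1 = _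
    rw [wt_half, add_zero, add_zero, add_zero]; rfl
  · show lobe₁ (wt v.1) (z + 0 + v.2.1) + 0 + v.2.2.2.2.1 = _
    rw [add_zero, add_zero]; rfl
  · show lobe₂ (wt (1 / 2)) (lobe₂ (wt v.1) (z + 0 + v.2.1) + 0 + v.2.2.1) + 0 + v.2.2.2.2.2 = _
    rw [wt_half, add_zero, add_zero, add_zero]; rfl

end Cactus

/-! ## Coincidences between the families of cacti with three circles -/

namespace Cactus

section Values

variable {w k : ℝ} (m : ℤ)

theorem lobes_half_left (hk : k = m) (h : k ≤ w) (h' : w ≤ k + 1 / 2) :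
    lobe₁ (1 / 2) w = 2 * w - k ∧ lobe₂ (1 / 2) w = k := by
  subst hk
  exact ⟨by rw [lobe₁_left (by norm_num) (by norm_num) m h h']; ring,
    lobe₂_left (by norm_num) (by norm_num) m h h'⟩

theorem lobes_half_right (hk : k = m) (h : k + 1 / 2 ≤ w) (h' : w ≤ k + 1) :
    lobe₁ (1 / 2) w = k + 1 ∧ lobe₂ (1 / 2) w = 2 * w - k - 1 := by
  subst hk
  exact ⟨lobe₁_right (by norm_num) (by norm_num) m h h',
    by rw [lobe₂_right (by norm_num) (by norm_num) m h h']; ring⟩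

theorem lobes_third_left (hk : k = m) (h : k ≤ w) (h' : w ≤ k + 1 / 3) :
    lobe₁ (1 / 3) w = 3 * w - 2 * k ∧ lobe₂ (1 / 3) w = k := by
  subst hk
  exact ⟨by rw [lobe₁_left (by norm_num) (by norm_num) m h h']; ring,
    lobe₂_left (by norm_num) (by norm_num) m h h'⟩

theorem lobes_third_right (hk : k = m) (h : k + 1 / 3 ≤ w) (h' : w ≤ k + 1) :
    lobe₁ (1 / 3) w = k + 1 ∧ lobe₂ (1 / 3) w = k + (w - k - 1 / 3) * (3 / 2) := by
  subst hk
  exact ⟨lobe₁_right (by norm_num) (by norm_num) m h h',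
    by rw [lobe₂_right (by norm_num) (by norm_num) m h h']; ring⟩

theorem lobes_two_thirds_left (hk : k = m) (h : k ≤ w) (h' : w ≤ k + 2 / 3) :
    lobe₁ (2 / 3) w = k + (w - k) * (3 / 2) ∧ lobe₂ (2 / 3) w = k := by
  subst hk
  exact ⟨by rw [lobe₁_left (by norm_num) (by norm_num) m h h']; ring,
    lobe₂_left (by norm_num) (by norm_num) m h h'⟩

theorem lobes_two_thirds_right (hk : k = m) (h : k + 2 / 3 ≤ w) (h' : w ≤ k + 1) :
    lobe₁ (2 / 3) w = k + 1 ∧ lobe₂ (2 / 3) w = k + (w - k - 2 / 3) * 3 := by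
  subst hk
  exact ⟨lobe₁_right (by norm_num) (by norm_num) m h h',
    by rw [lobe₂_right (by norm_num) (by norm_num) m h h']; ring⟩

end Values

theorem fam_congr_three {C D : Cactus 3} (x : ℝ) (e₀ e₁ e₂ : ℤ) (hl : C.len = D.len)
    (h : ∀ z, z + x ∈ Icc (0 : ℝ) 1 → C.map 0 z = D.map 0 z + e₀ ∧ C.map 1 z = D.map 1 z + e₁ ∧
      C.map 2 z = D.map 2 z + e₂) : C.fam = D.fam := by
  refine fam_congr_Icc x ![e₀, e₁, e₂] (congrFun hl) fun z hz i => ?_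
  obtain ⟨h0, h1, h2⟩ := h z hz
  fin_cases i
  · exact h0
  · exact h1
  · exact h2

theorem len_third : (1 - (1 / 3 : ℝ)) / 2 = 1 / 3 := by norm_num

theorem len_two_thirds : (2 / 3 : ℝ) / 2 = 1 / 3 := by norm_num

theorem len_two_thirds' : 1 - (2 / 3 : ℝ) = 1 / 3 := by norm_num

/-- For `u ≤ 1 / 2` the circle 1 is attached to the circle 2 at the coordinate `2 * u`, and the
circle 3 to the same circle at 0. This configuration also arises by first joining 1 and 2; the
parameters `2 * u / 3`, `-u` and `2 * u` restore the base points of the loop, of the pair and of the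
circle 2. -/
theorem famB_eq_famA_twist {u : ℝ} (hu : u ∈ Icc (0 : ℝ) (1 / 2)) :
    (famB (1 / 3, 0, u, 0, 0, 0)).fam = (famA (2 / 3, 2 * u / 3, -u, 0, 2 * u, 0)).fam := by
  obtain ⟨u0, u1⟩ := hu
  refine fam_congr_three 0 0 0 0 ?_ fun z hz => ?_
  · rw [famA_len, famB_len]
    simp only [wt_third, wt_two_thirds, len_third, len_two_thirds, len_two_thirds']
  obtain ⟨z0, z1⟩ : z ∈ Icc (0 : ℝ) 1 := by simpa using hz
  simp only [famA_map, famB_map, wt_third, wt_two_thirds, Matrix.cons_val, add_zero, Int.cast_zero]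
  rcases le_total z (1 / 3) with h1 | h1
  · obtain ⟨a1, a2⟩ := lobes_third_left (w := z) (k := 0) 0 (by simp) (by linarith) (by linarith)
    obtain ⟨b1, b2⟩ := lobes_half_left (w := lobe₂ (1 / 3) z + u) (k := 0) 0 (by simp) (by linarith) (by linarith)
    obtain ⟨c1, c2⟩ := lobes_two_thirds_left (w := z + 2 * u / 3) (k := 0) 0 (by simp) (by linarith) (by linarith)
    obtain ⟨d1, d2⟩ := lobes_half_left (w := lobe₁ (2 / 3) (z + 2 * u / 3) + -u) (k := 0) 0 (by simp) (by linarith) (by linarith)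
    refine ⟨?_, ?_, ?_⟩ <;> linarith
  rcases le_total z (2 / 3 - 2 * u / 3) with h2 | h2
  · obtain ⟨a1, a2⟩ := lobes_third_right (w := z) (k := 0) 0 (by simp) (by linarith) (by linarith)
    obtain ⟨b1, b2⟩ := lobes_half_left (w := lobe₂ (1 / 3) z + u) (k := 0) 0 (by simp) (by linarith) (by linarith)
    obtain ⟨c1, c2⟩ := lobes_two_thirds_left (w := z + 2 * u / 3) (k := 0) 0 (by simp) (by linarith) (by linarith)
    obtain ⟨d1, d2⟩ := lobes_half_right (w := lobe₁ (2 / 3) (z + 2 * u / 3) + -u) (k := 0) 0 (by simp) (by linarith) (by linarith)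
    refine ⟨?_, ?_, ?_⟩ <;> linarith
  rcases le_total z (1 - 2 * u / 3) with h3 | h3
  · obtain ⟨a1, a2⟩ := lobes_third_right (w := z) (k := 0) 0 (by simp) (by linarith) (by linarith)
    obtain ⟨b1, b2⟩ := lobes_half_right (w := lobe₂ (1 / 3) z + u) (k := 0) 0 (by simp) (by linarith) (by linarith)
    obtain ⟨c1, c2⟩ := lobes_two_thirds_right (w := z + 2 * u / 3) (k := 0) 0 (by simp) (by linarith) (by linarith)
    obtain ⟨d1, d2⟩ := lobes_half_right (w := lobe₁ (2 / 3) (z + 2 * u / 3) + -u) (k := 0) 0 (by simp) (by linarith) (by linarith)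
    refine ⟨?_, ?_, ?_⟩ <;> linarith
  · obtain ⟨a1, a2⟩ := lobes_third_right (w := z) (k := 0) 0 (by simp) (by linarith) (by linarith)
    obtain ⟨b1, b2⟩ := lobes_half_left (w := lobe₂ (1 / 3) z + u) (k := 1) 1 (by simp) (by linarith) (by linarith)
    obtain ⟨c1, c2⟩ := lobes_two_thirds_left (w := z + 2 * u / 3) (k := 1) 1 (by simp) (by linarith) (by linarith)
    obtain ⟨d1, d2⟩ := lobes_half_right (w := lobe₁ (2 / 3) (z + 2 * u / 3) + -u) (k := 0) 0 (by simp) (by linarith) (by linarith)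
    refine ⟨?_, ?_, ?_⟩ <;> linarith

/-- The same with the circle 1 in the middle: the circle 2 is attached to it at `2 * u`, the circle
3 at 0, and the first two circles are taken as the inner pair. -/
theorem famC_eq_famA_twist {u : ℝ} (hu : u ∈ Icc (0 : ℝ) (1 / 2)) :
    (famC (1 / 3, 0, u, 0, 0, 0)).fam = (famA (2 / 3, 2 * u / 3, 1 / 2 - u, 2 * u, 0, 0)).fam := by
  obtain ⟨u0, u1⟩ := hu
  refine fam_congr_three 0 (-1) 0 0 ?_ fun z hz => ?_
  · rw [famA_len, famC_len]
    simp only [wt_third, wt_two_thirds, len_third, len_two_thirds, len_two_thirds']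
  obtain ⟨z0, z1⟩ : z ∈ Icc (0 : ℝ) 1 := by simpa using hz
  simp only [famA_map, famC_map, wt_third, wt_two_thirds, Matrix.cons_val, add_zero, Int.cast_zero,
    Int.cast_neg, Int.cast_one]
  rcases le_total z (1 / 3) with h1 | h1
  · obtain ⟨a1, a2⟩ := lobes_third_left (w := z) (k := 0) 0 (by simp) (by linarith) (by linarith)
    obtain ⟨b1, b2⟩ := lobes_half_left (w := lobe₂ (1 / 3) z + u) (k := 0) 0 (by simp) (by linarith) (by linarith)
    obtain ⟨c1, c2⟩ := lobes_two_thirds_left (w := z + 2 * u / 3) (k := 0) 0 (by simp) (by linarith) (by linarith)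
    obtain ⟨d1, d2⟩ := lobes_half_right (w := lobe₁ (2 / 3) (z + 2 * u / 3) + (1 / 2 - u)) (k := 0) 0 (by simp) (by linarith) (by linarith)
    refine ⟨?_, ?_, ?_⟩ <;> linarith
  rcases le_total z (2 / 3 - 2 * u / 3) with h2 | h2
  · obtain ⟨a1, a2⟩ := lobes_third_right (w := z) (k := 0) 0 (by simp) (by linarith) (by linarith)
    obtain ⟨b1, b2⟩ := lobes_half_left (w := lobe₂ (1 / 3) z + u) (k := 0) 0 (by simp) (by linarith) (by linarith)
    obtain ⟨c1, c2⟩ := lobes_two_thirds_left (w := z + 2 * u / 3) (k := 0) 0 (by simp) (by linarith) (by linarith)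
    obtain ⟨d1, d2⟩ := lobes_half_left (w := lobe₁ (2 / 3) (z + 2 * u / 3) + (1 / 2 - u)) (k := 1) 1 (by simp) (by linarith) (by linarith)
    refine ⟨?_, ?_, ?_⟩ <;> linarith
  rcases le_total z (1 - 2 * u / 3) with h3 | h3
  · obtain ⟨a1, a2⟩ := lobes_third_right (w := z) (k := 0) 0 (by simp) (by linarith) (by linarith)
    obtain ⟨b1, b2⟩ := lobes_half_right (w := lobe₂ (1 / 3) z + u) (k := 0) 0 (by simp) (by linarith) (by linarith)
    obtain ⟨c1, c2⟩ := lobes_two_thirds_right (w := z + 2 * u / 3) (k := 0) 0 (by simp) (by linarith) (by linarith)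
    obtain ⟨d1, d2⟩ := lobes_half_left (w := lobe₁ (2 / 3) (z + 2 * u / 3) + (1 / 2 - u)) (k := 1) 1 (by simp) (by linarith) (by linarith)
    refine ⟨?_, ?_, ?_⟩ <;> linarith
  · obtain ⟨a1, a2⟩ := lobes_third_right (w := z) (k := 0) 0 (by simp) (by linarith) (by linarith)
    obtain ⟨b1, b2⟩ := lobes_half_left (w := lobe₂ (1 / 3) z + u) (k := 1) 1 (by simp) (by linarith) (by linarith)
    obtain ⟨c1, c2⟩ := lobes_two_thirds_left (w := z + 2 * u / 3) (k := 1) 1 (by simp) (by linarith) (by linarith)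
    obtain ⟨d1, d2⟩ := lobes_half_left (w := lobe₁ (2 / 3) (z + 2 * u / 3) + (1 / 2 - u)) (k := 1) 1 (by simp) (by linarith) (by linarith)
    refine ⟨?_, ?_, ?_⟩ <;> linarith

/-- In the second half turn the circle 2 is attached to the circle 3 at `2 * v`, with the circle 1
at 0, so that 2 and 3 can serve as the inner pair. -/
theorem famC_eq_famB_twist {v : ℝ} (hv : v ∈ Icc (0 : ℝ) (1 / 2)) :
    (famC (1 / 3, 0, 1 / 2 + v, 0, 0, 0)).fam = (famB (1 / 3, 1 / 3 + 2 * v / 3, -v, 0, 0, 2 * v)).fam := by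
  obtain ⟨v0, v1⟩ := hv
  refine fam_congr_three 0 0 0 0 ?_ fun z hz => ?_
  · rw [famB_len, famC_len]
    simp only [wt_third, len_third]
  obtain ⟨z0, z1⟩ : z ∈ Icc (0 : ℝ) 1 := by simpa using hz
  simp only [famB_map, famC_map, wt_third, Matrix.cons_val, add_zero, Int.cast_zero]
  rcases le_total z (1 / 3) with h1 | h1
  · obtain ⟨a1, a2⟩ := lobes_third_left (w := z) (k := 0) 0 (by simp) (by linarith) (by linarith)
    obtain ⟨b1, b2⟩ := lobes_half_right (w := lobe₂ (1 / 3) z + (1 / 2 + v)) (k := 0) 0 (by simp) (by linarith) (by linarith)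
    obtain ⟨c1, c2⟩ := lobes_third_right (w := z + (1 / 3 + 2 * v / 3)) (k := 0) 0 (by simp) (by linarith) (by linarith)
    obtain ⟨d1, d2⟩ := lobes_half_left (w := lobe₂ (1 / 3) (z + (1 / 3 + 2 * v / 3)) + -v) (k := 0) 0 (by simp) (by linarith) (by linarith)
    refine ⟨?_, ?_, ?_⟩ <;> linarith
  rcases le_total z (2 / 3 - 2 * v / 3) with h2 | h2
  · obtain ⟨a1, a2⟩ := lobes_third_right (w := z) (k := 0) 0 (by simp) (by linarith) (by linarith)
    obtain ⟨b1, b2⟩ := lobes_half_right (w := lobe₂ (1 / 3) z + (1 / 2 + v)) (k := 0) 0 (by simp) (by linarith) (by linarith)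
    obtain ⟨c1, c2⟩ := lobes_third_right (w := z + (1 / 3 + 2 * v / 3)) (k := 0) 0 (by simp) (by linarith) (by linarith)
    obtain ⟨d1, d2⟩ := lobes_half_right (w := lobe₂ (1 / 3) (z + (1 / 3 + 2 * v / 3)) + -v) (k := 0) 0 (by simp) (by linarith) (by linarith)
    refine ⟨?_, ?_, ?_⟩ <;> linarith
  rcases le_total z (1 - 2 * v / 3) with h3 | h3
  · obtain ⟨a1, a2⟩ := lobes_third_right (w := z) (k := 0) 0 (by simp) (by linarith) (by linarith)
    obtain ⟨b1, b2⟩ := lobes_half_left (w := lobe₂ (1 / 3) z + (1 / 2 + v)) (k := 1) 1 (by simp) (by linarith) (by linarith)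
    obtain ⟨c1, c2⟩ := lobes_third_left (w := z + (1 / 3 + 2 * v / 3)) (k := 1) 1 (by simp) (by linarith) (by linarith)
    obtain ⟨d1, d2⟩ := lobes_half_right (w := lobe₂ (1 / 3) (z + (1 / 3 + 2 * v / 3)) + -v) (k := 0) 0 (by simp) (by linarith) (by linarith)
    refine ⟨?_, ?_, ?_⟩ <;> linarith
  · obtain ⟨a1, a2⟩ := lobes_third_right (w := z) (k := 0) 0 (by simp) (by linarith) (by linarith)
    obtain ⟨b1, b2⟩ := lobes_half_right (w := lobe₂ (1 / 3) z + (1 / 2 + v)) (k := 1) 1 (by simp) (by linarith) (by linarith)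
    obtain ⟨c1, c2⟩ := lobes_third_right (w := z + (1 / 3 + 2 * v / 3)) (k := 1) 1 (by simp) (by linarith) (by linarith)
    obtain ⟨d1, d2⟩ := lobes_half_right (w := lobe₂ (1 / 3) (z + (1 / 3 + 2 * v / 3)) + -v) (k := 0) 0 (by simp) (by linarith) (by linarith)
    refine ⟨?_, ?_, ?_⟩ <;> linarith

/-- Three circles of length `1 / 3` with a common point, in the order 1, 2, 3: both bracketings give
the same cactus. -/
theorem famA_eq_famB (x y : ℝ) : (famA (2 / 3, x, 0, 0, 0, y)).fam = (famB (1 / 3, x, 0, 0, 0, y)).fam := by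
  refine fam_congr_three x 0 0 0 ?_ fun z ⟨z0, z1⟩ => ?_
  · rw [famA_len, famB_len]
    simp only [wt_third, wt_two_thirds, len_third, len_two_thirds, len_two_thirds']
  simp only [famA_map, famB_map, wt_third, wt_two_thirds, Matrix.cons_val, add_zero, Int.cast_zero]
  rcases le_total (z + x) (1 / 3) with h1 | h1
  · obtain ⟨a1, a2⟩ := lobes_third_left (w := z + x) (k := 0) 0 (by simp) (by linarith) (by linarith)
    obtain ⟨b1, b2⟩ := lobes_half_left (w := lobe₂ (1 / 3) (z + x)) (k := 0) 0 (by simp) (by linarith) (by linarith)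
    obtain ⟨c1, c2⟩ := lobes_two_thirds_left (w := z + x) (k := 0) 0 (by simp) (by linarith) (by linarith)
    obtain ⟨d1, d2⟩ := lobes_half_left (w := lobe₁ (2 / 3) (z + x)) (k := 0) 0 (by simp) (by linarith) (by linarith)
    refine ⟨?_, ?_, ?_⟩ <;> linarith
  rcases le_total (z + x) (2 / 3) with h2 | h2
  · obtain ⟨a1, a2⟩ := lobes_third_right (w := z + x) (k := 0) 0 (by simp) (by linarith) (by linarith)
    obtain ⟨b1, b2⟩ := lobes_half_left (w := lobe₂ (1 / 3) (z + x)) (k := 0) 0 (by simp) (by linarith) (by linarith)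
    obtain ⟨c1, c2⟩ := lobes_two_thirds_left (w := z + x) (k := 0) 0 (by simp) (by linarith) (by linarith)
    obtain ⟨d1, d2⟩ := lobes_half_right (w := lobe₁ (2 / 3) (z + x)) (k := 0) 0 (by simp) (by linarith) (by linarith)
    refine ⟨?_, ?_, ?_⟩ <;> linarith
  · obtain ⟨a1, a2⟩ := lobes_third_right (w := z + x) (k := 0) 0 (by simp) (by linarith) (by linarith)
    obtain ⟨b1, b2⟩ := lobes_half_right (w := lobe₂ (1 / 3) (z + x)) (k := 0) 0 (by simp) (by linarith) (by linarith)
    obtain ⟨c1, c2⟩ := lobes_two_thirds_right (w := z + x) (k := 0) 0 (by simp) (by linarith) (by linarith)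
    obtain ⟨d1, d2⟩ := lobes_half_right (w := lobe₁ (2 / 3) (z + x)) (k := 0) 0 (by simp) (by linarith) (by linarith)
    refine ⟨?_, ?_, ?_⟩ <;> linarith

/-- The half turn of the inner pair reverses the cyclic order of the three circles at their common
point. The traversals 2, 1, 3 and 1, 3, 2 differ by the rotation `2 / 3` of the loop. -/
theorem famA_eq_famB_half (x : ℝ) :
    (famA (2 / 3, x, 1 / 2, 0, 0, 0)).fam = (famB (1 / 3, x + 2 / 3, 1 / 2, 0, 0, 0)).fam := by
  refine fam_congr_three x 0 (-1) (-1) ?_ fun z ⟨z0, z1⟩ => ?_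
  · rw [famA_len, famB_len]
    simp only [wt_third, wt_two_thirds, len_third, len_two_thirds, len_two_thirds']
  simp only [famA_map, famB_map, wt_third, wt_two_thirds, Matrix.cons_val, add_zero, Int.cast_zero,
    Int.cast_neg, Int.cast_one]
  rcases le_total (z + x) (1 / 3) with h1 | h1
  · obtain ⟨a1, a2⟩ := lobes_third_right (w := z + (x + 2 / 3)) (k := 0) 0 (by simp) (by linarith) (by linarith)
    obtain ⟨b1, b2⟩ := lobes_half_left (w := lobe₂ (1 / 3) (z + (x + 2 / 3)) + 1 / 2) (k := 1) 1 (by simp) (by linarith) (by linarith)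
    obtain ⟨c1, c2⟩ := lobes_two_thirds_left (w := z + x) (k := 0) 0 (by simp) (by linarith) (by linarith)
    obtain ⟨d1, d2⟩ := lobes_half_right (w := lobe₁ (2 / 3) (z + x) + 1 / 2) (k := 0) 0 (by simp) (by linarith) (by linarith)
    refine ⟨?_, ?_, ?_⟩ <;> linarith
  rcases le_total (z + x) (2 / 3) with h2 | h2
  · obtain ⟨a1, a2⟩ := lobes_third_left (w := z + (x + 2 / 3)) (k := 1) 1 (by simp) (by linarith) (by linarith)
    obtain ⟨b1, b2⟩ := lobes_half_left (w := lobe₂ (1 / 3) (z + (x + 2 / 3)) + 1 / 2) (k := 1) 1 (by simp) (by linarith) (by linarith)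
    obtain ⟨c1, c2⟩ := lobes_two_thirds_left (w := z + x) (k := 0) 0 (by simp) (by linarith) (by linarith)
    obtain ⟨d1, d2⟩ := lobes_half_left (w := lobe₁ (2 / 3) (z + x) + 1 / 2) (k := 1) 1 (by simp) (by linarith) (by linarith)
    refine ⟨?_, ?_, ?_⟩ <;> linarith
  · obtain ⟨a1, a2⟩ := lobes_third_right (w := z + (x + 2 / 3)) (k := 1) 1 (by simp) (by linarith) (by linarith)
    obtain ⟨b1, b2⟩ := lobes_half_right (w := lobe₂ (1 / 3) (z + (x + 2 / 3)) + 1 / 2) (k := 1) 1 (by simp) (by linarith) (by linarith)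
    obtain ⟨c1, c2⟩ := lobes_two_thirds_right (w := z + x) (k := 0) 0 (by simp) (by linarith) (by linarith)
    obtain ⟨d1, d2⟩ := lobes_half_left (w := lobe₁ (2 / 3) (z + x) + 1 / 2) (k := 1) 1 (by simp) (by linarith) (by linarith)
    refine ⟨?_, ?_, ?_⟩ <;> linarith

theorem pairAt_half_rotate : ((pairAt (1 / 2)).rotate (1 / 2) 0).fam = ((pairAt (1 / 2)).perm (Equiv.swap 0 1)).fam := by
  refine fam_congr_Icc 0 ![1, 0] (fun i => ?_) fun z hz i => ?_
  · fin_cases i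
    · show wt (1 / 2) = 1 - wt (1 / 2)
      rw [wt_half]; norm_num
    · show 1 - wt (1 / 2) = wt (1 / 2)
      rw [wt_half]; norm_num
  obtain ⟨z0, z1⟩ : z ∈ Icc (0 : ℝ) 1 := by simpa using hz
  have key : lobe₁ (1 / 2) (z + 1 / 2) = lobe₂ (1 / 2) z + 1 ∧ lobe₂ (1 / 2) (z + 1 / 2) = lobe₁ (1 / 2) z := by
    rcases le_total z (1 / 2) with h1 | h1
    · obtain ⟨a1, a2⟩ := lobes_half_left (w := z) (k := 0) 0 (by simp) (by linarith) (by linarith)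
      obtain ⟨b1, b2⟩ := lobes_half_right (w := z + 1 / 2) (k := 0) 0 (by simp) (by linarith) (by linarith)
      constructor <;> linarith
    · obtain ⟨a1, a2⟩ := lobes_half_right (w := z) (k := 0) 0 (by simp) (by linarith) (by linarith)
      obtain ⟨b1, b2⟩ := lobes_half_left (w := z + 1 / 2) (k := 1) 1 (by simp) (by linarith) (by linarith)
      constructor <;> linarith
  fin_cases i
  · show lobe₁ (wt (1 / 2)) (z + 1 / 2) + 0 = lobe₂ (wt (1 / 2)) z + (1 : ℤ)
    rw [wt_half, key.1]; simp
  · show lobe₂ (wt (1 / 2)) (z + 1 / 2) + 0 = lobe₁ (wt (1 / 2)) z + (0 : ℤ)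
    rw [wt_half, key.2]; simp

theorem lobe₁_add_int (a z : ℝ) (m : ℤ) : lobe₁ a (z + m) = lobe₁ a z + m := degOne_add_int _ _ _

theorem lobe₂_add_int (a z : ℝ) (m : ℤ) : lobe₂ a (z + m) = lobe₂ a z + m := degOne_add_int _ _ _

/-- All parameters except the weight are angles: integer translations change the coordinates by
integers only. -/
theorem famA_periodic (v : Par) (m₁ m₂ m₃ m₄ m₅ : ℤ) :
    (famA (v + (0, (m₁ : ℝ), (m₂ : ℝ), (m₃ : ℝ), (m₄ : ℝ), (m₅ : ℝ)))).fam = (famA v).fam := by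
  obtain ⟨a, x, u, y₁, y₂, y₃⟩ := v
  simp only [Prod.mk_add_mk]
  refine fam_congr_three 0 (m₁ + m₂ + m₃) (m₁ + m₂ + m₄) (m₁ + m₅) ?_ fun z _ => ?_
  · rw [famA_len, famA_len, add_zero]
  simp only [famA_map, Matrix.cons_val, add_zero]
  rw [← add_assoc z x, lobe₁_add_int, lobe₂_add_int,
    show lobe₁ (wt a) (z + x) + m₁ + (u + m₂) = lobe₁ (wt a) (z + x) + u + ((m₁ + m₂ : ℤ) : ℝ) by push_cast; ring,
    lobe₁_add_int, lobe₂_add_int]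
  push_cast
  refine ⟨?_, ?_, ?_⟩ <;> ring

theorem famB_periodic (v : Par) (m₁ m₂ m₃ m₄ m₅ : ℤ) :
    (famB (v + (0, (m₁ : ℝ), (m₂ : ℝ), (m₃ : ℝ), (m₄ : ℝ), (m₅ : ℝ)))).fam = (famB v).fam := by
  obtain ⟨a, x, u, y₁, y₂, y₃⟩ := v
  simp only [Prod.mk_add_mk]
  refine fam_congr_three 0 (m₁ + m₃) (m₁ + m₂ + m₄) (m₁ + m₂ + m₅) ?_ fun z _ => ?_
  · rw [famB_len, famB_len, add_zero]
  simp only [famB_map, Matrix.cons_val, add_zero]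
  rw [← add_assoc z x, lobe₁_add_int, lobe₂_add_int,
    show lobe₂ (wt a) (z + x) + m₁ + (u + m₂) = lobe₂ (wt a) (z + x) + u + ((m₁ + m₂ : ℤ) : ℝ) by push_cast; ring,
    lobe₁_add_int, lobe₂_add_int]
  push_cast
  refine ⟨?_, ?_, ?_⟩ <;> ring

theorem famC_periodic (v : Par) (m₁ m₂ m₃ m₄ m₅ : ℤ) :
    (famC (v + (0, (m₁ : ℝ), (m₂ : ℝ), (m₃ : ℝ), (m₄ : ℝ), (m₅ : ℝ)))).fam = (famC v).fam := by
  obtain ⟨a, x, u, y₁, y₂, y₃⟩ := v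
  simp only [Prod.mk_add_mk]
  refine fam_congr_three 0 (m₁ + m₂ + m₃) (m₁ + m₄) (m₁ + m₂ + m₅) ?_ fun z _ => ?_
  · rw [famC_len, famC_len, add_zero]
  simp only [famC_map, Matrix.cons_val, add_zero]
  rw [← add_assoc z x, lobe₁_add_int, lobe₂_add_int,
    show lobe₂ (wt a) (z + x) + m₁ + (u + m₂) = lobe₂ (wt a) (z + x) + u + ((m₁ + m₂ : ℤ) : ℝ) by push_cast; ring,
    lobe₁_add_int, lobe₂_add_int]
  push_cast
  refine ⟨?_, ?_, ?_⟩ <;> ring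

end Cactus

/-! ## Chains of families of cacti -/

section Chains

variable (k : Type*) [CommRing k] {S : ∀ n, Set (Fam n)} {n p : ℕ}

theorem fam_of_degenerate {f : (Fin p → unitInterval) → Fam n} (h : Degenerate f) : fam k S f = 0 := by
  refine dif_neg ?_
  rintro ⟨ρ, hρ⟩
  obtain ⟨j, hj⟩ := h
  exact ρ.2.2 ⟨j, fun x y hxy => Subtype.ext (by rw [hρ, hρ, hj x y hxy])⟩

theorem fam_cub (ρ : Cub S n p) : fam k S (fun t => (ρ.1 t).1) = Finsupp.single ρ 1 := by
  have h : ∃ ρ' : Cub S n p, ∀ t, (ρ'.1 t).1 = (ρ.1 t).1 := ⟨ρ, fun _ => rfl⟩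
  rw [fam, dif_pos h]
  congr 1
  exact Subtype.ext (funext fun t => Subtype.ext (h.choose_spec t))

theorem fam_of_isCube {f : (Fin p → unitInterval) → Fam n} (h : IsCube S f) (hd : ¬ Degenerate f) :
    ∃ ρ : Cub S n p, (∀ t, (ρ.1 t).1 = f t) ∧ fam k S f = Finsupp.single ρ 1 := by
  obtain ⟨g, hg, h⟩ := h
  obtain rfl : (fun t => (g t).1) = f := funext h
  have hd' : ¬ Degenerate g := fun ⟨j, hj⟩ => hd ⟨j, fun x y hxy => congrArg Subtype.val (hj x y hxy)⟩
  exact ⟨⟨g, hg, hd'⟩, fun _ => rfl, fam_cub k ⟨g, hg, hd'⟩⟩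

theorem eq_of_mem_support_fam {f : (Fin p → unitInterval) → Fam n} {ρ : Cub S n p}
    (h : ρ ∈ (fam k S f).support) (t) : (ρ.1 t).1 = f t := by
  unfold fam at h
  split_ifs at h with h'
  · have := Finsupp.support_single_subset h
    rw [Finset.mem_singleton] at this
    rw [this]
    exact h'.choose_spec t
  · simp at h

theorem degenerate_face {X : Type} {f : (Fin (p + 1) → unitInterval) → X} {j₀ : Fin (p + 1)}
    (h : ∀ x y, (∀ l, l ≠ j₀ → x l = y l) → f x = f y) {j : Fin (p + 1)} (hj : j ≠ j₀) (c : unitInterval) :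
    Degenerate fun t => f (j.insertNth (α := fun _ => unitInterval) c t) := by
  obtain ⟨l, rfl⟩ := Fin.exists_succAbove_eq hj.symm
  refine ⟨l, fun x y hxy => h _ _ fun i hi => ?_⟩
  rcases Fin.eq_self_or_eq_succAbove j i with rfl | ⟨i, rfl⟩
  · simp
  · simp only [Fin.insertNth_apply_succAbove]
    exact hxy i fun h => hi (by rw [h])

/-- The boundary of a possibly degenerate cube. -/
theorem bd_fam {f : (Fin (p + 1) → unitInterval) → Fam n} (h : IsCube S f) :
    bd k S n p (fam k S f) = ∑ j : Fin (p + 1), (-1 : k) ^ j.1 •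
      (fam k S (fun t => f (j.insertNth (α := fun _ => unitInterval) 1 t)) -
        fam k S (fun t => f (j.insertNth (α := fun _ => unitInterval) 0 t))) := by
  by_cases hd : Degenerate f
  · rw [fam_of_degenerate k hd, map_zero]
    obtain ⟨j₀, hj₀⟩ := hd
    refine (Finset.sum_eq_zero fun j _ => ?_).symm
    by_cases hj : j = j₀
    · subst hj
      have : (fun t => f (j.insertNth (α := fun _ => unitInterval) 1 t)) =
          fun t => f (j.insertNth (α := fun _ => unitInterval) 0 t) := by
        funext t
        refine hj₀ _ _ fun l hl => ?_
        obtain ⟨l, rfl⟩ := Fin.exists_succAbove_eq hl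
        simp
      rw [this, sub_self, smul_zero]
    · rw [fam_of_degenerate k (degenerate_face hj₀ hj _), fam_of_degenerate k (degenerate_face hj₀ hj _),
        sub_self, smul_zero]
  · obtain ⟨ρ, hρ, e⟩ := fam_of_isCube k h hd
    rw [e, bd, Finsupp.linearCombination_single, one_smul]
    simp only [hρ]

variable {k} in
theorem bd_fam_eq_zero {f : (Fin (p + 1) → unitInterval) → Fam n} (h : IsCube S f)
    (hf : ∀ j : Fin (p + 1), ∀ t, f (j.insertNth (α := fun _ => unitInterval) 1 t) =
      f (j.insertNth (α := fun _ => unitInterval) 0 t)) : bd k S n p (fam k S f) = 0 := by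
  rw [bd_fam k h]
  refine Finset.sum_eq_zero fun j _ => ?_
  rw [funext (hf j), sub_self, smul_zero]

end Chains

/-! ### Composition, permutation and boundary of chains of cacti -/

namespace Cactus

section

variable (k : Type*) [CommRing k] {S : ∀ n, Set (Fam n)} (hS : ∀ n, ARCcp n ⊆ S n) {m n p q : ℕ}

variable (S) in
/-- The chain of a family of cacti over a cube. -/
def chain (C : (Fin p → unitInterval) → Cactus n) : Chain k S n p := ArcOperad.fam k S fun t => (C t).fam

include hS

theorem isCube {C : (Fin p → unitInterval) → Cactus n} (hC : ContFam C) : IsCube S fun t => (C t).fam :=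
  ⟨fun t => (C t).toSpace hS, continuous_fam hS hC.len hC.map, fun _ => rfl⟩

/-- The composition of chains is defined on nondegenerate cubes. For families of cacti the formula
persists in the degenerate case, since the product is then degenerate in the same direction. -/
theorem comp_chain {C : (Fin p → unitInterval) → Cactus (m + 1)} (hC : ContFam C) (i : Fin (m + 1))
    {D : (Fin q → unitInterval) → Cactus n} (hD : ContFam D) :
    ArcOperad.comp k S i (chain k S C) (chain k S D) =
      chain k S fun t => (C fun l => t (l.castAdd q)).comp i (D fun l => t (l.natAdd p)) := by
  by_cases hdC : Degenerate fun t => (C t).fam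
  · rw [chain, fam_of_degenerate k hdC, map_zero, LinearMap.zero_apply]
    obtain ⟨j, hj⟩ := hdC
    beta_reduce at hj
    refine (fam_of_degenerate k ⟨j.castAdd q, fun x y hxy => ?_⟩).symm
    simp only [← compFam_fam]
    rw [hj (fun l => x (l.castAdd q)) (fun l => y (l.castAdd q)) fun l hl => hxy _ fun h => hl (Fin.castAdd_injective _ _ h)]
    congr 2
    congr 1
    funext l
    refine hxy _ fun h => ?_
    have := congrArg Fin.val h
    simp at this
    omega
  by_cases hdD : Degenerate fun t => (D t).fam
  · rw [show chain k S D = 0 from fam_of_degenerate k hdD, map_zero]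
    obtain ⟨j, hj⟩ := hdD
    beta_reduce at hj
    refine (fam_of_degenerate k ⟨j.natAdd p, fun x y hxy => ?_⟩).symm
    simp only [← compFam_fam]
    rw [hj (fun l => x (l.natAdd p)) (fun l => y (l.natAdd p)) fun l hl => hxy _ fun h => hl (Fin.natAdd_injective _ _ h)]
    congr 2
    congr 1
    funext l
    refine hxy _ fun h => ?_
    have := congrArg Fin.val h
    simp at this
    omega
  obtain ⟨σ, hσ, e⟩ := fam_of_isCube k (isCube hS hC) hdC
  obtain ⟨τ, hτ, e'⟩ := fam_of_isCube k (isCube hS hD) hdD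
  rw [chain, chain, e, e', ArcOperad.comp, Finsupp.linearCombination_single, one_smul,
    Finsupp.linearCombination_single, one_smul, chain]
  congr 1
  funext t
  rw [prodFam, hσ, hτ, compFam_fam]

theorem composable_chain {x : Chain k S (m + 1) p} {y : Chain k S n q} {C : (Fin p → unitInterval) → Cactus (m + 1)}
    (hC : ContFam C) (i : Fin (m + 1)) {D : (Fin q → unitInterval) → Cactus n} (hD : ContFam D)
    (hx : x = chain k S C ∨ x = -chain k S C) (hy : y = chain k S D ∨ y = -chain k S D) : Composable x i y := by
  intro σ hσ τ hτ
  have h1 : σ ∈ (chain k S C).support := by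
    rcases hx with rfl | rfl
    · exact hσ
    · rwa [Finsupp.support_neg] at hσ
  have h2 : τ ∈ (chain k S D).support := by
    rcases hy with rfl | rfl
    · exact hτ
    · rwa [Finsupp.support_neg] at hτ
  have e : prodFam S i σ τ = fun t => ((C fun l => t (l.castAdd q)).comp i (D fun l => t (l.natAdd p))).fam := by
    funext t
    rw [prodFam, eq_of_mem_support_fam k h1, eq_of_mem_support_fam k h2, compFam_fam]
  rw [e]
  exact isCube hS ((hC.precomp (by fun_prop)).comp i (hD.precomp (by fun_prop)))

theorem perm_chain {C : (Fin p → unitInterval) → Cactus n} (hC : ContFam C) (σ : Equiv.Perm (Fin n)) :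
    ArcOperad.perm k S σ (chain k S C) = chain k S fun t => (C t).perm σ := by
  by_cases hd : Degenerate fun t => (C t).fam
  · rw [chain, fam_of_degenerate k hd, map_zero]
    obtain ⟨j, hj⟩ := hd
    beta_reduce at hj
    refine (fam_of_degenerate k ⟨j, fun x y hxy => ?_⟩).symm
    simp only [← permFam_fam]
    rw [hj x y hxy]
  · obtain ⟨ρ, hρ, e⟩ := fam_of_isCube k (isCube hS hC) hd
    rw [chain, e, ArcOperad.perm, Finsupp.linearCombination_single, one_smul, chain]
    congr 1
    funext t
    rw [hρ, permFam_fam]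

/-- The boundary of a path. -/
theorem bd_path {C : ℝ → Cactus n} (hC : ContFam C) :
    bd k S n 0 (chain k S fun t => C (t 0)) = (chain k S fun _ => C 1) - chain k S fun _ => C 0 := by
  rw [chain, bd_fam k (isCube hS (hC.precomp (by fun_prop)))]
  simp [chain]

/-- The boundary of a square. -/
theorem bd_square {C : ℝ × ℝ → Cactus n} (hC : ContFam C) :
    bd k S n 1 (chain k S fun t => C (t 0, t 1)) =
      (chain k S fun t => C (1, t 0)) - (chain k S fun t => C (0, t 0)) -
        ((chain k S fun t => C (t 0, 1)) - chain k S fun t => C (t 0, 0)) := by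
  rw [chain, bd_fam k (isCube hS (hC.precomp (by fun_prop))), Fin.sum_univ_two]
  have e : ∀ (c : unitInterval) (t : Fin 1 → unitInterval),
      Fin.insertNth (α := fun _ => unitInterval) 1 c t 0 = t 0 := fun c t =>
    Fin.insertNth_apply_succAbove (α := fun _ => unitInterval) 1 c t 0
  have e' : ∀ (c : unitInterval) (t : Fin 1 → unitInterval),
      Fin.insertNth (α := fun _ => unitInterval) 0 c t 1 = t 0 := fun c t =>
    Fin.insertNth_apply_succAbove (α := fun _ => unitInterval) 0 c t 0
  simp only [e, e', Fin.insertNth_apply_same, chain]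
  simp [sub_eq_add_neg, add_comm]

end

end Cactus

/-! ## Paths of cacti modulo boundaries -/

namespace Cactus

theorem Par.line (s a x u y₁ y₂ y₃ a' x' u' y₁' y₂' y₃' : ℝ) :
    ((a, x, u, y₁, y₂, y₃) : Par) + s • (((a', x', u', y₁', y₂', y₃') : Par) - (a, x, u, y₁, y₂, y₃)) =
      (a + s * (a' - a), x + s * (x' - x), u + s * (u' - u), y₁ + s * (y₁' - y₁), y₂ + s * (y₂' - y₂),
        y₃ + s * (y₃' - y₃)) := rfl

section

variable (k : Type*) [CommRing k] {S : ∀ n, Set (Fam n)} (hS : ∀ n, ARCcp n ⊆ S n) {n p : ℕ}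

theorem chain_congr {C D : (Fin p → unitInterval) → Cactus n} (h : ∀ t, (C t).fam = (D t).fam) :
    chain k S C = chain k S D := by
  unfold chain; rw [funext h]

variable (S) in
/-- The class of the straight path from `P` to `Q` in a family of cacti, modulo boundaries. -/
def seg (Ψ : Par → Cactus n) (P Q : Par) : Chain k S n 1 ⧸ LinearMap.range (bd k S n 1) :=
  (LinearMap.range (bd k S n 1)).mkQ (chain k S fun t => Ψ (P + (t 0 : ℝ) • (Q - P)))

theorem seg_congr {Ψ Φ : Par → Cactus n} {P Q P' Q' : Par}
    (h : ∀ s ∈ Icc (0 : ℝ) 1, (Ψ (P + s • (Q - P))).fam = (Φ (P' + s • (Q' - P'))).fam) :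
    seg k S Ψ P Q = seg k S Φ P' Q' := by
  unfold seg
  rw [chain_congr k fun t => h (t 0) (t 0).2]

theorem seg_self (Ψ : Par → Cactus n) (P : Par) : seg k S Ψ P P = 0 := by
  unfold seg chain
  rw [fam_of_degenerate k ⟨0, fun x y _ => by simp⟩, map_zero]

variable {Ψ : Par → Cactus n} (hΨ : ContFam Ψ)

theorem seg_add {e : Par} (he : ∀ v, (Ψ (v + e)).fam = (Ψ v).fam) (P Q : Par) :
    seg k S Ψ (P + e) (Q + e) = seg k S Ψ P Q := by
  refine seg_congr k fun s _ => ?_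
  rw [← he (P + s • (Q - P)), add_sub_add_right_eq_sub, add_right_comm]

include hS hΨ

/-- The parameter space is a vector space, so the triangle `P`, `Q`, `R` is filled by the square `P
+ t₁ (Q - P) + t₀ t₁ (R - Q)`; its side `t₁ = 0` is constant and vanishes in normalized chains. -/
theorem seg_trans (P Q R : Par) : seg k S Ψ P Q + seg k S Ψ Q R = seg k S Ψ P R := by
  have hc : ContFam fun v : ℝ × ℝ => Ψ (P + v.2 • (Q - P) + v.1 • v.2 • (R - Q)) := hΨ.precomp (by fun_prop)
  have h := bd_square (k := k) hS hc
  have h0 : (chain k S fun t : Fin 1 → unitInterval => Ψ (P + (0 : ℝ) • (Q - P) + (t 0 : ℝ) • (0 : ℝ) • (R - Q))) = 0 :=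
    fam_of_degenerate k ⟨0, fun x y _ => by simp⟩
  simp only at h
  rw [h0, sub_zero] at h
  have h1 : (LinearMap.range (bd k S n 1)).mkQ (bd k S n 1 (chain k S fun t : Fin 2 → unitInterval =>
      Ψ (P + (t 1 : ℝ) • (Q - P) + (t 0 : ℝ) • (t 1 : ℝ) • (R - Q)))) = 0 :=
    (Submodule.Quotient.mk_eq_zero _).2 (LinearMap.mem_range_self _ _)
  rw [h, map_sub, map_sub, sub_eq_zero, sub_eq_iff_eq_add] at h1
  have e1 : seg k S Ψ P R = (LinearMap.range (bd k S n 1)).mkQ (chain k S fun t : Fin 1 → unitInterval =>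
      Ψ (P + (t 0 : ℝ) • (Q - P) + (1 : ℝ) • (t 0 : ℝ) • (R - Q))) := by
    rw [seg]; congr 2; funext t
    rw [one_smul, add_assoc, ← smul_add, sub_add_sub_cancel']
  have e2 : seg k S Ψ P Q = (LinearMap.range (bd k S n 1)).mkQ (chain k S fun t : Fin 1 → unitInterval =>
      Ψ (P + (t 0 : ℝ) • (Q - P) + (0 : ℝ) • (t 0 : ℝ) • (R - Q))) := by
    rw [seg]; congr 2; funext t
    rw [zero_smul, add_zero]
  have e3 : seg k S Ψ Q R = (LinearMap.range (bd k S n 1)).mkQ (chain k S fun t : Fin 1 → unitInterval =>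
      Ψ (P + (1 : ℝ) • (Q - P) + (t 0 : ℝ) • (1 : ℝ) • (R - Q))) := by
    rw [seg]; congr 2; funext t
    rw [one_smul, one_smul, add_sub_cancel]
  rw [e1, e2, e3, h1]
  exact add_comm _ _

theorem seg_symm (P Q : Par) : seg k S Ψ Q P = -seg k S Ψ P Q := by
  rw [eq_neg_iff_add_eq_zero, seg_trans k hS hΨ, seg_self]

/-- Parallel loops are homologous. -/
theorem seg_loop {e : Par} (he : ∀ v, (Ψ (v + e)).fam = (Ψ v).fam) (P P' : Par) :
    seg k S Ψ P (P + e) = seg k S Ψ P' (P' + e) := by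
  have h1 := seg_trans k hS hΨ P P' (P' + e)
  have h2 := seg_trans k hS hΨ P (P + e) (P' + e)
  rw [seg_add k he] at h2
  rw [← h2] at h1
  exact (add_left_cancel (h1.trans (add_comm _ _))).symm

theorem seg_loop_neg {e : Par} (he : ∀ v, (Ψ (v + e)).fam = (Ψ v).fam) (P P' : Par) :
    seg k S Ψ P (P - e) = -seg k S Ψ P' (P' + e) := by
  rw [seg_symm k hS hΨ, seg_loop k hS hΨ he P' (P - e), sub_add_cancel]

end

section

variable (k : Type*) [CommRing k] {S : ∀ n, Set (Fam n)} (hS : ∀ n, ARCcp n ⊆ S n)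
include hS

/-- The relation between the seven loops which is behind the seven-term relation. -/
theorem loop_relation :
    seg k S famA (2 / 3, 0, 0, 0, 0, 0) (2 / 3, 1, 0, 0, 0, 0) - seg k S famA (2 / 3, 0, 0, 0, 0, 0) (2 / 3, 0, 1, 0, 0, 0)
      - seg k S famB (1 / 3, 0, 0, 0, 0, 0) (1 / 3, 0, 1, 0, 0, 0) - seg k S famC (1 / 3, 0, 0, 0, 0, 0) (1 / 3, 0, 1, 0, 0, 0)
      + seg k S famA (2 / 3, 0, 0, 0, 0, 0) (2 / 3, 0, 0, 1, 0, 0) + seg k S famA (2 / 3, 0, 0, 0, 0, 0) (2 / 3, 0, 0, 0, 1, 0)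
      + seg k S famA (2 / 3, 0, 0, 0, 0, 0) (2 / 3, 0, 0, 0, 0, 1) = 0 := by
  have tA := seg_trans k hS contFam_famA
  have tB := seg_trans k hS contFam_famB
  have tC := seg_trans k hS contFam_famC
  -- First half turn of the pair 2, 3: the circle 1 is carried once around the circle 2.
  have hB : seg k S famB (1 / 3, 0, 0, 0, 0, 0) (1 / 3, 0, 1 / 2, 0, 0, 0) =
      seg k S famA (2 / 3, 0, 0, 0, 0, 0) (2 / 3, 1 / 3, -1 / 2, 0, 1, 0) := by
    refine seg_congr k fun s hs => ?_
    have key := famB_eq_famA_twist (u := s / 2) ⟨by linarith [hs.1], by linarith [hs.2]⟩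
    rw [Par.line, Par.line]
    convert key using 4 <;> ring_nf
  -- The pair 1, 3 is cut likewise: the circle 2 goes around the circle 1 within `famA`, and then
  -- around the circle 3 within `famB`.
  have hC : seg k S famC (1 / 3, 0, 0, 0, 0, 0) (1 / 3, 0, 1 / 2, 0, 0, 0) =
      seg k S famA (2 / 3, 0, 1 / 2, 0, 0, 0) (2 / 3, 1 / 3, 0, 1, 0, 0) := by
    refine seg_congr k fun s hs => ?_
    have key := famC_eq_famA_twist (u := s / 2) ⟨by linarith [hs.1], by linarith [hs.2]⟩
    rw [Par.line, Par.line]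
    convert key using 4 <;> ring_nf
  have hC' : seg k S famC (1 / 3, 0, 1 / 2, 0, 0, 0) (1 / 3, 0, 1, 0, 0, 0) =
      seg k S famB (1 / 3, 1 / 3, 0, 0, 0, 0) (1 / 3, 2 / 3, -1 / 2, 0, 0, 1) := by
    refine seg_congr k fun s hs => ?_
    have key := famC_eq_famB_twist (v := s / 2) ⟨by linarith [hs.1], by linarith [hs.2]⟩
    rw [Par.line, Par.line]
    convert key using 4 <;> ring_nf
  have hx : ∀ c : ℝ, seg k S famA (2 / 3, 0, 0, 0, 0, 0) (2 / 3, c, 0, 0, 0, 0) =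
      seg k S famB (1 / 3, 0, 0, 0, 0, 0) (1 / 3, c, 0, 0, 0, 0) := fun c => by
    refine seg_congr k fun s hs => ?_
    have key := famA_eq_famB (s * c) 0
    rw [Par.line, Par.line]
    convert key using 4 <;> ring_nf
  have hy : seg k S famA (2 / 3, 0, 0, 0, 0, 0) (2 / 3, 0, 0, 0, 0, 1) =
      seg k S famB (1 / 3, 0, 0, 0, 0, 0) (1 / 3, 0, 0, 0, 0, 1) := by
    refine seg_congr k fun s hs => ?_
    have key := famA_eq_famB 0 s
    rw [Par.line, Par.line]
    convert key using 4 <;> ring_nf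
  -- With the reversed cyclic order, a rotation of the loop by `1 / 3` passes between `famA` and
  -- `famB`.
  have hq : seg k S famA (2 / 3, 0, 1 / 2, 0, 0, 0) (2 / 3, 1 / 3, 1 / 2, 0, 0, 0) =
      seg k S famB (1 / 3, 2 / 3, 1 / 2, 0, 0, 0) (1 / 3, 1, 1 / 2, 0, 0, 0) := by
    refine seg_congr k fun s hs => ?_
    have key := famA_eq_famB_half (s / 3)
    rw [Par.line, Par.line]
    convert key using 4 <;> ring_nf
  have pA : ∀ m₁ m₂ m₃ m₄ m₅ : ℤ, ∀ v : Par,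
      (famA (v + (0, (m₁ : ℝ), (m₂ : ℝ), (m₃ : ℝ), (m₄ : ℝ), (m₅ : ℝ)))).fam = (famA v).fam :=
    fun m₁ m₂ m₃ m₄ m₅ v => famA_periodic v m₁ m₂ m₃ m₄ m₅
  have pB : ∀ m₁ m₂ m₃ m₄ m₅ : ℤ, ∀ v : Par,
      (famB (v + (0, (m₁ : ℝ), (m₂ : ℝ), (m₃ : ℝ), (m₄ : ℝ), (m₅ : ℝ)))).fam = (famB v).fam :=
    fun m₁ m₂ m₃ m₄ m₅ v => famB_periodic v m₁ m₂ m₃ m₄ m₅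
  have l₁ : seg k S famA (2 / 3, 1 / 3, -1 / 2, 0, 0, 0) (2 / 3, 1 / 3, 1 / 2, 0, 0, 0) =
      seg k S famA (2 / 3, 0, 0, 0, 0, 0) (2 / 3, 0, 1, 0, 0, 0) := by
    convert seg_loop k hS contFam_famA (pA 0 1 0 0 0) (2 / 3, 1 / 3, -1 / 2, 0, 0, 0) (2 / 3, 0, 0, 0, 0, 0) using 2 <;>
      simp only [Prod.mk_add_mk] <;> norm_num
  have ly₁ : seg k S famA (2 / 3, 1 / 3, 0, 0, 0, 0) (2 / 3, 1 / 3, 0, 1, 0, 0) =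
      seg k S famA (2 / 3, 0, 0, 0, 0, 0) (2 / 3, 0, 0, 1, 0, 0) := by
    convert seg_loop k hS contFam_famA (pA 0 0 1 0 0) (2 / 3, 1 / 3, 0, 0, 0, 0) (2 / 3, 0, 0, 0, 0, 0) using 2 <;>
      simp only [Prod.mk_add_mk] <;> norm_num
  have ly₂ : seg k S famA (2 / 3, 1 / 3, -1 / 2, 0, 0, 0) (2 / 3, 1 / 3, -1 / 2, 0, 1, 0) =
      seg k S famA (2 / 3, 0, 0, 0, 0, 0) (2 / 3, 0, 0, 0, 1, 0) := by
    convert seg_loop k hS contFam_famA (pA 0 0 0 1 0) (2 / 3, 1 / 3, -1 / 2, 0, 0, 0) (2 / 3, 0, 0, 0, 0, 0) using 2 <;>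
      simp only [Prod.mk_add_mk] <;> norm_num
  have ly₃ : seg k S famB (1 / 3, 2 / 3, -1 / 2, 0, 0, 0) (1 / 3, 2 / 3, -1 / 2, 0, 0, 1) =
      seg k S famB (1 / 3, 0, 0, 0, 0, 0) (1 / 3, 0, 0, 0, 0, 1) := by
    convert seg_loop k hS contFam_famB (pB 0 0 0 0 1) (1 / 3, 2 / 3, -1 / 2, 0, 0, 0) (1 / 3, 0, 0, 0, 0, 0) using 2 <;>
      simp only [Prod.mk_add_mk] <;> norm_num
  have sq : seg k S famB (1 / 3, 2 / 3, 1 / 2, 0, 0, 0) (1 / 3, 1, 1 / 2, 0, 0, 0) =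
      seg k S famB (1 / 3, 2 / 3, -1 / 2, 0, 0, 0) (1 / 3, 1, -1 / 2, 0, 0, 0) := by
    convert seg_add (S := S) k (pB 0 1 0 0 0) (1 / 3, 2 / 3, -1 / 2, 0, 0, 0) (1 / 3, 1, -1 / 2, 0, 0, 0) using 2 <;>
      simp only [Prod.mk_add_mk] <;> norm_num
  -- The second half turn of the pair 2, 3 stays in `famB`; a period moves it next to the other
  -- pieces.
  have sb : seg k S famB (1 / 3, 0, 1 / 2, 0, 0, 0) (1 / 3, 0, 1, 0, 0, 0) =
      seg k S famB (1 / 3, 1, -1 / 2, 0, 0, 0) (1 / 3, 1, 0, 0, 0, 0) := by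
    convert seg_add (S := S) k (pB (-1) 1 0 0 0) (1 / 3, 1, -1 / 2, 0, 0, 0) (1 / 3, 1, 0, 0, 0, 0) using 2 <;>
      simp only [Prod.mk_add_mk] <;> norm_num
  -- The null path from inner angle `1 / 2` through 0 to `-1 / 2` and back expresses the full turn
  -- of the pair 1, 2 by two half turns, which then cancel against pieces of the other loops.
  have hz := seg_self (S := S) k famA (2 / 3, 1 / 3, 1 / 2, 0, 0, 0)
  rw [← tA _ (2 / 3, 1 / 3, -1 / 2, 0, 0, 0) _, l₁, ← tA _ (2 / 3, 1 / 3, 0, 0, 0, 0) _] at hz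
  rw [← tB (1 / 3, 0, 0, 0, 0, 0) (1 / 3, 0, 1 / 2, 0, 0, 0) (1 / 3, 0, 1, 0, 0, 0), hB, sb,
    ← tC (1 / 3, 0, 0, 0, 0, 0) (1 / 3, 0, 1 / 2, 0, 0, 0) (1 / 3, 0, 1, 0, 0, 0), hC, hC', hy, hx 1,
    ← tA _ (2 / 3, 1 / 3, -1 / 2, 0, 0, 0) (2 / 3, 1 / 3, -1 / 2, 0, 1, 0), ly₂,
    ← tA _ (2 / 3, 1 / 3, 0, 0, 0, 0) (2 / 3, 1 / 3, -1 / 2, 0, 0, 0), hx (1 / 3),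
    ← tA _ (2 / 3, 1 / 3, 0, 0, 0, 0) (2 / 3, 1 / 3, 0, 1, 0, 0), ly₁,
    ← tA _ (2 / 3, 1 / 3, 1 / 2, 0, 0, 0) (2 / 3, 1 / 3, 0, 0, 0, 0), hq, sq,
    ← tB _ (1 / 3, 2 / 3, -1 / 2, 0, 0, 0) (1 / 3, 2 / 3, -1 / 2, 0, 0, 1), ly₃,
    ← tB (1 / 3, 0, 0, 0, 0, 0) (1 / 3, 1, -1 / 2, 0, 0, 0) (1 / 3, 1, 0, 0, 0, 0),
    ← tB (1 / 3, 0, 0, 0, 0, 0) (1 / 3, 2 / 3, -1 / 2, 0, 0, 0) (1 / 3, 1, -1 / 2, 0, 0, 0),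
    ← tB (1 / 3, 0, 0, 0, 0, 0) (1 / 3, 1 / 3, 0, 0, 0, 0) (1 / 3, 2 / 3, -1 / 2, 0, 0, 0),
    eq_neg_of_add_eq_zero_right hz]
  abel

end

end Cactus

/-! ## The operations as chains of cacti -/

namespace Cactus

/-- The cactus of the triple product. -/
def triple : Cactus 3 := Cactus.comp (m := 1) (n := 2) (pairAt (1 / 2)) 0 (pairAt (1 / 2))

theorem fam_congr_real {n : ℕ} {C D : Cactus n} (hl : ∀ i, C.len i = D.len i)
    (h : ∀ i z, C.map i z = D.map i z) : C.fam = D.fam :=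
  fam_congr hl fun i z => by rw [h]

theorem oldIndex_zero {n : ℕ} (i : Fin (0 + n)) :
    oldIndex (m := 0) 0 i = Sum.inr (Fin.cast (zero_add n) i) := by
  have h : i.1 < n := by omega
  unfold oldIndex
  rw [dif_neg (by simp), dif_pos (by simpa using h)]
  rfl

theorem circle_comp_len {n : ℕ} (c : ℝ) (D : Cactus n) (i : Fin (0 + n)) :
    (Cactus.comp (m := 0) (circle c) 0 D).len i = D.len (Fin.cast (zero_add n) i) := by
  simp only [Cactus.comp, oldIndex_zero, Sum.elim_inr]
  exact one_mul _

theorem circle_comp_map {n : ℕ} (c : ℝ) (D : Cactus n) (i : Fin (0 + n)) (z : ℝ) :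
    (Cactus.comp (m := 0) (circle c) 0 D).map i z = D.map (Fin.cast (zero_add n) i) (z + c) := by
  simp only [Cactus.comp, oldIndex_zero, Sum.elim_inr]
  rfl

theorem circle_comp_triple (c : ℝ) :
    (Cactus.comp (m := 0) (n := 3) (circle c) 0 triple).fam = (famA (1 / 2, c, 0, 0, 0, 0)).fam := by
  refine fam_congr_real (fun i => ?_) fun i z => ?_
  · rw [famA_len]
    refine (circle_comp_len c triple i).trans ?_
    fin_cases i <;>
      simp only [Cactus.comp, oldIndex, triple, pairAt, pair] <;> simp [-one_div, wt_half] <;> ring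
  · rw [famA_map]
    refine (circle_comp_map c triple i z).trans ?_
    fin_cases i <;>
      simp only [Cactus.comp, oldIndex, triple, pairAt, pair] <;> simp [-one_div, wt_half]

theorem pair_comp_zero (c : ℝ) :
    (Cactus.comp (m := 1) (n := 2) (pairAt (1 / 2)) 0 (Cactus.comp (m := 0) (n := 2) (circle c) 0 (pairAt (1 / 2)))).fam =
      (famA (1 / 2, 0, c, 0, 0, 0)).fam := by
  have hl : ∀ i, (Cactus.comp (m := 0) (n := 2) (circle c) 0 (pairAt (1 / 2))).len i = (pairAt (1 / 2)).len i :=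
    circle_comp_len c _
  have hm : ∀ i z, (Cactus.comp (m := 0) (n := 2) (circle c) 0 (pairAt (1 / 2))).map i z = (pairAt (1 / 2)).map i (z + c) :=
    circle_comp_map c _
  revert hl hm
  generalize Cactus.comp (m := 0) (n := 2) (circle c) 0 (pairAt (1 / 2)) = D
  intro hl hm
  refine fam_congr_real (fun i => ?_) fun i z => ?_
  · simp only [pairAt, pair] at hl
    rw [famA_len]
    fin_cases i <;>
      simp only [Cactus.comp, oldIndex, pairAt, pair] <;> simp [-one_div, wt_half, hl] <;> ring
  · simp only [pairAt, pair] at hm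
    rw [famA_map]
    fin_cases i <;>
      simp only [Cactus.comp, oldIndex, pairAt, pair] <;> simp [-one_div, wt_half, hm]

theorem pair_comp_one (c : ℝ) :
    (Cactus.comp (m := 1) (n := 2) (pairAt (1 / 2)) 1 (Cactus.comp (m := 0) (n := 2) (circle c) 0 (pairAt (1 / 2)))).fam =
      (famB (1 / 2, 0, c, 0, 0, 0)).fam := by
  have hl : ∀ i, (Cactus.comp (m := 0) (n := 2) (circle c) 0 (pairAt (1 / 2))).len i = (pairAt (1 / 2)).len i :=
    circle_comp_len c _
  have hm : ∀ i z, (Cactus.comp (m := 0) (n := 2) (circle c) 0 (pairAt (1 / 2))).map i z = (pairAt (1 / 2)).map i (z + c) :=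
    circle_comp_map c _
  revert hl hm
  generalize Cactus.comp (m := 0) (n := 2) (circle c) 0 (pairAt (1 / 2)) = D
  intro hl hm
  refine fam_congr_real (fun i => ?_) fun i z => ?_
  · simp only [pairAt, pair] at hl
    rw [famB_len]
    fin_cases i <;>
      simp only [Cactus.comp, oldIndex, pairAt, pair] <;> simp [-one_div, wt_half, hl] <;> ring
  · simp only [pairAt, pair] at hm
    rw [famB_map]
    fin_cases i <;>
      simp only [Cactus.comp, oldIndex, pairAt, pair] <;> simp [-one_div, wt_half, hm]

theorem triple_comp_circle (i : Fin 3) (c : ℝ) :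
    (Cactus.comp (m := 2) (n := 1) triple i (circle c)).fam =
      (famA (1 / 2, 0, 0, (![c, 0, 0] : Fin 3 → ℝ) i, (![0, c, 0] : Fin 3 → ℝ) i, (![0, 0, c] : Fin 3 → ℝ) i)).fam := by
  refine fam_congr_real (fun j => ?_) fun j z => ?_
  · rw [famA_len]
    fin_cases i <;> fin_cases j <;>
      simp only [Cactus.comp, oldIndex, circle, triple, pairAt, pair] <;> simp [-one_div, wt_half] <;> ring
  · rw [famA_map]
    fin_cases i <;> fin_cases j <;>
      simp only [Cactus.comp, oldIndex, circle, triple, pairAt, pair] <;> simp [-one_div, wt_half]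

theorem circle_comp_circle (c c' : ℝ) :
    (Cactus.comp (m := 0) (n := 1) (circle c) 0 (circle c')).fam = (circle (c + c')).fam := by
  refine fam_congr_real (fun j => ?_) fun j z => ?_
  · fin_cases j; exact one_mul _
  · fin_cases j; exact add_assoc _ _ _

end Cactus

/-! ## The relations between the operations, up to boundaries -/

open Cactus

section

variable (k : Type*) [CommRing k] (S : ∀ n, Set (Fam n))

theorem delta_eq : delta k S = chain k S fun t : Fin 1 → unitInterval => circle (-(t 0 : ℝ)) := by
  unfold delta chain
  congr 1
  funext t
  rw [← deltaFam_eq, neg_neg]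

theorem mu_eq : mu k S = chain k S fun _ : Fin 0 → unitInterval => pairAt (1 / 2) := by
  unfold mu chain
  rw [muFam_eq_pairAt]

variable {S} (hS : ∀ n, ARCcp n ⊆ S n)

theorem contFam_loop : ContFam fun t : Fin 1 → unitInterval => circle (-(t 0 : ℝ)) :=
  contFam_circle.precomp (by fun_prop)

theorem contFam_deltaMu : ContFam fun t : Fin 1 → unitInterval =>
    Cactus.comp (m := 0) (n := 2) (circle (-(t 0 : ℝ))) 0 (pairAt (1 / 2)) :=
  ContFam.comp (m := 0) (n := 2) contFam_loop 0 (ContFam.const _)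

include hS

theorem mu₃_eq : mu₃ k S = chain k S fun _ : Fin 0 → unitInterval => triple := by
  unfold mu₃
  rw [mu_eq]
  exact comp_chain (m := 1) (n := 2) k hS (ContFam.const _) 0 (ContFam.const _)

theorem DeltaMu_eq : DeltaMu k S = -chain k S fun t : Fin 1 → unitInterval =>
    Cactus.comp (m := 0) (n := 2) (circle (-(t 0 : ℝ))) 0 (pairAt (1 / 2)) := by
  unfold DeltaMu
  rw [Delta, map_neg, LinearMap.neg_apply, mu_eq, delta_eq]
  exact congrArg Neg.neg (comp_chain (m := 0) (n := 2) k hS contFam_loop 0 (ContFam.const _))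

theorem comp_Delta_Delta : (comp k S (m := 0) (n := 1) 0 (Delta k S) (Delta k S) : Chain k S 1 2) =
    chain k S fun t : Fin 2 → unitInterval => circle (-((t 0 : ℝ) + t 1)) := by
  rw [Delta, map_neg, map_neg, LinearMap.neg_apply, neg_neg, delta_eq]
  refine (comp_chain (m := 0) (n := 1) k hS contFam_loop 0 contFam_loop).trans (chain_congr k fun t => ?_)
  rw [neg_add]
  exact circle_comp_circle _ _

theorem comp_Delta_mu₃ : (comp k S (m := 0) (n := 3) 0 (Delta k S) (mu₃ k S) : Chain k S 3 1) =
    -chain k S fun t : Fin 1 → unitInterval => famA (1 / 2, -(t 0 : ℝ), 0, 0, 0, 0) := by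
  rw [Delta, map_neg, LinearMap.neg_apply, delta_eq, mu₃_eq k hS]
  exact congrArg Neg.neg ((comp_chain (m := 0) (n := 3) k hS contFam_loop 0 (ContFam.const _)).trans
    (chain_congr k fun t => circle_comp_triple _))

theorem comp_mu_zero_DeltaMu : (comp k S (m := 1) (n := 2) 0 (mu k S) (DeltaMu k S) : Chain k S 3 1) =
    -chain k S fun t : Fin 1 → unitInterval => famA (1 / 2, 0, -(t 0 : ℝ), 0, 0, 0) := by
  rw [DeltaMu_eq k hS, map_neg, mu_eq]
  refine congrArg Neg.neg ((comp_chain (m := 1) (n := 2) k hS (ContFam.const _) 0 contFam_deltaMu).trans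
    (chain_congr k fun t => ?_))
  exact pair_comp_zero _

theorem muDeltaMu_eq' : muDeltaMu k S = -chain k S fun t : Fin 1 → unitInterval =>
      Cactus.comp (m := 1) (n := 2) (pairAt (1 / 2)) 1
        (Cactus.comp (m := 0) (n := 2) (circle (-(t 0 : ℝ))) 0 (pairAt (1 / 2))) := by
  rw [muDeltaMu, DeltaMu_eq k hS, map_neg, mu_eq]
  refine congrArg Neg.neg ((comp_chain (m := 1) (n := 2) k hS (ContFam.const _) 1 contFam_deltaMu).trans
    (chain_congr k fun t => ?_))
  rfl

theorem muDeltaMu_eq : muDeltaMu k S =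
    -chain k S fun t : Fin 1 → unitInterval => famB (1 / 2, 0, -(t 0 : ℝ), 0, 0, 0) := by
  rw [muDeltaMu_eq' k hS]
  exact congrArg Neg.neg (chain_congr k fun t => pair_comp_one _)

theorem perm_muDeltaMu : perm k S (Equiv.swap 0 1) (muDeltaMu k S) =
    -chain k S fun t : Fin 1 → unitInterval => famC (1 / 2, 0, -(t 0 : ℝ), 0, 0, 0) := by
  rw [muDeltaMu_eq k hS, map_neg, perm_chain k hS (contFam_famB.precomp (by fun_prop))]
  refine congrArg Neg.neg (chain_congr k fun t => fam_congr_real (fun i => rfl) fun i z => ?_)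
  rw [famC_map]
  refine (famB_map _ _ _).trans ?_
  fin_cases i <;> rfl

theorem comp_mu₃_Delta (i : Fin 3) : (comp k S (m := 2) (n := 1) i (mu₃ k S) (Delta k S) : Chain k S 3 1) =
    -chain k S fun t : Fin 1 → unitInterval => famA (1 / 2, 0, 0, (![-(t 0 : ℝ), 0, 0] : Fin 3 → ℝ) i,
      (![0, -(t 0 : ℝ), 0] : Fin 3 → ℝ) i, (![0, 0, -(t 0 : ℝ)] : Fin 3 → ℝ) i) := by
  rw [Delta, map_neg, delta_eq, mu₃_eq k hS]
  refine congrArg Neg.neg ((comp_chain (m := 2) (n := 1) k hS (ContFam.const _) i contFam_loop).trans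
    (chain_congr k fun t => ?_))
  exact triple_comp_circle i _

/-- The sign in `Δ = -δ` cancels the negative direction of the rotation, so the class is that of the
loop along `+e`. The loop may also be moved from the weight `1 / 2` of the operations to the weights
at which the three families meet. -/
theorem mkQ_loop {n : ℕ} {Ψ : Par → Cactus n} (hΨ : ContFam Ψ) (e : Par) (he : ∀ v, (Ψ (v + e)).fam = (Ψ v).fam)
    {T : Chain k S n 1} {C : (Fin 1 → unitInterval) → Cactus n} (hT : T = -chain k S C) (P P' Q' : Par)
    (hC : ∀ t, C t = Ψ (P + (t 0 : ℝ) • (-e))) (hQ : P' + e = Q') :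
    (LinearMap.range (bd k S n 1)).mkQ T = seg k S Ψ P' Q' := by
  rw [hT, map_neg, ← hQ, neg_eq_iff_eq_neg, ← seg_loop_neg k hS hΨ he P P', seg]
  congr 2
  funext t
  rw [hC, sub_sub_cancel_left]

theorem bvDefect_mem : bvDefect k S ∈ LinearMap.range (bd k S 3 1) := by
  rw [← Submodule.Quotient.mk_eq_zero, ← Submodule.mkQ_apply]
  refine Eq.trans ?_ (loop_relation k hS)
  unfold bvDefect
  simp only [map_add, map_sub]
  rw [mkQ_loop k hS contFam_famA (0, (1 : ℤ), (0 : ℤ), (0 : ℤ), (0 : ℤ), (0 : ℤ)) (fun v => famA_periodic v _ _ _ _ _) (comp_Delta_mu₃ k hS) (1 / 2, 0, 0, 0, 0, 0) _ _ (fun t => by simp) (show ((2 / 3, 0, 0, 0, 0, 0) : Par) + _ = (2 / 3, 1, 0, 0, 0, 0) by simp),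
    mkQ_loop k hS contFam_famA (0, (0 : ℤ), (1 : ℤ), (0 : ℤ), (0 : ℤ), (0 : ℤ)) (fun v => famA_periodic v _ _ _ _ _) (comp_mu_zero_DeltaMu k hS) (1 / 2, 0, 0, 0, 0, 0) _ _ (fun t => by simp) (show ((2 / 3, 0, 0, 0, 0, 0) : Par) + _ = (2 / 3, 0, 1, 0, 0, 0) by simp),
    mkQ_loop k hS contFam_famB (0, (0 : ℤ), (1 : ℤ), (0 : ℤ), (0 : ℤ), (0 : ℤ)) (fun v => famB_periodic v _ _ _ _ _) (muDeltaMu_eq k hS) (1 / 2, 0, 0, 0, 0, 0) _ _ (fun t => by simp) (show ((1 / 3, 0, 0, 0, 0, 0) : Par) + _ = (1 / 3, 0, 1, 0, 0, 0) by simp),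
    mkQ_loop k hS contFam_famC (0, (0 : ℤ), (1 : ℤ), (0 : ℤ), (0 : ℤ), (0 : ℤ)) (fun v => famC_periodic v _ _ _ _ _) (perm_muDeltaMu k hS) (1 / 2, 0, 0, 0, 0, 0) _ _ (fun t => by simp) (show ((1 / 3, 0, 0, 0, 0, 0) : Par) + _ = (1 / 3, 0, 1, 0, 0, 0) by simp),
    mkQ_loop k hS contFam_famA (0, (0 : ℤ), (0 : ℤ), (1 : ℤ), (0 : ℤ), (0 : ℤ)) (fun v => famA_periodic v _ _ _ _ _) (comp_mu₃_Delta k hS 0) (1 / 2, 0, 0, 0, 0, 0) _ _ (fun t => by simp) (show ((2 / 3, 0, 0, 0, 0, 0) : Par) + _ = (2 / 3, 0, 0, 1, 0, 0) by simp),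
    mkQ_loop k hS contFam_famA (0, (0 : ℤ), (0 : ℤ), (0 : ℤ), (1 : ℤ), (0 : ℤ)) (fun v => famA_periodic v _ _ _ _ _) (comp_mu₃_Delta k hS 1) (1 / 2, 0, 0, 0, 0, 0) _ _ (fun t => by simp) (show ((2 / 3, 0, 0, 0, 0, 0) : Par) + _ = (2 / 3, 0, 0, 0, 1, 0) by simp),
    mkQ_loop k hS contFam_famA (0, (0 : ℤ), (0 : ℤ), (0 : ℤ), (0 : ℤ), (1 : ℤ)) (fun v => famA_periodic v _ _ _ _ _) (comp_mu₃_Delta k hS 2) (1 / 2, 0, 0, 0, 0, 0) _ _ (fun t => by simp) (show ((2 / 3, 0, 0, 0, 0, 0) : Par) + _ = (2 / 3, 0, 0, 0, 0, 1) by simp)]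

/-- The cube contracts the total angle `t₁ + t₂` to 0. Its face `t₀ = 1` is constant and its face
`t₀ = 0` is the composite. The faces over `t₁` and `t₂` agree by the symmetry of the sum and enter
the boundary with opposite signs. -/
theorem exists_bd_eq_comp_Delta_Delta : ∃ h₂ : Chain k S 1 3,
    bd k S 1 2 h₂ = comp k S (m := 0) (n := 1) 0 (Delta k S) (Delta k S) := by
  have hc : ContFam fun t : Fin 3 → unitInterval => circle (-((1 - (t 0 : ℝ)) * (t 1 + t 2))) :=
    contFam_circle.precomp (by fun_prop)
  refine ⟨-chain k S fun t : Fin 3 → unitInterval => circle (-((1 - (t 0 : ℝ)) * (t 1 + t 2))), ?_⟩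
  refine Eq.trans ?_ (comp_Delta_Delta k hS).symm
  rw [map_neg, chain, bd_fam k (isCube hS hc), Fin.sum_univ_three]
  have e : ∀ (c : unitInterval) (t : Fin 2 → unitInterval) (j : Fin 3) (l : Fin 2),
      Fin.insertNth (α := fun _ => unitInterval) j c t (j.succAbove l) = t l := fun c t j l =>
    Fin.insertNth_apply_succAbove (α := fun _ => unitInterval) j c t l
  have e01 := fun c t => e c t 0 0
  have e02 := fun c t => e c t 0 1
  have e10 := fun c t => e c t 1 0
  have e12 := fun c t => e c t 1 1
  have e20 := fun c t => e c t 2 0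
  have e21 := fun c t => e c t 2 1
  simp only [show (0 : Fin 3).succAbove (0 : Fin 2) = 1 from rfl, show (0 : Fin 3).succAbove (1 : Fin 2) = 2 from rfl,
    show (1 : Fin 3).succAbove (0 : Fin 2) = 0 from rfl, show (1 : Fin 3).succAbove (1 : Fin 2) = 2 from rfl,
    show (2 : Fin 3).succAbove (0 : Fin 2) = 0 from rfl, show (2 : Fin 3).succAbove (1 : Fin 2) = 1 from rfl]
    at e01 e02 e10 e12 e20 e21
  simp only [e01, e02, e10, e12, e20, e21, Fin.insertNth_apply_same]
  have h0 : (ArcOperad.fam k S fun t : Fin 2 → unitInterval =>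
      (circle (-((1 - ((1 : unitInterval) : ℝ)) * (t 0 + t 1)))).fam) = 0 :=
    fam_of_degenerate k ⟨0, fun x y _ => by simp⟩
  have h1 : ∀ c : unitInterval, (fun t : Fin 2 → unitInterval => (circle (-((1 - (t 0 : ℝ)) * ((c : ℝ) + t 1)))).fam) =
      fun t => (circle (-((1 - (t 0 : ℝ)) * ((t 1 : ℝ) + c)))).fam := fun c => by
    funext t; rw [add_comm (c : ℝ)]
  rw [h0, h1, h1]
  simp [chain]
  abel

theorem Delta_mem_cycles : Delta k S ∈ cycles k S 1 1 := by
  refine neg_mem (LinearMap.mem_ker.2 ?_)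
  rw [delta_eq]
  refine bd_fam_eq_zero (isCube hS contFam_loop) fun j t => ?_
  obtain rfl : j = 0 := Subsingleton.elim (α := Fin 1) _ _
  refine fam_congr_Icc 0 (fun _ => -1) (fun _ => rfl) fun z _ i => ?_
  simp [circle]

theorem comp_Delta_Delta_mem_cycles :
    (comp k S (m := 0) (n := 1) 0 (Delta k S) (Delta k S) : Chain k S 1 2) ∈ cycles k S 1 2 := by
  rw [comp_Delta_Delta k hS]
  refine LinearMap.mem_ker.2 (bd_fam_eq_zero (isCube hS (contFam_circle.precomp (by fun_prop))) fun j t => ?_)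
  refine fam_congr_Icc 0 (fun _ => -1) (fun _ => rfl) fun z _ i => ?_
  have e : ∀ (c : unitInterval) (t : Fin 1 → unitInterval),
      Fin.insertNth (α := fun _ => unitInterval) 1 c t 0 = t 0 := fun c t =>
    Fin.insertNth_apply_succAbove (α := fun _ => unitInterval) 1 c t 0
  fin_cases j <;> simp [circle, e] <;> ring

theorem DeltaMu_mem_cycles : DeltaMu k S ∈ cycles k S 2 1 := by
  rw [DeltaMu_eq k hS]
  refine neg_mem (LinearMap.mem_ker.2 (bd_fam_eq_zero (isCube hS contFam_deltaMu) fun j t => ?_))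
  obtain rfl : j = 0 := Subsingleton.elim (α := Fin 1) _ _
  refine fam_congr_Icc 0 (fun _ => -1) (fun i => ?_) fun z _ i => ?_
  · exact (circle_comp_len _ _ _).trans (circle_comp_len _ _ _).symm
  · refine (circle_comp_map _ _ _ _).trans ?_
    have h := (pairAt (1 / 2)).map_add_int i z (-1)
    simp only [Fin.insertNth_apply_same, Set.Icc.coe_one, Set.Icc.coe_zero, neg_zero]
    refine Eq.trans ?_ (congrArg (· + ((-1 : ℤ) : ℝ)) (circle_comp_map 0 (pairAt (1 / 2)) i z).symm)
    rw [add_zero]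
    exact_mod_cast h

/-- Loops in a family of cacti are cycles. -/
theorem loop_mem_cycles {n : ℕ} {T : Chain k S n 1} {C : ℝ → Cactus n} (hC : ContFam C)
    (hT : T = -chain k S fun t => C (t 0)) (h : (C 1).fam = (C 0).fam) : T ∈ cycles k S n 1 := by
  rw [hT]
  refine neg_mem (LinearMap.mem_ker.2 ?_)
  refine bd_fam_eq_zero (isCube hS (hC.precomp (by fun_prop))) fun j t => ?_
  obtain rfl : j = 0 := Subsingleton.elim (α := Fin 1) _ _
  simpa using h

/-- The product is commutative up to a boundary. -/
theorem perm_mu_sub_mem : perm k S (Equiv.swap 0 1) (mu k S) - mu k S ∈ LinearMap.range (bd k S 2 0) := by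
  -- Half a turn of the loop interchanges two circles of equal length.
  have hc : ContFam fun x : ℝ => (pairAt (1 / 2)).rotate (x / 2) 0 :=
    (ContFam.const _).rotate (by fun_prop) fun _ => continuous_const
  refine ⟨_, (bd_path k hS hc).trans ?_⟩
  rw [mu_eq, perm_chain k hS (ContFam.const _)]
  refine congrArg₂ _ (chain_congr k fun _ => pairAt_half_rotate) (chain_congr k fun _ => ?_)
  exact fam_congr_real (fun _ => rfl) fun i z => by simp [Cactus.rotate]

/-- The product is associative up to a boundary. -/
theorem mu₃_sub_mem : mu₃ k S - (comp k S (m := 1) (n := 2) 1 (mu k S) (mu k S) : Chain k S 3 0) ∈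
    LinearMap.range (bd k S 3 0) := by
  have h1 : mu₃ k S = chain k S fun _ : Fin 0 → unitInterval => famA (1 / 2, 0, 0, 0, 0, 0) := by
    rw [mu₃_eq k hS]
    refine chain_congr k fun _ => fam_congr_real (fun i => ?_) fun i z => ?_
    · rw [famA_len]
      fin_cases i <;> simp only [Cactus.comp, oldIndex, triple, pairAt, pair] <;> simp [-one_div, wt_half] <;> ring
    · rw [famA_map]
      fin_cases i <;> simp only [Cactus.comp, oldIndex, triple, pairAt, pair] <;> simp [-one_div, wt_half]
  have h2 : (comp k S (m := 1) (n := 2) 1 (mu k S) (mu k S) : Chain k S 3 0) =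
      chain k S fun _ : Fin 0 → unitInterval => famB (1 / 2, 0, 0, 0, 0, 0) := by
    rw [mu_eq]
    refine (comp_chain (m := 1) (n := 2) k hS (ContFam.const _) 1 (ContFam.const _)).trans
      (chain_congr k fun _ => fam_congr_real (fun i => ?_) fun i z => ?_)
    · rw [famB_len]
      fin_cases i <;> simp only [Cactus.comp, oldIndex, pairAt, pair] <;> simp [-one_div, wt_half] <;> ring
    · rw [famB_map]
      fin_cases i <;> simp only [Cactus.comp, oldIndex, pairAt, pair] <;> simp [-one_div, wt_half]
  -- The weights are changed until all three circles have length `1 / 3`, where the two bracketings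
  -- coincide.
  have e1 := bd_path (C := fun x : ℝ => famA (2 / 3 - x / 6, 0, 0, 0, 0, 0)) k hS (contFam_famA.precomp (by fun_prop))
  have e2 := bd_path (C := fun x : ℝ => famB (1 / 3 + x / 6, 0, 0, 0, 0, 0)) k hS (contFam_famB.precomp (by fun_prop))
  refine ⟨_ - _, (map_sub _ _ _).trans ((congrArg₂ _ e1 e2).trans ?_)⟩
  rw [h1, h2, show (2 / 3 - 1 / 6 : ℝ) = 1 / 2 by norm_num, show (1 / 3 + 1 / 6 : ℝ) = 1 / 2 by norm_num,
    zero_div, sub_zero, add_zero, chain_congr k (C := fun _ => famA (2 / 3, 0, 0, 0, 0, 0)) fun _ => famA_eq_famB 0 0,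
    sub_sub_sub_cancel_right]

end

/-! ## Evaluation on algebras -/

theorem sgn_zero : sgn 0 = 1 := by simp [sgn]

theorem sgn_one : sgn 1 = -1 := by simp [sgn]

theorem sgn_mul_sgn (e f : ZMod 2) : sgn e * sgn f = sgn (e + f) := by
  revert e f; unfold sgn; decide

theorem koszul_swap_three (d : Fin 3 → ZMod 2) : koszul (Equiv.swap 0 1) d = sgn (d 1 * d 0) := by
  simp only [koszul, Fin.prod_univ_three]
  rw [if_neg (by decide), if_pos (by decide), if_neg (by decide), if_neg (by decide), if_neg (by decide),
    if_neg (by decide), if_neg (by decide), if_neg (by decide), if_neg (by decide)]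
  simp

theorem koszul_swap_two (d : Fin 2 → ZMod 2) : koszul (Equiv.swap 0 1) d = sgn (d 1 * d 0) := by
  simp only [koszul, Fin.prod_univ_two]
  rw [if_neg (by decide), if_pos (by decide), if_neg (by decide), if_neg (by decide)]
  simp

section Multilinear

variable {k : Type*} [CommRing k] {A : Type*} [AddCommGroup A] [Module k A]

/-- A unary operation as a linear map. -/
def unary (f : MultilinearMap k (fun _ : Fin 1 => A) A) : A →ₗ[k] A where
  toFun a := f ![a]
  map_add' x y := f.cons_add ![] x y
  map_smul' c x := f.cons_smul ![] c x

/-- A binary operation as a bilinear map. -/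
def binary (f : MultilinearMap k (fun _ : Fin 2 => A) A) : A →ₗ[k] A →ₗ[k] A :=
  LinearMap.mk₂ k (fun a b => f ![a, b]) (fun x y b => f.cons_add ![b] x y) (fun c x b => f.cons_smul ![b] c x)
    (fun a x y => (f.curryLeft a).cons_add ![] x y) fun c a x => (f.curryLeft a).cons_smul ![] c x

end Multilinear

namespace OperadAlgebra

variable {k : Type*} [CommRing k] {P : ℕ → ℕ → Type*} [∀ n p, AddCommGroup (P n p)] [∀ n p, Module k (P n p)]
  {isUnit : P 1 0 → Prop} {isComp : ∀ m n p q, P (m + 1) p → Fin (m + 1) → P n q → P (m + n) (p + q) → Prop}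
  {isPerm : ∀ n p, Equiv.Perm (Fin n) → P n p → P n p → Prop} {A : Type*} [AddCommGroup A] [Module k A]
  {𝒜 : ZMod 2 → Submodule k A} (θ : OperadAlgebra k P isUnit isComp isPerm A 𝒜)

include θ in
/-- Linear identities need only be checked on homogeneous elements. -/
theorem eq_of_homogeneous {B : Type*} [AddCommGroup B] [Module k B] {f g : A →ₗ[k] B}
    (h : ∀ e, ∀ a ∈ 𝒜 e, f a = g a) : f = g := by
  refine LinearMap.ext fun a => ?_
  have ha : a ∈ ⨆ e, 𝒜 e := by rw [θ.isInternal.submodule_iSup_eq_top]; trivial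
  induction ha using Submodule.iSup_induction' with
  | mem e a ha => exact h e a ha
  | zero => simp
  | add x y _ _ hx hy => rw [map_add, map_add, hx, hy]

variable {e f g : ZMod 2} {a b c : A} (ha : a ∈ 𝒜 e) (hb : b ∈ 𝒜 f) (hc : c ∈ 𝒜 g)

theorem mem_two (ha : a ∈ 𝒜 e) (hb : b ∈ 𝒜 f) (j : Fin 2) : ![a, b] j ∈ 𝒜 (![e, f] j) := by
  fin_cases j
  · exact ha
  · exact hb

theorem mem_three (ha : a ∈ 𝒜 e) (hb : b ∈ 𝒜 f) (hc : c ∈ 𝒜 g) (j : Fin 3) : ![a, b, c] j ∈ 𝒜 (![e, f, g] j) := by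
  fin_cases j
  · exact ha
  · exact hb
  · exact hc

include ha

theorem act_mem_one {p : ℕ} (x : P 1 p) : θ.act 1 p x ![a] ∈ 𝒜 (p + e) := by
  have := θ.act_mem 1 p x ![a] ![e] fun j => by fin_cases j; exact ha
  simpa using this

theorem act_comp_one_one {p q : ℕ} {x : P 1 p} {y : P 1 q} {z : P 1 (p + q)} (h : isComp 0 1 p q x 0 y z) :
    θ.act 1 (p + q) z ![a] = θ.act 1 p x ![θ.act 1 q y ![a]] := by
  refine (θ.act_comp 0 1 p q x 0 y z h ![a] ![e] fun j => by fin_cases j; exact ha).trans ?_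
  have e1 : blockArg (m := 0) (n := 1) 0 ![a] = ![a] := by
    funext j; fin_cases j; rfl
  have e2 : ∀ b : A, insertArg (m := 0) (n := 1) 0 ![a] b = ![b] := fun b => by
    funext j; fin_cases j; rfl
  rw [e1, e2]
  simp [sgn_zero]

include hb

theorem act_mem_two {p : ℕ} (x : P 2 p) : θ.act 2 p x ![a, b] ∈ 𝒜 (p + (e + f)) := by
  simpa using θ.act_mem 2 p x ![a, b] ![e, f] (mem_two ha hb)

theorem act_comp_one_two {p q : ℕ} {x : P 1 p} {y : P 2 q} {z : P 2 (p + q)} (h : isComp 0 2 p q x 0 y z) :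
    θ.act 2 (p + q) z ![a, b] = θ.act 1 p x ![θ.act 2 q y ![a, b]] := by
  refine (θ.act_comp 0 2 p q x 0 y z h ![a, b] ![e, f] (mem_two ha hb)).trans ?_
  have e1 : blockArg (m := 0) (n := 2) 0 ![a, b] = ![a, b] := by
    funext j; fin_cases j <;> rfl
  have e2 : ∀ b' : A, insertArg (m := 0) (n := 2) 0 ![a, b] b' = ![b'] := fun b => by
    funext j; fin_cases j; rfl
  rw [e1, e2]
  simp [sgn_zero]

theorem act_perm_two {p : ℕ} {x y : P 2 p} (h : isPerm 2 p (Equiv.swap 0 1) x y) :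
    θ.act 2 p y ![a, b] = sgn (e * f) • θ.act 2 p x ![b, a] := by
  rw [θ.act_perm 2 p _ x y h ![a, b] ![e, f] (mem_two ha hb), koszul_swap_two]
  have e1 : ![a, b] ∘ Equiv.swap (0 : Fin 2) 1 = ![b, a] := by
    funext j; fin_cases j <;> rfl
  rw [e1]
  simp [mul_comm]

include hc

theorem act_comp_one_three {p q : ℕ} {x : P 1 p} {y : P 3 q} {z : P 3 (p + q)} (h : isComp 0 3 p q x 0 y z) :
    θ.act 3 (p + q) z ![a, b, c] = θ.act 1 p x ![θ.act 3 q y ![a, b, c]] := by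
  refine (θ.act_comp 0 3 p q x 0 y z h ![a, b, c] ![e, f, g] (mem_three ha hb hc)).trans ?_
  have e1 : blockArg (m := 0) (n := 3) 0 ![a, b, c] = ![a, b, c] := by
    funext j; fin_cases j <;> rfl
  have e2 : ∀ b' : A, insertArg (m := 0) (n := 3) 0 ![a, b, c] b' = ![b'] := fun b => by
    funext j; fin_cases j; rfl
  rw [e1, e2]
  simp [sgn_zero]

theorem act_comp_two_two_zero {p q : ℕ} {x : P 2 p} {y : P 2 q} {z : P 3 (p + q)} (h : isComp 1 2 p q x 0 y z) :
    θ.act 3 (p + q) z ![a, b, c] = θ.act 2 p x ![θ.act 2 q y ![a, b], c] := by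
  refine (θ.act_comp 1 2 p q x 0 y z h ![a, b, c] ![e, f, g] (mem_three ha hb hc)).trans ?_
  have e1 : blockArg (m := 1) (n := 2) 0 ![a, b, c] = ![a, b] := by
    funext j; fin_cases j <;> rfl
  have e2 : ∀ b' : A, insertArg (m := 1) (n := 2) 0 ![a, b, c] b' = ![b', c] := fun b => by
    funext j; fin_cases j <;> rfl
  rw [e1, e2]
  simp [sgn_zero]

theorem act_comp_two_two_one {p q : ℕ} {x : P 2 p} {y : P 2 q} {z : P 3 (p + q)} (h : isComp 1 2 p q x 1 y z) :
    θ.act 3 (p + q) z ![a, b, c] = sgn (q * e) • θ.act 2 p x ![a, θ.act 2 q y ![b, c]] := by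
  refine (θ.act_comp 1 2 p q x 1 y z h ![a, b, c] ![e, f, g] (mem_three ha hb hc)).trans ?_
  have e1 : blockArg (m := 1) (n := 2) 1 ![a, b, c] = ![b, c] := by
    funext j; fin_cases j <;> rfl
  have e2 : ∀ b' : A, insertArg (m := 1) (n := 2) 1 ![a, b, c] b' = ![a, b'] := fun b => by
    funext j; fin_cases j <;> rfl
  rw [e1, e2]
  congr 3
  exact (Fin.sum_univ_three _).trans (by simp)

theorem act_comp_three_one {p q : ℕ} {x : P 3 p} {y : P 1 q} {z : P 3 (p + q)} (i : Fin 3) (h : isComp 2 1 p q x i y z) :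
    θ.act 3 (p + q) z ![a, b, c] = sgn (q * (![0, e, e + f] : Fin 3 → ZMod 2) i) •
      θ.act 3 p x (Function.update ![a, b, c] i (θ.act 1 q y ![![a, b, c] i])) := by
  refine (θ.act_comp 2 1 p q x i y z h ![a, b, c] ![e, f, g] (mem_three ha hb hc)).trans ?_
  have e1 : blockArg (m := 2) (n := 1) i ![a, b, c] = ![![a, b, c] i] := by
    fin_cases i <;> (funext j; fin_cases j; rfl)
  have e2 : ∀ b' : A, insertArg (m := 2) (n := 1) i ![a, b, c] b' = Function.update ![a, b, c] i b' := fun b => by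
    fin_cases i <;> (funext j; fin_cases j <;> rfl)
  rw [e1, e2]
  congr 3
  refine (Fin.sum_univ_three _).trans ?_
  fin_cases i <;> simp

theorem act_perm_three {p : ℕ} {x y : P 3 p} (h : isPerm 3 p (Equiv.swap 0 1) x y) :
    θ.act 3 p y ![a, b, c] = sgn (e * f) • θ.act 3 p x ![b, a, c] := by
  rw [θ.act_perm 3 p _ x y h ![a, b, c] ![e, f, g] (mem_three ha hb hc), koszul_swap_three]
  have e1 : ![a, b, c] ∘ Equiv.swap (0 : Fin 3) 1 = ![b, a, c] := by
    funext j; fin_cases j <;> rfl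
  rw [e1]
  simp [mul_comm]

/-- The seven-term expression. -/
theorem act_seven_terms {D : P 1 1} {M : P 2 0} {M₃ : P 3 0} {DM : P 2 1} {T₁ T₂ T₃ T₄ : P 3 1} {Y : Fin 3 → P 3 1}
    (hM₃ : isComp 1 2 0 0 M 0 M M₃) (hDM : isComp 0 2 1 0 D 0 M DM) (h₁ : isComp 0 3 1 0 D 0 M₃ T₁)
    (h₂ : isComp 1 2 0 1 M 0 DM T₂) (h₃ : isComp 1 2 0 1 M 1 DM T₃) (h₄ : isPerm 3 1 (Equiv.swap 0 1) T₃ T₄)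
    (hY : ∀ i, isComp 2 1 0 1 M₃ i D (Y i)) :
    θ.act 3 1 (T₁ - T₂ - T₃ - T₄ + Y 0 + Y 1 + Y 2) ![a, b, c] =
      θ.act 1 1 D ![θ.act 2 0 M ![θ.act 2 0 M ![a, b], c]] -
        (θ.act 2 0 M ![θ.act 1 1 D ![θ.act 2 0 M ![a, b]], c] + sgn e • θ.act 2 0 M ![a, θ.act 1 1 D ![θ.act 2 0 M ![b, c]]]
          + sgn ((e + 1) * f) • θ.act 2 0 M ![b, θ.act 1 1 D ![θ.act 2 0 M ![a, c]]]
          - θ.act 2 0 M ![θ.act 2 0 M ![θ.act 1 1 D ![a], b], c]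
          - sgn e • θ.act 2 0 M ![θ.act 2 0 M ![a, θ.act 1 1 D ![b]], c]
          - sgn (e + f) • θ.act 2 0 M ![θ.act 2 0 M ![a, b], θ.act 1 1 D ![c]]) := by
  have hm : ∀ {e f g : ZMod 2} {a b c : A}, a ∈ 𝒜 e → b ∈ 𝒜 f → c ∈ 𝒜 g →
      θ.act 3 0 M₃ ![a, b, c] = θ.act 2 0 M ![θ.act 2 0 M ![a, b], c] := fun ha hb hc =>
    θ.act_comp_two_two_zero ha hb hc (p := 0) (q := 0) hM₃
  have hd : ∀ {e f : ZMod 2} {a b : A}, a ∈ 𝒜 e → b ∈ 𝒜 f →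
      θ.act 2 1 DM ![a, b] = θ.act 1 1 D ![θ.act 2 0 M ![a, b]] := fun ha hb =>
    θ.act_comp_one_two ha hb (p := 1) (q := 0) hDM
  have e₁ : θ.act 3 1 T₁ ![a, b, c] = _ := θ.act_comp_one_three ha hb hc (p := 1) (q := 0) h₁
  have e₂ : θ.act 3 1 T₂ ![a, b, c] = _ := θ.act_comp_two_two_zero ha hb hc (p := 0) (q := 1) h₂
  have e₃ : θ.act 3 1 T₃ ![a, b, c] = _ := θ.act_comp_two_two_one ha hb hc (p := 0) (q := 1) h₃
  have e₃' : θ.act 3 1 T₃ ![b, a, c] = _ := θ.act_comp_two_two_one hb ha hc (p := 0) (q := 1) h₃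
  have e₄ := θ.act_perm_three ha hb hc h₄
  have y₀ : θ.act 3 1 (Y 0) ![a, b, c] = _ := θ.act_comp_three_one ha hb hc (p := 0) (q := 1) 0 (hY 0)
  have y₁ : θ.act 3 1 (Y 1) ![a, b, c] = _ := θ.act_comp_three_one ha hb hc (p := 0) (q := 1) 1 (hY 1)
  have y₂ : θ.act 3 1 (Y 2) ![a, b, c] = _ := θ.act_comp_three_one ha hb hc (p := 0) (q := 1) 2 (hY 2)
  have u₀ : ∀ x : A, Function.update ![a, b, c] 0 x = ![x, b, c] := fun x => by
    funext j; fin_cases j <;> rfl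
  have u₁ : ∀ x : A, Function.update ![a, b, c] 1 x = ![a, x, c] := fun x => by
    funext j; fin_cases j <;> rfl
  have u₂ : ∀ x : A, Function.update ![a, b, c] 2 x = ![a, b, x] := fun x => by
    funext j; fin_cases j <;> rfl
  rw [hm ha hb hc] at e₁
  rw [hd ha hb] at e₂
  rw [hd hb hc] at e₃
  rw [hd ha hc] at e₃'
  -- The exchange of `a` and `b` gives the sign exponent `e * f`, and moving the odd operator past
  -- `b` gives `f`; together `(e + 1) * f`.
  rw [e₃', smul_smul, sgn_mul_sgn] at e₄
  rw [u₀, show ![a, b, c] 0 = a from rfl, hm (θ.act_mem_one ha D) hb hc] at y₀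
  rw [u₁, show ![a, b, c] 1 = b from rfl, hm ha (θ.act_mem_one hb D) hc] at y₁
  rw [u₂, show ![a, b, c] 2 = c from rfl, hm ha hb (θ.act_mem_one hc D)] at y₂
  simp only [map_add, map_sub, add_apply, sub_apply]
  rw [e₁, e₂, e₃, e₄, y₀, y₁, y₂]
  simp only [Matrix.cons_val, Nat.cast_one, one_mul, mul_zero, sgn_zero, one_smul, add_mul]
  abel

end OperadAlgebra

open Cactus

/-! ## Composability and homology classes -/

section

variable (k : Type*) [CommRing k] {S : ∀ n, Set (Fam n)} (hS : ∀ n, ARCcp n ⊆ S n)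

theorem Delta_eq : Delta k S = -chain k S fun t : Fin 1 → unitInterval => circle (-(t 0 : ℝ)) := by
  rw [Delta, delta_eq]

include hS

theorem isCube_deltaFam : IsCube S fun t : Fin 1 → unitInterval => deltaFam ((t 0 : ℝ) : Circ) := by
  have := isCube hS contFam_loop
  simpa only [← deltaFam_eq, neg_neg] using this

theorem isCube_muFam : IsCube S fun _ : Fin 0 → unitInterval => muFam := by
  rw [muFam_eq_pairAt]
  exact isCube hS (ContFam.const _)

theorem composable_Delta_Delta : Composable (m := 0) (Delta k S) 0 (Delta k S) :=
  composable_chain (m := 0) k hS contFam_loop 0 contFam_loop (Or.inr (Delta_eq k)) (Or.inr (Delta_eq k))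

theorem composable_mu_mu (i : Fin 2) : Composable (m := 1) (mu k S) i (mu k S) :=
  composable_chain (m := 1) k hS (ContFam.const _) i (ContFam.const _) (Or.inl (mu_eq k S)) (Or.inl (mu_eq k S))

theorem composable_Delta_mu : Composable (m := 0) (Delta k S) 0 (mu k S) :=
  composable_chain (m := 0) k hS contFam_loop 0 (ContFam.const _) (Or.inr (Delta_eq k)) (Or.inl (mu_eq k S))

theorem composable_Delta_mu₃ : Composable (m := 0) (Delta k S) 0 (mu₃ k S) :=
  composable_chain (m := 0) k hS contFam_loop 0 (ContFam.const _) (Or.inr (Delta_eq k)) (Or.inl (mu₃_eq k hS))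

theorem composable_mu_DeltaMu (i : Fin 2) : Composable (m := 1) (mu k S) i (DeltaMu k S) :=
  composable_chain (m := 1) k hS (ContFam.const _) i contFam_deltaMu (Or.inl (mu_eq k S)) (Or.inr (DeltaMu_eq k hS))

theorem composable_mu₃_Delta (i : Fin 3) : Composable (m := 2) (mu₃ k S) i (Delta k S) :=
  composable_chain (m := 2) k hS (ContFam.const _) i contFam_loop (Or.inl (mu₃_eq k hS)) (Or.inr (Delta_eq k))

theorem comp_Delta_mu₃_mem_cycles :
    (comp k S (m := 0) (n := 3) 0 (Delta k S) (mu₃ k S) : Chain k S 3 1) ∈ cycles k S 3 1 :=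
  loop_mem_cycles k hS (C := fun x => famA (1 / 2, -x, 0, 0, 0, 0)) (contFam_famA.precomp (by fun_prop)) (comp_Delta_mu₃ k hS)
    (by simpa using famA_periodic (1 / 2, 0, 0, 0, 0, 0) (-1) 0 0 0 0)

theorem comp_mu_zero_DeltaMu_mem_cycles :
    (comp k S (m := 1) (n := 2) 0 (mu k S) (DeltaMu k S) : Chain k S 3 1) ∈ cycles k S 3 1 :=
  loop_mem_cycles k hS (C := fun x => famA (1 / 2, 0, -x, 0, 0, 0)) (contFam_famA.precomp (by fun_prop)) (comp_mu_zero_DeltaMu k hS)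
    (by simpa using famA_periodic (1 / 2, 0, 0, 0, 0, 0) 0 (-1) 0 0 0)

theorem muDeltaMu_mem_cycles : muDeltaMu k S ∈ cycles k S 3 1 :=
  loop_mem_cycles k hS (C := fun x => famB (1 / 2, 0, -x, 0, 0, 0)) (contFam_famB.precomp (by fun_prop)) (muDeltaMu_eq k hS)
    (by simpa using famB_periodic (1 / 2, 0, 0, 0, 0, 0) 0 (-1) 0 0 0)

theorem perm_muDeltaMu_mem_cycles : perm k S (Equiv.swap 0 1) (muDeltaMu k S) ∈ cycles k S 3 1 :=
  loop_mem_cycles k hS (C := fun x => famC (1 / 2, 0, -x, 0, 0, 0)) (contFam_famC.precomp (by fun_prop)) (perm_muDeltaMu k hS)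
    (by simpa using famC_periodic (1 / 2, 0, 0, 0, 0, 0) 0 (-1) 0 0 0)

theorem comp_mu₃_Delta_mem_cycles (i : Fin 3) :
    (comp k S (m := 2) (n := 1) i (mu₃ k S) (Delta k S) : Chain k S 3 1) ∈ cycles k S 3 1 := by
  refine loop_mem_cycles k hS (C := fun x => famA (1 / 2, 0, 0, (![-x, 0, 0] : Fin 3 → ℝ) i,
      (![0, -x, 0] : Fin 3 → ℝ) i, (![0, 0, -x] : Fin 3 → ℝ) i)) (contFam_famA.precomp ?_) (comp_mu₃_Delta k hS i) ?_
  · fin_cases i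
    · show Continuous fun x : ℝ => ((1 / 2, 0, 0, -x, 0, 0) : Par)
      fun_prop
    · show Continuous fun x : ℝ => ((1 / 2, 0, 0, 0, -x, 0) : Par)
      fun_prop
    · show Continuous fun x : ℝ => ((1 / 2, 0, 0, 0, 0, -x) : Par)
      fun_prop
  · fin_cases i
    · simpa using famA_periodic (1 / 2, 0, 0, 0, 0, 0) 0 0 (-1) 0 0
    · simpa using famA_periodic (1 / 2, 0, 0, 0, 0, 0) 0 0 0 (-1) 0
    · simpa using famA_periodic (1 / 2, 0, 0, 0, 0, 0) 0 0 0 0 (-1)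

end

section

variable {k : Type*} [CommRing k] {S : ∀ n, Set (Fam n)} {n p : ℕ}

/-- The class of a cycle. -/
def homologyClass {x : Chain k S n p} (hx : x ∈ cycles k S n p) : Homology k S n p :=
  ⟨_, Submodule.mem_map_of_mem hx⟩

theorem represents_homologyClass {x : Chain k S n p} (hx : x ∈ cycles k S n p) : Represents x (homologyClass hx) :=
  ⟨hx, rfl⟩

theorem mem_cycles_zero (x : Chain k S n 0) : x ∈ cycles k S n 0 := LinearMap.mem_ker.2 rfl

end

/-- The seven-term relation and `Δ² = 0` on algebras over the chain operad. -/
theorem ChainAlgebra.relations {k : Type*} [CommRing k] {S : ∀ n, Set (Fam n)} (hS : ∀ n, ARCcp n ⊆ S n)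
    {h₂ : Chain k S 1 3} {h₃ : Chain k S 3 2}
    (e₂ : bd k S 1 2 h₂ = comp k S (m := 0) (n := 1) 0 (Delta k S) (Delta k S)) (e₃ : bd k S 3 1 h₃ = bvDefect k S)
    {A : Type*} [AddCommGroup A] [Module k A] {𝒜 : ZMod 2 → Submodule k A} (θ : ChainAlgebra k S A 𝒜) :
    let D : A → A := fun a => θ.act 1 1 (Delta k S) ![a]
    let mul : A → A → A := fun a b => θ.act 2 0 (mu k S) ![a, b]
    let H₂ : A → A := fun a => θ.act 1 3 h₂ ![a]
    let H₃ : A → A → A → A := fun a b c => θ.act 3 2 h₃ ![a, b, c]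
    (∀ a, D (D a) = θ.d (H₂ a) + H₂ (θ.d a)) ∧
    ∀ e f g, ∀ a ∈ 𝒜 e, ∀ b ∈ 𝒜 f, ∀ c ∈ 𝒜 g,
      D (mul (mul a b) c) -
        (mul (D (mul a b)) c + sgn e • mul a (D (mul b c))
          + sgn ((e + 1) * f) • mul b (D (mul a c))
          - mul (mul (D a) b) c - sgn e • mul (mul a (D b)) c
          - sgn (e + f) • mul (mul a b) (D c)) =
      θ.d (H₃ a b c) -
        (H₃ (θ.d a) b c + sgn e • H₃ a (θ.d b) c + sgn (e + f) • H₃ a b (θ.d c)) := by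
  refine ⟨fun a => ?_, fun e f g a ha b hb c hc => ?_⟩
  · set D := unary (θ.act 1 1 (Delta k S))
    set H := unary (θ.act 1 3 h₂)
    suffices D ∘ₗ D = θ.d ∘ₗ H + H ∘ₗ θ.d from LinearMap.congr_fun this a
    refine θ.eq_of_homogeneous fun e a ha => ?_
    have h1 := θ.d_act 1 3 h₂ ![a] ![e] fun j => by fin_cases j; exact ha
    have h2 := θ.act_comp_one_one ha (p := 1) (q := 1) (x := Delta k S) (y := Delta k S) ⟨composable_Delta_Delta k hS, rfl⟩
    have h3 : θ.act 1 2 (diff k S 1 3 h₂) ![a] = D (D a) := (congrArg (fun x => θ.act 1 2 x ![a]) e₂).trans h2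
    have h4 : Function.update ![a] 0 (θ.d a) = ![θ.d a] := by
      funext j; fin_cases j; rfl
    rw [Fin.sum_univ_one, show ![a] 0 = a from rfl, h4] at h1
    -- As `h₂` has odd degree, the differential of the argument enters with a minus sign, which
    -- becomes the plus sign of the homotopy formula.
    have h5 : sgn (((3 : ℕ) : ZMod 2) + ∑ l : Fin 1, if l < 0 then (![e] : Fin 1 → ZMod 2) l else 0) = -1 := by
      rw [show ((3 : ℕ) : ZMod 2) = 1 from rfl]; simp [sgn_one]
    rw [h5] at h1
    show D (D a) = θ.d (H a) + H (θ.d a)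
    have h6 : θ.d (H a) = D (D a) + (-1 : ℤ) • H (θ.d a) := h1.trans (congrArg (· + _) h3)
    rw [h6]; simp
  · have h1 := θ.act_seven_terms ha hb hc (D := Delta k S) (M := mu k S) (M₃ := mu₃ k S) (DM := DeltaMu k S)
      (Y := fun i => comp k S (m := 2) (n := 1) i (mu₃ k S) (Delta k S))
      ⟨composable_mu_mu k hS 0, rfl⟩ ⟨composable_Delta_mu k hS, rfl⟩ ⟨composable_Delta_mu₃ k hS, rfl⟩
      ⟨composable_mu_DeltaMu k hS 0, rfl⟩ ⟨composable_mu_DeltaMu k hS 1, rfl⟩ rfl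
      fun i => ⟨composable_mu₃_Delta k hS i, rfl⟩
    refine h1.symm.trans ?_
    have h2 := θ.d_act 3 2 h₃ ![a, b, c] ![e, f, g] (OperadAlgebra.mem_three ha hb hc)
    have h3 : θ.act 3 1 (diff k S 3 2 h₃) ![a, b, c] = θ.act 3 1 (bvDefect k S) ![a, b, c] :=
      congrArg (fun x => θ.act 3 1 x ![a, b, c]) e₃
    rw [Fin.sum_univ_three] at h2
    have u₀ : ∀ x : A, Function.update ![a, b, c] 0 x = ![x, b, c] := fun x => by
      funext j; fin_cases j <;> rfl
    have u₁ : ∀ x : A, Function.update ![a, b, c] 1 x = ![a, x, c] := fun x => by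
      funext j; fin_cases j <;> rfl
    have u₂ : ∀ x : A, Function.update ![a, b, c] 2 x = ![a, b, x] := fun x => by
      funext j; fin_cases j <;> rfl
    rw [u₀, u₁, u₂] at h2
    simp only [Fin.sum_univ_three, show ((2 : ℕ) : ZMod 2) = 0 from rfl, zero_add] at h2
    have i0 : ∀ l : Fin 3, ¬ l < 0 := by decide
    have i1 : (0 : Fin 3) < 1 ∧ ¬ (1 : Fin 3) < 1 ∧ ¬ (2 : Fin 3) < 1 := by decide
    have i2 : (0 : Fin 3) < 2 ∧ (1 : Fin 3) < 2 ∧ ¬ (2 : Fin 3) < 2 := by decide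
    simp only [i0, i1, i2, if_true, if_false, add_zero, Matrix.cons_val, sgn_zero, one_smul] at h2
    refine Eq.trans ?_ (eq_sub_of_add_eq h2.symm)
    exact h3.symm

/-- Algebras over the homology operad are BV algebras. -/
theorem isBVAlgebra_of_homologyAlgebra {k : Type*} [CommRing k] {S : ∀ n, Set (Fam n)} (hS : ∀ n, ARCcp n ⊆ S n)
    {A : Type*} [AddCommGroup A] [Module k A] {𝒜 : ZMod 2 → Submodule k A} (θ : HomologyAlgebra k S A 𝒜)
    {XΔ : Homology k S 1 1} {Xμ : Homology k S 2 0} (hΔ : Represents (Delta k S) XΔ) (hμ : Represents (mu k S) Xμ) :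
    IsBVAlgebra 𝒜 (binary (θ.act 2 0 Xμ)) (unary (θ.act 1 1 XΔ)) := by
  have hrange : ∀ {n p : ℕ} {x : Chain k S n p}, x ∈ LinearMap.range (bd k S n p) →
      (LinearMap.range (bd k S n p)).mkQ x = 0 := fun hx => (Submodule.Quotient.mk_eq_zero _).2 hx
  have hM₃ := represents_homologyClass (mem_cycles_zero (mu₃ k S))
  have hM₃' := represents_homologyClass (mem_cycles_zero (comp k S (m := 1) (n := 2) 1 (mu k S) (mu k S) : Chain k S 3 0))
  have hDM := represents_homologyClass (DeltaMu_mem_cycles k hS)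
  have hT := represents_homologyClass (muDeltaMu_mem_cycles k hS)
  refine ⟨θ.isInternal, fun e f a ha b hb => ?_, ?_, fun e f a ha b hb => ?_, fun e a ha => ?_, ?_,
    fun e f g a ha b hb c hc => ?_⟩
  · have := θ.act_mem_two ha hb Xμ
    rwa [Nat.cast_zero, zero_add] at this
  · have hassoc : ∀ e f g, ∀ a ∈ 𝒜 e, ∀ b ∈ 𝒜 f, ∀ c ∈ 𝒜 g,
        binary (θ.act 2 0 Xμ) (binary (θ.act 2 0 Xμ) a b) c = binary (θ.act 2 0 Xμ) a (binary (θ.act 2 0 Xμ) b c) := by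
      intro e f g a ha b hb c hc
      have h1 := θ.act_comp_two_two_zero ha hb hc (p := 0) (q := 0) (x := Xμ) (y := Xμ)
        ⟨_, _, hμ, hμ, composable_mu_mu k hS 0, hM₃⟩
      have h2 := θ.act_comp_two_two_one ha hb hc (p := 0) (q := 0) (x := Xμ) (y := Xμ)
        ⟨_, _, hμ, hμ, composable_mu_mu k hS 1, hM₃'⟩
      have h3 : homologyClass hM₃.1 = homologyClass hM₃'.1 :=
        Subtype.ext (sub_eq_zero.1 ((map_sub _ _ _).symm.trans (hrange (mu₃_sub_mem k hS))))
      rw [Nat.cast_zero, zero_mul, sgn_zero, one_smul] at h2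
      exact h1.symm.trans ((congrArg (fun X => θ.act 3 0 X ![a, b, c]) h3).trans h2)
    set m := binary (θ.act 2 0 Xμ)
    -- Associativity passes from homogeneous to arbitrary elements in one variable after the other.
    have s₁ : ∀ f g, ∀ b ∈ 𝒜 f, ∀ c ∈ 𝒜 g, m.flip c ∘ₗ m.flip b = m.flip (m b c) := fun f g b hb c hc =>
      θ.eq_of_homogeneous fun e a ha => hassoc e f g a ha b hb c hc
    have s₂ : ∀ a g, ∀ c ∈ 𝒜 g, m.flip c ∘ₗ m a = m a ∘ₗ m.flip c := fun a g c hc =>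
      θ.eq_of_homogeneous fun f b hb => LinearMap.congr_fun (s₁ f g b hb c hc) a
    have s₃ : ∀ a b, m (m a b) = m a ∘ₗ m b := fun a b =>
      θ.eq_of_homogeneous fun g c hc => LinearMap.congr_fun (s₂ a g c hc) b
    exact fun a b c => LinearMap.congr_fun (s₃ a b) c
  · have hp := represents_homologyClass (mem_cycles_zero (perm k S (Equiv.swap 0 1) (mu k S)))
    have h1 := θ.act_perm_two ha hb (x := Xμ) ⟨_, hμ, hp⟩
    have h2 : homologyClass hp.1 = Xμ := Subtype.ext
      ((sub_eq_zero.1 ((map_sub _ _ _).symm.trans (hrange (perm_mu_sub_mem k hS)))).trans hμ.2)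
    rw [h2] at h1
    exact h1
  · have := θ.act_mem_one ha XΔ
    rwa [Nat.cast_one, add_comm] at this
  · set D := unary (θ.act 1 1 XΔ)
    suffices D ∘ₗ D = 0 from fun a => LinearMap.congr_fun this a
    refine θ.eq_of_homogeneous fun e a ha => ?_
    have hr := represents_homologyClass (comp_Delta_Delta_mem_cycles k hS)
    have h1 := θ.act_comp_one_one ha (p := 1) (q := 1) (x := XΔ) (y := XΔ)
      ⟨_, _, hΔ, hΔ, composable_Delta_Delta k hS, hr⟩
    have h2 : homologyClass hr.1 = 0 := by
      obtain ⟨h₂, e₂⟩ := exists_bd_eq_comp_Delta_Delta k hS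
      exact Subtype.ext (hrange ⟨h₂, e₂⟩)
    refine h1.symm.trans ?_
    rw [h2, map_zero]; rfl
  · have h1 := θ.act_seven_terms ha hb hc (D := XΔ) (M := Xμ)
      (Y := fun i => homologyClass (comp_mu₃_Delta_mem_cycles k hS i))
      ⟨_, _, hμ, hμ, composable_mu_mu k hS 0, hM₃⟩ ⟨_, _, hΔ, hμ, composable_Delta_mu k hS, hDM⟩
      ⟨_, _, hΔ, hM₃, composable_Delta_mu₃ k hS, represents_homologyClass (comp_Delta_mu₃_mem_cycles k hS)⟩
      ⟨_, _, hμ, hDM, composable_mu_DeltaMu k hS 0, represents_homologyClass (comp_mu_zero_DeltaMu_mem_cycles k hS)⟩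
      ⟨_, _, hμ, hDM, composable_mu_DeltaMu k hS 1, hT⟩
      ⟨_, hT, represents_homologyClass (perm_muDeltaMu_mem_cycles k hS)⟩
      fun i => ⟨_, _, hM₃, hΔ, composable_mu₃_Delta k hS i, represents_homologyClass (comp_mu₃_Delta_mem_cycles k hS i)⟩
    refine sub_eq_zero.1 (h1.symm.trans ?_)
    have h2 := hrange (bvDefect_mem k hS)
    unfold bvDefect at h2
    simp only [map_add, map_sub] at h2
    refine (congrArg (fun X : Homology k S 3 1 => θ.act 3 1 X ![a, b, c])
      (show _ = (0 : Homology k S 3 1) from Subtype.ext h2)).trans ?_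
    simp

end ArcOperad

end

open ArcOperad in
theorem mainTheorem2 (k : Type*) [CommRing k] (S : ∀ n, Set (Fam n))
    (hS : S = ARCcp ∨ S = ARC) :
    -- the basic families and all the composites that occur below are singular cubes
    (IsCube S (fun t : Fin 1 → unitInterval => deltaFam ((t 0 : ℝ) : Circ)) ∧
      IsCube S (fun _ : Fin 0 → unitInterval => muFam) ∧
      Composable (m := 0) (Delta k S) 0 (Delta k S) ∧
      Composable (m := 1) (mu k S) 0 (mu k S) ∧
      Composable (m := 0) (Delta k S) 0 (mu k S) ∧
      Composable (m := 0) (Delta k S) 0 (mu₃ k S) ∧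
      (∀ i, Composable (m := 1) (mu k S) i (DeltaMu k S)) ∧
      (∀ i, Composable (m := 2) (mu₃ k S) i (Delta k S))) ∧
    -- `Δ` is a cycle of degree one
    Delta k S ∈ cycles k S 1 1 ∧
    -- the relations up to chain homotopy
    (∃ (h₂ : Chain k S 1 3) (h₃ : Chain k S 3 2),
      bd k S 1 2 h₂ = comp k S (m := 0) (n := 1) 0 (Delta k S) (Delta k S) ∧
      bd k S 3 1 h₃ = bvDefect k S ∧
      ∀ (A : Type*) [AddCommGroup A] [Module k A] (𝒜 : ZMod 2 → Submodule k A)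
        (θ : ChainAlgebra k S A 𝒜),
        let D : A → A := fun a => θ.act 1 1 (Delta k S) ![a]
        let mul : A → A → A := fun a b => θ.act 2 0 (mu k S) ![a, b]
        let H₂ : A → A := fun a => θ.act 1 3 h₂ ![a]
        let H₃ : A → A → A → A := fun a b c => θ.act 3 2 h₃ ![a, b, c]
        (∀ a, D (D a) = θ.d (H₂ a) + H₂ (θ.d a)) ∧
        ∀ e f g, ∀ a ∈ 𝒜 e, ∀ b ∈ 𝒜 f, ∀ c ∈ 𝒜 g,
          D (mul (mul a b) c) -
            (mul (D (mul a b)) c + sgn e • mul a (D (mul b c))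
              + sgn ((e + 1) * f) • mul b (D (mul a c))
              - mul (mul (D a) b) c - sgn e • mul (mul a (D b)) c
              - sgn (e + f) • mul (mul a b) (D c)) =
          θ.d (H₃ a b c) -
            (H₃ (θ.d a) b c + sgn e • H₃ a (θ.d b) c + sgn (e + f) • H₃ a b (θ.d c))) ∧
    -- every algebra over the homology operad is a BV algebra
    ∀ (A : Type*) [AddCommGroup A] [Module k A] (𝒜 : ZMod 2 → Submodule k A)
      (θ : HomologyAlgebra k S A 𝒜) (XΔ : Homology k S 1 1) (Xμ : Homology k S 2 0),
      Represents (Delta k S) XΔ → Represents (mu k S) Xμ →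
      ∃ (mul : A →ₗ[k] A →ₗ[k] A) (D : A →ₗ[k] A), IsBVAlgebra 𝒜 mul D ∧
        (∀ a b, mul a b = θ.act 2 0 Xμ ![a, b]) ∧ (∀ a, D a = θ.act 1 1 XΔ ![a]) := by
  -- All families used have genus 0 and no punctures, so this inclusion is all that is needed of the
  -- operad.
  have hS' : ∀ n, ARCcp n ⊆ S n := by
    rcases hS with rfl | rfl
    · exact fun n => subset_rfl
    · exact fun n α hα => Set.mem_iUnion₂.2 ⟨0, 0, hα⟩
  obtain ⟨h₂, e₂⟩ := exists_bd_eq_comp_Delta_Delta k hS'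
  obtain ⟨h₃, e₃⟩ := bvDefect_mem k hS'
  refine ⟨⟨isCube_deltaFam hS', isCube_muFam hS', composable_Delta_Delta k hS', composable_mu_mu k hS' 0,
    composable_Delta_mu k hS', composable_Delta_mu₃ k hS', composable_mu_DeltaMu k hS', composable_mu₃_Delta k hS'⟩,
    Delta_mem_cycles k hS', ⟨h₂, h₃, e₂, e₃, fun A _ _ 𝒜 θ => θ.relations hS' e₂ e₃⟩, ?_⟩
  intro A _ _ 𝒜 θ XΔ Xμ hΔ hμ
  exact ⟨binary (θ.act 2 0 Xμ), unary (θ.act 1 1 XΔ), isBVAlgebra_of_homologyAlgebra hS' θ hΔ hμ,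
    fun _ _ => rfl, fun _ => rfl⟩
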